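/- **Setting.** Let $d\ge 1$ and let $\Omega\subset\mathbb R^d$ be a $d$-dimensional polytope. Here a $0$-dimensional polytope is a point, and an $n$-dimensional polytope ($n\ge1$) is a relatively open, bounded, connected, Lipschitz subset of an $n$-dimensional affine subspace whose relative boundary is a finite union of closures of $(n-1)$-dimensional polytopes. A mesh $\mathcal T_h$ of $\Omega$ is a finite family of disjoint $d$-dimensional polytopes $T$ with $\overline\Omega=\bigcup_T\overline T$. It comes with a finite set $\mathcal E_h$ of facets $e$, each the closure of a $(d-1)$-dimensional polytope, distinct facets overlapping only in sets of $(d-1)$-dimensional measure zero. Each $\partial T$ is the union of the facets $\mathcal F_T=\{e\in\mathcal E_h: e\subseteq\partial T\}$, and each facet is either interior (contained in $\partial T_1\cap\partial T_2$ for two elements $T_1\ne T_2$; set $\mathcal E_h^I$) or a boundary facet (contained in $\partial T\cap\partial\Omega$; set $\mathcal E_h^B=\mathcal E_h^D\sqcup\mathcal E_h^N$), where $\Gamma_D=\bigcup\mathcal E_h^D$ and $\Gamma_N=\bigcup\mathcal E_h^N$. Write $h_T=\operatorname{diam}T$, $h=\max_Th_T$, $h_e=\operatorname{diam}e$ (if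 $d=1$: the smallest $h_T$ among the elements adjacent to $e$), $N_\partial=\max_T\#\mathcal F_T$, $|T|$ and $|\partial T|$ for the $d$- and $(d-1)$-dimensional measures, and $n_T$ for the outward unit normal to $T$. Consider a family of such meshes for which there are constants $r\in(0,\tfrac12]$, $C_g,\eta>0$ such that for every mesh of the family and every element $T$: $T$ is star-shaped with respect to a ball of radius $rh_T$ centred in $T$; $h_T\le C_gh_e$ for all $e\in\mathcal F_T$; $h_T|\partial T|\le\eta|T|$. For an element $T$, $C^m(T)$ is the space of functions whose derivatives of order $\le m$ are continuous in $T$ and extend continuously to $\overline T$; $|v|_{C^m(T)}=\max_{|i|=m}\sup_T|D^iv|$; $v\in C^m(\mathcal T_h)$ means $v|_T\in C^m(T)$ for all $T$, and $|v|_{C^m(\mathcal T_h)}=\max_T|v|_{C^m(T)}$; $H^m(\mathcal T_h)$ is the broken Sobolev space. $\|K\|_{L^\infty}$ is the essential supremum of the spectral norm, $\|\beta\|_{L^\infty}$ that of the Euclidean norm. On an interior facet $e$, $\{v\}=\frac12(v|_{T_1}+v|_{T_2})$, $[v]=v|_{T_1}n_{T_1}+v|_{T_2}n_{T_2}$; on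 a boundary facet $\{v\}=v|_T$, $[v]=v|_Tn_T$. On a boundary facet $n=n_T$; $n_e$ is a unit normal to $e$. **Problem.** Let $p\in\mathbb N=\{0,1,\dots\}$, $K_{jm},\beta_j\in C^{\max\{p-1,1\}}(\mathcal T_h)$, $\sigma\in C^{\max\{p-2,0\}}(\mathcal T_h)$, $\beta\in W^{1,\infty}(\Omega)^d$, $K$ symmetric with $\xi^TK\xi\ge k_{min}|\xi|^2$ a.e. in $\Omega$ for all $\xi\in\mathbb R^d$, $k_{min}>0$; $\sigma+\frac12\operatorname{div}\beta\ge\sigma_0>0$ a.e.; $\beta\cdot n\le0$ on $\Gamma_D$ and $\beta\cdot n\ge0$ on $\Gamma_N$. Put $\mathcal Lv=\operatorname{div}(-K\nabla v+\beta v)+\sigma v$. Let $g_N\in L^2(\Gamma_N)$ and let $u\in H^1(\Omega)\cap H^2(\mathcal T_h)\cap C^{p+1}(\mathcal T_h)$ be a weak solution of $$\mathcal Lu=0\ \text{in }\Omega,\qquad u=g_D\ \text{on }\Gamma_D,\qquad -K\nabla u\cdot n=g_N\ \text{on }\Gamma_N,$$ i.e. $u=g_D$ on $\Gamma_D$ and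 $\int_\Omega K\nabla u\cdot\nabla\varphi+(\beta\cdot\nabla u)\varphi+(\sigma+\operatorname{div}\beta)u\varphi=-\int_{\Gamma_N}g_N\varphi$ for all $\varphi\in C_c^\infty(\mathbb R^d)$ vanishing in a neighbourhood of $\Gamma_D$. **Method.** For every $T$ let $x_T\in T$ be a point with respect to which $T$ is star-shaped. Let $V_h=\mathbb{QT}^p(\mathcal T_h)$ be the set of functions $v$ such that, for each $T$, $v|_T$ is a polynomial of degree at most $p$ with $D^i(\mathcal Lv)(x_T)=0$ for all multi-indices $|i|\le p-2$. For $\epsilon\in\{-1,0,1\}$ and $\gamma>0$, let $u_h\in V_h$ satisfy $a_h(u_h,v_h)=L_h(v_h)$ for all $v_h\in V_h$, where $$\begin{aligned}a_h(w,v)=&\sum_T\int_TK\nabla w\cdot\nabla v-\sum_{e\in\mathcal E_h^I}\int_e\{K\nabla w\}\cdot[v]+\epsilon\sum_{e\in\mathcal E_h^I}\int_e[w]\cdot\{K\nabla v\}-\sum_{e\in\mathcal E_h^D}\int_eK\nabla w\cdot n\,v\\&+\epsilon\sum_{e\in\mathcal E_h^D}\int_ew\,K\nabla v\cdot n+\sum_{e\in\mathcal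 E_h^I}\frac\gamma{h_e}\int_e[w]\cdot[v]+\sum_{e\in\mathcal E_h^D}\frac\gamma{h_e}\int_ewv-\sum_T\int_T(\beta w)\cdot\nabla v+\sum_T\int_T\sigma wv\\&+\sum_{e\in\mathcal E_h^I}\int_e\{\beta w\}\cdot[v]+\frac12\sum_{e\in\mathcal E_h^I}\int_e|\beta\cdot n_e|[w]\cdot[v]+\sum_{e\in\mathcal E_h^N}\int_e(\beta w)\cdot n\,v,\end{aligned}$$ $$L_h(v)=-\sum_{e\in\mathcal E_h^N}\int_eg_Nv+\epsilon\sum_{e\in\mathcal E_h^D}\int_eg_DK\nabla v\cdot n+\sum_{e\in\mathcal E_h^D}\frac\gamma{h_e}\int_eg_Dv-\sum_{e\in\mathcal E_h^D}\int_eg_D\,\beta\cdot n\,v,$$ and let $$|||v|||_{dar}^2=\sum_T\int_TK\nabla v\cdot\nabla v+\sum_{e\in\mathcal E_h^I}\frac\gamma{h_e}\int_e|[v]|^2+\sum_{e\in\mathcal E_h^D}\frac\gamma{h_e}\int_ev^2+\|v\|_{L^2(\Omega)}^2+\frac12\sum_{e\in\mathcal E_h}\int_e|\beta\cdot n_e||[v]|^2.$$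 **Claim.** There is a constant $C_{tr}>0$, uniform over the family of meshes, with $$\|v\|_{L^2(\partial T)}^2\le C_{tr}h_T^{-1}\|v\|_{L^2(T)}^2\qquad\text{for all elements }T\text{ and all polynomials }v\text{ of degree}\le p.\tag{1}$$ For every $C_{tr}>0$ satisfying (1), write $\kappa=\|K\|_{L^\infty(\Omega)}$ and $$\gamma_\epsilon=\begin{cases}0,&\epsilon=1\\ \kappa^2\frac{N_\partial C_{tr}}{4k_{min}},&\epsilon=0\\ \kappa^2\frac{N_\partial C_{tr}}{k_{min}},&\epsilon=-1\end{cases}\qquad \alpha_d=\begin{cases}1,&\epsilon=1\\1+\frac{\epsilon-1}2\kappa\Big(\frac{N_\partial C_{tr}}{\gamma k_{min}}\Big)^{1/2},&\epsilon\in\{0,-1\}\end{cases}\qquad\alpha=\min\{1,\sigma_0,\alpha_d\},$$ $$M=2+\kappa^{1/2}\gamma^{-1/2}+\kappa\Big(\frac{N_\partial C_{tr}}{\gamma k_{min}}\Big)^{1/2}+\|\beta\|_{L^\infty(\Omega)}k_{min}^{-1/2}+\|\sigma\|_{L^\infty(\Omega)}+2+\|\beta\|_{L^\infty(\Omega)}^{1/2}.$$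 If $\gamma>\gamma_\epsilon$, then for every mesh of the family $$|||u-u_h|||_{dar}\le\Big(1+\frac M\alpha\Big)\frac{d^p}{p!}\bigg[\sum_T|T|\Big((1+\eta)\|K\|_{L^\infty(T)}+\frac{d^2}{(p+1)^2}\big(2C_g\gamma\eta+\|\beta\|_{L^\infty(T)}\eta h_T+h_T^2+\eta h_T\big)\Big)h_T^{2p}|u|_{C^{p+1}(T)}^2\bigg]^{1/2}.$$ In particular the error is of order $h^p$: $$|||u-u_h|||_{dar}\le\Big(1+\frac M\alpha\Big)\frac{d^p}{p!}\bigg[|\Omega|\Big((1+\eta)\kappa+\frac{d^2}{(p+1)^2}\big(2C_g\gamma\eta+\|\beta\|_{L^\infty(\Omega)}\eta h+h^2+\eta h\big)\Big)\bigg]^{1/2}h^p\,|u|_{C^{p+1}(\mathcal T_h)}.$$ -/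

import Mathlib

open MeasureTheory
open scoped ENNReal NNReal Topology ContDiff Gradient

namespace QTDG

noncomputable section

/-- Euclidean space `ℝ^d`. -/
abbrev Vec (d : ℕ) : Type := EuclideanSpace ℝ (Fin d)

/-! ### Differential operators -/

/-- The `k`-th vector of the canonical basis. -/
def unitVec {d : ℕ} (k : Fin d) : Vec d := EuclideanSpace.single k (1 : ℝ)

/-- First order partial derivative. -/
def partialD {d : ℕ} (k : Fin d) (v : Vec d → ℝ) : Vec d → ℝ :=
  fun x => fderiv ℝ v x (unitVec k)

/-- `D^i v = ∂_{x_1}^{i_1} ⋯ ∂_{x_d}^{i_d} v` for a multi-index `i`. -/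
def multiD {d : ℕ} (i : Fin d → ℕ) (v : Vec d → ℝ) : Vec d → ℝ :=
  (List.finRange d).foldr (fun k w => (partialD k)^[i k] w) v

/-- Length of a multi-index. -/
def multiLen {d : ℕ} (i : Fin d → ℕ) : ℕ := ∑ k, i k

/-- Divergence of a vector field. -/
def divg {d : ℕ} (w : Vec d → Vec d) (x : Vec d) : ℝ :=
  ∑ k, fderiv ℝ w x (unitVec k) k

/-! ### Function spaces -/

/-- Test functions: smooth, with compact support contained in `S`. -/
def IsTestFun {d : ℕ} (S : Set (Vec d)) (φ : Vec d → ℝ) : Prop :=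
  ContDiff ℝ ∞ φ ∧ HasCompactSupport φ ∧ tsupport φ ⊆ S

/-- `g` is the distributional derivative `∂_k v` on the open set `S`. -/
def IsWeakPartial {d : ℕ} (S : Set (Vec d)) (k : Fin d) (v g : Vec d → ℝ) : Prop :=
  ∀ φ, IsTestFun S φ → ∫ x in S, v x * partialD k φ x = - ∫ x in S, g x * φ x

/-- Membership in the Sobolev space `W^{m,q}(S)`. -/
def MemSobolev {d : ℕ} (q : ℝ≥0∞) (S : Set (Vec d)) : ℕ → (Vec d → ℝ) → Prop
  | 0, v => MemLp v q (volume.restrict S)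
  | m + 1, v => MemLp v q (volume.restrict S) ∧
      ∀ k, ∃ g, IsWeakPartial S k v g ∧ MemSobolev q S m g

/-- `v ∈ C^m(T)`, `T` open: `v` is `m` times continuously differentiable in `T` and all its
derivatives of order at most `m` extend continuously to the closure of `T`. -/
def MemC {d : ℕ} (m : ℕ) (T : Set (Vec d)) (v : Vec d → ℝ) : Prop :=
  ContDiffOn ℝ m v T ∧
    ∀ k ≤ m, ∃ g, ContinuousOn g (closure T) ∧ Set.EqOn (iteratedFDeriv ℝ k v) g T

/-- `|v|_{C^m(T)} = max_{|i|=m} sup_{x ∈ T} |D^i v(x)|`. -/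
def seminormC {d : ℕ} (m : ℕ) (T : Set (Vec d)) (v : Vec d → ℝ) : ℝ :=
  sSup {y | ∃ i : Fin d → ℕ, multiLen i = m ∧ ∃ x ∈ T, y = |multiD i v x|}

/-- `‖f‖_{L^∞(S)}`. -/
def linfNorm {d : ℕ} {F : Type*} [NormedAddCommGroup F] (S : Set (Vec d)) (f : Vec d → F) : ℝ :=
  (eLpNorm f ∞ (volume.restrict S)).toReal

/-! ### Polytopes and meshes -/

/-- The subset `P` of the affine subspace `A` is Lipschitz in `A`: near each point of its relative
boundary it is the part of `A` strictly below the graph of a Lipschitz function, in suitable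
orthogonal coordinates with vertical direction `ν`. -/
def IsLipschitzIn {d : ℕ} (A : AffineSubspace ℝ (Vec d)) (P : Set (Vec d)) : Prop :=
  ∀ x ∈ closure P \ P, ∃ ν ∈ A.direction, ‖ν‖ = 1 ∧ ∃ (L : ℝ≥0) (φ : Vec d → ℝ),
    LipschitzWith L φ ∧ ∀ᶠ y in 𝓝 x, y ∈ A →
      (y ∈ P ↔ inner ℝ (y - x) ν < φ ((y - x) - (inner ℝ (y - x) ν : ℝ) • ν))

/-- `n`-dimensional polytopes of `ℝ^d`: points if `n = 0`; otherwise relatively open, bounded,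
connected, Lipschitz subsets of an `n`-dimensional affine subspace whose relative boundary is a
finite union of closures of `(n-1)`-dimensional polytopes. -/
def IsPolytope {d : ℕ} : ℕ → Set (Vec d) → Prop
  | 0, P => ∃ x, P = {x}
  | n + 1, P => ∃ A : AffineSubspace ℝ (Vec d), Module.finrank ℝ A.direction = n + 1 ∧
      (∃ U, IsOpen U ∧ P = U ∩ A) ∧ Bornology.IsBounded P ∧ IsConnected P ∧
      IsLipschitzIn A P ∧
      ∃ F : Set (Set (Vec d)), F.Finite ∧ (∀ Q ∈ F, IsPolytope n Q) ∧
        closure P \ P = ⋃ Q ∈ F, closure Q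

/-- `n` is the outward unit normal to `T` at the boundary point `x`: near `x`, the set `T` is the
open half space through `x` with outward normal `n`. -/
def IsOuterNormal {d : ℕ} (T : Set (Vec d)) (x n : Vec d) : Prop :=
  ‖n‖ = 1 ∧ ∀ᶠ y in 𝓝 x, (y ∈ T ↔ inner ℝ (y - x) n < 0)

/-- The outward unit normal `n_T(x)`. For a polytope it is defined at every boundary point that
lies in the relative interior of a facet, hence almost everywhere on the boundary. -/
def outerNormal {d : ℕ} (T : Set (Vec d)) (x : Vec d) : Vec d :=
  Classical.epsilon (IsOuterNormal T x)

/-- Surface measure: the `(d-1)`-dimensional Hausdorff measure, normalized so that it is the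
Lebesgue measure on hyperplanes (the counting measure if `d = 1`). -/
def surf (d : ℕ) : Measure (Vec d) := μHE[d - 1]

/-- A polytopic mesh of `Ω` with its facets. -/
structure Mesh {d : ℕ} (Ω : Set (Vec d)) where
  /-- the mesh elements -/
  elements : Finset (Set (Vec d))
  /-- the mesh facets -/
  facets : Finset (Set (Vec d))
  isPolytope : ∀ T ∈ elements, IsPolytope d T
  disjoint : ∀ T ∈ elements, ∀ T' ∈ elements, T ≠ T' → Disjoint T T'
  cover : closure Ω = ⋃ T ∈ elements, closure T
  facet_isPolytope : ∀ e ∈ facets, ∃ P, IsPolytope (d - 1) P ∧ e = closure P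
  frontier_eq : ∀ T ∈ elements, frontier T = ⋃ e ∈ facets, ⋃ _ : e ⊆ frontier T, e
  facet_overlap : ∀ e ∈ facets, ∀ e' ∈ facets, e ≠ e' → surf d (e ∩ e') = 0
  interior_or_boundary : ∀ e ∈ facets,
    (∃ T₁ ∈ elements, ∃ T₂ ∈ elements, T₁ ≠ T₂ ∧ e ⊆ frontier T₁ ∩ frontier T₂) ∨
    (∃ T ∈ elements, e ⊆ frontier T ∩ frontier Ω)

namespace Mesh

variable {d : ℕ} {Ω : Set (Vec d)} (M : Mesh Ω)

open Classical in
/-- The facets `𝓕_T` of the element `T`. -/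
def facetsOf (T : Set (Vec d)) : Finset (Set (Vec d)) := {e ∈ M.facets | e ⊆ frontier T}

open Classical in
/-- The elements having `e` as a facet: two if `e` is interior, one if `e` is a boundary facet. -/
def adj (e : Set (Vec d)) : Finset (Set (Vec d)) := {T ∈ M.elements | e ⊆ frontier T}

open Classical in
/-- The interior facets. -/
def interiorFacets : Finset (Set (Vec d)) :=
  {e ∈ M.facets | ∃ T₁ ∈ M.elements, ∃ T₂ ∈ M.elements, T₁ ≠ T₂ ∧ e ⊆ frontier T₁ ∩ frontier T₂}

open Classical in
/-- The boundary facets. -/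
def boundaryFacets : Finset (Set (Vec d)) :=
  {e ∈ M.facets | ∃ T ∈ M.elements, e ⊆ frontier T ∩ frontier Ω}

/-- `N_∂`, the maximal number of facets of an element. -/
def maxFacets : ℕ := M.elements.sup fun T => (M.facetsOf T).card

/-- The facet size `h_e`: the diameter of `e`; in one dimension, where facets are points, the
smallest diameter of the adjacent elements. -/
def facetSize (e : Set (Vec d)) : ℝ :=
  if d = 1 then sInf (Metric.diam '' (M.adj e : Set (Set (Vec d)))) else Metric.diam e

/-- The meshsize `h`. -/
def meshSize : ℝ := sSup (Metric.diam '' (M.elements : Set (Set (Vec d))))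

/-- `v ∈ C^m(𝓣_h)`. -/
def BrokenC (m : ℕ) (v : Vec d → ℝ) : Prop := ∀ T ∈ M.elements, MemC m T v

/-- `|v|_{C^m(𝓣_h)}`. -/
def brokenSeminormC (m : ℕ) (v : Vec d → ℝ) : ℝ :=
  sSup ((fun T => seminormC m T v) '' (M.elements : Set (Set (Vec d))))

/-- `v ∈ H^m(𝓣_h)`. -/
def BrokenH (m : ℕ) (v : Vec d → ℝ) : Prop :=
  MemLp v 2 (volume.restrict Ω) ∧ ∀ T ∈ M.elements, MemSobolev 2 T m v

/-- The mesh is graded with constant `Cg`. -/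
def IsGraded (Cg : ℝ) : Prop :=
  ∀ T ∈ M.elements, ∀ e ∈ M.facetsOf T, Metric.diam T ≤ Cg * M.facetSize e

/-- Every element `T` is star-shaped with respect to a ball of radius `r h_T` centred in `T`. -/
def IsStarShapedBall (r : ℝ) : Prop :=
  ∀ T ∈ M.elements, ∃ c ∈ T, ∀ y ∈ Metric.ball c (r * Metric.diam T), StarConvex ℝ y T

/-- `h_T |∂T| ≤ η |T|` for every element. -/
def IsChunky (η : ℝ) : Prop :=
  ∀ T ∈ M.elements, Metric.diam T * (surf d).real (frontier T) ≤ η * volume.real T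

/-- `C` is a constant of the discrete trace inequality
`‖v‖²_{L²(∂T)} ≤ C h_T⁻¹ ‖v‖²_{L²(T)}` for polynomials of degree at most `p`. -/
def IsTraceConst (p : ℕ) (C : ℝ) : Prop :=
  ∀ T ∈ M.elements, ∀ q : MvPolynomial (Fin d) ℝ, q.totalDegree ≤ p →
    ∫ x in frontier T, MvPolynomial.eval (fun k => x k) q ^ 2 ∂(surf d) ≤
      C * (Metric.diam T)⁻¹ * ∫ x in T, MvPolynomial.eval (fun k => x k) q ^ 2

/-! Functions on the mesh are determined by their restrictions to the (open) elements; the trace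
from `T` at a point of a facet is the limit from within `T`, i.e. `extendFrom T`. The definitions
below give the usual averages and jumps on interior facets (two adjacent elements) and the usual
conventions on boundary facets (one adjacent element). -/

/-- Average of a scalar or vector function on the facet `e`. -/
def avg {F : Type*} [NormedAddCommGroup F] [NormedSpace ℝ F] (e : Set (Vec d)) (f : Vec d → F)
    (x : Vec d) : F :=
  ((M.adj e).card : ℝ)⁻¹ • ∑ T ∈ M.adj e, extendFrom T f x

/-- Jump of a scalar function on the facet `e` (a vector). -/
def jump (e : Set (Vec d)) (v : Vec d → ℝ) (x : Vec d) : Vec d :=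
  ∑ T ∈ M.adj e, extendFrom T v x • outerNormal T x

/-- Jump of a vector function on the facet `e` (a scalar); on a boundary facet, `w · n`. -/
def vecJump (e : Set (Vec d)) (w : Vec d → Vec d) (x : Vec d) : ℝ :=
  ∑ T ∈ M.adj e, inner ℝ (extendFrom T w x) (outerNormal T x)

/-- `|β · n_e|` on the facet `e`, for a field `β` that is continuous across `e`. -/
def absNormal (e : Set (Vec d)) (β : Vec d → Vec d) (x : Vec d) : ℝ :=
  ((M.adj e).card : ℝ)⁻¹ * ∑ T ∈ M.adj e, |inner ℝ (extendFrom T β x) (outerNormal T x)|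

end Mesh

/-! ### The boundary value problem -/

/-- Coefficients of the diffusion-advection-reaction operator. -/
structure Coeffs (d : ℕ) where
  /-- diffusion matrix -/
  K : Vec d → Matrix (Fin d) (Fin d) ℝ
  /-- advection field -/
  β : Vec d → Vec d
  /-- reaction coefficient -/
  σ : Vec d → ℝ

namespace Coeffs

variable {d : ℕ} (c : Coeffs d)

/-- The diffusion matrix as a linear operator of `ℝ^d`; its norm is the spectral norm. -/
def Kop (x : Vec d) : Vec d →L[ℝ] Vec d := Matrix.toEuclideanCLM (𝕜 := ℝ) (c.K x)

/-- `K ∇v`. -/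
def diffFlux (v : Vec d → ℝ) (x : Vec d) : Vec d := c.Kop x (∇ v x)

/-- The operator `𝓛 v = div(-K ∇v + β v) + σ v`. -/
def L (v : Vec d → ℝ) (x : Vec d) : ℝ :=
  divg (fun y => - c.diffFlux v y + v y • c.β y) x + c.σ x * v x

/-- `u` is a weak solution of `𝓛 u = f` in `Ω`, `u = gD` on the facets in `D`,
`-K ∇u · n = gN` on the facets in `N`: `u ∈ H¹(Ω)` with weak gradient `G`,
`∫_Ω K G · ∇φ + (β · G) φ + (σ + div β) u φ = ∫_Ω f φ - ∫_{Γ_N} gN φ` for all smooth `φ` vanishing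
near `Γ_D`, and the trace of `u` on `Γ_D` is `gD`. -/
def IsWeakSolution {Ω : Set (Vec d)} (M : Mesh Ω) (D N : Finset (Set (Vec d)))
    (f gD gN : Vec d → ℝ) (u : Vec d → ℝ) : Prop :=
  (∃ G : Vec d → Vec d, MemLp u 2 (volume.restrict Ω) ∧ MemLp G 2 (volume.restrict Ω) ∧
    (∀ k, IsWeakPartial Ω k u fun x => G x k) ∧
    ∀ φ : Vec d → ℝ, IsTestFun (⋃ e ∈ D, e)ᶜ φ →
      ∫ x in Ω, (inner ℝ (c.Kop x (G x)) (∇ φ x) + inner ℝ (c.β x) (G x) * φ x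
          + (c.σ x + divg c.β x) * u x * φ x)
        = (∫ x in Ω, f x * φ x) - ∑ e ∈ N, ∫ x in e, gN x * φ x ∂(surf d)) ∧
  ∀ e ∈ D, ∀ T ∈ M.adj e, ∀ᵐ x ∂((surf d).restrict e), extendFrom T u x = gD x

/-! ### The discontinuous Galerkin method -/

/-- The bilinear form `a_h^dar`. On a boundary facet, `avg e v` is the trace of `v` and `vecJump e w`
is `w · n`. -/
def aDar {Ω : Set (Vec d)} (M : Mesh Ω) (D N : Finset (Set (Vec d))) (ε γ : ℝ)
    (w v : Vec d → ℝ) : ℝ :=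
  (∑ T ∈ M.elements, ∫ x in T, inner ℝ (c.diffFlux w x) (∇ v x))
  - (∑ e ∈ M.interiorFacets, ∫ x in e,
      inner ℝ (M.avg e (c.diffFlux w) x) (M.jump e v x) ∂(surf d))
  + ε * (∑ e ∈ M.interiorFacets, ∫ x in e,
      inner ℝ (M.jump e w x) (M.avg e (c.diffFlux v) x) ∂(surf d))
  - (∑ e ∈ D, ∫ x in e, M.vecJump e (c.diffFlux w) x * M.avg e v x ∂(surf d))
  + ε * (∑ e ∈ D, ∫ x in e, M.avg e w x * M.vecJump e (c.diffFlux v) x ∂(surf d))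
  + (∑ e ∈ M.interiorFacets, γ / M.facetSize e *
      ∫ x in e, inner ℝ (M.jump e w x) (M.jump e v x) ∂(surf d))
  + (∑ e ∈ D, γ / M.facetSize e * ∫ x in e, M.avg e w x * M.avg e v x ∂(surf d))
  - (∑ T ∈ M.elements, ∫ x in T, inner ℝ (w x • c.β x) (∇ v x))
  + (∑ T ∈ M.elements, ∫ x in T, c.σ x * w x * v x)
  + (∑ e ∈ M.interiorFacets, ∫ x in e,
      inner ℝ (M.avg e (fun y => w y • c.β y) x) (M.jump e v x) ∂(surf d))
  + 1 / 2 * (∑ e ∈ M.interiorFacets, ∫ x in e,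
      M.absNormal e c.β x * inner ℝ (M.jump e w x) (M.jump e v x) ∂(surf d))
  + ∑ e ∈ N, ∫ x in e, M.vecJump e (fun y => w y • c.β y) x * M.avg e v x ∂(surf d)

/-- The linear form `L_h`. -/
def rhsDar {Ω : Set (Vec d)} (M : Mesh Ω) (D N : Finset (Set (Vec d))) (ε γ : ℝ)
    (f gD gN : Vec d → ℝ) (v : Vec d → ℝ) : ℝ :=
  (∫ x in Ω, f x * v x)
  - (∑ e ∈ N, ∫ x in e, gN x * M.avg e v x ∂(surf d))
  + ε * (∑ e ∈ D, ∫ x in e, gD x * M.vecJump e (c.diffFlux v) x ∂(surf d))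
  + (∑ e ∈ D, γ / M.facetSize e * ∫ x in e, gD x * M.avg e v x ∂(surf d))
  - ∑ e ∈ D, ∫ x in e, gD x * M.vecJump e c.β x * M.avg e v x ∂(surf d)

/-- The norm `|||·|||_dar`. -/
def normDar {Ω : Set (Vec d)} (M : Mesh Ω) (D : Finset (Set (Vec d))) (γ : ℝ)
    (v : Vec d → ℝ) : ℝ :=
  Real.sqrt (
    (∑ T ∈ M.elements, ∫ x in T, inner ℝ (c.diffFlux v x) (∇ v x))
    + (∑ e ∈ M.interiorFacets, γ / M.facetSize e * ∫ x in e, ‖M.jump e v x‖ ^ 2 ∂(surf d))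
    + (∑ e ∈ D, γ / M.facetSize e * ∫ x in e, M.avg e v x ^ 2 ∂(surf d))
    + (∫ x in Ω, v x ^ 2)
    + 1 / 2 * ∑ e ∈ M.facets, ∫ x in e, M.absNormal e c.β x * ‖M.jump e v x‖ ^ 2 ∂(surf d))

/-- The global quasi-Trefftz space `QT^p(𝓣_h)`, with Taylor centre `xc T` in the element `T`. -/
def MemQT {Ω : Set (Vec d)} (M : Mesh Ω) (xc : Set (Vec d) → Vec d) (p : ℕ)
    (v : Vec d → ℝ) : Prop :=
  ∀ T ∈ M.elements,
    (∃ q : MvPolynomial (Fin d) ℝ, q.totalDegree ≤ p ∧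
      ∀ x ∈ T, v x = MvPolynomial.eval (fun k => x k) q) ∧
    ∀ i : Fin d → ℕ, multiLen i + 2 ≤ p → multiD i (c.L v) (xc T) = 0

/-- `uh` solves the quasi-Trefftz DG problem: `uh ∈ QT^p(𝓣_h)` and `a_h^dar(uh, vh) = L_h(vh)` for
all `vh ∈ QT^p(𝓣_h)`. -/
def IsQTDGSolution {Ω : Set (Vec d)} (M : Mesh Ω) (xc : Set (Vec d) → Vec d) (p : ℕ)
    (D N : Finset (Set (Vec d))) (ε γ : ℝ) (f gD gN : Vec d → ℝ) (uh : Vec d → ℝ) : Prop :=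
  c.MemQT M xc p uh ∧ ∀ vh, c.MemQT M xc p vh →
    c.aDar M D N ε γ uh vh = c.rhsDar M D N ε γ f gD gN vh

end Coeffs

/-! ### Constants -/

/-- The threshold `γ_ε`; `κ = ‖K‖_{L^∞(Ω)}`, `Np = N_∂`. -/
def gammaEps (ε κ Np Ctr kmin : ℝ) : ℝ :=
  if ε = 1 then 0
  else if ε = 0 then κ ^ 2 * (Np * Ctr / (4 * kmin))
  else κ ^ 2 * (Np * Ctr / kmin)

/-- The coercivity constant of the diffusion part. -/
def alphaD (ε γ κ Np Ctr kmin : ℝ) : ℝ :=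
  if ε = 1 then 1 else 1 + 1 / 2 * (ε - 1) * κ * Real.sqrt (Np * Ctr / (γ * kmin))

/-- The coercivity constant `α = min {1, σ₀, α_d}`. -/
def alphaDar (ε γ κ Np Ctr kmin σ₀ : ℝ) : ℝ :=
  min 1 (min σ₀ (alphaD ε γ κ Np Ctr kmin))

/-- The boundedness constant `M = M_d + M_ar`; `b = ‖β‖_{L^∞(Ω)}`, `s = ‖σ‖_{L^∞(Ω)}`. -/
def boundDar (γ κ b s Np Ctr kmin : ℝ) : ℝ :=
  (2 + Real.sqrt κ / Real.sqrt γ + κ * Real.sqrt (Np * Ctr / (γ * kmin)))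
  + (b / Real.sqrt kmin + s + 2 + Real.sqrt b)

end

end QTDG

open QTDG

/-! The error estimate is a Céa argument with an explicit competitor. On each element let `v` be the
Taylor polynomial of `u` of degree `p` at `x_T`. Derivatives of `𝓛 w` of order at most `p - 2` at a
point only involve derivatives of `w` of order at most `p` there, so `𝓛 (u - v)` vanishes to order
`p - 2` at `x_T`. For `p ≥ 2` the weak solution satisfies `𝓛 u = 0` classically inside each element,
hence `v` is a quasi-Trefftz function (`Coeffs.exists_memQT_approx`).

Put `w = u - v` and `z = u_h - v`. Since `z` is an admissible test function, consistency gives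
`a_h(z, z) = a_h(w, z)`. Coercivity bounds the left side below by `α |||z|||²` (`Setting.coercive`),
and Cauchy-Schwarz on each term bounds the right side by `M E |||z|||`, where `E` controls
`|||w|||`, the boundary norms of `w` and the weighted boundary norms of `K ∇w`. Thus `|||z||| ≤ (M /
α) E`, and the triangle inequality gives the factor `1 + M / α` (`Setting.error_le`). The size of
`E` follows from Taylor's theorem on star-shaped sets; the bound `h_T |∂T| ≤ η |T|` turns boundary
terms into volume terms (`Setting.approximation_le`).

Coercivity has two sources. In the diffusive part the consistency terms are absorbed through the
discrete trace inequality, and `γ > γ_ε` is exactly the condition that something is left. In the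
advective part the divergence theorem for `β z²` produces `σ + div β / 2` in the volume and the
upwind seminorm on the facets (`Setting.formR_add_formF_self`).

Consistency (`Setting.consistency`) is where little regularity is available: for `p = 0` the flux `K
∇u` is merely continuous up to the boundary of each element, and its divergence is known only from
the weak formulation. It therefore rests on a divergence theorem for continuous fields with an
integrable weak divergence (`FacetSystem.integral_weakDiv`). Its proof tests the weak divergence
with a cutoff that is a function of the gauge of the element about the centre of its ball.
Star-shapedness with respect to the ball makes the gauge Lipschitz, and flatness of the facets makes
it linear on the cone over each facet; so the cutoff yields averages of `F · n` over thin shells,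
which tend to the surface integrals. The same theorem, localised by test functions, shows that `u`
and `β` have no jumps and that the normal flux of `u` does not jump and obeys the Neumann condition.

The case `p = 0` needs care, because the gradient estimate is then too weak by a factor `d`. In the
energy this is absorbed by `1 + η`, since `d ≤ η` by an isoperimetric inequality. In the flux term
it is absorbed because piecewise constant test functions have no flux, so one of the two consistency
terms vanishes and its share of `M` is free.

The uniform trace constant (`exists_isTraceConst`) comes from scaling: polynomials of degree at most
`p` form a finite-dimensional space, an element rescaled to unit diameter contains a ball of radius
`r / 2` and lies in a unit ball about the same centre, and the measure of its boundary is controlled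
by `η`. -/

namespace QTDG

/-! ### Star-shaped bodies and their gauge. -/

/-- `T` is a bounded open set that is star-shaped with respect to the ball of centre `c` and
radius `R`. -/
structure StarBody {d : ℕ} (T : Set (Vec d)) (c : Vec d) (R : ℝ) : Prop where
  isOpen : IsOpen T
  bounded : Bornology.IsBounded T
  pos : 0 < R
  mem : c ∈ T
  star : ∀ y ∈ Metric.ball c R, StarConvex ℝ y T

/-- The gauge of `T` about the point `c`. -/
noncomputable def sgauge {d : ℕ} (T : Set (Vec d)) (c x : Vec d) : ℝ :=
  gauge ((fun y => c + y) ⁻¹' T) (x - c)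

namespace StarBody

variable {d : ℕ} {T : Set (Vec d)} {c : Vec d} {R : ℝ}

lemma absorbent (h : StarBody T c R) : Absorbent ℝ ((fun y => c + y) ⁻¹' T) := by
  apply absorbent_nhds_zero
  have : Continuous fun y : Vec d => c + y := by fun_prop
  exact (h.isOpen.preimage this).mem_nhds (by simpa using h.mem)

lemma sgauge_nonneg (x : Vec d) : 0 ≤ sgauge T c x := gauge_nonneg _

lemma sgauge_homothety (x : Vec d) {s : ℝ} (hs : 0 ≤ s) :
    sgauge T c (c + s • (x - c)) = s * sgauge T c x := by
  simp only [sgauge, add_sub_cancel_left]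
  rw [gauge_smul_of_nonneg hs, smul_eq_mul]

lemma starConvex_center (h : StarBody T c R) : StarConvex ℝ c T :=
  h.star c (Metric.mem_ball_self h.pos)

lemma mem_of_sgauge_lt (h : StarBody T c R) {x : Vec d} (hx : sgauge T c x < 1) : x ∈ T := by
  obtain ⟨b, hb0, hb1, y, hy, hyx⟩ := exists_lt_of_gauge_lt h.absorbent hx
  have hy' : c + y ∈ T := hy
  have := (h.starConvex_center) hy' (a := 1 - b) (b := b) (by linarith) hb0.le (by ring)
  have e : (1 - b) • c + b • (c + y) = x := by
    have : b • y = x - c := hyx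
    rw [smul_add, this]; module
  rwa [e] at this

lemma sgauge_lt_one (h : StarBody T c R) {x : Vec d} (hx : x ∈ T) : sgauge T c x < 1 := by
  apply gauge_lt_one_of_mem_of_isOpen
  · exact h.isOpen.preimage (by fun_prop)
  · simpa using hx

lemma mem_iff (h : StarBody T c R) {x : Vec d} : x ∈ T ↔ sgauge T c x < 1 :=
  ⟨h.sgauge_lt_one, h.mem_of_sgauge_lt⟩

/-- `T` need not be convex, so its gauge need not be subadditive. Star-shapedness with respect to
the whole ball is a substitute: if `y - c = b z` with `c + z ∈ T` and `m > ‖x - y‖ / R`, then `c +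
m⁻¹ (x - y)` lies in the ball, and the segment from it to `c + z` contains `c + (b + m)⁻¹ (x - c)`.
Hence the gauge is Lipschitz with constant `1 / R`. -/
lemma sgauge_le_add (h : StarBody T c R) (x y : Vec d) :
    sgauge T c x ≤ sgauge T c y + R⁻¹ * ‖x - y‖ := by
  apply le_of_forall_pos_le_add
  intro ε hε
  obtain ⟨b, hb0, hb1, z, hz, hzy⟩ := exists_lt_of_gauge_lt h.absorbent
    (show gauge ((fun y => c + y) ⁻¹' T) (y - c) < sgauge T c y + ε / 2 by
      simp only [sgauge]; linarith)
  set m : ℝ := R⁻¹ * ‖x - y‖ + ε / 2 with hm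
  have hR := h.pos
  have hm0 : 0 < m := by positivity
  have hp : c + m⁻¹ • (x - y) ∈ Metric.ball c R := by
    rw [mem_ball_iff_norm, add_sub_cancel_left, norm_smul, norm_inv, Real.norm_of_nonneg hm0.le,
      inv_mul_lt_iff₀ hm0, hm]
    have : R⁻¹ * ‖x - y‖ * R = ‖x - y‖ := by field_simp
    nlinarith
  have hz' : c + z ∈ T := hz
  have hbm : 0 < b + m := by positivity
  have key := h.star _ hp hz' (a := m / (b + m)) (b := b / (b + m)) (by positivity) (by positivity)
    (by field_simp; ring)
  have hle : gauge ((fun y => c + y) ⁻¹' T) (x - c) ≤ b + m := by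
    apply gauge_le_of_mem hbm.le
    refine ⟨(b + m)⁻¹ • (x - c), ?_, ?_⟩
    · change c + (b + m)⁻¹ • (x - c) ∈ T
      convert key using 1
      have e1 : b • z = y - c := hzy
      have e2 : x - c = b • z + (x - y) := by rw [e1]; abel
      rw [e2, smul_add, smul_add, smul_add, smul_smul, smul_smul]
      have e3 : m / (b + m) * m⁻¹ = (b + m)⁻¹ := by field_simp
      have e4 : (m / (b + m)) • c + (b / (b + m)) • c = c := by
        rw [← add_smul]
        have : m / (b + m) + b / (b + m) = 1 := by field_simp; ring
        rw [this, one_smul]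
      have e5 : b / (b + m) = (b + m)⁻¹ * b := by field_simp
      rw [e3]
      nth_rewrite 1 [← e4]
      rw [e5]
      abel
    · simp [smul_smul, hbm.ne']
  simp only [sgauge] at *
  linarith

lemma lipschitz (h : StarBody T c R) : LipschitzWith (Real.toNNReal R⁻¹) (sgauge T c) := by
  apply LipschitzWith.of_le_add_mul
  intro x y
  rw [Real.coe_toNNReal _ (inv_nonneg.2 h.pos.le), dist_eq_norm]
  exact h.sgauge_le_add x y

lemma continuous_sgauge (h : StarBody T c R) : Continuous (sgauge T c) := h.lipschitz.continuous

lemma sgauge_le_one (h : StarBody T c R) {x : Vec d} (hx : x ∈ closure T) : sgauge T c x ≤ 1 := by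
  have : closure T ⊆ {x | sgauge T c x ≤ 1} :=
    closure_minimal (fun y hy => (h.sgauge_lt_one hy).le)
      (isClosed_le h.continuous_sgauge continuous_const)
  exact this hx

lemma sgauge_eq_one (h : StarBody T c R) {x : Vec d} (hx : x ∈ frontier T) : sgauge T c x = 1 := by
  rw [h.isOpen.frontier_eq] at hx
  exact le_antisymm (h.sgauge_le_one hx.1) (not_lt.1 fun hlt => hx.2 (h.mem_of_sgauge_lt hlt))

lemma mem_frontier (h : StarBody T c R) {x : Vec d} (hx : sgauge T c x = 1) : x ∈ frontier T := by
  rw [h.isOpen.frontier_eq]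
  refine ⟨?_, fun hxT => (h.sgauge_lt_one hxT).ne hx⟩
  have hc : Filter.Tendsto (fun s : ℝ => c + s • (x - c)) (𝓝[<] 1) (𝓝 (c + (1 : ℝ) • (x - c))) := by
    apply Filter.Tendsto.mono_left _ nhdsWithin_le_nhds
    exact Continuous.tendsto (by fun_prop) 1
  rw [one_smul, add_sub_cancel] at hc
  refine mem_closure_of_tendsto hc ?_
  have : Set.Ioo (0 : ℝ) 1 ∈ 𝓝[<] (1 : ℝ) := Ioo_mem_nhdsLT one_pos
  filter_upwards [this] with s hs
  apply h.mem_of_sgauge_lt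
  rw [sgauge_homothety x hs.1.le, hx, mul_one]
  exact hs.2

lemma sgauge_pos (h : StarBody T c R) {x : Vec d} (hx : x ≠ c) : 0 < sgauge T c x := by
  rw [sgauge, gauge_pos h.absorbent]
  · exact sub_ne_zero.2 hx
  · rw [NormedSpace.isVonNBounded_iff]
    have : (fun y => c + y) ⁻¹' T = (fun y => -c + y) '' T := by
      ext y
      constructor
      · intro hy; exact ⟨c + y, hy, by simp⟩
      · rintro ⟨z, hz, rfl⟩; simpa using hz
    rw [this]
    have h2 := h.bounded
    rw [isBounded_iff_forall_norm_le] at h2 ⊢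
    obtain ⟨C, hC⟩ := h2
    refine ⟨‖c‖ + C, ?_⟩
    rintro _ ⟨z, hz, rfl⟩
    calc ‖-c + z‖ ≤ ‖-c‖ + ‖z‖ := norm_add_le _ _
      _ ≤ ‖c‖ + C := by rw [norm_neg]; gcongr; exact hC z hz

lemma radial_mem_frontier (h : StarBody T c R) {x : Vec d} (hx : x ≠ c) :
    c + (sgauge T c x)⁻¹ • (x - c) ∈ frontier T := by
  apply h.mem_frontier
  rw [sgauge_homothety x (inv_nonneg.2 (sgauge_nonneg x)), inv_mul_cancel₀ (h.sgauge_pos hx).ne']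

end StarBody

/-! ### Cones over flat pieces of the boundary, and outward normals. -/

/-- The hyperplane through `a` with normal `n`. -/
def hyp {d : ℕ} (a n : Vec d) : Set (Vec d) := {y | inner ℝ (y - a) n = 0}

/-- The ratio `⟪x - c, n⟫ / ⟪a - c, n⟫`, equal to `1` on the hyperplane `hyp a n`. -/
noncomputable def coneHeight {d : ℕ} (c a n x : Vec d) : ℝ := inner ℝ (x - c) n / inner ℝ (a - c) n

/-- The radial projection from `c` to the hyperplane `hyp a n`. -/
noncomputable def coneProj {d : ℕ} (c a n x : Vec d) : Vec d :=
  c + (coneHeight c a n x)⁻¹ • (x - c)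

section Cone

variable {d : ℕ} {c a n : Vec d}

lemma continuous_coneHeight : Continuous (coneHeight c a n) := by
  unfold coneHeight; fun_prop

lemma measurable_coneProj : Measurable (coneProj c a n) := by
  have := (continuous_coneHeight (c := c) (a := a) (n := n)).measurable
  unfold coneProj; fun_prop

lemma coneHeight_of_mem_hyp (hc : inner ℝ (a - c) n ≠ (0 : ℝ)) {x : Vec d} (hx : x ∈ hyp a n) :
    coneHeight c a n x = 1 := by
  have h1 : inner ℝ (x - a) n = (0 : ℝ) := hx
  have : x - c = (x - a) + (a - c) := by abel
  rw [coneHeight, this, inner_add_left, h1, zero_add, div_self hc]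

lemma coneHeight_homothety (s : ℝ) (x : Vec d) :
    coneHeight c a n (c + s • (x - c)) = s * coneHeight c a n x := by
  rw [coneHeight, coneHeight, add_sub_cancel_left, real_inner_smul_left, mul_div_assoc]

lemma coneProj_homothety (hc : inner ℝ (a - c) n ≠ (0 : ℝ)) {x : Vec d} (hx : x ∈ hyp a n) {s : ℝ}
    (hs : s ≠ 0) : coneProj c a n (c + s • (x - c)) = x := by
  rw [coneProj, coneHeight_homothety, coneHeight_of_mem_hyp hc hx, mul_one, add_sub_cancel_left,
    smul_smul, inv_mul_cancel₀ hs, one_smul, add_sub_cancel]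

lemma homothety_coneProj {x : Vec d} (hx : coneHeight c a n x ≠ 0) :
    c + coneHeight c a n x • (coneProj c a n x - c) = x := by
  rw [coneProj, add_sub_cancel_left, smul_smul, mul_inv_cancel₀ hx, one_smul, add_sub_cancel]

lemma coneProj_mem_hyp {x : Vec d}
    (hx : coneHeight c a n x ≠ 0) : coneProj c a n x ∈ hyp a n := by
  have : inner ℝ (x - c) n ≠ (0 : ℝ) := fun h0 => hx (by simp [coneHeight, h0])
  have e : coneProj c a n x - a = (coneHeight c a n x)⁻¹ • (x - c) - (a - c) := by
    rw [coneProj]; abel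
  rw [hyp, Set.mem_ofPred_eq, e, inner_sub_left, real_inner_smul_left, coneHeight]
  field_simp
  simp

/-- The open cone with apex `c` over `U ∩ hyp a n`. -/
def openCone (c a n : Vec d) (U : Set (Vec d)) : Set (Vec d) :=
  {x | 0 < coneHeight c a n x ∧ coneProj c a n x ∈ U}

lemma isOpen_openCone {U : Set (Vec d)} (hU : IsOpen U) : IsOpen (openCone c a n U) := by
  have h1 : IsOpen {x | 0 < coneHeight c a n x} := isOpen_lt continuous_const continuous_coneHeight
  have h2 : ContinuousOn (coneProj c a n) {x | 0 < coneHeight c a n x} := by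
    unfold coneProj
    refine continuousOn_const.add (ContinuousOn.smul (f := fun x => (coneHeight c a n x)⁻¹) ?_
      (Continuous.continuousOn (by fun_prop)))
    exact continuous_coneHeight.continuousOn.inv₀ fun x hx => (ne_of_gt hx)
  exact h2.isOpen_inter_preimage h1 hU

/-- If `U ∩ hyp a n` is contained in the boundary of a star body, then the hyperplane does not pass
through the centre. -/
lemma StarBody.inner_ne_zero {T : Set (Vec d)} {R : ℝ} (h : StarBody T c R) {U : Set (Vec d)}
    (hU : IsOpen U) (ha : a ∈ U) (hsub : U ∩ hyp a n ⊆ frontier T) :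
    inner ℝ (a - c) n ≠ (0 : ℝ) := by
  -- If the hyperplane contained `c`, it would contain the ray from `c` through `a`. Points of this
  -- ray slightly beyond `a` would still be boundary points, although their gauge exceeds `1`.
  intro h0
  have haf : a ∈ frontier T := hsub ⟨ha, by simp [hyp]⟩
  have hc : Filter.Tendsto (fun s : ℝ => c + s • (a - c)) (𝓝 1) (𝓝 (c + (1 : ℝ) • (a - c))) :=
    Continuous.tendsto (by fun_prop) 1
  rw [one_smul, add_sub_cancel] at hc
  have h1 : ∀ᶠ s : ℝ in 𝓝 1, c + s • (a - c) ∈ U := hc.eventually (hU.mem_nhds ha)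
  have h2 : ∀ᶠ s : ℝ in 𝓝[>] 1, c + s • (a - c) ∈ U ∧ s ∈ Set.Ioi (1 : ℝ) :=
    (h1.filter_mono nhdsWithin_le_nhds).and self_mem_nhdsWithin
  obtain ⟨s, hs, hs1⟩ := h2.exists
  have hs1' : (1 : ℝ) < s := hs1
  have hf : c + s • (a - c) ∈ frontier T := by
    apply hsub ⟨hs, ?_⟩
    have : c + s • (a - c) - a = (s - 1) • (a - c) := by module
    rw [hyp, Set.mem_ofPred_eq, this, real_inner_smul_left, h0, mul_zero]
  have e1 := h.sgauge_eq_one hf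
  rw [StarBody.sgauge_homothety a (by linarith), h.sgauge_eq_one haf] at e1
  linarith

/-- Both functions are homogeneous of degree one about `c` and equal `1` on the base of the cone. So
the gauge is affine over a flat piece of the boundary. -/
lemma StarBody.sgauge_eq_coneHeight {T : Set (Vec d)} {R : ℝ} (h : StarBody T c R)
    {U : Set (Vec d)} (hsub : U ∩ hyp a n ⊆ frontier T)
    {x : Vec d} (hx : x ∈ openCone c a n U) : sgauge T c x = coneHeight c a n x := by
  have hp : coneProj c a n x ∈ frontier T := hsub ⟨hx.2, coneProj_mem_hyp hx.1.ne'⟩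
  conv_lhs => rw [← homothety_coneProj hx.1.ne']
  rw [StarBody.sgauge_homothety _ hx.1.le, h.sgauge_eq_one hp, mul_one]

lemma mem_openCone_self (hc : inner ℝ (a - c) n ≠ (0 : ℝ)) {U : Set (Vec d)} {x : Vec d}
    (hx : x ∈ U ∩ hyp a n) : x ∈ openCone c a n U := by
  have h1 := coneHeight_of_mem_hyp hc hx.2
  refine ⟨by rw [h1]; exact one_pos, ?_⟩
  rw [coneProj, h1, inv_one, one_smul, add_sub_cancel]
  exact hx.1

/-- Near a flat boundary point `T` is the set where the gauge is below `1`, and there the gauge is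
the affine function `coneHeight`; so `T` is locally a half space. -/
lemma StarBody.isOuterNormal {T : Set (Vec d)} {R : ℝ} (h : StarBody T c R) {U : Set (Vec d)}
    (hU : IsOpen U) (hn : ‖n‖ = 1) (hc : 0 < inner ℝ (a - c) n)
    (hsub : U ∩ hyp a n ⊆ frontier T) {x : Vec d} (hx : x ∈ U ∩ hyp a n) :
    IsOuterNormal T x n := by
  refine ⟨hn, ?_⟩
  filter_upwards [(isOpen_openCone hU).mem_nhds (mem_openCone_self hc.ne' hx)] with y hy
  rw [h.mem_iff, h.sgauge_eq_coneHeight hsub hy, coneHeight, div_lt_one hc]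
  have h1 : inner ℝ (x - a) n = (0 : ℝ) := hx.2
  have e : y - c = (y - x) + (x - a) + (a - c) := by abel
  rw [e, inner_add_left, inner_add_left, h1]
  constructor <;> intro <;> linarith

end Cone

/-- If the normals differ, the point `x + s (n - n')` is outside the half space of `n` and inside
that of `n'`, since `⟪n, n'⟫ < 1`. -/
lemma IsOuterNormal.unique {d : ℕ} {T : Set (Vec d)} {x n n' : Vec d} (h : IsOuterNormal T x n)
    (h' : IsOuterNormal T x n') : n = n' := by
  have hc : Filter.Tendsto (fun s : ℝ => x + s • (n - n')) (𝓝[>] 0) (𝓝 x) := by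
    have : Filter.Tendsto (fun s : ℝ => x + s • (n - n')) (𝓝 0) (𝓝 (x + (0 : ℝ) • (n - n'))) :=
      Continuous.tendsto (by fun_prop) 0
    rw [zero_smul, add_zero] at this
    exact this.mono_left nhdsWithin_le_nhds
  by_contra hne
  have e1 := hc.eventually (h.2.and h'.2)
  obtain ⟨s, ⟨h1, h2⟩, hs⟩ := (e1.and self_mem_nhdsWithin).exists
  have hs' : (0 : ℝ) < s := hs
  rw [add_sub_cancel_left, real_inner_smul_left, inner_sub_left, real_inner_self_eq_norm_sq,
    h.1, real_inner_comm] at h1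
  rw [add_sub_cancel_left, real_inner_smul_left, inner_sub_left, real_inner_self_eq_norm_sq,
    h'.1] at h2
  have hlt : inner ℝ n n' < (1 : ℝ) := (inner_lt_one_iff_real_of_norm_eq_one h.1 h'.1).2 hne
  have a2 := h1.1 (h2.2 (by nlinarith))
  nlinarith

lemma IsOuterNormal.outerNormal_eq {d : ℕ} {T : Set (Vec d)} {x n : Vec d}
    (h : IsOuterNormal T x n) : outerNormal T x = n :=
  (Classical.epsilon_spec (p := IsOuterNormal T x) ⟨n, h⟩).unique h

/-- Disjoint sets have opposite outward normals at common boundary points. -/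
lemma IsOuterNormal.eq_neg_of_disjoint {d : ℕ} {T T' : Set (Vec d)} {x n n' : Vec d}
    (h : IsOuterNormal T x n) (h' : IsOuterNormal T' x n') (hd : Disjoint T T') : n' = -n := by
  -- Unless `n' = -n`, the direction `-n - n'` points into both half spaces, which would give a
  -- common point of the two disjoint sets.
  have hc : Filter.Tendsto (fun s : ℝ => x + s • (-n - n')) (𝓝[>] 0) (𝓝 x) := by
    have : Filter.Tendsto (fun s : ℝ => x + s • (-n - n')) (𝓝 0) (𝓝 (x + (0 : ℝ) • (-n - n'))) :=
      Continuous.tendsto (by fun_prop) 0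
    rw [zero_smul, add_zero] at this
    exact this.mono_left nhdsWithin_le_nhds
  by_contra hne
  obtain ⟨s, ⟨h1, h2⟩, hs⟩ := ((hc.eventually (h.2.and h'.2)).and self_mem_nhdsWithin).exists
  have hs' : (0 : ℝ) < s := hs
  rw [add_sub_cancel_left, real_inner_smul_left, inner_sub_left, inner_neg_left,
    real_inner_self_eq_norm_sq, h.1, real_inner_comm] at h1
  rw [add_sub_cancel_left, real_inner_smul_left, inner_sub_left, inner_neg_left,
    real_inner_self_eq_norm_sq, h'.1] at h2
  have hlt : inner ℝ (-n) n' < (1 : ℝ) :=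
    (inner_lt_one_iff_real_of_norm_eq_one (by rw [norm_neg, h.1]) h'.1).2 (Ne.symm hne)
  rw [inner_neg_left] at hlt
  refine Set.disjoint_left.1 hd (h1.2 ?_) (h2.2 ?_) <;> nlinarith

/-! ### Surface measure -/

lemma hausdorff_lt_top_of_subset_affine {d n : ℕ} {A : AffineSubspace ℝ (Vec d)}
    (hA : Module.finrank ℝ A.direction = n) {s : Set (Vec d)} (hs : s ⊆ A)
    (hb : Bornology.IsBounded s) : μHE[n] s < ⊤ := by
  rcases s.eq_empty_or_nonempty with rfl | ⟨a, ha⟩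
  · simp
  let f : A.direction → Vec d := fun v => v + a
  have hf : Isometry f := by
    intro x y
    simp [f, edist_add_right, Subtype.edist_eq]
  have hsr : s = f '' (f ⁻¹' s) := by
    rw [Set.image_preimage_eq_inter_range, Set.inter_eq_left.2]
    intro y hy
    exact ⟨⟨y - a, A.vsub_mem_direction (hs hy) (hs ha)⟩, by simp [f]⟩
  rw [hsr, hf.euclideanHausdorffMeasure_image, ← hA,
    InnerProductSpace.euclideanHausdorffMeasure_eq_volume]
  apply Bornology.IsBounded.measure_lt_top
  exact hf.antilipschitz.isBounded_preimage hb

/-- A set of finite `n`-dimensional measure is null in every higher dimension. -/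
lemma surf_eq_zero_of_subset_affine {d n : ℕ} {A : AffineSubspace ℝ (Vec d)}
    (hA : Module.finrank ℝ A.direction = n) (hn : n < d - 1) {s : Set (Vec d)} (hs : s ⊆ A)
    (hb : Bornology.IsBounded s) : surf d s = 0 := by
  rcases Measure.euclideanHausdorffMeasure_zero_or_top hn s with h | h
  · exact h
  · exact absurd h (hausdorff_lt_top_of_subset_affine hA hs hb).ne

lemma IsPolytope.exists_affine {d n : ℕ} {P : Set (Vec d)} (h : IsPolytope n P) :
    ∃ A : AffineSubspace ℝ (Vec d), Module.finrank ℝ A.direction = n ∧ P ⊆ A ∧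
      Bornology.IsBounded P ∧ P.Nonempty := by
  cases n with
  | zero =>
    obtain ⟨x, rfl⟩ := h
    refine ⟨AffineSubspace.mk' x ⊥, by simp, ?_, Bornology.isBounded_singleton,
      Set.singleton_nonempty x⟩
    rintro y rfl
    simp
  | succ n =>
    obtain ⟨A, hA, ⟨U, -, rfl⟩, hb, hc, -⟩ := h
    exact ⟨A, hA, Set.inter_subset_right, hb, hc.nonempty⟩

lemma isClosed_affine {d : ℕ} (A : AffineSubspace ℝ (Vec d)) : IsClosed (A : Set (Vec d)) :=
  AffineSubspace.closed_of_finiteDimensional A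

/-- A hyperplane is determined by a point and a unit normal. -/
lemma exists_eq_hyp {d : ℕ} (hd : 1 ≤ d) {A : AffineSubspace ℝ (Vec d)}
    (hA : Module.finrank ℝ A.direction = d - 1) {a : Vec d} (ha : a ∈ A) :
    ∃ n : Vec d, ‖n‖ = 1 ∧ (A : Set (Vec d)) = hyp a n := by
  have h1 := A.direction.finrank_add_finrank_orthogonal
  rw [hA, finrank_euclideanSpace_fin] at h1
  have h2 : Module.finrank ℝ A.directionᗮ = 1 := by omega
  obtain ⟨⟨v, hvm⟩, hv0, hv⟩ := finrank_eq_one_iff'.1 h2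
  have hv0' : v ≠ 0 := by simpa using hv0
  have hspan : A.directionᗮ = Submodule.span ℝ {v} := by
    apply le_antisymm
    · intro w hw
      obtain ⟨t, ht⟩ := hv ⟨w, hw⟩
      rw [Submodule.mem_span_singleton]
      exact ⟨t, congrArg Subtype.val ht⟩
    · rw [Submodule.span_singleton_le_iff_mem]; exact hvm
  refine ⟨(‖v‖)⁻¹ • v, ?_, ?_⟩
  · rw [norm_smul, norm_inv, norm_norm, inv_mul_cancel₀ (norm_ne_zero_iff.2 hv0')]
  · ext y
    have e1 : y ∈ A ↔ y - a ∈ A.direction := by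
      rw [← vsub_eq_sub, AffineSubspace.vsub_right_mem_direction_iff_mem ha]
    have e2 : A.direction = (Submodule.span ℝ {v})ᗮ := by
      rw [← hspan, Submodule.orthogonal_orthogonal]
    rw [SetLike.mem_coe, e1, e2, Submodule.mem_orthogonal_singleton_iff_inner_left, hyp,
      Set.mem_ofPred_eq, inner_smul_right]
    simp [hv0']

/-- Data of a facet: a bounded closed set `e` that is the closure of a relatively open subset
`U ∩ hyp a n` of a hyperplane, up to a null set. -/
structure FacetData {d : ℕ} (e U : Set (Vec d)) (a n : Vec d) : Prop where
  isOpen : IsOpen U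
  mem : a ∈ U
  norm : ‖n‖ = 1
  bounded : Bornology.IsBounded e
  closure_eq : e = closure (U ∩ hyp a n)
  null : surf d (e \ (U ∩ hyp a n)) = 0

lemma isClosed_hyp {d : ℕ} (a n : Vec d) : IsClosed (hyp a n) :=
  isClosed_eq (by fun_prop) continuous_const

/-- Brings a facet to the form used everywhere below: a relatively open piece of one hyperplane with
unit normal `n`, plus a null set. -/
lemma IsPolytope.exists_facetData {d : ℕ} (hd : 1 ≤ d) {P : Set (Vec d)}
    (hP : IsPolytope (d - 1) P) : ∃ U a n, FacetData (closure P) U a n ∧ P = U ∩ hyp a n := by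
  obtain ⟨A, hA, hPA, hb, a, ha⟩ := hP.exists_affine
  obtain ⟨n, hn, hAn⟩ := exists_eq_hyp hd hA (hPA ha)
  rcases hk : d - 1 with _ | k
  -- For `d = 1` the hyperplane is a single point and the facet is its own relative interior.
  · rw [hk] at hP hA
    obtain ⟨x, rfl⟩ := hP
    have ha' := ha
    obtain rfl : a = x := ha'
    have hA1 : (A : Set (Vec d)) = {a} := by
      have : A.direction = ⊥ := Submodule.finrank_eq_zero.1 hA
      ext y
      rw [SetLike.mem_coe, ← AffineSubspace.vsub_right_mem_direction_iff_mem (hPA ha), this]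
      simp [sub_eq_zero]
    have e : ({a} : Set (Vec d)) = Set.univ ∩ hyp a n := by rw [Set.univ_inter, ← hAn, hA1]
    refine ⟨Set.univ, a, n, ⟨isOpen_univ, Set.mem_univ _, hn, hb.closure, by rw [← e], ?_⟩, e⟩
    rw [← e]; simp
  · have hP' := hP
    rw [hk] at hP
    obtain ⟨A', hA', ⟨U, hU, hPU⟩, -, -, -, F, hF, hFQ, hcl⟩ := hP
    -- Two hyperplanes carry `P` here: `A`, and the `A'` in which `P` is relatively open. Small
    -- steps from `a` in a direction of `A'` stay in `P ⊆ A`, so the directions of `A'` are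
    -- directions of `A`; equal dimensions do the rest.
    have hAA : (A' : Set (Vec d)) = hyp a n := by
      have haA' : a ∈ A' := by rw [hPU] at ha; exact ha.2
      obtain ⟨n', hn', hAn'⟩ := exists_eq_hyp hd (by rw [hA', hk]) haA'
      have hsub : ∀ v, inner ℝ v n' = (0 : ℝ) → inner ℝ v n = (0 : ℝ) := by
        intro v hv
        have hc : Filter.Tendsto (fun s : ℝ => a + s • v) (𝓝[>] 0) (𝓝 a) := by
          have : Filter.Tendsto (fun s : ℝ => a + s • v) (𝓝 0) (𝓝 (a + (0 : ℝ) • v)) :=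
            Continuous.tendsto (by fun_prop) 0
          rw [zero_smul, add_zero] at this
          exact this.mono_left nhdsWithin_le_nhds
        have haU : a ∈ U := by rw [hPU] at ha; exact ha.1
        obtain ⟨s, hs, hs0⟩ := ((hc.eventually (hU.mem_nhds haU)).and self_mem_nhdsWithin).exists
        have hs0' : (0 : ℝ) < s := hs0
        have hmem : a + s • v ∈ P := by
          rw [hPU]; refine ⟨hs, ?_⟩
          rw [hAn', hyp, Set.mem_ofPred_eq, add_sub_cancel_left, real_inner_smul_left, hv, mul_zero]
        have := hPA hmem
        rw [hAn, hyp, Set.mem_ofPred_eq, add_sub_cancel_left, real_inner_smul_left] at this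
        exact (mul_eq_zero.1 this).resolve_left hs0'.ne'
      have hle : A'.direction ≤ A.direction := by
        intro v hv
        have h1 : v +ᵥ a ∈ A' := AffineSubspace.vadd_mem_of_mem_direction hv haA'
        have h2 : v +ᵥ a ∈ (A' : Set (Vec d)) := h1
        rw [hAn', hyp, Set.mem_ofPred_eq, vadd_eq_add, add_sub_cancel_right] at h2
        have h3 : v +ᵥ a ∈ (A : Set (Vec d)) := by
          rw [hAn, hyp, Set.mem_ofPred_eq, vadd_eq_add, add_sub_cancel_right]; exact hsub v h2
        have := A.vsub_mem_direction h3 (hPA ha)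
        simpa using this
      have heq : A'.direction = A.direction :=
        Submodule.eq_of_le_of_finrank_eq hle (by rw [hA, hA', hk])
      have : A' = A := AffineSubspace.ext_of_direction_eq heq ⟨a, haA', hPA ha⟩
      rw [this, hAn]
    have e : P = U ∩ hyp a n := by rw [hPU, hAA]
    refine ⟨U, a, n, ⟨hU, by rw [e] at ha; exact ha.1, hn, hb.closure, by rw [← e], ?_⟩, e⟩
    -- The relative boundary is covered by finitely many bounded pieces of affine subspaces of
    -- dimension `d - 2`.
    rw [← e, hcl]
    refine (measure_biUnion_null_iff hF.countable).2 fun Q hQ => ?_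
    obtain ⟨B, hB, hQB, hQb, -⟩ := (hFQ Q hQ).exists_affine
    exact surf_eq_zero_of_subset_affine hB (by omega)
      (closure_minimal hQB (isClosed_affine B)) hQb.closure

namespace FacetData

variable {d : ℕ} {e U : Set (Vec d)} {a n : Vec d}

lemma subset_hyp (h : FacetData e U a n) : e ⊆ hyp a n := by
  rw [h.closure_eq]
  exact closure_minimal Set.inter_subset_right (isClosed_hyp a n)

lemma core_subset (h : FacetData e U a n) : U ∩ hyp a n ⊆ e := by
  rw [h.closure_eq]; exact subset_closure

lemma isCompact (h : FacetData e U a n) : IsCompact e :=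
  Metric.isCompact_of_isClosed_isBounded (by rw [h.closure_eq]; exact isClosed_closure) h.bounded

lemma measurableSet_core (h : FacetData e U a n) : MeasurableSet (U ∩ hyp a n) :=
  h.isOpen.measurableSet.inter (isClosed_hyp a n).measurableSet

end FacetData

lemma surf_hyp_lt_top {d : ℕ} {a n : Vec d} (hn : ‖n‖ = 1) {s : Set (Vec d)}
    (hs : s ⊆ hyp a n) (hb : Bornology.IsBounded s) : surf d s < ⊤ := by
  have hn0 : n ≠ 0 := by rintro rfl; simp at hn
  have h1 := (Submodule.span ℝ {n}).finrank_add_finrank_orthogonal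
  rw [finrank_span_singleton hn0, finrank_euclideanSpace_fin] at h1
  refine hausdorff_lt_top_of_subset_affine (A := AffineSubspace.mk' a (Submodule.span ℝ {n})ᗮ)
    (by rw [AffineSubspace.direction_mk']; omega) ?_ hb
  intro y hy
  rw [SetLike.mem_coe, AffineSubspace.mem_mk', vsub_eq_sub,
    Submodule.mem_orthogonal_singleton_iff_inner_left]
  exact hs hy

/-! ### Volumes of cones by slicing. -/

/-- The part between the heights `α` and `β` of the cone with apex `c` over `B`. -/
def frustum {d : ℕ} (c a n : Vec d) (α β : ℝ) (B : Set (Vec d)) : Set (Vec d) :=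
  {x | α < coneHeight c a n x ∧ coneHeight c a n x < β ∧ coneProj c a n x ∈ B}

lemma measurableSet_frustum {d : ℕ} {c a n : Vec d} {α β : ℝ} {B : Set (Vec d)}
    (hB : MeasurableSet B) : MeasurableSet (frustum c a n α β B) := by
  have h1 := (continuous_coneHeight (c := c) (a := a) (n := n)).measurable
  refine (measurableSet_lt measurable_const h1).inter
    ((measurableSet_lt h1 measurable_const).inter (measurable_coneProj hB))

/-- Fubini's theorem along the unit direction `n`; the slices carry the `(d-1)`-dimensional
Hausdorff measure. -/
lemma volume_eq_lintegral_slices {d : ℕ} (c : Vec d) {n : Vec d} (hn : ‖n‖ = 1)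
    {t : Set (Vec d)} (ht : MeasurableSet t) :
    volume t = ∫⁻ x : ℝ, surf d (t ∩ {y | inner ℝ (y - c) n = x}) := by
  have hn0 : n ≠ 0 := by rintro rfl; simp at hn
  have h := EuclideanGeometry.euclideanHausdorffMeasure_eq_lintegral c hn0 ht
  have h1 : ‖n‖ₑ = 1 := by rw [← ofReal_norm, hn]; simp
  rw [h1, one_mul, InnerProductSpace.euclideanHausdorffMeasure_eq_volume] at h
  rw [h]
  congr with x
  rw [surf, finrank_euclideanSpace_fin]
  congr 2
  ext y
  rw [SetLike.mem_coe, AffineSubspace.mem_mk', Submodule.mem_orthogonal_singleton_iff_inner_left,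
    Set.mem_ofPred_eq, vsub_eq_sub, vadd_eq_add]
  have : y - (x • n + c) = (y - c) - x • n := by abel
  rw [this, inner_sub_left, real_inner_smul_left, real_inner_self_eq_norm_sq, hn]
  constructor <;> intro h <;> linarith

/-- The volume of a frustum. -/
lemma volume_frustum {d : ℕ} {c a n : Vec d} (hn : ‖n‖ = 1) (hc : 0 < inner ℝ (a - c) n)
    {α β : ℝ} (hα : 0 ≤ α) {B : Set (Vec d)} (hB : MeasurableSet B) (hBh : B ⊆ hyp a n) :
    volume (frustum c a n α β B) =
      ENNReal.ofReal (inner ℝ (a - c) n) * (∫⁻ s in Set.Ioo α β, ENNReal.ofReal (s ^ (d - 1)))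
        * surf d B := by
  set δ : ℝ := inner ℝ (a - c) n with hδ
  rw [volume_eq_lintegral_slices c hn (measurableSet_frustum hB)]
  -- The slice at distance `x` from the apex is the image of `B` under the homothety of ratio `x /
  -- δ`, hence the factor `(x / δ)^(d-1)`.
  have key : ∀ x : ℝ, surf d (frustum c a n α β B ∩ {y | inner ℝ (y - c) n = x}) =
      (Set.Ioo α β).indicator (fun s => ENNReal.ofReal (s ^ (d - 1)) * surf d B) (δ⁻¹ * x) := by
    intro x
    by_cases hx : δ⁻¹ * x ∈ Set.Ioo α β
    · rw [Set.indicator_of_mem hx]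
      have hpos : 0 < δ⁻¹ * x := lt_of_le_of_lt hα hx.1
      have e1 : frustum c a n α β B ∩ {y | inner ℝ (y - c) n = x} =
          AffineMap.homothety c (δ⁻¹ * x) '' B := by
        ext y
        constructor
        · rintro ⟨⟨h1, h2, h3⟩, h4⟩
          have h4' : coneHeight c a n y = δ⁻¹ * x := by
            rw [coneHeight, ← hδ, show inner ℝ (y - c) n = x from h4]; ring
          refine ⟨coneProj c a n y, h3, ?_⟩
          rw [AffineMap.homothety_apply, vsub_eq_sub, vadd_eq_add, ← h4', add_comm]
          exact homothety_coneProj (by rw [h4']; exact hpos.ne')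
        · rintro ⟨z, hz, rfl⟩
          rw [AffineMap.homothety_apply, vsub_eq_sub, vadd_eq_add, add_comm]
          have hz1 := coneHeight_of_mem_hyp hc.ne' (hBh hz)
          refine ⟨⟨?_, ?_, ?_⟩, ?_⟩
          · rw [coneHeight_homothety, hz1, mul_one]; exact hx.1
          · rw [coneHeight_homothety, hz1, mul_one]; exact hx.2
          · rw [coneProj_homothety hc.ne' (hBh hz) hpos.ne']; exact hz
          · rw [Set.mem_ofPred_eq, add_sub_cancel_left, real_inner_smul_left]
            have : inner ℝ (z - c) n = δ := by
              rw [coneHeight, ← hδ, div_eq_one_iff_eq hc.ne'] at hz1; exact hz1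
            rw [this]; field_simp
      rw [e1, surf, euclideanHausdorffMeasure_homothety_image _ _ hpos.ne', ENNReal.smul_def,
        smul_eq_mul, ENNReal.coe_pow]
      congr 1
      rw [ENNReal.ofReal_pow hpos.le, ENNReal.ofReal, Real.toNNReal_eq_nnnorm_of_nonneg hpos.le]
    · rw [Set.indicator_of_notMem hx]
      have : frustum c a n α β B ∩ {y | inner ℝ (y - c) n = x} = ∅ := by
        rw [Set.eq_empty_iff_forall_notMem]
        rintro y ⟨⟨h1, h2, -⟩, h4⟩
        have h4' : coneHeight c a n y = δ⁻¹ * x := by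
          rw [coneHeight, ← hδ, show inner ℝ (y - c) n = x from h4]; ring
        rw [h4'] at h1 h2
        exact hx ⟨h1, h2⟩
      rw [this, measure_empty]
  simp_rw [key]
  -- The substitution `x = δ s` contributes the factor `δ`.
  rw [← lintegral_map' (μ := volume) (g := fun x => δ⁻¹ * x)
    (f := (Set.Ioo α β).indicator (fun s => ENNReal.ofReal (s ^ (d - 1)) * surf d B))
    (Measurable.aemeasurable (Measurable.indicator (by fun_prop) measurableSet_Ioo))
    (by fun_prop), Real.map_volume_mul_left (inv_ne_zero hc.ne'), lintegral_smul_measure,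
    lintegral_indicator measurableSet_Ioo, lintegral_mul_const _ (by fun_prop), inv_inv,
    abs_of_pos hc, smul_eq_mul, mul_assoc]

/-! ### Weak divergence -/

/-- `g` is the distributional divergence of `F` on `T`. -/
def HasWeakDiv {d : ℕ} (T : Set (Vec d)) (F : Vec d → Vec d) (g : Vec d → ℝ) : Prop :=
  ∀ φ, IsTestFun T φ → ∫ x in T, fderiv ℝ φ x (F x) = - ∫ x in T, g x * φ x

open scoped Convolution

/-- The derivative first falls on the smooth bump and is then moved onto `χ` by the integration by
parts formula for Lipschitz functions. Line derivatives are used because `χ` is differentiable only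
almost everywhere. -/
lemma fderiv_convolution_bump_apply {d : ℕ} {C : ℝ≥0} {χ : Vec d → ℝ} (hχ : LipschitzWith C χ)
    (hs : HasCompactSupport χ) (b : ContDiffBump (0 : Vec d)) (x v : Vec d) :
    fderiv ℝ (b.normed volume ⋆[ContinuousLinearMap.lsmul ℝ ℝ, volume] χ) x v =
      (b.normed volume ⋆[ContinuousLinearMap.lsmul ℝ ℝ, volume] fun y => lineDeriv ℝ χ y v) x := by
  have hb : ContDiff ℝ 1 (b.normed volume) := b.contDiff_normed
  have hbs : HasCompactSupport (b.normed volume) := b.hasCompactSupport_normed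
  have hloc : LocallyIntegrable χ volume := hχ.continuous.locallyIntegrable
  rw [(hbs.hasFDerivAt_convolution_left (ContinuousLinearMap.lsmul ℝ ℝ) hb hloc x).fderiv]
  have hex : ConvolutionExistsAt (fderiv ℝ (b.normed volume)) χ x
      ((ContinuousLinearMap.lsmul ℝ ℝ).precompL (Vec d)) volume :=
    (hbs.fderiv ℝ).convolutionExists_left _ (hb.continuous_fderiv one_ne_zero) hloc x
  rw [convolution_def, ContinuousLinearMap.integral_apply hex, convolution_def]
  obtain ⟨D, hD⟩ := hb.lipschitzWith_of_hasCompactSupport hbs one_ne_zero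
  have hg : LipschitzWith C fun t => χ (x - t) := by
    refine LipschitzWith.of_dist_le_mul fun p q => ?_
    have := hχ.dist_le_mul (x - p) (x - q)
    rwa [dist_sub_left] at this
  have hgs : HasCompactSupport fun t => χ (x - t) :=
    hs.comp_homeomorph (Homeomorph.subLeft x)
  have h := LipschitzWith.integral_lineDeriv_mul_eq (μ := volume) hD hg hgs v
  have e1 : ∀ t, ((((ContinuousLinearMap.lsmul ℝ ℝ).precompL (Vec d))
      (fderiv ℝ (b.normed volume) t)) (χ (x - t))) v =
      lineDeriv ℝ (b.normed volume) t v * χ (x - t) := by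
    intro t
    rw [((hb.differentiable one_ne_zero) t).lineDeriv_eq_fderiv]
    simp [ContinuousLinearMap.precompL_apply]
  simp_rw [e1]
  rw [h]
  congr with t
  have : lineDeriv ℝ (fun t => χ (x - t)) t (-v) = lineDeriv ℝ χ (x - t) v := by
    simp only [lineDeriv]
    congr with s
    congr 1
    simp [sub_eq_add_neg]
    abel
  rw [this]
  simp [mul_comm]

lemma sum_coord_smul_unitVec {d : ℕ} (v : Vec d) : ∑ k, v k • unitVec k = v := by
  ext j
  simp [unitVec, Finset.sum_apply, Pi.single_apply]

lemma clm_apply_eq_sum {d : ℕ} (L : Vec d →L[ℝ] ℝ) (v : Vec d) :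
    L v = ∑ k, v k * L (unitVec k) := by
  conv_lhs => rw [← sum_coord_smul_unitVec v]
  simp [map_sum]

lemma norm_unitVec {d : ℕ} (k : Fin d) : ‖unitVec k‖ = 1 := by
  simp [unitVec]

lemma norm_convolution_bump_le {d : ℕ} {C : ℝ} {f : Vec d → ℝ} (hf : ∀ x, |f x| ≤ C)
    (b : ContDiffBump (0 : Vec d)) (x : Vec d) :
    ‖(b.normed volume ⋆[ContinuousLinearMap.lsmul ℝ ℝ, volume] f) x‖ ≤ C := by
  rw [convolution_def]
  calc ‖∫ t, (ContinuousLinearMap.lsmul ℝ ℝ) (b.normed volume t) (f (x - t))‖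
      ≤ ∫ t, C * b.normed volume t := by
        apply norm_integral_le_of_norm_le
        · exact b.integrable_normed.const_mul C
        · refine Filter.Eventually.of_forall fun t => ?_
          simp only [ContinuousLinearMap.lsmul_apply, smul_eq_mul, norm_mul, Real.norm_eq_abs]
          rw [abs_of_nonneg (b.nonneg_normed t), mul_comm]
          exact mul_le_mul_of_nonneg_right (hf _) (b.nonneg_normed t)
    _ = C := by rw [integral_const_mul, b.integral_normed, mul_one]

/-- The weak divergence can be tested with compactly supported Lipschitz functions. -/
lemma HasWeakDiv.lipschitz_test {d : ℕ} {T : Set (Vec d)} (hT : IsOpen T) {F : Vec d → Vec d}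
    {g : Vec d → ℝ} (h : HasWeakDiv T F g) (hF : ∀ k, IntegrableOn (fun x => F x k) T)
    (hg : IntegrableOn g T) {C : ℝ≥0} {χ : Vec d → ℝ} (hχ : LipschitzWith C χ)
    (hs : HasCompactSupport χ) (hsT : tsupport χ ⊆ T) :
    ∫ x in T, ∑ k, F x k * lineDeriv ℝ χ x (unitVec k) = - ∫ x in T, g x * χ x := by
  -- The mollifiers shrink with a fixed ratio `2` between outer and inner radius; this ratio bound
  -- is needed for the almost everywhere convergence in `hae`.
  let b : ℕ → ContDiffBump (0 : Vec d) := fun i =>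
    ⟨1 / ((i : ℝ) + 1), 2 / ((i : ℝ) + 1), by positivity, by gcongr; norm_num⟩
  let ψ : ℕ → Vec d → ℝ := fun i =>
    (b i).normed volume ⋆[ContinuousLinearMap.lsmul ℝ ℝ, volume] χ
  have hrout : Filter.Tendsto (fun i => (b i).rOut) Filter.atTop (𝓝 0) := by
    have := (tendsto_one_div_add_atTop_nhds_zero_nat (𝕜 := ℝ)).const_mul 2
    simp only [mul_zero] at this
    refine this.congr fun i => ?_
    simp [b, div_eq_mul_inv]
  -- A closed neighbourhood of the support of `χ` is still inside `T`, so late mollifications of `χ`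
  -- are admissible test functions.
  obtain ⟨δ, hδ, hδT⟩ := (show IsCompact (tsupport χ) from hs).exists_cthickening_subset_open hT hsT
  have hbound : ∃ B, ∀ x, |χ x| ≤ B := by
    obtain ⟨B, hB⟩ := hs.exists_bound_of_continuous hχ.continuous
    exact ⟨B, fun x => by simpa using hB x⟩
  obtain ⟨B, hB⟩ := hbound
  have htest : ∀ᶠ i in Filter.atTop, IsTestFun T (ψ i) := by
    have : ∀ᶠ i in Filter.atTop, (b i).rOut < δ := hrout.eventually (gt_mem_nhds hδ)
    filter_upwards [this] with i hi
    refine ⟨?_, ?_, ?_⟩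
    · exact (b i).hasCompactSupport_normed.contDiff_convolution_left _ (b i).contDiff_normed
        hχ.continuous.locallyIntegrable
    · exact HasCompactSupport.convolution _ (b i).hasCompactSupport_normed hs
    · refine subset_trans ?_ hδT
      refine closure_minimal ?_ Metric.isClosed_cthickening
      refine (support_convolution_subset _).trans ?_
      rw [(b i).support_normed_eq]
      rintro _ ⟨p, hp, q, hq, rfl⟩
      apply Metric.mem_cthickening_of_dist_le (p + q) q δ _ (subset_tsupport _ hq)
      rw [dist_eq_norm, add_sub_cancel_right]
      have : ‖p‖ < (b i).rOut := by simpa using hp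
      linarith
  have heq : ∀ᶠ i in Filter.atTop,
      ∫ x in T, ∑ k, F x k * ((b i).normed volume ⋆[ContinuousLinearMap.lsmul ℝ ℝ, volume]
        fun y => lineDeriv ℝ χ y (unitVec k)) x = - ∫ x in T, g x * ψ i x := by
    filter_upwards [htest] with i hi
    rw [← h _ hi]
    congr with x
    rw [clm_apply_eq_sum]
    refine Finset.sum_congr rfl fun k _ => ?_
    rw [fderiv_convolution_bump_apply hχ hs]
  have hlim1 : Filter.Tendsto (fun i => - ∫ x in T, g x * ψ i x) Filter.atTop
      (𝓝 (- ∫ x in T, g x * χ x)) := by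
    apply Filter.Tendsto.neg
    apply tendsto_integral_of_dominated_convergence (fun x => |g x| * B)
    · intro i
      refine hg.aestronglyMeasurable.mul (Continuous.aestronglyMeasurable ?_)
      exact ((b i).hasCompactSupport_normed.contDiff_convolution_left (n := 0) _
        (b i).contDiff_normed hχ.continuous.locallyIntegrable).continuous
    · exact hg.abs.mul_const B
    · intro i
      refine Filter.Eventually.of_forall fun x => ?_
      rw [norm_mul, Real.norm_eq_abs]
      gcongr
      exact norm_convolution_bump_le hB _ _
    · refine Filter.Eventually.of_forall fun x => ?_
      apply Filter.Tendsto.const_mul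
      exact ContDiffBump.convolution_tendsto_right_of_continuous hrout hχ.continuous x
  have hld : ∀ k : Fin d, ∀ x, |lineDeriv ℝ χ x (unitVec k)| ≤ C := by
    intro k x
    have := norm_lineDeriv_le_of_lipschitz ℝ hχ (x₀ := x) (v := unitVec k)
    rwa [norm_unitVec, mul_one, Real.norm_eq_abs] at this
  have hlim2 : Filter.Tendsto (fun i => ∫ x in T, ∑ k, F x k *
      ((b i).normed volume ⋆[ContinuousLinearMap.lsmul ℝ ℝ, volume]
        fun y => lineDeriv ℝ χ y (unitVec k)) x) Filter.atTop
      (𝓝 (∫ x in T, ∑ k, F x k * lineDeriv ℝ χ x (unitVec k))) := by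
    apply tendsto_integral_of_dominated_convergence (fun x => ∑ k, |F x k| * C)
    · intro i
      refine Finset.aestronglyMeasurable_fun_sum _ fun k _ => ?_
      refine (hF k).aestronglyMeasurable.mul (Continuous.aestronglyMeasurable ?_)
      exact ((b i).hasCompactSupport_normed.contDiff_convolution_left (n := 0) _
        (b i).contDiff_normed (hχ.locallyIntegrable_lineDeriv _)).continuous
    · exact integrable_finsetSum _ fun k _ => (hF k).abs.mul_const _
    · intro i
      refine Filter.Eventually.of_forall fun x => ?_
      refine (norm_sum_le _ _).trans (Finset.sum_le_sum fun k _ => ?_)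
      rw [norm_mul, Real.norm_eq_abs]
      gcongr
      exact norm_convolution_bump_le (hld k) _ _
    -- The line derivatives are not continuous, so their mollifications converge only at almost
    -- every point, by Lebesgue differentiation.
    · have hae : ∀ k : Fin d, ∀ᵐ x ∂(volume : Measure (Vec d)),
          Filter.Tendsto (fun i => ((b i).normed volume ⋆[ContinuousLinearMap.lsmul ℝ ℝ, volume]
            fun y => lineDeriv ℝ χ y (unitVec k)) x) Filter.atTop
            (𝓝 (lineDeriv ℝ χ x (unitVec k))) := by
        intro k
        apply ContDiffBump.ae_convolution_tendsto_right_of_locallyIntegrable (K := 2) hrout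
        · refine Filter.Eventually.of_forall fun i => ?_
          simp only [b]
          apply le_of_eq; ring
        · exact hχ.locallyIntegrable_lineDeriv _
      filter_upwards [ae_restrict_of_ae (ae_all_iff.2 hae)] with x hx
      exact tendsto_finsetSum _ fun k _ => (hx k).const_mul _
  exact tendsto_nhds_unique_of_eventuallyEq hlim2 hlim1 heq

/-! ### Thin shells of a cone, and surface integrals as limits of shell averages. -/

lemma volume_coneHeight_eq {d : ℕ} {c a n : Vec d} (hn : ‖n‖ = 1) (hc : 0 < inner ℝ (a - c) n)
    (t : ℝ) : volume {x | coneHeight c a n x = t} = 0 := by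
  have hm : MeasurableSet {x | coneHeight c a n x = t} :=
    (isClosed_eq continuous_coneHeight continuous_const).measurableSet
  rw [volume_eq_lintegral_slices c hn hm, lintegral_eq_zero_iff']
  · have : ∀ᵐ x : ℝ, x ≠ t * inner ℝ (a - c) n := by
      simp [ae_iff]
    filter_upwards [this] with x hx
    have : {x | coneHeight c a n x = t} ∩ {y | inner ℝ (y - c) n = x} = ∅ := by
      rw [Set.eq_empty_iff_forall_notMem]
      rintro y ⟨h1, h2⟩
      apply hx
      rw [Set.mem_ofPred_eq, coneHeight, div_eq_iff hc.ne'] at h1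
      rw [← h1]; exact h2.symm
    rw [this, measure_empty, Pi.zero_apply]
  · have : ∀ x : ℝ, surf d ({x | coneHeight c a n x = t} ∩ {y | inner ℝ (y - c) n = x}) =
        Set.indicator {t * inner ℝ (a - c) n} (fun _ => surf d {x | coneHeight c a n x = t}) x := by
      intro x
      by_cases hx : x = t * inner ℝ (a - c) n
      · rw [Set.indicator_of_mem (by simpa using hx)]
        congr 1
        ext y
        simp only [Set.mem_inter_iff, Set.mem_ofPred_eq, coneHeight, div_eq_iff hc.ne', hx, and_self]
      · rw [Set.indicator_of_notMem (by simpa using hx)]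
        have : {x | coneHeight c a n x = t} ∩ {y | inner ℝ (y - c) n = x} = ∅ := by
          rw [Set.eq_empty_iff_forall_notMem]
          rintro y ⟨h1, h2⟩
          apply hx
          rw [Set.mem_ofPred_eq, coneHeight, div_eq_iff hc.ne'] at h1
          rw [← h1]; exact h2.symm
        rw [this, measure_empty]
    simp_rw [this]
    exact (Measurable.indicator measurable_const (measurableSet_singleton _)).aemeasurable

lemma volume_frustum_null {d : ℕ} {c a n : Vec d} (hn : ‖n‖ = 1) (hc : 0 < inner ℝ (a - c) n)
    {B : Set (Vec d)} (hB : MeasurableSet B) (hBh : B ⊆ hyp a n) (h0 : surf d B = 0) :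
    volume (frustum c a n 0 1 B) = 0 := by
  rw [volume_frustum hn hc le_rfl hB hBh, h0, mul_zero]

/-- Radial projection maps the volume of a frustum to a multiple of the surface measure. -/
lemma map_coneProj_frustum {d : ℕ} {c a n : Vec d} (hn : ‖n‖ = 1) (hc : 0 < inner ℝ (a - c) n)
    {α β : ℝ} (hα : 0 ≤ α) {B : Set (Vec d)} (hB : MeasurableSet B) (hBh : B ⊆ hyp a n) :
    (volume.restrict (frustum c a n α β B)).map (coneProj c a n) =
      (ENNReal.ofReal (inner ℝ (a - c) n) * ∫⁻ s in Set.Ioo α β, ENNReal.ofReal (s ^ (d - 1))) •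
        (surf d).restrict B := by
  ext S hS
  rw [Measure.map_apply measurable_coneProj hS, Measure.restrict_apply (measurable_coneProj hS),
    Measure.smul_apply, Measure.restrict_apply hS, smul_eq_mul]
  have : coneProj c a n ⁻¹' S ∩ frustum c a n α β B = frustum c a n α β (S ∩ B) := by
    ext x; simp only [frustum, Set.mem_inter_iff, Set.mem_preimage, Set.mem_ofPred_eq]; tauto
  rw [this, volume_frustum hn hc hα (hS.inter hB) (Set.inter_subset_right.trans hBh)]

/-- The integral `∫ s^{d-1}` over `(1-2δ, 1-δ)`. -/
noncomputable def shellInt (d : ℕ) (δ : ℝ) : ℝ :=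
  (∫⁻ s in Set.Ioo (1 - 2 * δ) (1 - δ), ENNReal.ofReal (s ^ (d - 1))).toReal

lemma shell_lintegral_bounds (d : ℕ) {δ : ℝ} (hδ' : δ < 1 / 2) :
    ENNReal.ofReal ((1 - 2 * δ) ^ (d - 1) * δ) ≤
        ∫⁻ s in Set.Ioo (1 - 2 * δ) (1 - δ), ENNReal.ofReal (s ^ (d - 1)) ∧
      ∫⁻ s in Set.Ioo (1 - 2 * δ) (1 - δ), ENNReal.ofReal (s ^ (d - 1)) ≤ ENNReal.ofReal δ := by
  have hv : volume (Set.Ioo (1 - 2 * δ) (1 - δ)) = ENNReal.ofReal δ := by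
    rw [Real.volume_Ioo]; congr 1; ring
  constructor
  · rw [ENNReal.ofReal_mul (by apply pow_nonneg; linarith), ← hv, ← setLIntegral_const]
    refine setLIntegral_mono (by fun_prop) fun s hs => ?_
    apply ENNReal.ofReal_le_ofReal
    have : 0 ≤ 1 - 2 * δ := by linarith
    have := hs.1
    gcongr
  · rw [← hv, ← one_mul (volume _), ← setLIntegral_const]
    refine setLIntegral_mono (by fun_prop) fun s hs => ?_
    rw [← ENNReal.ofReal_one]
    apply ENNReal.ofReal_le_ofReal
    have h1 := hs.1
    have h2 := hs.2
    exact pow_le_one₀ (by linarith) (by linarith)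

lemma shellInt_bounds (d : ℕ) {δ : ℝ} (hδ : 0 < δ) (hδ' : δ < 1 / 2) :
    (1 - 2 * δ) ^ (d - 1) * δ ≤ shellInt d δ ∧ shellInt d δ ≤ δ := by
  obtain ⟨h1, h2⟩ := shell_lintegral_bounds d hδ'
  have hne : ∫⁻ s in Set.Ioo (1 - 2 * δ) (1 - δ), ENNReal.ofReal (s ^ (d - 1)) ≠ ⊤ :=
    (h2.trans_lt ENNReal.ofReal_lt_top).ne
  exact ⟨(ENNReal.ofReal_le_iff_le_toReal hne).1 h1, ENNReal.toReal_le_of_le_ofReal hδ.le h2⟩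

lemma tendsto_shellInt_div (d : ℕ) :
    Filter.Tendsto (fun δ => shellInt d δ / δ) (𝓝[>] 0) (𝓝 1) := by
  have hmem : Set.Ioo (0 : ℝ) (1 / 2) ∈ 𝓝[>] (0 : ℝ) := Ioo_mem_nhdsGT (by norm_num)
  have h1 : Filter.Tendsto (fun δ : ℝ => (1 - 2 * δ) ^ (d - 1)) (𝓝[>] 0) (𝓝 1) := by
    have : Filter.Tendsto (fun δ : ℝ => (1 - 2 * δ) ^ (d - 1)) (𝓝 0)
        (𝓝 ((1 - 2 * 0) ^ (d - 1))) := Continuous.tendsto (by fun_prop) 0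
    simp only [mul_zero, sub_zero, one_pow] at this
    exact this.mono_left nhdsWithin_le_nhds
  refine tendsto_of_tendsto_of_tendsto_of_le_of_le' h1 tendsto_const_nhds ?_ ?_
  · filter_upwards [hmem] with δ hδ
    rw [le_div_iff₀ hδ.1]
    exact (shellInt_bounds d hδ.1 hδ.2).1
  · filter_upwards [hmem] with δ hδ
    rw [div_le_one hδ.1]
    exact (shellInt_bounds d hδ.1 hδ.2).2

/-- Averages over thin shells of a cone converge to the surface integral. -/
lemma tendsto_shell_average {d : ℕ} {c a n : Vec d} (hn : ‖n‖ = 1) (hc : 0 < inner ℝ (a - c) n)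
    {B S : Set (Vec d)} (hB : MeasurableSet B) (hBh : B ⊆ hyp a n) (hS : IsCompact S)
    (hBS : ∀ x ∈ frustum c a n 0 1 B, x ∈ S ∧ coneProj c a n x ∈ S) (hBb : B ⊆ S)
    {f : Vec d → ℝ} (hf : ContinuousOn f S) :
    Filter.Tendsto (fun δ => (δ * inner ℝ (a - c) n)⁻¹ *
      ∫ x in frustum c a n (1 - 2 * δ) (1 - δ) B, f x) (𝓝[>] 0) (𝓝 (∫ x in B, f x ∂(surf d))) := by
  set D : ℝ := inner ℝ (a - c) n with hD
  have hBbd : Bornology.IsBounded B := hS.isBounded.subset hBb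
  have hBfin : surf d B < ⊤ := surf_hyp_lt_top hn hBh hBbd
  obtain ⟨r, hr0, hr⟩ : ∃ r, 0 < r ∧ ∀ y ∈ S, ‖y - c‖ ≤ r := by
    obtain ⟨r, hr0, hr⟩ := hS.isBounded.subset_closedBall_lt 0 c
    exact ⟨r, hr0, fun y hy => by simpa [dist_eq_norm] using hr hy⟩
  have hfB : IntegrableOn f B (surf d) := by
    obtain ⟨C, hC⟩ := hS.exists_bound_of_continuousOn hf
    exact IntegrableOn.of_bound hBfin ((hf.mono hBb).aestronglyMeasurable hB) C
      ((ae_restrict_iff' hB).2 (Filter.Eventually.of_forall fun x hx => hC x (hBb hx)))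
  set I0 : ℝ := ∫ x in B, f x ∂(surf d) with hI0
  have hfr_sub : ∀ δ ∈ Set.Ioo (0 : ℝ) (1 / 2), frustum c a n (1 - 2 * δ) (1 - δ) B ⊆
      frustum c a n 0 1 B := by
    rintro δ hδ x ⟨h1, h2, h3⟩
    exact ⟨by linarith [hδ.2], by linarith [hδ.1], h3⟩
  -- If the integrand is evaluated at the radial projection, the shell integral is exactly a
  -- multiple of the surface integral, because radial projection pushes volume forward to a multiple
  -- of surface measure.
  have hproj : ∀ δ ∈ Set.Ioo (0 : ℝ) (1 / 2),
      ∫ x in frustum c a n (1 - 2 * δ) (1 - δ) B, f (coneProj c a n x) =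
        D * shellInt d δ * I0 := by
    intro δ hδ
    have h := map_coneProj_frustum (d := d) (β := 1 - δ) hn hc
      (α := 1 - 2 * δ) (by linarith [hδ.2]) hB hBh
    have hm : AEStronglyMeasurable f
        ((volume.restrict (frustum c a n (1 - 2 * δ) (1 - δ) B)).map (coneProj c a n)) := by
      rw [h]; exact hfB.aestronglyMeasurable.smul_measure _
    rw [← integral_map measurable_coneProj.aemeasurable hm, h, integral_smul_measure,
      ENNReal.toReal_mul, ENNReal.toReal_ofReal hc.le, smul_eq_mul, shellInt]
  have hvol : ∀ δ ∈ Set.Ioo (0 : ℝ) (1 / 2),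
      volume.real (frustum c a n (1 - 2 * δ) (1 - δ) B) = D * shellInt d δ * (surf d).real B := by
    intro δ hδ
    rw [Measure.real, volume_frustum hn hc (by linarith [hδ.2]) hB hBh, ENNReal.toReal_mul,
      ENNReal.toReal_mul, ENNReal.toReal_ofReal hc.le, shellInt, Measure.real]
  have hmem : Set.Ioo (0 : ℝ) (1 / 2) ∈ 𝓝[>] (0 : ℝ) := Ioo_mem_nhdsGT (by norm_num)
  rw [Metric.tendsto_nhdsWithin_nhds]
  intro ε hε
  have hunif := hS.uniformContinuousOn_of_continuous hf
  rw [Metric.uniformContinuousOn_iff] at hunif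
  -- The `+ 1` keeps the tolerance positive when `B` is null.
  obtain ⟨ρ, hρ, hunif⟩ := hunif (ε / (2 * ((surf d).real B + 1))) (by positivity)
  have ht := (tendsto_shellInt_div d).mul_const I0
  rw [one_mul] at ht
  have ht' := Metric.tendsto_nhds.1 ht (ε / 2) (by positivity)
  have hsmall : ∀ᶠ δ in 𝓝[>] (0 : ℝ), 2 * δ * r < ρ := by
    have : Filter.Tendsto (fun δ : ℝ => 2 * δ * r) (𝓝 0) (𝓝 (2 * 0 * r)) :=
      Continuous.tendsto (by fun_prop) 0
    simp only [mul_zero, zero_mul] at this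
    exact (this.mono_left nhdsWithin_le_nhds).eventually (gt_mem_nhds hρ)
  have hfin : ∀ᶠ δ in 𝓝[>] (0 : ℝ), dist ((δ * D)⁻¹ *
      ∫ x in frustum c a n (1 - 2 * δ) (1 - δ) B, f x) I0 < ε := by
    filter_upwards [hmem, ht', hsmall] with δ hδ h1 h2
    set Q := frustum c a n (1 - 2 * δ) (1 - δ) B with hQ
    have hQm : MeasurableSet Q := measurableSet_frustum hB
    have hQfin : volume Q < ⊤ := by
      apply lt_of_le_of_lt (measure_mono ((hfr_sub δ hδ).trans fun x hx => (hBS x hx).1))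
      exact hS.measure_lt_top
    obtain ⟨C, hC⟩ := hS.exists_bound_of_continuousOn hf
    have hQS : Q ⊆ S := (hfr_sub δ hδ).trans fun x hx => (hBS x hx).1
    have i1 : IntegrableOn f Q :=
      IntegrableOn.of_bound hQfin ((hf.mono hQS).aestronglyMeasurable hQm) C
        ((ae_restrict_iff' hQm).2 (Filter.Eventually.of_forall fun x hx => hC x (hQS hx)))
    have i2 : IntegrableOn (fun x => f (coneProj c a n x)) Q := by
      refine IntegrableOn.of_bound hQfin ?_ C
        ((ae_restrict_iff' hQm).2 (Filter.Eventually.of_forall fun x hx =>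
          hC _ (hBS x (hfr_sub δ hδ hx)).2))
      refine AEStronglyMeasurable.comp_measurable (g := f) (f := coneProj c a n) ?_
        measurable_coneProj
      rw [map_coneProj_frustum hn hc (by linarith [hδ.2]) hB hBh]
      exact hfB.aestronglyMeasurable.smul_measure _
    -- Replacing `x` by its projection moves it by at most `2 δ r`, and uniform continuity of `f` on
    -- the compact set `S` bounds the resulting error.
    have herr : |(∫ x in Q, f x) - D * shellInt d δ * I0| ≤
        ε / (2 * ((surf d).real B + 1)) * (D * shellInt d δ * (surf d).real B) := by
      rw [← hproj δ hδ, ← integral_sub i1 i2, ← hvol δ hδ, ← Real.norm_eq_abs]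
      refine norm_setIntegral_le_of_norm_le_const hQfin fun x hx => ?_
      have hxS := hBS x (hfr_sub δ hδ hx)
      have hdist : dist x (coneProj c a n x) < ρ := by
        have hne : coneHeight c a n x ≠ 0 := by have := hx.1; have := hδ.2; linarith
        have e : x - coneProj c a n x = (coneHeight c a n x - 1) • (coneProj c a n x - c) := by
          nth_rewrite 1 [← homothety_coneProj hne]
          module
        rw [dist_eq_norm, e, norm_smul, Real.norm_eq_abs]
        refine lt_of_le_of_lt ?_ h2
        have : |coneHeight c a n x - 1| ≤ 2 * δ := by
          rw [abs_le]; constructor <;> linarith [hx.1, hx.2.1, hδ.1]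
        exact mul_le_mul this (hr _ hxS.2) (norm_nonneg _) (by linarith [hδ.1])
      exact (hunif x hxS.1 _ hxS.2 hdist).le
    have hδD : 0 < δ * D := mul_pos hδ.1 hc
    have hsb := shellInt_bounds d hδ.1 hδ.2
    rw [Real.dist_eq] at h1 ⊢
    have e1 : (δ * D)⁻¹ * ∫ x in Q, f x = (δ * D)⁻¹ * ((∫ x in Q, f x) - D * shellInt d δ * I0) +
        shellInt d δ / δ * I0 := by
      have hδ0 := hδ.1.ne'
      have := hc.ne'
      field_simp
      ring
    rw [e1]
    have hs0 : 0 ≤ (surf d).real B := measureReal_nonneg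
    have e2 : |(δ * D)⁻¹ * ((∫ x in Q, f x) - D * shellInt d δ * I0)| ≤ ε / 2 := by
      rw [abs_mul, abs_of_pos (inv_pos.2 hδD), inv_mul_le_iff₀ hδD]
      refine herr.trans ?_
      have : D * shellInt d δ * (surf d).real B ≤ D * δ * ((surf d).real B + 1) := by
        have := hsb.2
        have h0 : 0 ≤ shellInt d δ := ENNReal.toReal_nonneg
        gcongr <;> linarith
      calc ε / (2 * ((surf d).real B + 1)) * (D * shellInt d δ * (surf d).real B)
          ≤ ε / (2 * ((surf d).real B + 1)) * (D * δ * ((surf d).real B + 1)) := by gcongr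
        _ = δ * D * (ε / 2) := by field_simp
    calc |(δ * D)⁻¹ * ((∫ x in Q, f x) - D * shellInt d δ * I0) + shellInt d δ / δ * I0 - I0|
        = |(δ * D)⁻¹ * ((∫ x in Q, f x) - D * shellInt d δ * I0) +
          (shellInt d δ / δ * I0 - I0)| := by congr 1; ring
      _ ≤ _ := abs_add_le _ _
      _ < ε := by linarith
  rw [eventually_nhdsWithin_iff, Metric.eventually_nhds_iff] at hfin
  obtain ⟨δ0, hδ0, h⟩ := hfin
  exact ⟨δ0, hδ0, fun {x} hx hx' => h hx' hx⟩

/-! ### The divergence theorem on a star body with flat facets. -/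

/-- The boundary of `T` is the union of the finitely many essentially disjoint facets in `s`, with
outward normals `n e` as seen from the interior point `c`. -/
structure FacetSystem {d : ℕ} (T : Set (Vec d)) (c : Vec d) (s : Finset (Set (Vec d)))
    (U : Set (Vec d) → Set (Vec d)) (a n : Set (Vec d) → Vec d) : Prop where
  data : ∀ e ∈ s, FacetData e (U e) (a e) (n e)
  pos : ∀ e ∈ s, 0 < inner ℝ (a e - c) (n e)
  frontier_eq : frontier T = ⋃ e ∈ s, e
  overlap : ∀ e ∈ s, ∀ e' ∈ s, e ≠ e' → surf d (e ∩ e') = 0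

/-- The cutoff function equal to `1` where the gauge is at most `1 - 2δ` and to `0` where it is at
least `1 - δ`. -/
noncomputable def shellCut {d : ℕ} (T : Set (Vec d)) (c : Vec d) (δ : ℝ) (x : Vec d) : ℝ :=
  max 0 (min 1 ((1 - δ - sgauge T c x) / δ))

section

variable {d : ℕ} {T : Set (Vec d)} {c : Vec d} {R : ℝ}

lemma shellCut_lipschitz (h : StarBody T c R) {δ : ℝ} (hδ : 0 < δ) :
    LipschitzWith (Real.toNNReal (R⁻¹ / δ)) (shellCut T c δ) := by
  have h1 : LipschitzWith (Real.toNNReal (R⁻¹ / δ)) fun x => (1 - δ - sgauge T c x) / δ := by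
    apply LipschitzWith.of_le_add_mul
    intro x y
    have hR := h.pos
    rw [Real.coe_toNNReal _ (by positivity), dist_comm, dist_eq_norm]
    have := h.sgauge_le_add y x
    have e : R⁻¹ / δ * ‖y - x‖ = (R⁻¹ * ‖y - x‖) / δ := by ring
    rw [e, ← add_div, div_le_div_iff_of_pos_right hδ]
    linarith
  exact (h1.const_min 1).const_max 0

lemma shellCut_nonneg (δ : ℝ) (x : Vec d) : 0 ≤ shellCut T c δ x := le_max_left _ _

lemma shellCut_le_one (δ : ℝ) (x : Vec d) : shellCut T c δ x ≤ 1 :=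
  max_le zero_le_one (min_le_left _ _)

lemma shellCut_eq_one {δ : ℝ} (hδ : 0 < δ) {x : Vec d} (hx : sgauge T c x ≤ 1 - 2 * δ) :
    shellCut T c δ x = 1 := by
  have : 1 ≤ (1 - δ - sgauge T c x) / δ := by rw [le_div_iff₀ hδ]; linarith
  rw [shellCut, min_eq_left this, max_eq_right zero_le_one]

lemma shellCut_eq_zero {δ : ℝ} (hδ : 0 < δ) {x : Vec d} (hx : 1 - δ ≤ sgauge T c x) :
    shellCut T c δ x = 0 := by
  have : (1 - δ - sgauge T c x) / δ ≤ 0 := div_nonpos_of_nonpos_of_nonneg (by linarith) hδ.le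
  rw [shellCut, max_eq_left]
  exact (min_le_right _ _).trans this

lemma shellCut_eq_mid {δ : ℝ} (hδ : 0 < δ) {x : Vec d} (hx : 1 - 2 * δ ≤ sgauge T c x)
    (hx' : sgauge T c x ≤ 1 - δ) : shellCut T c δ x = (1 - δ - sgauge T c x) / δ := by
  have h1 : (1 - δ - sgauge T c x) / δ ≤ 1 := by rw [div_le_one hδ]; linarith
  have h2 : 0 ≤ (1 - δ - sgauge T c x) / δ := div_nonneg (by linarith) hδ.le
  rw [shellCut, min_eq_right h1, max_eq_right h2]

lemma tsupport_shellCut_subset (h : StarBody T c R) {δ : ℝ} (hδ : 0 < δ) :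
    tsupport (shellCut T c δ) ⊆ {x | sgauge T c x ≤ 1 - δ} := by
  refine closure_minimal ?_ (isClosed_le h.continuous_sgauge continuous_const)
  intro x hx
  by_contra hcon
  exact hx (shellCut_eq_zero hδ (not_le.1 hcon).le)

lemma tsupport_shellCut_subset' (h : StarBody T c R) {δ : ℝ} (hδ : 0 < δ) :
    tsupport (shellCut T c δ) ⊆ T := fun _ hx =>
  h.mem_of_sgauge_lt (lt_of_le_of_lt (tsupport_shellCut_subset h hδ hx) (by linarith))

lemma hasCompactSupport_shellCut (h : StarBody T c R) {δ : ℝ} (hδ : 0 < δ) :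
    HasCompactSupport (shellCut T c δ) :=
  Metric.isCompact_of_isClosed_isBounded (isClosed_tsupport _)
    (h.bounded.subset (tsupport_shellCut_subset' h hδ))

lemma lineDeriv_congr_nhds {f g : Vec d → ℝ} {x : Vec d} (h : f =ᶠ[𝓝 x] g) (v : Vec d) :
    lineDeriv ℝ f x v = lineDeriv ℝ g x v := by
  simp only [lineDeriv]
  apply Filter.EventuallyEq.deriv_eq
  have hc : Filter.Tendsto (fun t : ℝ => x + t • v) (𝓝 0) (𝓝 (x + (0 : ℝ) • v)) :=
    Continuous.tendsto (by fun_prop) 0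
  rw [zero_smul, add_zero] at hc
  exact hc.eventually h

lemma lineDeriv_coneHeight_cut {a n x v : Vec d} {δ : ℝ} :
    lineDeriv ℝ (fun y => (1 - δ - coneHeight c a n y) / δ) x v =
      -(inner ℝ v n / (δ * inner ℝ (a - c) n)) := by
  have e : ∀ t : ℝ, (1 - δ - coneHeight c a n (x + t • v)) / δ =
      (1 - δ - coneHeight c a n x) / δ + t * -(inner ℝ v n / (δ * inner ℝ (a - c) n)) := by
    intro t
    have : x + t • v - c = (x - c) + t • v := by abel
    rw [coneHeight, coneHeight, this, inner_add_left, real_inner_smul_left]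
    rw [div_eq_mul_inv, div_eq_mul_inv, div_eq_mul_inv, div_eq_mul_inv, div_eq_mul_inv, mul_inv]
    ring
  rw [lineDeriv, deriv_congr_fun_at_zero e]
where
  deriv_congr_fun_at_zero {f : ℝ → ℝ} {p q : ℝ} (e : ∀ t, f t = p + t * q) : deriv f 0 = q := by
    rw [funext e]
    simp

variable {s : Finset (Set (Vec d))} {U : Set (Vec d) → Set (Vec d)} {a n : Set (Vec d) → Vec d}

/-- The relatively open part of the facet `e`. -/
def core (U : Set (Vec d) → Set (Vec d)) (a n : Set (Vec d) → Vec d) (e : Set (Vec d)) :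
    Set (Vec d) := U e ∩ hyp (a e) (n e)

namespace FacetSystem

lemma core_frontier (hs : FacetSystem T c s U a n) {e : Set (Vec d)} (he : e ∈ s) :
    core U a n e ⊆ frontier T := by
  rw [hs.frontier_eq]
  exact (hs.data e he).core_subset.trans (Set.subset_biUnion_of_mem (u := id) he)

lemma measurableSet_core (hs : FacetSystem T c s U a n) {e : Set (Vec d)} (he : e ∈ s) :
    MeasurableSet (core U a n e) := (hs.data e he).measurableSet_core

lemma frustum_sgauge (hs : FacetSystem T c s U a n) (h : StarBody T c R) {e : Set (Vec d)}
    (he : e ∈ s) {x : Vec d} {α β : ℝ} (hα : 0 ≤ α)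
    (hx : x ∈ frustum c (a e) (n e) α β (core U a n e)) :
    sgauge T c x = coneHeight c (a e) (n e) x :=
  h.sgauge_eq_coneHeight (hs.core_frontier he) ⟨lt_of_le_of_lt hα hx.1, hx.2.2.1⟩

lemma frustum_subset (hs : FacetSystem T c s U a n) (h : StarBody T c R) {e : Set (Vec d)}
    (he : e ∈ s) : frustum c (a e) (n e) 0 1 (core U a n e) ⊆ T := by
  intro x hx
  apply h.mem_of_sgauge_lt
  rw [hs.frustum_sgauge h he le_rfl hx]
  exact hx.2.1

/-- Almost every point of `T` lies in the open cone over exactly one facet. -/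
lemma ae_mem_cone (hs : FacetSystem T c s U a n) (h : StarBody T c R) (hd : 1 ≤ d) :
    ∀ᵐ x, x ∈ T → ∃ e ∈ s, x ∈ frustum c (a e) (n e) 0 1 (core U a n e) ∧
      ∀ e' ∈ s, e' ≠ e → x ∉ frustum c (a e') (n e') 0 1 (core U a n e') := by
  have h0 : ∀ᵐ x : Vec d, x ≠ c := by
    have : Nontrivial (Vec d) := by
      have : Nonempty (Fin d) := ⟨⟨0, hd⟩⟩
      infer_instance
    simp [ae_iff]
  -- The radial projection of `x ≠ c` to the boundary lies on some facet. It can miss the relative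
  -- interior of that facet, or lie on a second one, only when `x` is in a cone over a surface-null
  -- set, and such cones have volume zero.
  have h1 : ∀ᵐ x : Vec d, ∀ e ∈ s, x ∉ frustum c (a e) (n e) 0 1 (e \ core U a n e) := by
    rw [Filter.eventually_all_finset]
    intro e he
    have hz := volume_frustum_null (hs.data e he).norm (hs.pos e he)
      ((hs.data e he).isCompact.measurableSet.diff (hs.measurableSet_core he))
      (Set.sdiff_subset.trans (hs.data e he).subset_hyp) (hs.data e he).null
    exact measure_eq_zero_iff_ae_notMem.1 hz
  have h2 : ∀ᵐ x : Vec d, ∀ e ∈ s, ∀ e' ∈ s, e' ≠ e →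
      x ∉ frustum c (a e) (n e) 0 1 (e ∩ e') := by
    rw [Filter.eventually_all_finset]
    intro e he
    rw [Filter.eventually_all_finset]
    intro e' he'
    by_cases hne : e' = e
    · exact Filter.Eventually.of_forall fun x hx => absurd hne hx
    have hz := volume_frustum_null (hs.data e he).norm (hs.pos e he)
      ((hs.data e he).isCompact.measurableSet.inter (hs.data e' he').isCompact.measurableSet)
      (Set.inter_subset_left.trans (hs.data e he).subset_hyp)
      (hs.overlap e he e' he' (Ne.symm hne))
    filter_upwards [measure_eq_zero_iff_ae_notMem.1 hz] with x hx _
    exact hx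
  filter_upwards [h0, h1, h2] with x hx0 hx1 hx2 hxT
  have hGpos := h.sgauge_pos hx0
  have hG1 := h.sgauge_lt_one hxT
  have hy := h.radial_mem_frontier hx0
  set y := c + (sgauge T c x)⁻¹ • (x - c) with hydef
  have hxy : x = c + sgauge T c x • (y - c) := by
    rw [hydef, add_sub_cancel_left, smul_smul, mul_inv_cancel₀ hGpos.ne', one_smul, add_sub_cancel]
  have key : ∀ e ∈ s, ∀ B, y ∈ e → y ∈ B → x ∈ frustum c (a e) (n e) 0 1 B := by
    intro e he B hye hyB
    have hyh := (hs.data e he).subset_hyp hye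
    have e1 : coneHeight c (a e) (n e) x = sgauge T c x := by
      conv_lhs => rw [hxy]
      rw [coneHeight_homothety, coneHeight_of_mem_hyp (hs.pos e he).ne' hyh, mul_one]
    refine ⟨by rw [e1]; exact hGpos, by rw [e1]; exact hG1, ?_⟩
    rw [hxy, coneProj_homothety (hs.pos e he).ne' hyh hGpos.ne']
    exact hyB
  rw [hs.frontier_eq] at hy
  obtain ⟨e, he, hye⟩ := Set.mem_iUnion₂.1 hy
  have hyc : y ∈ core U a n e := by
    by_contra hcon
    exact hx1 e he (key e he _ hye ⟨hye, hcon⟩)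
  refine ⟨e, he, key e he _ hye hyc, fun e' he' hne hx' => ?_⟩
  have hp : coneProj c (a e') (n e') x = y := by
    have := hs.frustum_sgauge h he' le_rfl hx'
    rw [hydef, this, coneProj]
  have hye' : y ∈ e' := by
    rw [← hp]; exact (hs.data e' he').core_subset hx'.2.2
  exact hx2 e he e' he' hne (key e he _ hye ⟨hye, hye'⟩)

/-- In the cone over `e` the gauge is the affine function `coneHeight`. Hence the cutoff has the
constant gradient `-n / (δ ⟪a - c, n⟫)` in the shell between the levels `1 - 2δ` and `1 - δ` and is
locally constant off it; the two level sets are null. -/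
lemma ae_lineDeriv_shellCut (hs : FacetSystem T c s U a n) (h : StarBody T c R) (hd : 1 ≤ d)
    {δ : ℝ} (hδ : 0 < δ) (hδ' : δ < 1 / 2) (F : Vec d → Vec d) :
    ∀ᵐ x, x ∈ T → ∑ k, F x k * lineDeriv ℝ (shellCut T c δ) x (unitVec k) =
      ∑ e ∈ s, (frustum c (a e) (n e) (1 - 2 * δ) (1 - δ) (core U a n e)).indicator
        (fun x => -((δ * inner ℝ (a e - c) (n e))⁻¹ * inner ℝ (F x) (n e))) x := by
  have h1 : ∀ᵐ x : Vec d, ∀ e ∈ s, coneHeight c (a e) (n e) x ≠ 1 - δ ∧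
      coneHeight c (a e) (n e) x ≠ 1 - 2 * δ := by
    rw [Filter.eventually_all_finset]
    intro e he
    have z1 := measure_eq_zero_iff_ae_notMem.1
      (volume_coneHeight_eq (hs.data e he).norm (hs.pos e he) (1 - δ))
    have z2 := measure_eq_zero_iff_ae_notMem.1
      (volume_coneHeight_eq (hs.data e he).norm (hs.pos e he) (1 - 2 * δ))
    filter_upwards [z1, z2] with x hx1 hx2
    exact ⟨hx1, hx2⟩
  filter_upwards [h1, hs.ae_mem_cone h hd] with x hx1 hx2 hxT
  obtain ⟨e, he, hxe, huniq⟩ := hx2 hxT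
  rw [Finset.sum_eq_single_of_mem e he]
  swap
  · intro e' he' hne
    rw [Set.indicator_of_notMem]
    intro hx'
    refine huniq e' he' hne ⟨by linarith [hx'.1], by linarith [hx'.2.1], hx'.2.2⟩
  have hG := hs.frustum_sgauge h he le_rfl hxe
  have hcone : openCone c (a e) (n e) (U e) ∈ 𝓝 x :=
    (isOpen_openCone (hs.data e he).isOpen).mem_nhds ⟨hxe.1, hxe.2.2.1⟩
  obtain ⟨hx1a, hx1b⟩ := hx1 e he
  by_cases hmid : x ∈ frustum c (a e) (n e) (1 - 2 * δ) (1 - δ) (core U a n e)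
  · rw [Set.indicator_of_mem hmid]
    have hev : shellCut T c δ =ᶠ[𝓝 x] fun y => (1 - δ - coneHeight c (a e) (n e) y) / δ := by
      have o1 : {y | 1 - 2 * δ < coneHeight c (a e) (n e) y} ∈ 𝓝 x :=
        (isOpen_lt continuous_const continuous_coneHeight).mem_nhds hmid.1
      have o2 : {y | coneHeight c (a e) (n e) y < 1 - δ} ∈ 𝓝 x :=
        (isOpen_lt continuous_coneHeight continuous_const).mem_nhds hmid.2.1
      filter_upwards [hcone, o1, o2] with y hy hy1 hy2
      have := h.sgauge_eq_coneHeight (hs.core_frontier he) hy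
      have hy1' : 1 - 2 * δ < coneHeight c (a e) (n e) y := hy1
      have hy2' : coneHeight c (a e) (n e) y < 1 - δ := hy2
      rw [shellCut_eq_mid hδ (by rw [this]; exact hy1'.le) (by rw [this]; exact hy2'.le), this]
    simp_rw [lineDeriv_congr_nhds hev, lineDeriv_coneHeight_cut]
    have : inner ℝ (F x) (n e) = ∑ k, F x k * inner ℝ (unitVec k) (n e) := by
      conv_lhs => rw [← sum_coord_smul_unitVec (F x)]
      rw [sum_inner]
      exact Finset.sum_congr rfl fun k _ => real_inner_smul_left _ _ _
    rw [this, Finset.mul_sum, ← Finset.sum_neg_distrib]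
    refine Finset.sum_congr rfl fun k _ => ?_
    rw [div_eq_mul_inv]; ring
  · rw [Set.indicator_of_notMem hmid]
    have hcase : coneHeight c (a e) (n e) x < 1 - 2 * δ ∨ 1 - δ < coneHeight c (a e) (n e) x := by
      by_contra hcon
      push Not at hcon
      exact hmid ⟨lt_of_le_of_ne hcon.1 (Ne.symm hx1b), lt_of_le_of_ne hcon.2 hx1a, hxe.2.2⟩
    have hconst : ∃ t : ℝ, shellCut T c δ =ᶠ[𝓝 x] fun _ => t := by
      rcases hcase with hlt | hlt
      · refine ⟨1, ?_⟩
        have o1 : {y | sgauge T c y < 1 - 2 * δ} ∈ 𝓝 x :=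
          (isOpen_lt h.continuous_sgauge continuous_const).mem_nhds
            (by rw [Set.mem_ofPred_eq, hG]; exact hlt)
        filter_upwards [o1] with y hy
        exact shellCut_eq_one hδ (le_of_lt hy)
      · refine ⟨0, ?_⟩
        have o1 : {y | 1 - δ < sgauge T c y} ∈ 𝓝 x :=
          (isOpen_lt continuous_const h.continuous_sgauge).mem_nhds
            (by rw [Set.mem_ofPred_eq, hG]; exact hlt)
        filter_upwards [o1] with y hy
        exact shellCut_eq_zero hδ (le_of_lt hy)
    obtain ⟨t, ht⟩ := hconst
    refine Finset.sum_eq_zero fun k _ => ?_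
    rw [lineDeriv_congr_nhds ht]
    simp [lineDeriv]

/-- The divergence theorem for continuous fields with an integrable weak divergence. -/
theorem integral_weakDiv (hs : FacetSystem T c s U a n) (h : StarBody T c R) (hd : 1 ≤ d)
    {F : Vec d → Vec d} {g : Vec d → ℝ} (hF : ContinuousOn F (closure T)) (hg : IntegrableOn g T)
    (hdiv : HasWeakDiv T F g) :
    ∫ x in T, g x = ∑ e ∈ s, ∫ x in e, inner ℝ (F x) (n e) ∂(surf d) := by
  have hcomp : IsCompact (closure T) := h.bounded.isCompact_closure
  have hTfin : volume T < ⊤ := h.bounded.measure_lt_top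
  have hFk : ∀ k, IntegrableOn (fun x => F x k) T := by
    intro k
    have hc : ContinuousOn (fun x => F x k) (closure T) :=
      (EuclideanSpace.proj k : Vec d →L[ℝ] ℝ).continuous.comp_continuousOn hF
    exact (hc.integrableOn_compact hcomp).mono_set subset_closure
  have hFn : ∀ e, ContinuousOn (fun x => inner ℝ (F x) (n e)) (closure T) := fun e =>
    hF.inner continuousOn_const
  -- Testing the weak divergence with the cutoff produces averages of `F · n` over the shells of the
  -- facet cones. As `δ → 0` they tend to the surface integrals, while the cutoff tends to `1` in
  -- `T`.
  have heq : ∀ δ ∈ Set.Ioo (0 : ℝ) (1 / 2), ∑ e ∈ s, (δ * inner ℝ (a e - c) (n e))⁻¹ *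
      ∫ x in frustum c (a e) (n e) (1 - 2 * δ) (1 - δ) (core U a n e), inner ℝ (F x) (n e) =
      ∫ x in T, g x * shellCut T c δ x := by
    intro δ hδ
    have h1 := hdiv.lipschitz_test h.isOpen hFk hg (shellCut_lipschitz h hδ.1)
      (hasCompactSupport_shellCut h hδ.1) (tsupport_shellCut_subset' h hδ.1)
    have h2 : ∫ x in T, ∑ k, F x k * lineDeriv ℝ (shellCut T c δ) x (unitVec k) =
        ∫ x in T, ∑ e ∈ s, (frustum c (a e) (n e) (1 - 2 * δ) (1 - δ) (core U a n e)).indicator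
        (fun x => -((δ * inner ℝ (a e - c) (n e))⁻¹ * inner ℝ (F x) (n e))) x :=
      setIntegral_congr_ae h.isOpen.measurableSet (hs.ae_lineDeriv_shellCut h hd hδ.1 hδ.2 F)
    have hsub : ∀ e ∈ s, frustum c (a e) (n e) (1 - 2 * δ) (1 - δ) (core U a n e) ⊆ T := by
      intro e he x hx
      exact hs.frustum_subset h he ⟨by linarith [hx.1, hδ.2], by linarith [hx.2.1, hδ.1], hx.2.2⟩
    have hmeas : ∀ e ∈ s,
        MeasurableSet (frustum c (a e) (n e) (1 - 2 * δ) (1 - δ) (core U a n e)) :=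
      fun e he => measurableSet_frustum (hs.measurableSet_core he)
    rw [h2, integral_finsetSum] at h1
    · have h3 : ∀ e ∈ s, ∫ x in T,
          (frustum c (a e) (n e) (1 - 2 * δ) (1 - δ) (core U a n e)).indicator
          (fun x => -((δ * inner ℝ (a e - c) (n e))⁻¹ * inner ℝ (F x) (n e))) x =
          -((δ * inner ℝ (a e - c) (n e))⁻¹ *
          ∫ x in frustum c (a e) (n e) (1 - 2 * δ) (1 - δ) (core U a n e), inner ℝ (F x) (n e)) := by
        intro e he
        rw [setIntegral_indicator (hmeas e he), Set.inter_eq_right.2 (hsub e he), integral_neg,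
          integral_const_mul]
      rw [Finset.sum_congr rfl h3, Finset.sum_neg_distrib, neg_inj] at h1
      exact h1
    · intro e he
      refine Integrable.indicator ?_ (hmeas e he)
      exact ((((hFn e).integrableOn_compact hcomp).mono_set subset_closure).const_mul _).neg
  have hmem : Set.Ioo (0 : ℝ) (1 / 2) ∈ 𝓝[>] (0 : ℝ) := Ioo_mem_nhdsGT (by norm_num)
  have hlim1 : Filter.Tendsto (fun δ => ∑ e ∈ s, (δ * inner ℝ (a e - c) (n e))⁻¹ *
      ∫ x in frustum c (a e) (n e) (1 - 2 * δ) (1 - δ) (core U a n e), inner ℝ (F x) (n e))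
      (𝓝[>] 0) (𝓝 (∑ e ∈ s, ∫ x in core U a n e, inner ℝ (F x) (n e) ∂(surf d))) := by
    refine tendsto_finsetSum _ fun e he => ?_
    refine tendsto_shell_average (hs.data e he).norm (hs.pos e he) (hs.measurableSet_core he)
      Set.inter_subset_right hcomp (fun x hx => ⟨subset_closure (hs.frustum_subset h he hx), ?_⟩)
      ((hs.core_frontier he).trans frontier_subset_closure) (hFn e)
    exact frontier_subset_closure (hs.core_frontier he hx.2.2)
  have hlim2 : Filter.Tendsto (fun δ => ∫ x in T, g x * shellCut T c δ x) (𝓝[>] 0)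
      (𝓝 (∫ x in T, g x)) := by
    apply tendsto_integral_filter_of_dominated_convergence (fun x => |g x|)
    · filter_upwards [hmem] with δ hδ
      exact hg.aestronglyMeasurable.mul (shellCut_lipschitz h hδ.1).continuous.aestronglyMeasurable
    · refine Filter.Eventually.of_forall fun δ => Filter.Eventually.of_forall fun x => ?_
      rw [norm_mul, Real.norm_eq_abs, Real.norm_eq_abs, abs_of_nonneg (shellCut_nonneg δ x)]
      exact mul_le_of_le_one_right (abs_nonneg _) (shellCut_le_one δ x)
    · exact hg.abs
    · refine (ae_restrict_iff' h.isOpen.measurableSet).2 (Filter.Eventually.of_forall fun x hx => ?_)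
      have hx1 := h.sgauge_lt_one hx
      have : ∀ᶠ δ in 𝓝[>] (0 : ℝ), g x * shellCut T c δ x = g x := by
        have hm : Set.Ioo (0 : ℝ) ((1 - sgauge T c x) / 2) ∈ 𝓝[>] (0 : ℝ) :=
          Ioo_mem_nhdsGT (by linarith)
        filter_upwards [hm] with δ hδ
        rw [shellCut_eq_one hδ.1 (by linarith [hδ.2]), mul_one]
      exact tendsto_const_nhds.congr' (this.mono fun _ h => h.symm)
  have hfin := tendsto_nhds_unique_of_eventuallyEq hlim1 hlim2
    (by filter_upwards [hmem] with δ hδ using heq δ hδ)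
  -- The limit was taken over relative interiors, which differ from the facets by null sets.
  rw [← hfin]
  refine Finset.sum_congr rfl fun e he => ?_
  refine setIntegral_congr_set ?_
  exact (Filter.EventuallyLE.antisymm (LE.le.eventuallyLE (hs.data e he).core_subset)
    (ae_le_set.2 (hs.data e he).null))

end FacetSystem

end

/-! ### Functions with a continuous extension to the closure -/

/-- `f` coincides on `T` with a function that is continuous on the closure of `T`. -/
def Extends {d : ℕ} {F : Type*} [TopologicalSpace F] (T : Set (Vec d)) (f : Vec d → F) : Prop :=
  ∃ g, ContinuousOn g (closure T) ∧ Set.EqOn f g T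

section Extends

variable {d : ℕ} {T : Set (Vec d)} {F F' F'' : Type*} [NormedAddCommGroup F]
  [NormedAddCommGroup F'] [NormedAddCommGroup F'']

lemma Extends.of_continuous {f : Vec d → F} (hf : Continuous f) : Extends T f :=
  ⟨f, hf.continuousOn, fun _ _ => rfl⟩

lemma Extends.tendsto_extendFrom {f : Vec d → F} (hf : Extends T f) {x : Vec d}
    (hx : x ∈ closure T) : Filter.Tendsto f (𝓝[T] x) (𝓝 (extendFrom T f x)) := by
  obtain ⟨g, hg, hfg⟩ := hf
  apply _root_.tendsto_extendFrom
  refine ⟨g x, ?_⟩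
  have h1 : Filter.Tendsto g (𝓝[T] x) (𝓝 (g x)) :=
    (hg x hx).mono_left (nhdsWithin_mono x subset_closure)
  exact h1.congr' (by filter_upwards [self_mem_nhdsWithin] with y hy using (hfg hy).symm)

lemma Extends.continuousOn_extendFrom {f : Vec d → F} (hf : Extends T f) :
    ContinuousOn (extendFrom T f) (closure T) :=
  _root_.continuousOn_extendFrom subset_rfl fun _ hx => ⟨_, hf.tendsto_extendFrom hx⟩

lemma Extends.continuousOn {f : Vec d → F} (hf : Extends T f) : ContinuousOn f T := by
  obtain ⟨g, hg, hfg⟩ := hf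
  exact (hg.mono subset_closure).congr hfg

lemma Extends.extendFrom_eq_self {f : Vec d → F} (hf : Extends T f) {x : Vec d} (hx : x ∈ T) :
    extendFrom T f x = f x := extendFrom_extends hf.continuousOn x hx

lemma extendFrom_congr {f g : Vec d → F} (h : Set.EqOn f g T) (x : Vec d) :
    extendFrom T f x = extendFrom T g x := by
  rw [extendFrom, extendFrom, Filter.limUnder, Filter.limUnder]
  congr 1
  apply Filter.map_congr
  filter_upwards [self_mem_nhdsWithin] with y hy using h hy

lemma Extends.congr {f g : Vec d → F} (hf : Extends T f) (h : Set.EqOn f g T) : Extends T g := by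
  obtain ⟨g', hg', hfg⟩ := hf
  exact ⟨g', hg', fun x hx => (h hx).symm.trans (hfg hx)⟩

lemma Extends.comp {f : Vec d → F} (hf : Extends T f) {Φ : F → F'} (hΦ : Continuous Φ) :
    Extends T fun x => Φ (f x) := by
  obtain ⟨g, hg, hfg⟩ := hf
  exact ⟨fun x => Φ (g x), hΦ.comp_continuousOn hg, fun x hx => by simp [hfg hx]⟩

lemma Extends.comp₂ {f : Vec d → F} {g : Vec d → F'} (hf : Extends T f) (hg : Extends T g)
    {Φ : F → F' → F''} (hΦ : Continuous fun p : F × F' => Φ p.1 p.2) :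
    Extends T fun x => Φ (f x) (g x) := by
  obtain ⟨f', hf', hff⟩ := hf
  obtain ⟨g', hg', hgg⟩ := hg
  exact ⟨fun x => Φ (f' x) (g' x), hΦ.comp_continuousOn (hf'.prodMk hg'),
    fun x hx => by simp [hff hx, hgg hx]⟩

lemma Extends.extendFrom_comp {f : Vec d → F} (hf : Extends T f) {Φ : F → F'}
    (hΦ : Continuous Φ) {x : Vec d} (hx : x ∈ closure T) :
    extendFrom T (fun x => Φ (f x)) x = Φ (extendFrom T f x) :=
  extendFrom_eq hx ((hΦ.tendsto _).comp (hf.tendsto_extendFrom hx))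

lemma Extends.extendFrom_comp₂ {f : Vec d → F} {g : Vec d → F'} (hf : Extends T f)
    (hg : Extends T g) {Φ : F → F' → F''} (hΦ : Continuous fun p : F × F' => Φ p.1 p.2)
    {x : Vec d} (hx : x ∈ closure T) :
    extendFrom T (fun x => Φ (f x) (g x)) x = Φ (extendFrom T f x) (extendFrom T g x) :=
  extendFrom_eq hx ((hΦ.tendsto _).comp
    ((hf.tendsto_extendFrom hx).prodMk_nhds (hg.tendsto_extendFrom hx)))

lemma extendFrom_of_continuous {f : Vec d → F} (hf : Continuous f) {x : Vec d}
    (hx : x ∈ closure T) : extendFrom T f x = f x :=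
  extendFrom_eq hx ((hf.tendsto x).mono_left nhdsWithin_le_nhds)

lemma Extends.exists_bound (hb : Bornology.IsBounded T) {f : Vec d → F} (hf : Extends T f) :
    ∃ C, ∀ x ∈ T, ‖f x‖ ≤ C := by
  obtain ⟨g, hg, hfg⟩ := hf
  obtain ⟨C, hC⟩ := hb.isCompact_closure.exists_bound_of_continuousOn hg
  exact ⟨C, fun x hx => by rw [hfg hx]; exact hC x (subset_closure hx)⟩

lemma Extends.integrableOn (ho : IsOpen T) (hb : Bornology.IsBounded T) {f : Vec d → ℝ}
    (hf : Extends T f) : IntegrableOn f T := by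
  obtain ⟨g, hg, hfg⟩ := hf
  exact ((hg.integrableOn_compact hb.isCompact_closure).mono_set subset_closure).congr_fun
    hfg.symm ho.measurableSet

end Extends

section MemC

variable {d : ℕ} {T : Set (Vec d)} {m : ℕ} {v : Vec d → ℝ}

lemma MemC.mono {m' : ℕ} (h : MemC m T v) (hm : m' ≤ m) : MemC m' T v :=
  ⟨h.1.of_le (by exact_mod_cast hm), fun k hk => h.2 k (hk.trans hm)⟩

lemma MemC.extends (h : MemC m T v) : Extends T v := by
  obtain ⟨g, hg, hvg⟩ := h.2 0 (Nat.zero_le m)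
  refine ⟨fun x => g x 0, ?_, fun x hx => ?_⟩
  · exact (ContinuousMultilinearMap.apply ℝ (fun _ : Fin 0 => Vec d) ℝ 0).continuous.comp_continuousOn hg
  · simp [← hvg hx]

lemma MemC.extends_fderiv (h : MemC m T v) (hm : 1 ≤ m) : Extends T (fderiv ℝ v) := by
  obtain ⟨g, hg, hvg⟩ := h.2 1 hm
  let e := continuousMultilinearCurryFin1 ℝ (Vec d) ℝ
  refine ⟨fun x => e (g x), e.continuous.comp_continuousOn hg, fun x hx => ?_⟩
  change _ = e (g x)
  rw [← hvg hx]
  ext w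
  simp [e, iteratedFDeriv_one_apply]

lemma MemC.contDiffAt (h : MemC m T v) (ho : IsOpen T) {x : Vec d} (hx : x ∈ T) :
    ContDiffAt ℝ m v x := h.1.contDiffAt (ho.mem_nhds hx)

lemma MemC.differentiableAt (h : MemC m T v) (hm : 1 ≤ m) (ho : IsOpen T) {x : Vec d}
    (hx : x ∈ T) : DifferentiableAt ℝ v x :=
  (h.contDiffAt ho hx).differentiableAt (by exact_mod_cast (by omega : m ≠ 0))

lemma inner_gradient (f : Vec d → ℝ) (x v : Vec d) : inner ℝ (∇ f x) v = fderiv ℝ f x v := by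
  simp [gradient]

lemma MemC.extends_gradient (h : MemC m T v) (hm : 1 ≤ m) : Extends T (∇ v) :=
  (h.extends_fderiv hm).comp (InnerProductSpace.toDual ℝ (Vec d)).symm.continuous

lemma Extends.fderiv_apply (h : Extends T (fderiv ℝ v)) (w : Vec d) :
    Extends T fun x => fderiv ℝ v x w :=
  h.comp (ContinuousLinearMap.apply ℝ ℝ w).continuous

end MemC

/-! ### Weak divergences of smooth fields and of products. -/

section WeakDiv

variable {d : ℕ} {T : Set (Vec d)}

/-- All integrands vanish outside `T`, so the integrals may be taken over the whole space, and there
`f` has to be differentiable only on the support of `φ`. -/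
lemma IsTestFun.integral_mul_fderiv {φ : Vec d → ℝ} (hφ : IsTestFun T φ)
    {f : Vec d → ℝ} (hf : ∀ x ∈ T, DifferentiableAt ℝ f x) (v : Vec d)
    (hfi : IntegrableOn f T) (hfi' : IntegrableOn (fun x => fderiv ℝ f x v) T) :
    ∫ x in T, f x * fderiv ℝ φ x v = - ∫ x in T, fderiv ℝ f x v * φ x := by
  obtain ⟨hφs, hφc, hφT⟩ := hφ
  have hφ0 : ∀ x, x ∉ T → φ x = 0 := fun x hx => image_eq_zero_of_notMem_tsupport fun h => hx (hφT h)
  have hφ1 : ∀ x, x ∉ T → fderiv ℝ φ x = 0 := fun x hx =>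
    image_eq_zero_of_notMem_tsupport fun h => hx (hφT (tsupport_fderiv_subset ℝ h))
  have hd : Continuous fun x => fderiv ℝ φ x v :=
    (hφs.continuous_fderiv (by simp)).clm_apply continuous_const
  obtain ⟨C0, hC0⟩ := hφc.exists_bound_of_continuous hφs.continuous
  obtain ⟨C1, hC1⟩ := (hφc.fderiv_apply ℝ v).exists_bound_of_continuous hd
  have g1 : IntegrableOn (fun x => f x * fderiv ℝ φ x v) T :=
    hfi.mul_bdd hd.aestronglyMeasurable (Filter.Eventually.of_forall hC1)
  have g0 : IntegrableOn (fun x => f x * φ x) T :=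
    hfi.mul_bdd hφs.continuous.aestronglyMeasurable (Filter.Eventually.of_forall hC0)
  have g2 : IntegrableOn (fun x => fderiv ℝ f x v * φ x) T :=
    hfi'.mul_bdd hφs.continuous.aestronglyMeasurable (Filter.Eventually.of_forall hC0)
  rw [setIntegral_eq_integral_of_forall_compl_eq_zero fun x hx => by simp [hφ1 x hx],
    setIntegral_eq_integral_of_forall_compl_eq_zero fun x hx => by simp [hφ0 x hx]]
  apply integral_mul_fderiv_eq_neg_fderiv_mul_of_integrable
  · exact (integrableOn_iff_integrable_of_support_subset fun x hx => by
      by_contra h; exact hx (by simp [hφ0 x h])).1 g2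
  · exact (integrableOn_iff_integrable_of_support_subset fun x hx => by
      by_contra h; exact hx (by simp [hφ1 x h])).1 g1
  · exact (integrableOn_iff_integrable_of_support_subset fun x hx => by
      by_contra h; exact hx (by simp [hφ0 x h])).1 g0
  · exact fun x hx => hf x (hφT hx)
  · exact fun x _ => hφs.differentiable (by simp) x

lemma IsTestFun.mul {φ v : Vec d → ℝ} (hφ : IsTestFun T φ) (hv : ContDiff ℝ ∞ v) :
    IsTestFun T fun x => v x * φ x :=
  ⟨hv.mul hφ.1, hφ.2.1.mul_left, (tsupport_mul_subset_right (f := v)).trans hφ.2.2⟩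

lemma IsTestFun.extends {φ : Vec d → ℝ} {S : Set (Vec d)} (hφ : IsTestFun S φ) : Extends T φ :=
  Extends.of_continuous hφ.1.continuous

lemma IsTestFun.extends_fderiv {φ : Vec d → ℝ} {S : Set (Vec d)} (hφ : IsTestFun S φ) :
    Extends T (fderiv ℝ φ) :=
  Extends.of_continuous (hφ.1.continuous_fderiv (by simp))

lemma Extends.clm_apply {L : Vec d → (Vec d →L[ℝ] ℝ)} {F : Vec d → Vec d} (hL : Extends T L)
    (hF : Extends T F) : Extends T fun x => L x (F x) :=
  hL.comp₂ hF (Φ := fun L v => L v) (continuous_fst.clm_apply continuous_snd)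

lemma Extends.mul {f g : Vec d → ℝ} (hf : Extends T f) (hg : Extends T g) :
    Extends T fun x => f x * g x := hf.comp₂ hg (Φ := fun a b => a * b) (by fun_prop)

lemma Extends.add {f g : Vec d → ℝ} (hf : Extends T f) (hg : Extends T g) :
    Extends T fun x => f x + g x := hf.comp₂ hg (Φ := fun a b => a + b) (by fun_prop)

lemma Extends.sub {f g : Vec d → ℝ} (hf : Extends T f) (hg : Extends T g) :
    Extends T fun x => f x - g x := hf.comp₂ hg (Φ := fun a b => a - b) (by fun_prop)

lemma Extends.dot {f g : Vec d → Vec d} (hf : Extends T f) (hg : Extends T g) :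
    Extends T fun x => inner ℝ (f x) (g x) :=
  hf.comp₂ hg (Φ := fun a b => inner ℝ a b) (by fun_prop)

lemma Extends.smul {f : Vec d → ℝ} {g : Vec d → Vec d} (hf : Extends T f) (hg : Extends T g) :
    Extends T fun x => f x • g x := hf.comp₂ hg (Φ := fun a b => a • b) (by fun_prop)

lemma Extends.finset_sum {ι : Type*} (s : Finset ι) {f : ι → Vec d → ℝ}
    (hf : ∀ i ∈ s, Extends T (f i)) : Extends T fun x => ∑ i ∈ s, f i x := by
  classical
  induction s using Finset.induction_on with
  | empty => exact Extends.of_continuous (by simpa using continuous_const)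
  | insert a s ha ih =>
    simp_rw [Finset.sum_insert ha]
    exact (hf a (Finset.mem_insert_self a s)).add
      (ih fun i hi => hf i (Finset.mem_insert_of_mem hi))

lemma Extends.of_coord {f : Vec d → Vec d} (hf : ∀ k, Extends T fun x => f x k) :
    Extends T f := by
  choose g hg hfg using hf
  refine ⟨fun x => WithLp.toLp 2 fun k => g k x, ?_, fun x hx => ?_⟩
  · exact (PiLp.continuous_toLp 2 _).comp_continuousOn (continuousOn_pi.2 hg)
  · ext k
    exact hfg k hx

lemma HasWeakDiv.congr {F F' : Vec d → Vec d} {g g' : Vec d → ℝ} (h : HasWeakDiv T F g)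
    (hT : MeasurableSet T) (hF : Set.EqOn F F' T) (hg : Set.EqOn g g' T) : HasWeakDiv T F' g' := by
  intro φ hφ
  have e1 : ∫ x in T, fderiv ℝ φ x (F x) = ∫ x in T, fderiv ℝ φ x (F' x) :=
    setIntegral_congr_fun hT fun x hx => by simp only [hF hx]
  have e2 : ∫ x in T, g x * φ x = ∫ x in T, g' x * φ x :=
    setIntegral_congr_fun hT fun x hx => by simp only [hg hx]
  rw [← e1, ← e2, h φ hφ]

/-- A weak divergence can be multiplied by smooth functions. -/
lemma HasWeakDiv.smul (ho : IsOpen T) (hb : Bornology.IsBounded T) {F : Vec d → Vec d}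
    {g v : Vec d → ℝ} (h : HasWeakDiv T F g) (hF : Extends T F) (hg : IntegrableOn g T)
    (hv : ContDiff ℝ ∞ v) :
    HasWeakDiv T (fun x => v x • F x) (fun x => g x * v x + fderiv ℝ v x (F x)) := by
  intro φ hφ
  have hve : Extends T v := Extends.of_continuous hv.continuous
  have hve' : Extends T (fderiv ℝ v) := Extends.of_continuous (hv.continuous_fderiv (by simp))
  -- The product `v φ` is again a test function; the product rule separates the two contributions.
  have h1 := h _ (hφ.mul hv)
  have e : ∀ x, fderiv ℝ (fun x => v x * φ x) x (F x) =
      fderiv ℝ φ x (v x • F x) + fderiv ℝ v x (F x) * φ x := by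
    intro x
    rw [fderiv_fun_mul (hv.differentiable (by simp) x) (hφ.1.differentiable (by simp) x)]
    simp
    ring
  simp_rw [e] at h1
  have i1 : IntegrableOn (fun x => fderiv ℝ φ x (v x • F x)) T :=
    (hφ.extends_fderiv.clm_apply (hve.smul hF)).integrableOn ho hb
  have i2 : IntegrableOn (fun x => fderiv ℝ v x (F x) * φ x) T :=
    ((hve'.clm_apply hF).mul hφ.extends).integrableOn ho hb
  obtain ⟨C, hC⟩ := Extends.exists_bound hb (hve.mul (hφ.extends (T := T)))
  have i3 : IntegrableOn (fun x => g x * (v x * φ x)) T := by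
    refine hg.mul_bdd (hv.continuous.mul hφ.1.continuous).aestronglyMeasurable (c := C) ?_
    exact (ae_restrict_iff' ho.measurableSet).2 (Filter.Eventually.of_forall hC)
  rw [integral_add i1 i2] at h1
  have e2 : ∫ x in T, (g x * v x + fderiv ℝ v x (F x)) * φ x =
      (∫ x in T, g x * (v x * φ x)) + ∫ x in T, fderiv ℝ v x (F x) * φ x := by
    rw [← integral_add i3 i2]
    congr with x
    ring
  rw [e2]
  linarith

/-- Continuously differentiable fields have a weak divergence. -/
lemma hasWeakDiv_of_memC (ho : IsOpen T) (hb : Bornology.IsBounded T) {F : Vec d → Vec d}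
    (hF : ∀ k, MemC 1 T fun x => F x k) :
    HasWeakDiv T F fun x => ∑ k, fderiv ℝ (fun y => F y k) x (unitVec k) := by
  intro φ hφ
  have hFd : ∀ k, Extends T fun x => fderiv ℝ (fun y => F y k) x (unitVec k) := fun k =>
    ((hF k).extends_fderiv le_rfl).fderiv_apply _
  have hφd : ∀ k, Extends T fun x => fderiv ℝ φ x (unitVec k) := fun k =>
    (hφ.extends_fderiv).fderiv_apply _
  have e : ∀ x, fderiv ℝ φ x (F x) = ∑ k, F x k * fderiv ℝ φ x (unitVec k) := fun x =>
    clm_apply_eq_sum _ _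
  simp_rw [e, Finset.sum_mul]
  rw [integral_finsetSum, integral_finsetSum, ← Finset.sum_neg_distrib]
  · refine Finset.sum_congr rfl fun k _ => ?_
    exact hφ.integral_mul_fderiv (fun x hx => (hF k).differentiableAt le_rfl ho hx) _
      ((hF k).extends.integrableOn ho hb) ((hFd k).integrableOn ho hb)
  · exact fun k _ => ((hFd k).mul hφ.extends).integrableOn ho hb
  · exact fun k _ => ((hF k).extends.mul (hφd k)).integrableOn ho hb

lemma divg_eq_sum {F : Vec d → Vec d} {x : Vec d}
    (hF : ∀ k, DifferentiableAt ℝ (fun y => F y k) x) :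
    divg F x = ∑ k, fderiv ℝ (fun y => F y k) x (unitVec k) := by
  have hd : DifferentiableAt ℝ F x := differentiableAt_euclidean.2 hF
  refine Finset.sum_congr rfl fun k _ => ?_
  have := ((EuclideanSpace.proj k : Vec d →L[ℝ] ℝ).hasFDerivAt.comp x hd.hasFDerivAt).fderiv
  have e : (⇑(EuclideanSpace.proj k : Vec d →L[ℝ] ℝ) ∘ F) = fun y => F y k := rfl
  rw [e] at this
  rw [this]
  rfl

end WeakDiv

/-! ### Geometry of meshes -/

lemma IsPolytope.isOpen {d : ℕ} (hd : 1 ≤ d) {P : Set (Vec d)} (h : IsPolytope d P) :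
    IsOpen P ∧ Bornology.IsBounded P ∧ P.Nonempty := by
  obtain ⟨k, rfl⟩ : ∃ k, d = k + 1 := ⟨d - 1, by omega⟩
  obtain ⟨A, hA, ⟨U, hU, rfl⟩, hb, hc, -⟩ := h
  refine ⟨?_, hb, hc.nonempty⟩
  have hdir : A.direction = ⊤ := Submodule.eq_top_of_finrank_eq (by simpa using hA)
  obtain ⟨x, hx⟩ := hc.nonempty
  have htop : A = ⊤ := (AffineSubspace.direction_eq_top_iff_of_nonempty ⟨x, hx.2⟩).1 hdir
  rw [htop]
  simpa using hU

/-- A full-dimensional polytope is a regular open set. -/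
lemma IsPolytope.interior_closure_subset {d : ℕ} (hd : 1 ≤ d) {P : Set (Vec d)}
    (h : IsPolytope d P) : interior (closure P) ⊆ P := by
  intro x hx
  by_contra hxP
  obtain ⟨k, rfl⟩ : ∃ k, d = k + 1 := ⟨d - 1, by omega⟩
  obtain ⟨A, hA, -, -, hc, hlip, -⟩ := h
  have hdir : A.direction = ⊤ := Submodule.eq_top_of_finrank_eq (by simpa using hA)
  obtain ⟨ν, -, hν, L, φ, hφ, hev⟩ := hlip x ⟨interior_subset hx, hxP⟩
  -- An empty `A` would have the zero direction space, and then the whole space would be trivial,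
  -- against the unit vector `ν`.
  have hAtop : ∀ y, y ∈ A := by
    rcases (A : Set (Vec (k + 1))).eq_empty_or_nonempty with h0 | h0
    · rw [AffineSubspace.coe_eq_bot_iff] at h0
      rw [h0, AffineSubspace.direction_bot] at hdir
      have := (subsingleton_of_bot_eq_top hdir)
      rw [Submodule.subsingleton_iff] at this
      exact absurd (Subsingleton.elim (0 : Vec (k + 1)) ν) (by rintro rfl; simp at hν)
    · have htop : A = ⊤ := (AffineSubspace.direction_eq_top_iff_of_nonempty h0).1 hdir
      intro y; rw [htop]; trivial
  have hφ0 : φ 0 ≤ 0 := by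
    have := hev.self_of_nhds (hAtop x)
    simp only [sub_self, inner_zero_left, zero_smul] at this
    exact not_lt.1 fun h => hxP (this.2 h)
  -- Since `x ∉ P`, the graph passes through `x` or below it. A small step along `ν` therefore lands
  -- strictly above the graph, where a whole neighbourhood misses `P`, although the point is still
  -- in the closure of `P`.
  have hc : Filter.Tendsto (fun s : ℝ => x + s • ν) (𝓝[>] 0) (𝓝 x) := by
    have : Filter.Tendsto (fun s : ℝ => x + s • ν) (𝓝 0) (𝓝 (x + (0 : ℝ) • ν)) :=
      Continuous.tendsto (by fun_prop) 0
    rw [zero_smul, add_zero] at this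
    exact this.mono_left nhdsWithin_le_nhds
  have hev' := hev.eventually_nhds
  obtain ⟨s, ⟨h1, h2⟩, hs⟩ := ((hc.eventually (hev'.and (isOpen_interior.mem_nhds hx))).and
    self_mem_nhdsWithin).exists
  have hs' : (0 : ℝ) < s := hs
  have hopen : IsOpen {y | φ ((y - x) - (inner ℝ (y - x) ν : ℝ) • ν) < inner ℝ (y - x) ν} := by
    have := hφ.continuous
    exact isOpen_lt (by fun_prop) (by fun_prop)
  have hmem : x + s • ν ∈ {y | φ ((y - x) - (inner ℝ (y - x) ν : ℝ) • ν) < inner ℝ (y - x) ν} := by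
    rw [Set.mem_ofPred_eq, add_sub_cancel_left, real_inner_smul_left, real_inner_self_eq_norm_sq,
      hν]
    simp only [one_pow, mul_one, sub_self]
    linarith
  have h3 : ∀ᶠ y in 𝓝 (x + s • ν), y ∉ P := by
    filter_upwards [h1, hopen.mem_nhds hmem] with y hy hy'
    intro hyP
    have a1 := (hy (hAtop y)).1 hyP
    have a2 : φ ((y - x) - (inner ℝ (y - x) ν : ℝ) • ν) < inner ℝ (y - x) ν := hy'
    linarith
  have h4 : ∃ᶠ y in 𝓝 (x + s • ν), y ∈ P := mem_closure_iff_frequently.1 (interior_subset h2)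
  exact h4 h3

lemma hyp_neg {d : ℕ} (a n : Vec d) : hyp a (-n) = hyp a n := by
  ext y; simp [hyp, inner_neg_right]

lemma FacetData.neg {d : ℕ} {e U : Set (Vec d)} {a n : Vec d} (h : FacetData e U a n) :
    FacetData e U a (-n) := by
  refine ⟨h.isOpen, h.mem, by rw [norm_neg, h.norm], h.bounded, ?_, ?_⟩
  · rw [hyp_neg]; exact h.closure_eq
  · rw [hyp_neg]; exact h.null

lemma volume_hyp {d : ℕ} (a n : Vec d) (hn : ‖n‖ = 1) : volume (hyp a n) = 0 := by
  have hc : 0 < inner ℝ (a - (a - n)) n := by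
    rw [sub_sub_cancel, real_inner_self_eq_norm_sq, hn]; norm_num
  refine measure_mono_null (fun x hx => ?_) (volume_coneHeight_eq (c := a - n) (a := a) hn hc 1)
  exact coneHeight_of_mem_hyp hc.ne' hx

variable {d : ℕ} {Ω : Set (Vec d)}

/-- Summary of the geometry of a mesh of star-shaped elements: `core e` is the relative interior
of the facet `e`, and `nu T e` is the outward unit normal to `T` on `e`. -/
structure Mesh.Geometry (M : Mesh Ω) (core : Set (Vec d) → Set (Vec d))
    (nu : Set (Vec d) → Set (Vec d) → Vec d) : Prop where
  omega_open : IsOpen Ω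
  elem_open : ∀ T ∈ M.elements, IsOpen T
  elem_bdd : ∀ T ∈ M.elements, Bornology.IsBounded T
  elem_sub : ∀ T ∈ M.elements, T ⊆ Ω
  elem_nonempty : ∀ T ∈ M.elements, T.Nonempty
  omega_nonempty : Ω.Nonempty
  diam_pos : ∀ T ∈ M.elements, 0 < Metric.diam T
  null : volume (Ω \ ⋃ T ∈ M.elements, T) = 0
  facet_compact : ∀ e ∈ M.facets, IsCompact e
  facet_fin : ∀ e ∈ M.facets, surf d e < ⊤
  core_sub : ∀ e ∈ M.facets, core e ⊆ e
  core_meas : ∀ e ∈ M.facets, MeasurableSet (core e)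
  core_null : ∀ e ∈ M.facets, surf d (e \ core e) = 0
  nu_norm : ∀ T ∈ M.elements, ∀ e ∈ M.facetsOf T, ‖nu T e‖ = 1
  outerNormal_eq : ∀ T ∈ M.elements, ∀ e ∈ M.facetsOf T, ∀ x ∈ core e, outerNormal T x = nu T e
  interior : ∀ e ∈ M.interiorFacets, ∃ T₁ ∈ M.elements, ∃ T₂ ∈ M.elements, T₁ ≠ T₂ ∧
    M.adj e = {T₁, T₂} ∧ nu T₂ e = - nu T₁ e ∧ core e ⊆ Ω
  boundary : ∀ e ∈ M.boundaryFacets, ∃ T ∈ M.elements, M.adj e = {T}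
  disjoint : Disjoint M.interiorFacets M.boundaryFacets
  boundary_not_mem : ∀ e ∈ M.boundaryFacets, Disjoint e Ω
  div : ∀ T ∈ M.elements, ∀ (F : Vec d → Vec d) (g : Vec d → ℝ), Extends T F → IntegrableOn g T →
    HasWeakDiv T F g →
    ∫ x in T, g x = ∑ e ∈ M.facetsOf T, ∫ x in e, inner ℝ (extendFrom T F x) (nu T e) ∂(surf d)

lemma Mesh.mem_facetsOf {M : Mesh Ω} {T e : Set (Vec d)} :
    e ∈ M.facetsOf T ↔ e ∈ M.facets ∧ e ⊆ frontier T := by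
  simp [Mesh.facetsOf]

lemma Mesh.mem_adj {M : Mesh Ω} {T e : Set (Vec d)} :
    T ∈ M.adj e ↔ T ∈ M.elements ∧ e ⊆ frontier T := by
  simp [Mesh.adj]

lemma Mesh.mem_interiorFacets {M : Mesh Ω} {e : Set (Vec d)} :
    e ∈ M.interiorFacets ↔ e ∈ M.facets ∧
      ∃ T₁ ∈ M.elements, ∃ T₂ ∈ M.elements, T₁ ≠ T₂ ∧ e ⊆ frontier T₁ ∩ frontier T₂ := by
  simp [Mesh.interiorFacets]

lemma Mesh.mem_boundaryFacets {M : Mesh Ω} {e : Set (Vec d)} :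
    e ∈ M.boundaryFacets ↔ e ∈ M.facets ∧
      ∃ T ∈ M.elements, e ⊆ frontier T ∩ frontier Ω := by
  simp [Mesh.boundaryFacets]

lemma diam_pos_of_isOpen (hd : 1 ≤ d) {T : Set (Vec d)} (ho : IsOpen T)
    (hb : Bornology.IsBounded T) (hne : T.Nonempty) : 0 < Metric.diam T := by
  obtain ⟨x, hx⟩ := hne
  obtain ⟨ε, hε, hball⟩ := Metric.isOpen_iff.1 ho x hx
  have hy : x + (ε / 2) • unitVec (⟨0, hd⟩ : Fin d) ∈ T := by
    apply hball
    rw [mem_ball_iff_norm, add_sub_cancel_left, norm_smul, norm_unitVec, mul_one,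
      Real.norm_of_nonneg (by positivity)]
    linarith
  have := Metric.dist_le_diam_of_mem hb hx hy
  rw [dist_comm, dist_eq_norm, add_sub_cancel_left, norm_smul, norm_unitVec, mul_one,
      Real.norm_of_nonneg (by positivity)] at this
  linarith

lemma Mesh.starBody (M : Mesh Ω) (hd : 1 ≤ d) {r : ℝ} (hr : 0 < r) (hstar : M.IsStarShapedBall r)
    {T : Set (Vec d)} (hT : T ∈ M.elements) : ∃ c, StarBody T c (r * Metric.diam T) := by
  obtain ⟨ho, hb, hne⟩ := (M.isPolytope T hT).isOpen hd
  obtain ⟨c, hc, hs⟩ := hstar T hT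
  exact ⟨c, ho, hb, mul_pos hr (diam_pos_of_isOpen hd ho hb hne), hc, hs⟩

/-- Extracts from the definition of a mesh everything the analysis needs: constant outward normals
on facets, opposite normals on the two sides, exactly two or one neighbours, and the divergence
theorem on each element. Beyond this theorem polytopes are no longer looked at. -/
theorem Mesh.exists_geometry (M : Mesh Ω) (hd : 1 ≤ d) (hΩ : IsPolytope d Ω) {r : ℝ} (hr : 0 < r)
    (hstar : M.IsStarShapedBall r) : ∃ core nu, M.Geometry core nu := by
  classical
  have hfd : ∀ e, ∃ (U : Set (Vec d)) (a n : Vec d), e ∈ M.facets → FacetData e U a n := by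
    intro e
    by_cases he : e ∈ M.facets
    · obtain ⟨P, hP, rfl⟩ := M.facet_isPolytope e he
      obtain ⟨U, a, n, h, -⟩ := hP.exists_facetData hd
      exact ⟨U, a, n, fun _ => h⟩
    · exact ⟨∅, 0, 0, fun h => absurd h he⟩
  choose U a n hfd using hfd
  have hstb : ∀ T, ∃ c, T ∈ M.elements → StarBody T c (r * Metric.diam T) := by
    intro T
    by_cases hT : T ∈ M.elements
    · obtain ⟨c, hc⟩ := M.starBody hd hr hstar hT
      exact ⟨c, fun _ => hc⟩
    · exact ⟨0, fun h => absurd h hT⟩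
  choose c hsb using hstb
  -- The sign of the facet normal is chosen so that the star centre of `T` lies behind the facet.
  let nu : Set (Vec d) → Set (Vec d) → Vec d := fun T e =>
    if 0 < inner ℝ (a e - c T) (n e) then n e else - n e
  have hnu : ∀ T e, nu T e = n e ∨ nu T e = - n e := by
    intro T e; by_cases h : 0 < inner ℝ (a e - c T) (n e) <;> simp [nu, h]
  have hhyp : ∀ T e, hyp (a e) (nu T e) = hyp (a e) (n e) := by
    intro T e
    rcases hnu T e with h | h <;> rw [h]
    exact hyp_neg _ _
  have hfd' : ∀ T, ∀ e ∈ M.facets, FacetData e (U e) (a e) (nu T e) := by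
    intro T e he
    rcases hnu T e with h | h <;> rw [h]
    · exact hfd e he
    · exact (hfd e he).neg
  let cor : Set (Vec d) → Set (Vec d) := fun e => U e ∩ hyp (a e) (n e)
  have hcorT : ∀ T e, core U a (nu T) e = cor e := by
    intro T e; simp only [core, cor, hhyp]
  have hcf : ∀ T ∈ M.elements, ∀ e ∈ M.facetsOf T, cor e ⊆ frontier T := fun T _ e he =>
    (hfd e (Mesh.mem_facetsOf.1 he).1).core_subset.trans (Mesh.mem_facetsOf.1 he).2
  have hpos : ∀ T ∈ M.elements, ∀ e ∈ M.facetsOf T, 0 < inner ℝ (a e - c T) (nu T e) := by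
    intro T hT e he
    have hne := (hsb T hT).inner_ne_zero (hfd e (Mesh.mem_facetsOf.1 he).1).isOpen
      (hfd e (Mesh.mem_facetsOf.1 he).1).mem (hcf T hT e he)
    simp only [nu]
    split_ifs with h
    · exact h
    · rw [inner_neg_right]
      exact neg_pos.2 (lt_of_le_of_ne (not_lt.1 h) hne)
  have hfs : ∀ T ∈ M.elements, FacetSystem T (c T) (M.facetsOf T) U a (nu T) := by
    intro T hT
    refine ⟨fun e he => hfd' T e (Mesh.mem_facetsOf.1 he).1, fun e he => hpos T hT e he, ?_,
      fun e he e' he' hne => M.facet_overlap e (Mesh.mem_facetsOf.1 he).1 e'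
        (Mesh.mem_facetsOf.1 he').1 hne⟩
    rw [M.frontier_eq T hT]
    ext x
    simp only [Set.mem_iUnion, Mesh.mem_facetsOf, exists_prop, and_assoc]
  have hnormal : ∀ T ∈ M.elements, ∀ e ∈ M.facetsOf T, ∀ x ∈ cor e,
      IsOuterNormal T x (nu T e) := by
    intro T hT e he x hx
    have hd' := hfd' T e (Mesh.mem_facetsOf.1 he).1
    refine (hsb T hT).isOuterNormal hd'.isOpen hd'.norm (hpos T hT e he) ?_ ?_
    · rw [hhyp]; exact hcf T hT e he
    · rw [hhyp]; exact hx
  have hcne : ∀ e ∈ M.facets, (cor e).Nonempty := fun e he =>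
    ⟨a e, (hfd e he).mem, by simp [hyp]⟩
  obtain ⟨hΩo, -, hΩne⟩ := hΩ.isOpen hd
  have helem : ∀ T ∈ M.elements, closure T ⊆ closure Ω := by
    intro T hT
    rw [M.cover]
    exact Set.subset_biUnion_of_mem (u := fun T => closure T) hT
  -- An element is an open subset of `closure Ω`, and `Ω` equals the interior of its closure because
  -- its boundary is Lipschitz.
  have helΩ : ∀ T ∈ M.elements, T ⊆ Ω := by
    intro T hT
    refine subset_trans ?_ (hΩ.interior_closure_subset hd)
    exact interior_maximal (subset_closure.trans (helem T hT)) (hsb T hT).isOpen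
  have hadjf : ∀ e ∈ M.facets, ∀ T ∈ M.adj e, T ∈ M.elements ∧ e ∈ M.facetsOf T := fun e he T hT =>
    ⟨(Mesh.mem_adj.1 hT).1, Mesh.mem_facetsOf.2 ⟨he, (Mesh.mem_adj.1 hT).2⟩⟩
  have hopp : ∀ e ∈ M.facets, ∀ T ∈ M.adj e, ∀ T' ∈ M.adj e, T ≠ T' → nu T' e = - nu T e := by
    intro e he T hT T' hT' hne
    obtain ⟨x, hx⟩ := hcne e he
    obtain ⟨h1, h2⟩ := hadjf e he T hT
    obtain ⟨h1', h2'⟩ := hadjf e he T' hT'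
    exact (hnormal T h1 e h2 x hx).eq_neg_of_disjoint (hnormal T' h1' e h2' x hx)
      (M.disjoint T h1 T' h1' hne)
  -- Near a relative interior point of a shared facet, the two elements fill the two opposite open
  -- half spaces and the facet fills the hyperplane between them; so a neighbourhood lies in
  -- `closure Ω`.
  have hcoreΩ : ∀ e ∈ M.facets, ∀ T ∈ M.adj e, ∀ T' ∈ M.adj e, T ≠ T' → cor e ⊆ Ω := by
    intro e he T hT T' hT' hne x hx
    obtain ⟨h1, h2⟩ := hadjf e he T hT
    obtain ⟨h1', h2'⟩ := hadjf e he T' hT'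
    apply hΩ.interior_closure_subset hd
    rw [mem_interior_iff_mem_nhds]
    have hUx : U e ∈ 𝓝 x := (hfd e he).isOpen.mem_nhds hx.1
    filter_upwards [(hnormal T h1 e h2 x hx).2, (hnormal T' h1' e h2' x hx).2, hUx] with y hy hy' hyU
    rw [hopp e he T hT T' hT' hne, inner_neg_right] at hy'
    rcases lt_trichotomy (inner ℝ (y - x) (nu T e)) 0 with hlt | heq | hgt
    · exact helem T h1 (subset_closure (hy.2 hlt))
    · have hyc : y ∈ cor e := by
        refine ⟨hyU, ?_⟩
        rw [← hhyp T e]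
        have hxa : inner ℝ (x - a e) (nu T e) = (0 : ℝ) := by
          have := hx.2; rw [← hhyp T e] at this; exact this
        have : y - a e = (y - x) + (x - a e) := by abel
        rw [hyp, Set.mem_ofPred_eq, this, inner_add_left, heq, hxa, add_zero]
      exact helem T h1 (frontier_subset_closure (hcf T h1 e h2 hyc))
    · exact helem T' h1' (subset_closure (hy'.2 (by linarith)))
  have hbd : ∀ e ∈ M.boundaryFacets, Disjoint e Ω := by
    intro e he
    obtain ⟨-, T, -, hsub⟩ := Mesh.mem_boundaryFacets.1 he
    rw [Set.disjoint_left]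
    intro x hx hxΩ
    have := (hsub hx).2
    rw [hΩo.frontier_eq] at this
    exact this.2 hxΩ
  -- Two neighbours would put the relative interior of the facet inside `Ω`, which boundary facets
  -- do not meet.
  have hbd1 : ∀ e ∈ M.boundaryFacets, ∀ T ∈ M.adj e, ∀ T' ∈ M.adj e, T = T' := by
    intro e he T hT T' hT'
    by_contra hne
    have hef := (Mesh.mem_boundaryFacets.1 he).1
    obtain ⟨x, hx⟩ := hcne e hef
    exact Set.disjoint_left.1 (hbd e he) ((hfd e hef).core_subset hx)
      (hcoreΩ e hef T hT T' hT' hne hx)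
  have hfnull : ∀ T ∈ M.elements, volume (frontier T) = 0 := by
    intro T hT
    rw [(hfs T hT).frontier_eq]
    refine (measure_biUnion_null_iff (M.facetsOf T).countable_toSet).2 fun e he => ?_
    have hd' := hfd e (Mesh.mem_facetsOf.1 he).1
    exact measure_mono_null hd'.subset_hyp (volume_hyp _ _ hd'.norm)
  refine ⟨cor, nu, hΩo, fun T hT => (hsb T hT).isOpen, fun T hT => (hsb T hT).bounded, helΩ,
    fun T hT => ⟨_, (hsb T hT).mem⟩, hΩne,
    fun T hT => diam_pos_of_isOpen hd (hsb T hT).isOpen (hsb T hT).bounded ⟨_, (hsb T hT).mem⟩,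
    ?_, fun e he => (hfd e he).isCompact,
    fun e he => surf_hyp_lt_top (hfd e he).norm (hfd e he).subset_hyp (hfd e he).bounded,
    fun e he => (hfd e he).core_subset, fun e he => (hfd e he).measurableSet_core,
    fun e he => (hfd e he).null, fun T hT e he => (hfd' T e (Mesh.mem_facetsOf.1 he).1).norm,
    fun T hT e he x hx => (hnormal T hT e he x hx).outerNormal_eq, ?_, ?_, ?_, hbd, ?_⟩
  · have hsub : Ω \ (⋃ T ∈ M.elements, T) ⊆ ⋃ T ∈ M.elements, frontier T := by
      rintro x ⟨hx, hx'⟩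
      have : x ∈ closure Ω := subset_closure hx
      rw [M.cover] at this
      obtain ⟨T, hT, hxT⟩ := Set.mem_iUnion₂.1 this
      refine Set.mem_iUnion₂.2 ⟨T, hT, ?_⟩
      rw [(hsb T hT).isOpen.frontier_eq]
      exact ⟨hxT, fun h => hx' (Set.mem_iUnion₂.2 ⟨T, hT, h⟩)⟩
    refine measure_mono_null hsub ?_
    exact (measure_biUnion_null_iff M.elements.countable_toSet).2 hfnull
  · intro e he
    obtain ⟨hef, T₁, h1, T₂, h2, hne, hsub⟩ := Mesh.mem_interiorFacets.1 he
    have ha1 : T₁ ∈ M.adj e := Mesh.mem_adj.2 ⟨h1, hsub.trans Set.inter_subset_left⟩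
    have ha2 : T₂ ∈ M.adj e := Mesh.mem_adj.2 ⟨h2, hsub.trans Set.inter_subset_right⟩
    refine ⟨T₁, h1, T₂, h2, hne, ?_, hopp e hef T₁ ha1 T₂ ha2 hne, hcoreΩ e hef T₁ ha1 T₂ ha2 hne⟩
    ext T
    rw [Finset.mem_insert, Finset.mem_singleton]
    constructor
    -- A third neighbour would have a normal opposite to each of two opposite normals.
    · intro hT
      by_contra hcon
      push Not at hcon
      have e1 := hopp e hef T₁ ha1 T hT (Ne.symm hcon.1)
      have e2 := hopp e hef T₂ ha2 T hT (Ne.symm hcon.2)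
      rw [hopp e hef T₁ ha1 T₂ ha2 hne, neg_neg, e1] at e2
      have hn1 := (hfd' T₁ e hef).norm
      have : nu T₁ e = 0 := by
        have h2 : (2 : ℝ) • nu T₁ e = 0 := by
          rw [two_smul]; nth_rewrite 1 [← e2]; simp
        simpa using h2
      rw [this] at hn1
      simp at hn1
    · rintro (rfl | rfl)
      · exact ha1
      · exact ha2
  · intro e he
    obtain ⟨hef, T, hT, hsub⟩ := Mesh.mem_boundaryFacets.1 he
    have ha : T ∈ M.adj e := Mesh.mem_adj.2 ⟨hT, hsub.trans Set.inter_subset_left⟩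
    refine ⟨T, hT, ?_⟩
    ext T'
    rw [Finset.mem_singleton]
    exact ⟨fun h => hbd1 e he T' h T ha, fun h => h ▸ ha⟩
  · rw [Finset.disjoint_left]
    intro e he he'
    obtain ⟨hef, T₁, h1, T₂, h2, hne, hsub⟩ := Mesh.mem_interiorFacets.1 he
    exact hne (hbd1 e he' T₁ (Mesh.mem_adj.2 ⟨h1, hsub.trans Set.inter_subset_left⟩) T₂
      (Mesh.mem_adj.2 ⟨h2, hsub.trans Set.inter_subset_right⟩))
  · intro T hT F g hF hg hdiv
    refine (hfs T hT).integral_weakDiv (hsb T hT) hd hF.continuousOn_extendFrom hg ?_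
    exact hdiv.congr (hsb T hT).isOpen.measurableSet (fun x hx => (hF.extendFrom_eq_self hx).symm)
      fun _ _ => rfl

/-! ### Integration over elements and facets; traces of weakly differentiable functions. -/

namespace Mesh.Geometry

variable {M : Mesh Ω} {core : Set (Vec d) → Set (Vec d)} {nu : Set (Vec d) → Set (Vec d) → Vec d}

lemma ae_eq_iUnion (G : M.Geometry core nu) : Ω =ᵐ[volume] ⋃ T ∈ M.elements, T :=
  Filter.EventuallyLE.antisymm (ae_le_set.2 G.null)
    (LE.le.eventuallyLE (Set.iUnion₂_subset G.elem_sub))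

lemma integral_eq_sum (G : M.Geometry core nu) {f : Vec d → ℝ}
    (hf : ∀ T ∈ M.elements, IntegrableOn f T) :
    ∫ x in Ω, f x = ∑ T ∈ M.elements, ∫ x in T, f x := by
  rw [setIntegral_congr_set G.ae_eq_iUnion, integral_biUnion_finset]
  · exact fun T hT => (G.elem_open T hT).measurableSet
  · intro T hT T' hT' hne
    exact M.disjoint T hT T' hT' hne
  · exact hf

lemma volume_eq_sum (G : M.Geometry core nu) :
    volume.real Ω = ∑ T ∈ M.elements, volume.real T := by
  have := G.integral_eq_sum (f := fun _ => (1 : ℝ))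
    (fun T hT => integrableOn_const (G.elem_bdd T hT).measure_lt_top.ne)
  simpa using this

lemma ae_of_ae_elements (G : M.Geometry core nu) {p : Vec d → Prop}
    (h : ∀ T ∈ M.elements, ∀ x ∈ T, p x) : ∀ᵐ x ∂(volume.restrict Ω), p x := by
  rw [Measure.restrict_congr_set G.ae_eq_iUnion,
    ae_restrict_iff' (M.elements.measurableSet_biUnion fun T hT => (G.elem_open T hT).measurableSet)]
  refine Filter.Eventually.of_forall fun x hx => ?_
  obtain ⟨T, hT, hxT⟩ := Set.mem_iUnion₂.1 hx
  exact h T hT x hxT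

lemma ae_element (G : M.Geometry core nu) {p : Vec d → Prop} {T : Set (Vec d)}
    (hT : T ∈ M.elements) (h : ∀ᵐ x ∂(volume.restrict Ω), p x) :
    ∀ᵐ x ∂(volume.restrict T), p x :=
  ae_mono (Measure.restrict_mono (G.elem_sub T hT) le_rfl) h

lemma ae_core (G : M.Geometry core nu) {e : Set (Vec d)} (he : e ∈ M.facets) :
    ∀ᵐ x ∂((surf d).restrict e), x ∈ core e := by
  rw [ae_restrict_iff' (G.facet_compact e he).measurableSet]
  filter_upwards [measure_eq_zero_iff_ae_notMem.1 (G.core_null e he)] with x hx hxe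
  by_contra h
  exact hx ⟨hxe, h⟩

lemma mem_closure_of_facet {T e : Set (Vec d)} (he : e ∈ M.facetsOf T) {x : Vec d} (hx : x ∈ e) :
    x ∈ closure T := frontier_subset_closure ((Mesh.mem_facetsOf.1 he).2 hx)

lemma integrableOn_facet (G : M.Geometry core nu) {e : Set (Vec d)} (he : e ∈ M.facets)
    {f : Vec d → ℝ} (hf : ContinuousOn f e) : IntegrableOn f e (surf d) := by
  obtain ⟨C, hC⟩ := (G.facet_compact e he).exists_bound_of_continuousOn hf
  have hm := (G.facet_compact e he).measurableSet
  exact IntegrableOn.of_bound (G.facet_fin e he) (hf.aestronglyMeasurable hm) C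
    ((ae_restrict_iff' hm).2 (Filter.Eventually.of_forall hC))

/-- Sums over elements and their facets are sums over facets and their adjacent elements. -/
lemma sum_facets_comm (f : Set (Vec d) → Set (Vec d) → ℝ) :
    ∑ T ∈ M.elements, ∑ e ∈ M.facetsOf T, f T e = ∑ e ∈ M.facets, ∑ T ∈ M.adj e, f T e := by
  refine Finset.sum_comm' fun T e => ?_
  rw [Mesh.mem_facetsOf, Mesh.mem_adj]
  tauto

end Mesh.Geometry

namespace Mesh.Geometry

variable {d : ℕ} {Ω : Set (Vec d)} {M : Mesh Ω} {core : Set (Vec d) → Set (Vec d)}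
  {nu : Set (Vec d) → Set (Vec d) → Vec d}

lemma mem_facets {T e : Set (Vec d)} (he : e ∈ M.facetsOf T) : e ∈ M.facets :=
  (Mesh.mem_facetsOf.1 he).1

lemma facetsOf_of_adj {T e : Set (Vec d)} (he : e ∈ M.facets) (hT : T ∈ M.adj e) :
    T ∈ M.elements ∧ e ∈ M.facetsOf T :=
  ⟨(Mesh.mem_adj.1 hT).1, Mesh.mem_facetsOf.2 ⟨he, (Mesh.mem_adj.1 hT).2⟩⟩

lemma continuousOn_trace {F : Type*} [NormedAddCommGroup F] {T e : Set (Vec d)}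
    (he : e ∈ M.facetsOf T) {f : Vec d → F} (hf : Extends T f) :
    ContinuousOn (extendFrom T f) e :=
  hf.continuousOn_extendFrom.mono fun _ hx => mem_closure_of_facet he hx

/-- Integration by parts on an element. -/
lemma integral_parts (G : M.Geometry core nu) {T : Set (Vec d)} (hT : T ∈ M.elements)
    {F : Vec d → Vec d} {g v : Vec d → ℝ} (hF : Extends T F) (hg : IntegrableOn g T)
    (hdiv : HasWeakDiv T F g) (hv : ContDiff ℝ ∞ v) :
    ∫ x in T, (g x * v x + fderiv ℝ v x (F x)) =
      ∑ e ∈ M.facetsOf T, ∫ x in e, inner ℝ (extendFrom T F x) (nu T e) * v x ∂(surf d) := by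
  have ho := G.elem_open T hT
  have hb := G.elem_bdd T hT
  have hve : Extends T v := Extends.of_continuous hv.continuous
  have hve' : Extends T (fderiv ℝ v) := Extends.of_continuous (hv.continuous_fderiv (by simp))
  obtain ⟨C, hC⟩ := Extends.exists_bound hb hve
  have i1 : IntegrableOn (fun x => g x * v x) T := by
    refine hg.mul_bdd hv.continuous.aestronglyMeasurable (c := C) ?_
    exact (ae_restrict_iff' ho.measurableSet).2 (Filter.Eventually.of_forall hC)
  rw [G.div T hT _ (fun x => g x * v x + fderiv ℝ v x (F x)) (hve.smul hF) (i1.add ((hve'.clm_apply hF).integrableOn ho hb))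
    (hdiv.smul ho hb hF hg hv)]
  refine Finset.sum_congr rfl fun e he => ?_
  refine setIntegral_congr_fun (G.facet_compact e (mem_facets he)).measurableSet fun x hx => ?_
  have hxc := mem_closure_of_facet he hx
  rw [hve.extendFrom_comp₂ hF (Φ := fun a b => a • b) (by fun_prop) hxc,
    extendFrom_of_continuous hv.continuous hxc, real_inner_smul_left, mul_comm]

/-- If the facet functions `f e` are orthogonal to all test functions in the open set `W`, then
they vanish almost everywhere in `W`. -/
lemma ae_zero_of_test (G : M.Geometry core nu) {W : Set (Vec d)} (hW : IsOpen W)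
    {f : Set (Vec d) → Vec d → ℝ} (hf : ∀ e ∈ M.facets, IntegrableOn (f e) e (surf d))
    (h : ∀ φ, IsTestFun W φ → ∑ e ∈ M.facets, ∫ x in e, f e x * φ x ∂(surf d) = 0)
    {e : Set (Vec d)} (he : e ∈ M.facets) :
    ∀ᵐ x ∂((surf d).restrict e), x ∈ W → f e x = 0 := by
  classical
  -- Off the other facets only the term of `e` survives, and the other facets meet `e` in null sets.
  set V : Set (Vec d) := W ∩ (⋃ e' ∈ M.facets.erase e, e')ᶜ with hV
  have hcl : IsClosed (⋃ e' ∈ M.facets.erase e, e') :=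
    Set.Finite.isClosed_biUnion (M.facets.erase e).finite_toSet fun e' he' =>
      (G.facet_compact e' (Finset.mem_of_mem_erase he')).isClosed
  have hVo : IsOpen V := hW.inter hcl.isOpen_compl
  have key : ∀ᵐ x ∂((surf d).restrict e), x ∈ V → f e x = 0 := by
    refine hVo.ae_eq_zero_of_integral_contDiff_smul_eq_zero
      ((hf e he).locallyIntegrable.locallyIntegrableOn _) ?_
    intro φ hφ hφc hφV
    have h1 := h φ ⟨hφ, hφc, hφV.trans Set.inter_subset_left⟩
    rw [← Finset.add_sum_erase _ _ he, Finset.sum_eq_zero, add_zero] at h1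
    · rw [← h1]
      congr with x
      rw [smul_eq_mul, mul_comm]
    · intro e' he'
      refine setIntegral_eq_zero_of_forall_eq_zero fun x hx => ?_
      have : φ x = 0 := image_eq_zero_of_notMem_tsupport fun hxs =>
        (hφV hxs).2 (Set.mem_iUnion₂.2 ⟨e', he', hx⟩)
      rw [this, mul_zero]
  have hover : ∀ᵐ x ∂((surf d).restrict e), ∀ e' ∈ M.facets.erase e, x ∉ e' := by
    rw [Filter.eventually_all_finset]
    intro e' he'
    have hz := M.facet_overlap e he e' (Finset.mem_of_mem_erase he')
      (Finset.ne_of_mem_erase he').symm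
    rw [ae_restrict_iff' (G.facet_compact e he).measurableSet]
    filter_upwards [measure_eq_zero_iff_ae_notMem.1 hz] with x hx hxe hxe'
    exact hx ⟨hxe, hxe'⟩
  filter_upwards [key, hover] with x h1 h2 hxW
  refine h1 ⟨hxW, fun hx => ?_⟩
  obtain ⟨e', he', hxe'⟩ := Set.mem_iUnion₂.1 hx
  exact h2 e' he' hxe'

lemma volume_lt_top (G : M.Geometry core nu) : volume Ω < ⊤ := by
  rw [measure_congr G.ae_eq_iUnion]
  refine (measure_biUnion_finset_le _ _).trans_lt ?_
  exact ENNReal.sum_lt_top.2 fun T hT => (G.elem_bdd T hT).measure_lt_top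

lemma integral_restrict_test {S T : Set (Vec d)} (hTS : T ⊆ S)
    {f : Vec d → ℝ} (hf : ∀ x, x ∉ T → f x = 0) : ∫ x in S, f x = ∫ x in T, f x := by
  rw [setIntegral_eq_integral_of_forall_compl_eq_zero hf,
    setIntegral_eq_integral_of_forall_compl_eq_zero fun x hx => hf x fun h => hx (hTS h)]

/-- The weak derivative of a piecewise smooth function is the classical one on each element. -/
lemma weakPartial_ae_eq (G : M.Geometry core nu) {T : Set (Vec d)} (hT : T ∈ M.elements)
    {v g : Vec d → ℝ} {k : Fin d} (hv : MemC 1 T v) (hg : IntegrableOn g Ω)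
    (hw : IsWeakPartial Ω k v g) :
    ∀ᵐ x ∂(volume.restrict T), g x = fderiv ℝ v x (unitVec k) := by
  have ho := G.elem_open T hT
  have hb := G.elem_bdd T hT
  have hvd : Extends T fun x => fderiv ℝ v x (unitVec k) :=
    (hv.extends_fderiv le_rfl).fderiv_apply _
  have hgT : IntegrableOn g T := hg.mono_set (G.elem_sub T hT)
  have hvdi := hvd.integrableOn ho hb
  have key : ∀ᵐ x, x ∈ T → g x - fderiv ℝ v x (unitVec k) = 0 := by
    refine ho.ae_eq_zero_of_integral_contDiff_smul_eq_zero
      ((hgT.sub hvdi).locallyIntegrableOn) ?_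
    intro φ hφ hφc hφT
    have htT : IsTestFun T φ := ⟨hφ, hφc, hφT⟩
    have htΩ : IsTestFun Ω φ := ⟨hφ, hφc, hφT.trans (G.elem_sub T hT)⟩
    have hφ0 : ∀ x, x ∉ T → φ x = 0 := fun x hx =>
      image_eq_zero_of_notMem_tsupport fun h => hx (hφT h)
    have hφ1 : ∀ x, x ∉ T → fderiv ℝ φ x = 0 := fun x hx =>
      image_eq_zero_of_notMem_tsupport fun h => hx (hφT (tsupport_fderiv_subset ℝ h))
    have h1 := hw φ htΩ
    have h2 := htT.integral_mul_fderiv (fun x hx => hv.differentiableAt le_rfl ho hx) (unitVec k)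
      (hv.extends.integrableOn ho hb) hvdi
    rw [integral_restrict_test (G.elem_sub T hT)
        (fun x hx => by simp [partialD, hφ1 x hx]),
      integral_restrict_test (G.elem_sub T hT)
        (fun x hx => by simp [hφ0 x hx])] at h1
    simp only [partialD] at h1
    rw [h1, neg_inj] at h2
    obtain ⟨C, hC⟩ := hφc.exists_bound_of_continuous hφ.continuous
    have i1 : IntegrableOn (fun x => g x * φ x) T :=
      hgT.mul_bdd hφ.continuous.aestronglyMeasurable (Filter.Eventually.of_forall hC)
    have i2 : IntegrableOn (fun x => fderiv ℝ v x (unitVec k) * φ x) T :=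
      hvdi.mul_bdd hφ.continuous.aestronglyMeasurable (Filter.Eventually.of_forall hC)
    rw [← setIntegral_eq_integral_of_forall_compl_eq_zero (s := T)
      fun x hx => by simp [hφ0 x hx]]
    have e : ∀ x, φ x • (g x - fderiv ℝ v x (unitVec k)) =
        g x * φ x - fderiv ℝ v x (unitVec k) * φ x := fun x => by rw [smul_eq_mul]; ring
    simp_rw [e]
    rw [integral_sub i1 i2, h2, sub_self]
  rw [ae_restrict_iff' ho.measurableSet]
  filter_upwards [key] with x hx hxT
  linarith [hx hxT]

lemma memC_smul_const {T : Set (Vec d)} (ho : IsOpen T) {v : Vec d → ℝ} (hv : MemC 1 T v) (k j : Fin d) :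
    MemC 1 T fun x => (v x • unitVec k) j := by
  have e : (fun x => (v x • unitVec k) j) = fun x => (unitVec k : Vec d) j • v x := by
    ext x; simp [mul_comm]
  rw [e]
  refine ⟨hv.1.const_smul _, fun i hi => ?_⟩
  obtain ⟨g, hg, hgv⟩ := hv.2 i hi
  refine ⟨fun x => (unitVec k : Vec d) j • g x, hg.fun_const_smul _, fun x hx => ?_⟩
  change _ = (unitVec k : Vec d) j • g x
  rw [← hgv hx]
  exact iteratedFDeriv_const_smul_apply' ((hv.contDiffAt ho hx).of_le (by exact_mod_cast hi))

/-- A function that is weakly differentiable and piecewise smooth has no jumps. -/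
lemma trace_eq_of_weakPartial (G : M.Geometry core nu) {v : Vec d → ℝ}
    (hv : ∀ T ∈ M.elements, MemC 1 T v) {g : Fin d → Vec d → ℝ}
    (hg : ∀ k, IntegrableOn (g k) Ω) (hw : ∀ k, IsWeakPartial Ω k v (g k)) {e : Set (Vec d)}
    (he : e ∈ M.facets) (k : Fin d) :
    ∀ᵐ x ∂((surf d).restrict e), x ∈ Ω →
      ∑ T ∈ M.adj e, extendFrom T v x * nu T e k = 0 := by
  refine G.ae_zero_of_test G.omega_open (f := fun e x => ∑ T ∈ M.adj e, extendFrom T v x * nu T e k)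
    ?_ ?_ he
  · intro e he
    refine integrable_finsetSum _ fun T hT => ?_
    obtain ⟨hT', heT⟩ := facetsOf_of_adj he hT
    exact G.integrableOn_facet he
      ((continuousOn_trace heT (hv T hT').extends).mul continuousOn_const)
  · intro φ hφ
    -- This is the divergence theorem on `T` for the field `v φ` times the `k`-th basis vector.
    have hdiv : ∀ T ∈ M.elements, ∫ x in T, (fderiv ℝ v x (unitVec k) * φ x +
        v x * fderiv ℝ φ x (unitVec k)) =
        ∑ e ∈ M.facetsOf T, ∫ x in e, extendFrom T v x * nu T e k * φ x ∂(surf d) := by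
      intro T hT
      have ho := G.elem_open T hT
      have hb := G.elem_bdd T hT
      have hvT := hv T hT
      have hvd : Extends T fun x => fderiv ℝ v x (unitVec k) :=
        (hvT.extends_fderiv le_rfl).fderiv_apply _
      have hF : Extends T fun x => v x • unitVec k :=
        hvT.extends.smul (Extends.of_continuous continuous_const)
      have hwd : HasWeakDiv T (fun x => v x • unitVec k) fun x => fderiv ℝ v x (unitVec k) := by
        refine (hasWeakDiv_of_memC ho hb fun j => memC_smul_const ho hvT k j).congr ho.measurableSet
          (fun _ _ => rfl) fun x hx => ?_
        have : ∀ j, fderiv ℝ (fun y => (v y • unitVec k) j) x (unitVec j) =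
            (unitVec k : Vec d) j * fderiv ℝ v x (unitVec j) := by
          intro j
          have e : (fun y => (v y • unitVec k) j) = fun y => (unitVec k : Vec d) j * v y := by
            ext x; simp [mul_comm]
          rw [e, fderiv_const_mul (hvT.differentiableAt le_rfl ho hx)]
          simp
        simp only [this]
        rw [Finset.sum_eq_single k]
        · simp [unitVec]
        · intro j _ hj; simp [unitVec, hj]
        · simp
      have := G.integral_parts hT hF (hvd.integrableOn ho hb) hwd hφ.1
      simp only [map_smul, smul_eq_mul] at this
      rw [this]
      refine Finset.sum_congr rfl fun e he => ?_
      refine setIntegral_congr_fun (G.facet_compact e (mem_facets he)).measurableSet fun x hx => ?_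
      have hxc := mem_closure_of_facet he hx
      have e1 : extendFrom T (fun x => v x • unitVec k) x = extendFrom T v x • unitVec k :=
        hvT.extends.extendFrom_comp (Φ := fun a : ℝ => a • (unitVec k : Vec d)) (by fun_prop) hxc
      have e2 : inner ℝ (unitVec k) (nu T e) = nu T e k := by
        simp [unitVec, EuclideanSpace.inner_single_left]
      simp only []
      rw [e1, real_inner_smul_left, e2]
    -- The volume terms add up to the definition of the weak derivative on `Ω`, so the facet terms
    -- must cancel by themselves.
    have hsum : ∑ T ∈ M.elements, ∫ x in T, (fderiv ℝ v x (unitVec k) * φ x +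
        v x * fderiv ℝ φ x (unitVec k)) = 0 := by
      have h1 := hw k φ hφ
      obtain ⟨C, hC⟩ := hφ.2.1.exists_bound_of_continuous hφ.1.continuous
      have i1 : IntegrableOn (fun x => g k x * φ x) Ω :=
        (hg k).mul_bdd hφ.1.continuous.aestronglyMeasurable (Filter.Eventually.of_forall hC)
      have i2 : ∀ T ∈ M.elements, IntegrableOn (fun x => v x * fderiv ℝ φ x (unitVec k)) T :=
        fun T hT => ((hv T hT).extends.mul (hφ.extends_fderiv.fderiv_apply _)).integrableOn
          (G.elem_open T hT) (G.elem_bdd T hT)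
      simp only [partialD] at h1
      rw [G.integral_eq_sum i2, G.integral_eq_sum fun T hT => i1.mono_set (G.elem_sub T hT)] at h1
      have h2 : ∀ T ∈ M.elements, ∫ x in T, (fderiv ℝ v x (unitVec k) * φ x +
          v x * fderiv ℝ φ x (unitVec k)) =
          (∫ x in T, g k x * φ x) + ∫ x in T, v x * fderiv ℝ φ x (unitVec k) := by
        intro T hT
        rw [← integral_add (i1.mono_set (G.elem_sub T hT)) (i2 T hT)]
        refine integral_congr_ae ?_
        filter_upwards [G.weakPartial_ae_eq hT (hv T hT) (hg k) (hw k)] with x hx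
        rw [hx]
      rw [Finset.sum_congr rfl h2, Finset.sum_add_distrib, h1]
      ring
    rw [Finset.sum_congr rfl hdiv, sum_facets_comm] at hsum
    rw [← hsum]
    refine Finset.sum_congr rfl fun e he => ?_
    simp_rw [Finset.sum_mul]
    refine integral_finsetSum _ fun T hT => ?_
    obtain ⟨hT', heT⟩ := facetsOf_of_adj he hT
    exact G.integrableOn_facet he (((continuousOn_trace heT (hv T hT').extends).mul
      continuousOn_const).mul hφ.1.continuous.continuousOn)

/-- A function that is weakly differentiable and piecewise smooth has equal traces on interior
facets. -/
lemma trace_eq_interior (G : M.Geometry core nu) {v : Vec d → ℝ}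
    (hv : ∀ T ∈ M.elements, MemC 1 T v) {g : Fin d → Vec d → ℝ}
    (hg : ∀ k, IntegrableOn (g k) Ω) (hw : ∀ k, IsWeakPartial Ω k v (g k)) {e : Set (Vec d)}
    (he : e ∈ M.interiorFacets) :
    ∀ᵐ x ∂((surf d).restrict e), ∀ T ∈ M.adj e, ∀ T' ∈ M.adj e,
      extendFrom T v x = extendFrom T' v x := by
  have hef := (Mesh.mem_interiorFacets.1 he).1
  obtain ⟨T₁, h1, T₂, h2, hne, hadj, hnu, hcΩ⟩ := G.interior e he
  have hall := ae_all_iff.2 fun k => G.trace_eq_of_weakPartial hv hg hw hef k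
  filter_upwards [hall, G.ae_core hef] with x hx hxc
  have key : extendFrom T₁ v x = extendFrom T₂ v x := by
    have hmem : T₁ ∈ M.adj e := by rw [hadj]; simp
    have hnorm := G.nu_norm T₁ h1 e (facetsOf_of_adj hef hmem).2
    -- One nonzero component of the unit normal suffices to read off equality of the two traces.
    obtain ⟨k, hk⟩ : ∃ k, nu T₁ e k ≠ 0 := by
      by_contra hcon
      push Not at hcon
      have : nu T₁ e = 0 := by ext k; simpa using hcon k
      rw [this] at hnorm
      simp at hnorm
    have := hx k (hcΩ hxc)
    rw [hadj, Finset.sum_pair hne, hnu] at this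
    have e2 : (extendFrom T₁ v x - extendFrom T₂ v x) * nu T₁ e k = 0 := by
      rw [← this]; simp; ring
    exact sub_eq_zero.1 ((mul_eq_zero.1 e2).resolve_right hk)
  intro T hT T' hT'
  rw [hadj, Finset.mem_insert, Finset.mem_singleton] at hT hT'
  rcases hT with rfl | rfl <;> rcases hT' with rfl | rfl <;> simp [key]

end Mesh.Geometry

lemma memC_one_of_extends {d : ℕ} {T : Set (Vec d)} {f : Vec d → ℝ} (hf : ContDiffOn ℝ 1 f T)
    (h0 : Extends T f) (h1 : Extends T (fderiv ℝ f)) : MemC 1 T f := by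
  refine ⟨by exact_mod_cast hf, fun k hk => ?_⟩
  interval_cases k
  · obtain ⟨g, hg, hfg⟩ := h0
    let e := (continuousMultilinearCurryFin0 ℝ (Vec d) ℝ).symm
    refine ⟨fun x => e (g x), e.continuous.comp_continuousOn hg, fun x hx => ?_⟩
    change _ = e (g x)
    rw [← hfg hx]
    rfl
  · obtain ⟨g, hg, hfg⟩ := h1
    let e := (continuousMultilinearCurryFin1 ℝ (Vec d) ℝ).symm
    refine ⟨fun x => e (g x), e.continuous.comp_continuousOn hg, fun x hx => ?_⟩
    change _ = e (g x)
    rw [← hfg hx]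
    ext m
    simp [e, iteratedFDeriv_one_apply]

lemma MemC.mul_one {d : ℕ} {T : Set (Vec d)} (ho : IsOpen T) {f g : Vec d → ℝ} (hf : MemC 1 T f)
    (hg : MemC 1 T g) : MemC 1 T fun x => f x * g x := by
  refine memC_one_of_extends (by exact_mod_cast hf.1.mul hg.1) (hf.extends.mul hg.extends) ?_
  have h1 : Extends T fun x => f x • fderiv ℝ g x :=
    hf.extends.comp₂ (hg.extends_fderiv le_rfl) (Φ := fun a b => a • b) (by fun_prop)
  have h2 : Extends T fun x => g x • fderiv ℝ f x :=
    hg.extends.comp₂ (hf.extends_fderiv le_rfl) (Φ := fun a b => a • b) (by fun_prop)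
  refine (h1.comp₂ h2 (Φ := fun a b => a + b) (by fun_prop)).congr fun x hx => ?_
  exact (fderiv_fun_mul (hf.differentiableAt le_rfl ho hx) (hg.differentiableAt le_rfl ho hx)).symm

/-! ### Averages and jumps on facets with two neighbours or one. -/

namespace Mesh

variable {d : ℕ} {Ω : Set (Vec d)} {M : Mesh Ω} {core : Set (Vec d) → Set (Vec d)}
  {nu : Set (Vec d) → Set (Vec d) → Vec d}

/-- `e` is the interior facet between `T₁` and `T₂`, with normal `n` pointing from `T₁` to `T₂`. -/
structure IsInt (M : Mesh Ω) (nu : Set (Vec d) → Set (Vec d) → Vec d) (e T₁ T₂ : Set (Vec d))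
    (n : Vec d) : Prop where
  mem : e ∈ M.facets
  mem₁ : T₁ ∈ M.elements
  mem₂ : T₂ ∈ M.elements
  facet₁ : e ∈ M.facetsOf T₁
  facet₂ : e ∈ M.facetsOf T₂
  ne : T₁ ≠ T₂
  adj : M.adj e = {T₁, T₂}
  nu₁ : nu T₁ e = n
  nu₂ : nu T₂ e = -n
  norm : ‖n‖ = 1

/-- `e` is a boundary facet of the element `T`, with outward normal `n`. -/
structure IsBd (M : Mesh Ω) (nu : Set (Vec d) → Set (Vec d) → Vec d) (e T : Set (Vec d))
    (n : Vec d) : Prop where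
  mem : e ∈ M.facets
  memT : T ∈ M.elements
  facet : e ∈ M.facetsOf T
  adj : M.adj e = {T}
  nu_eq : nu T e = n
  norm : ‖n‖ = 1

namespace Geometry

lemma exists_isInt (G : M.Geometry core nu) {e : Set (Vec d)} (he : e ∈ M.interiorFacets) :
    ∃ T₁ T₂ n, M.IsInt nu e T₁ T₂ n := by
  have hef := (Mesh.mem_interiorFacets.1 he).1
  obtain ⟨T₁, h1, T₂, h2, hne, hadj, hnu, -⟩ := G.interior e he
  have a1 : T₁ ∈ M.adj e := by rw [hadj]; simp
  have a2 : T₂ ∈ M.adj e := by rw [hadj]; simp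
  exact ⟨T₁, T₂, nu T₁ e, hef, h1, h2, (facetsOf_of_adj hef a1).2, (facetsOf_of_adj hef a2).2, hne,
    hadj, rfl, hnu, G.nu_norm T₁ h1 e (facetsOf_of_adj hef a1).2⟩

lemma exists_isBd (G : M.Geometry core nu) {e : Set (Vec d)} (he : e ∈ M.boundaryFacets) :
    ∃ T n, M.IsBd nu e T n := by
  have hef := (Mesh.mem_boundaryFacets.1 he).1
  obtain ⟨T, hT, hadj⟩ := G.boundary e he
  have a1 : T ∈ M.adj e := by rw [hadj]; simp
  exact ⟨T, nu T e, hef, hT, (facetsOf_of_adj hef a1).2, hadj, rfl,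
    G.nu_norm T hT e (facetsOf_of_adj hef a1).2⟩

end Geometry

section Traces

variable {e T T₁ T₂ : Set (Vec d)} {n : Vec d}

lemma IsInt.avg_eq {F : Type*} [NormedAddCommGroup F] [NormedSpace ℝ F]
    (h : M.IsInt nu e T₁ T₂ n) (f : Vec d → F) (x : Vec d) :
    M.avg e f x = (1 / 2 : ℝ) • (extendFrom T₁ f x + extendFrom T₂ f x) := by
  rw [Mesh.avg, h.adj, Finset.sum_pair h.ne, Finset.card_pair h.ne]
  norm_num

lemma IsBd.avg_eq {F : Type*} [NormedAddCommGroup F] [NormedSpace ℝ F]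
    (h : M.IsBd nu e T n) (f : Vec d → F) (x : Vec d) : M.avg e f x = extendFrom T f x := by
  rw [Mesh.avg, h.adj, Finset.sum_singleton, Finset.card_singleton]
  norm_num

lemma IsBd.jump_eq (h : M.IsBd nu e T n) (G : M.Geometry core nu) (v : Vec d → ℝ)
    {x : Vec d} (hx : x ∈ core e) : M.jump e v x = extendFrom T v x • n := by
  rw [Mesh.jump, h.adj, Finset.sum_singleton, G.outerNormal_eq T h.memT e h.facet x hx, h.nu_eq]

lemma IsBd.vecJump_eq (h : M.IsBd nu e T n) (G : M.Geometry core nu) (w : Vec d → Vec d)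
    {x : Vec d} (hx : x ∈ core e) : M.vecJump e w x = inner ℝ (extendFrom T w x) n := by
  rw [Mesh.vecJump, h.adj, Finset.sum_singleton, G.outerNormal_eq T h.memT e h.facet x hx, h.nu_eq]

end Traces

end Mesh

/-! ### Regularity of coefficients and of the fields built from them. -/

/-- Piecewise regularity of the coefficients, as needed for the bilinear form. -/
structure Coeffs.Regular {d : ℕ} (c : Coeffs d) {Ω : Set (Vec d)} (M : Mesh Ω) : Prop where
  K_ext : ∀ T ∈ M.elements, Extends T c.Kop
  beta_C : ∀ T ∈ M.elements, ∀ j, MemC 1 T fun x => c.β x j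
  sigma_ext : ∀ T ∈ M.elements, Extends T c.σ

lemma Extends.toEuclideanCLM {d : ℕ} {T : Set (Vec d)} {K : Vec d → Matrix (Fin d) (Fin d) ℝ}
    (hK : ∀ j m, Extends T fun x => K x j m) :
    Extends T fun x => (Matrix.toEuclideanCLM (𝕜 := ℝ) (K x) : Vec d →L[ℝ] Vec d) := by
  choose g hg hKg using hK
  refine ⟨fun x => Matrix.toEuclideanCLM (𝕜 := ℝ) (Matrix.of fun j m => g j m x), ?_,
    fun x hx => ?_⟩
  · have hlin : Continuous fun A : Matrix (Fin d) (Fin d) ℝ =>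
        (Matrix.toEuclideanCLM (𝕜 := ℝ) A : Vec d →L[ℝ] Vec d) :=
      LinearMap.continuous_of_finiteDimensional
        ((Matrix.toEuclideanCLM (n := Fin d) (𝕜 := ℝ)).toAlgEquiv.toLinearEquiv.toLinearMap)
    refine hlin.comp_continuousOn ?_
    exact continuousOn_pi.2 fun j => continuousOn_pi.2 fun m => hg j m
  · have : K x = Matrix.of fun j m => g j m x := by
      ext j m; exact hKg j m hx
    simp only [this]

namespace Coeffs.Regular

variable {d : ℕ} {Ω : Set (Vec d)} {M : Mesh Ω} {c : Coeffs d} {core : Set (Vec d) → Set (Vec d)}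
  {nu : Set (Vec d) → Set (Vec d) → Vec d} {T : Set (Vec d)}

lemma beta_ext (h : c.Regular M) (hT : T ∈ M.elements) : Extends T c.β :=
  Extends.of_coord fun k => (h.beta_C T hT k).extends

lemma divg_eqOn (h : c.Regular M) (G : M.Geometry core nu) (hT : T ∈ M.elements) :
    Set.EqOn (divg c.β) (fun x => ∑ k, fderiv ℝ (fun y => c.β y k) x (unitVec k)) T := fun _ hx =>
  divg_eq_sum fun k => (h.beta_C T hT k).differentiableAt le_rfl (G.elem_open T hT) hx

lemma divg_ext (h : c.Regular M) (G : M.Geometry core nu) (hT : T ∈ M.elements) :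
    Extends T (divg c.β) :=
  (Extends.finset_sum (T := T) Finset.univ fun k _ =>
    ((h.beta_C T hT k).extends_fderiv le_rfl).fderiv_apply (unitVec k)).congr
    (h.divg_eqOn G hT).symm

lemma hasWeakDiv_beta (h : c.Regular M) (G : M.Geometry core nu) (hT : T ∈ M.elements) :
    HasWeakDiv T c.β (divg c.β) :=
  (hasWeakDiv_of_memC (G.elem_open T hT) (G.elem_bdd T hT) (h.beta_C T hT)).congr
    (G.elem_open T hT).measurableSet (fun _ _ => rfl) (h.divg_eqOn G hT).symm

lemma diffFlux_ext (h : c.Regular M) (hT : T ∈ M.elements) {v : Vec d → ℝ}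
    (hv : Extends T (∇ v)) : Extends T (c.diffFlux v) :=
  (h.K_ext T hT).comp₂ hv (Φ := fun L v => L v) (continuous_fst.clm_apply continuous_snd)

lemma hasWeakDiv_smul_beta (h : c.Regular M) (G : M.Geometry core nu) (hT : T ∈ M.elements)
    {u : Vec d → ℝ} (hu : MemC 1 T u) :
    HasWeakDiv T (fun x => u x • c.β x)
      (fun x => inner ℝ (c.β x) (∇ u x) + divg c.β x * u x) := by
  have ho := G.elem_open T hT
  refine (hasWeakDiv_of_memC ho (G.elem_bdd T hT) (F := fun x => u x • c.β x)
    fun k => ?_).congr ho.measurableSet (fun _ _ => rfl) fun x hx => ?_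
  · exact hu.mul_one ho (h.beta_C T hT k)
  · have e : ∀ k, fderiv ℝ (fun y => (u y • c.β y) k) x (unitVec k) =
        u x * fderiv ℝ (fun y => c.β y k) x (unitVec k) + c.β x k * fderiv ℝ u x (unitVec k) := by
      intro k
      have : (fun y => (u y • c.β y) k) = fun y => u y * c.β y k := by ext y; simp
      rw [this, fderiv_fun_mul (hu.differentiableAt le_rfl ho hx)
        ((h.beta_C T hT k).differentiableAt le_rfl ho hx)]
      simp
    have hdiv := h.divg_eqOn G hT hx
    simp only at hdiv
    simp only [e]
    rw [Finset.sum_add_distrib, ← Finset.mul_sum, ← hdiv, real_inner_comm,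
      inner_gradient, clm_apply_eq_sum (fderiv ℝ u x) (c.β x)]
    ring

end Coeffs.Regular

/-! ### The flux of a weak solution. -/

section WeakSolution

variable {d : ℕ} {Ω : Set (Vec d)} {M : Mesh Ω} {c : Coeffs d} {core : Set (Vec d) → Set (Vec d)}
  {nu : Set (Vec d) → Set (Vec d) → Vec d} {D N : Finset (Set (Vec d))} {gD gN u : Vec d → ℝ}

/-- The weak divergence `β · ∇u + (σ + div β) u` of the diffusive flux of a solution. -/
noncomputable def Coeffs.fluxDiv (c : Coeffs d) (u : Vec d → ℝ) (x : Vec d) : ℝ :=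
  inner ℝ (c.β x) (∇ u x) + (c.σ x + divg c.β x) * u x

lemma Coeffs.Regular.fluxDiv_ext (h : c.Regular M) (G : M.Geometry core nu) {T : Set (Vec d)}
    (hT : T ∈ M.elements) (hu : MemC 1 T u) : Extends T (c.fluxDiv u) :=
  ((h.beta_ext hT).dot (hu.extends_gradient le_rfl)).add
    (((h.sigma_ext T hT).add (h.divg_ext G hT)).mul hu.extends)

lemma gradient_apply_coord (f : Vec d → ℝ) (x : Vec d) (k : Fin d) :
    ∇ f x k = fderiv ℝ f x (unitVec k) := by
  have h := inner_gradient f x (unitVec k)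
  rw [unitVec, EuclideanSpace.inner_single_right] at h
  simpa [unitVec] using h

/-- The weak formulation with the weak gradient replaced by the broken one. -/
lemma weakForm_broken (G : M.Geometry core nu) (h : c.Regular M)
    (hu : ∀ T ∈ M.elements, MemC 1 T u)
    (hsol : c.IsWeakSolution M D N (fun _ => 0) gD gN u) {φ : Vec d → ℝ}
    (hφ : IsTestFun (⋃ e ∈ D, e)ᶜ φ) :
    ∑ T ∈ M.elements, ∫ x in T, (c.fluxDiv u x * φ x + fderiv ℝ φ x (c.diffFlux u x)) =
      - ∑ e ∈ N, ∫ x in e, gN x * φ x ∂(surf d) := by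
  obtain ⟨⟨Gr, -, hGr, hweak, htest⟩, -⟩ := hsol
  have : IsFiniteMeasure (volume.restrict Ω) := ⟨by simpa using G.volume_lt_top⟩
  have hGk : ∀ k, IntegrableOn (fun x => Gr x k) Ω := fun k => by
    have h1 : MemLp (fun x => Gr x k) 2 (volume.restrict Ω) :=
      (EuclideanSpace.proj k : Vec d →L[ℝ] ℝ).comp_memLp' hGr
    exact h1.integrable (by norm_num)
  have hae : ∀ T ∈ M.elements, ∀ᵐ x ∂(volume.restrict T), Gr x = ∇ u x := by
    intro T hT
    filter_upwards [ae_all_iff.2 fun k => G.weakPartial_ae_eq hT (hu T hT) (hGk k) (hweak k)]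
      with x hx
    ext k
    rw [gradient_apply_coord]
    exact hx k
  have h1 := htest φ hφ
  simp only [zero_mul, integral_zero, zero_sub] at h1
  rw [← h1]
  have hcong : ∀ T ∈ M.elements, (fun x => inner ℝ (c.Kop x (Gr x)) (∇ φ x) +
      inner ℝ (c.β x) (Gr x) * φ x + (c.σ x + divg c.β x) * u x * φ x) =ᵐ[volume.restrict T]
      fun x => c.fluxDiv u x * φ x + fderiv ℝ φ x (c.diffFlux u x) := by
    intro T hT
    filter_upwards [hae T hT] with x hx
    rw [hx, Coeffs.fluxDiv, ← inner_gradient, Coeffs.diffFlux, real_inner_comm]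
    ring
  have hfint : ∀ T ∈ M.elements,
      IntegrableOn (fun x => c.fluxDiv u x * φ x + fderiv ℝ φ x (c.diffFlux u x)) T := fun T hT =>
    (((h.fluxDiv_ext G hT (hu T hT)).mul hφ.extends).add (hφ.extends_fderiv.clm_apply
      (h.diffFlux_ext hT ((hu T hT).extends_gradient le_rfl)))).integrableOn (G.elem_open T hT)
      (G.elem_bdd T hT)
  rw [G.integral_eq_sum fun T hT => (hfint T hT).congr (hcong T hT).symm]
  exact Finset.sum_congr rfl fun T hT => integral_congr_ae (hcong T hT).symm

/-- The flux of a weak solution has a weak divergence on each element. -/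
lemma hasWeakDiv_flux (hDN : ∀ e, e ∈ M.boundaryFacets ↔ e ∈ D ∨ e ∈ N)
    (G : M.Geometry core nu) (h : c.Regular M)
    (hu : ∀ T ∈ M.elements, MemC 1 T u)
    (hsol : c.IsWeakSolution M D N (fun _ => 0) gD gN u) {T : Set (Vec d)}
    (hT : T ∈ M.elements) : HasWeakDiv T (c.diffFlux u) (c.fluxDiv u) := by
  intro φ hφ
  have hφ0 : ∀ x, x ∉ T → φ x = 0 := fun x hx =>
    image_eq_zero_of_notMem_tsupport fun h => hx (hφ.2.2 h)
  have hφ1 : ∀ x, x ∉ T → fderiv ℝ φ x = 0 := fun x hx =>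
    image_eq_zero_of_notMem_tsupport fun h => hx (hφ.2.2 (tsupport_fderiv_subset ℝ h))
  have hdis : ∀ e ∈ M.boundaryFacets, ∀ x ∈ e, x ∉ T := fun e he x hx hxT =>
    Set.disjoint_left.1 (G.boundary_not_mem e he) hx (G.elem_sub T hT hxT)
  -- A function supported in one open element vanishes near every boundary facet. So it may be used
  -- in the weak formulation, and the Neumann term drops out.
  have htest : IsTestFun (⋃ e ∈ D, e)ᶜ φ := by
    refine ⟨hφ.1, hφ.2.1, fun x hx hx' => ?_⟩
    obtain ⟨e, he, hxe⟩ := Set.mem_iUnion₂.1 hx'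
    exact hdis e ((hDN e).2 (Or.inl he)) x hxe (hφ.2.2 hx)
  have h1 := weakForm_broken G h hu hsol htest
  have e1 : ∑ e ∈ N, ∫ x in e, gN x * φ x ∂(surf d) = 0 := by
    refine Finset.sum_eq_zero fun e he => setIntegral_eq_zero_of_forall_eq_zero fun x hx => ?_
    rw [hφ0 x (hdis e ((hDN e).2 (Or.inr he)) x hx), mul_zero]
  rw [e1, neg_zero, Finset.sum_eq_single_of_mem T hT] at h1
  · have ho := G.elem_open T hT
    have hb := G.elem_bdd T hT
    rw [integral_add] at h1
    · linarith
    · exact ((h.fluxDiv_ext G hT (hu T hT)).mul hφ.extends).integrableOn ho hb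
    · exact (hφ.extends_fderiv.clm_apply
        (h.diffFlux_ext hT ((hu T hT).extends_gradient le_rfl))).integrableOn ho hb
  · intro T' hT' hne
    refine setIntegral_eq_zero_of_forall_eq_zero fun x hx => ?_
    have hxT : x ∉ T := fun hxT => Set.disjoint_left.1 (M.disjoint T' hT' T hT hne) hx hxT
    simp [hφ0 x hxT, hφ1 x hxT]

lemma ae_notMem_of_ne (G : M.Geometry core nu) {e : Set (Vec d)} (he : e ∈ M.facets)
    {S : Finset (Set (Vec d))} (hS : S ⊆ M.facets) (heS : e ∉ S) :
    ∀ᵐ x ∂((surf d).restrict e), x ∈ (⋃ e ∈ S, e)ᶜ := by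
  have hover : ∀ᵐ x ∂((surf d).restrict e), ∀ e' ∈ S, x ∉ e' := by
    rw [Filter.eventually_all_finset]
    intro e' he'
    have hz := M.facet_overlap e he e' (hS he') (by rintro rfl; exact heS he')
    rw [ae_restrict_iff' (G.facet_compact e he).measurableSet]
    filter_upwards [measure_eq_zero_iff_ae_notMem.1 hz] with x hx hxe hxe'
    exact hx ⟨hxe, hxe'⟩
  filter_upwards [hover] with x hx hx'
  obtain ⟨e', he', hxe'⟩ := Set.mem_iUnion₂.1 hx'
  exact hx e' he' hxe'

open Classical in
/-- The normal flux of a weak solution does not jump and satisfies the Neumann condition. -/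
lemma ae_flux_jump (hDN : ∀ e, e ∈ M.boundaryFacets ↔ e ∈ D ∨ e ∈ N)
    (G : M.Geometry core nu) (h : c.Regular M)
    (hu : ∀ T ∈ M.elements, MemC 1 T u)
    (hgN : ∀ e ∈ N, MemLp gN 2 ((surf d).restrict e))
    (hsol : c.IsWeakSolution M D N (fun _ => 0) gD gN u) {e : Set (Vec d)}
    (he : e ∈ M.facets) (heD : e ∉ D) :
    ∀ᵐ x ∂((surf d).restrict e), (∑ T ∈ M.adj e, inner ℝ (extendFrom T (c.diffFlux u) x) (nu T e))
      + (if e ∈ N then gN x else 0) = 0 := by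
  have hD : D ⊆ M.facets := fun e he => (Mesh.mem_boundaryFacets.1 ((hDN e).2 (Or.inl he))).1
  have hN : N ⊆ M.facets := fun e he => (Mesh.mem_boundaryFacets.1 ((hDN e).2 (Or.inr he))).1
  have hW : IsOpen (⋃ e ∈ D, e)ᶜ :=
    (Set.Finite.isClosed_biUnion D.finite_toSet fun e he =>
      (G.facet_compact e (hD he)).isClosed).isOpen_compl
  have hflux : ∀ T ∈ M.elements, Extends T (c.diffFlux u) := fun T hT =>
    h.diffFlux_ext hT ((hu T hT).extends_gradient le_rfl)
  have hcont : ∀ e ∈ M.facets, ∀ T ∈ M.adj e,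
      ContinuousOn (fun x => inner ℝ (extendFrom T (c.diffFlux u) x) (nu T e)) e := by
    intro e he T hT
    obtain ⟨hT', heT⟩ := Mesh.Geometry.facetsOf_of_adj he hT
    exact (Mesh.Geometry.continuousOn_trace heT (hflux T hT')).inner continuousOn_const
  have hgNi : ∀ e ∈ N, IntegrableOn gN e (surf d) := by
    intro e he
    have : IsFiniteMeasure ((surf d).restrict e) := ⟨by simpa using G.facet_fin e (hN he)⟩
    exact (hgN e he).integrable (by norm_num)
  -- After elementwise integration by parts the weak formulation retains only facet integrals of the
  -- normal flux jumps and of `gN`. Test functions vanishing near `Γ_D` then isolate each facet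
  -- outside `D`.
  have key := G.ae_zero_of_test hW (f := fun e x =>
    (∑ T ∈ M.adj e, inner ℝ (extendFrom T (c.diffFlux u) x) (nu T e))
      + (if e ∈ N then gN x else 0)) ?_ ?_ he
  · filter_upwards [key, ae_notMem_of_ne G he hD heD] with x hx hx'
    exact hx hx'
  · intro e he
    refine Integrable.add ?_ ?_
    · exact integrable_finsetSum _ fun T hT => G.integrableOn_facet he (hcont e he T hT)
    · by_cases heN : e ∈ N
      · simp only [heN, if_true]
        exact hgNi e heN
      · simp [heN]
  · intro φ hφ
    have h1 := weakForm_broken G h hu hsol hφ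
    have h2 : ∀ T ∈ M.elements, _ := fun T hT => G.integral_parts hT (hflux T hT)
      ((h.fluxDiv_ext G hT (hu T hT)).integrableOn (G.elem_open T hT) (G.elem_bdd T hT))
      (hasWeakDiv_flux hDN G h hu hsol hT) hφ.1
    rw [Finset.sum_congr rfl h2, Mesh.Geometry.sum_facets_comm] at h1
    obtain ⟨C, hC⟩ := hφ.2.1.exists_bound_of_continuous hφ.1.continuous
    have h3 : ∀ e ∈ M.facets, ∫ x in e,
        ((∑ T ∈ M.adj e, inner ℝ (extendFrom T (c.diffFlux u) x) (nu T e))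
          + (if e ∈ N then gN x else 0)) * φ x ∂(surf d) =
        (∑ T ∈ M.adj e, ∫ x in e, inner ℝ (extendFrom T (c.diffFlux u) x) (nu T e) * φ x ∂(surf d))
          + if e ∈ N then ∫ x in e, gN x * φ x ∂(surf d) else 0 := by
      intro e he
      have i1 : ∀ T ∈ M.adj e, IntegrableOn
          (fun x => inner ℝ (extendFrom T (c.diffFlux u) x) (nu T e) * φ x) e (surf d) :=
        fun T hT => G.integrableOn_facet he
          ((hcont e he T hT).mul hφ.1.continuous.continuousOn)
      simp_rw [add_mul, Finset.sum_mul]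
      by_cases heN : e ∈ N
      · simp only [heN, if_true]
        rw [integral_add (integrable_finsetSum _ i1), integral_finsetSum _ i1]
        exact (hgNi e heN).mul_bdd hφ.1.continuous.aestronglyMeasurable
          (Filter.Eventually.of_forall hC)
      · simp only [heN, if_false, zero_mul, add_zero]
        rw [integral_finsetSum _ i1]
    rw [Finset.sum_congr rfl h3, Finset.sum_add_distrib, h1, ← Finset.sum_filter,
      Finset.filter_mem_eq_inter, Finset.inter_eq_right.2 hN]
    ring

end WeakSolution

/-! ### The forms of the method, rewritten with constant facet normals. -/

namespace Mesh

variable {d : ℕ} {Ω : Set (Vec d)}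

/-- The jump, written with the constant normals of the facets. -/
noncomputable def jmp (M : Mesh Ω) (nu : Set (Vec d) → Set (Vec d) → Vec d) (e : Set (Vec d))
    (v : Vec d → ℝ) (x : Vec d) : Vec d :=
  ∑ T ∈ M.adj e, extendFrom T v x • nu T e

/-- `|β · n_e|`, written with the constant normals of the facets. -/
noncomputable def abn (M : Mesh Ω) (nu : Set (Vec d) → Set (Vec d) → Vec d) (e : Set (Vec d))
    (β : Vec d → Vec d) (x : Vec d) : ℝ :=
  ((M.adj e).card : ℝ)⁻¹ * ∑ T ∈ M.adj e, |inner ℝ (extendFrom T β x) (nu T e)|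

/-- Half the sum of the traces. -/
noncomputable def mean (M : Mesh Ω) (e : Set (Vec d)) (v : Vec d → ℝ) (x : Vec d) : ℝ :=
  1 / 2 * ∑ T ∈ M.adj e, extendFrom T v x

open Classical in
/-- The facets carrying the diffusive terms. -/
noncomputable def active (M : Mesh Ω) (D : Finset (Set (Vec d))) : Finset (Set (Vec d)) :=
  M.interiorFacets ∪ D

variable {M : Mesh Ω} {core : Set (Vec d) → Set (Vec d)}
  {nu : Set (Vec d) → Set (Vec d) → Vec d} {e : Set (Vec d)}

lemma continuousOn_avg {F : Type*} [NormedAddCommGroup F] [NormedSpace ℝ F] (he : e ∈ M.facets)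
    {f : Vec d → F} (hf : ∀ T ∈ M.elements, Extends T f) : ContinuousOn (M.avg e f) e := by
  refine ContinuousOn.const_smul (continuousOn_finsetSum _ fun T hT => ?_) _
  obtain ⟨hT', heT⟩ := Geometry.facetsOf_of_adj he hT
  exact Geometry.continuousOn_trace heT (hf T hT')

lemma continuousOn_jmp (he : e ∈ M.facets) {v : Vec d → ℝ}
    (hv : ∀ T ∈ M.elements, Extends T v) : ContinuousOn (M.jmp nu e v) e := by
  refine continuousOn_finsetSum _ fun T hT => ?_
  obtain ⟨hT', heT⟩ := Geometry.facetsOf_of_adj he hT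
  exact (Geometry.continuousOn_trace heT (hv T hT')).smul continuousOn_const

lemma continuousOn_abn (he : e ∈ M.facets) {β : Vec d → Vec d}
    (hv : ∀ T ∈ M.elements, Extends T β) : ContinuousOn (M.abn nu e β) e := by
  refine continuousOn_const.mul (continuousOn_finsetSum _ fun T hT => ?_)
  obtain ⟨hT', heT⟩ := Geometry.facetsOf_of_adj he hT
  exact ((Geometry.continuousOn_trace heT (hv T hT')).inner continuousOn_const).abs

lemma continuousOn_mean (he : e ∈ M.facets) {v : Vec d → ℝ}
    (hv : ∀ T ∈ M.elements, Extends T v) : ContinuousOn (M.mean e v) e := by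
  refine continuousOn_const.mul (continuousOn_finsetSum _ fun T hT => ?_)
  obtain ⟨hT', heT⟩ := Geometry.facetsOf_of_adj he hT
  exact Geometry.continuousOn_trace heT (hv T hT')

namespace Geometry

lemma jump_eq (G : M.Geometry core nu) (he : e ∈ M.facets) (v : Vec d → ℝ) {x : Vec d}
    (hx : x ∈ core e) : M.jump e v x = M.jmp nu e v x := by
  refine Finset.sum_congr rfl fun T hT => ?_
  obtain ⟨hT', heT⟩ := Geometry.facetsOf_of_adj he hT
  rw [G.outerNormal_eq T hT' e heT x hx]

lemma absNormal_eq (G : M.Geometry core nu) (he : e ∈ M.facets) (β : Vec d → Vec d) {x : Vec d}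
    (hx : x ∈ core e) : M.absNormal e β x = M.abn nu e β x := by
  rw [Mesh.absNormal, Mesh.abn]
  congr 1
  refine Finset.sum_congr rfl fun T hT => ?_
  obtain ⟨hT', heT⟩ := Geometry.facetsOf_of_adj he hT
  rw [G.outerNormal_eq T hT' e heT x hx]

end Geometry

end Mesh

/-- The hypotheses on mesh and coefficients, in the form in which they are used. -/
structure Setting {d : ℕ} {Ω : Set (Vec d)} (M : Mesh Ω) (core : Set (Vec d) → Set (Vec d))
    (nu : Set (Vec d) → Set (Vec d) → Vec d) (c : Coeffs d) (D N : Finset (Set (Vec d))) :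
    Prop where
  geom : M.Geometry core nu
  reg : c.Regular M
  DN : ∀ e, e ∈ M.boundaryFacets ↔ e ∈ D ∨ e ∈ N
  disj : Disjoint D N
  beta_trace : ∀ e ∈ M.facets, ∀ᵐ x ∂((surf d).restrict e), ∀ T ∈ M.adj e,
    extendFrom T c.β x = M.avg e c.β x
  beta_D : ∀ e ∈ D, ∀ᵐ x ∂((surf d).restrict e), ∀ T ∈ M.adj e,
    inner ℝ (M.avg e c.β x) (nu T e) ≤ 0
  beta_N : ∀ e ∈ N, ∀ᵐ x ∂((surf d).restrict e), ∀ T ∈ M.adj e,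
    0 ≤ inner ℝ (M.avg e c.β x) (nu T e)

namespace Coeffs

variable {d : ℕ} {Ω : Set (Vec d)} (c : Coeffs d) (M : Mesh Ω)
  (nu : Set (Vec d) → Set (Vec d) → Vec d) (D : Finset (Set (Vec d)))

/-- Diffusive energy. -/
noncomputable def formA (w z : Vec d → ℝ) : ℝ :=
  ∑ T ∈ M.elements, ∫ x in T, inner ℝ (c.diffFlux w x) (∇ z x)

/-- Diffusive consistency term. -/
noncomputable def formP (w z : Vec d → ℝ) : ℝ :=
  ∑ e ∈ M.active D, ∫ x in e, inner ℝ (M.avg e (c.diffFlux w) x) (M.jmp nu e z x) ∂(surf d)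

/-- Penalty term. -/
noncomputable def formJ (_c : Coeffs d) (γ : ℝ) (w z : Vec d → ℝ) : ℝ :=
  ∑ e ∈ M.active D, γ / M.facetSize e *
    ∫ x in e, inner ℝ (M.jmp nu e w x) (M.jmp nu e z x) ∂(surf d)

/-- Advection-reaction volume term. -/
noncomputable def formR (w z : Vec d → ℝ) : ℝ :=
  ∑ T ∈ M.elements, ∫ x in T, (c.σ x * w x * z x - inner ℝ (w x • c.β x) (∇ z x))

/-- Upwind facet term. -/
noncomputable def formF (w z : Vec d → ℝ) : ℝ :=
  ∑ e ∈ M.facets, ∫ x in e, (M.mean e w x * inner ℝ (M.avg e c.β x) (M.jmp nu e z x)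
    + 1 / 2 * (M.abn nu e c.β x * inner ℝ (M.jmp nu e w x) (M.jmp nu e z x))) ∂(surf d)

/-- Upwind part of the norm. -/
noncomputable def formU (w : Vec d → ℝ) : ℝ :=
  1 / 2 * ∑ e ∈ M.facets, ∫ x in e, M.abn nu e c.β x * ‖M.jmp nu e w x‖ ^ 2 ∂(surf d)

end Coeffs

namespace Setting

variable {d : ℕ} {Ω : Set (Vec d)} {M : Mesh Ω} {core : Set (Vec d) → Set (Vec d)}
  {nu : Set (Vec d) → Set (Vec d) → Vec d} {c : Coeffs d} {D N : Finset (Set (Vec d))}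
  {w z : Vec d → ℝ} {e : Set (Vec d)}

lemma D_sub (S : Setting M core nu c D N) (he : e ∈ D) : e ∈ M.facets :=
  (Mesh.mem_boundaryFacets.1 ((S.DN e).2 (Or.inl he))).1

lemma active_sub (S : Setting M core nu c D N) (he : e ∈ M.active D) : e ∈ M.facets := by
  rw [Mesh.active, Finset.mem_union] at he
  exact he.elim (fun h => (Mesh.mem_interiorFacets.1 h).1) S.D_sub

lemma sum_active (S : Setting M core nu c D N) (f : Set (Vec d) → ℝ) :
    ∑ e ∈ M.active D, f e = ∑ e ∈ M.interiorFacets, f e + ∑ e ∈ D, f e := by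
  classical
  rw [Mesh.active, Finset.sum_union]
  exact Finset.disjoint_of_subset_right (fun e he => (S.DN e).2 (Or.inl he)) S.geom.disjoint

lemma sum_facets (S : Setting M core nu c D N) (f : Set (Vec d) → ℝ) :
    ∑ e ∈ M.facets, f e = ∑ e ∈ M.interiorFacets, f e + ∑ e ∈ D, f e + ∑ e ∈ N, f e := by
  classical
  have h1 : M.facets = M.interiorFacets ∪ (D ∪ N) := by
    ext e
    simp only [Finset.mem_union, ← S.DN]
    rw [Mesh.mem_interiorFacets, Mesh.mem_boundaryFacets, ← and_or_left]
    exact ⟨fun h => ⟨h, M.interior_or_boundary e h⟩, fun h => h.1⟩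
  rw [h1, Finset.sum_union, Finset.sum_union S.disj, add_assoc]
  refine Finset.disjoint_of_subset_right (fun e he => ?_) S.geom.disjoint
  exact (S.DN e).2 (Finset.mem_union.1 he)

/-- The traces of `β` from both sides agree and the normals are opposite, so every adjacent element
gives the same absolute value. -/
lemma abn_eq (S : Setting M core nu c D N) (he : e ∈ M.facets) :
    ∀ᵐ x ∂((surf d).restrict e), ∀ T ∈ M.adj e,
      M.abn nu e c.β x = |inner ℝ (M.avg e c.β x) (nu T e)| := by
  filter_upwards [S.beta_trace e he] with x hx T hT
  rcases M.interior_or_boundary e he with hi | hb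
  · obtain ⟨T₁, T₂, n, h⟩ := S.geom.exists_isInt (Mesh.mem_interiorFacets.2 ⟨he, hi⟩)
    have m1 : T₁ ∈ M.adj e := by rw [h.adj]; simp
    have m2 : T₂ ∈ M.adj e := by rw [h.adj]; simp
    rw [Mesh.abn, h.adj, Finset.sum_pair h.ne, Finset.card_pair h.ne, hx T₁ m1, hx T₂ m2, h.nu₁,
      h.nu₂, inner_neg_right, abs_neg]
    rw [h.adj, Finset.mem_insert, Finset.mem_singleton] at hT
    rcases hT with rfl | rfl
    · rw [h.nu₁]; push_cast; ring
    · rw [h.nu₂, inner_neg_right, abs_neg]; push_cast; ring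
  · obtain ⟨T', n, h⟩ := S.geom.exists_isBd (Mesh.mem_boundaryFacets.2 ⟨he, hb⟩)
    have m1 : T' ∈ M.adj e := by rw [h.adj]; simp
    rw [Mesh.abn, h.adj, Finset.sum_singleton, Finset.card_singleton, hx T' m1]
    rw [h.adj, Finset.mem_singleton] at hT
    subst hT
    norm_num

lemma abn_nonneg (e : Set (Vec d)) (β : Vec d → Vec d) (x : Vec d) : 0 ≤ M.abn nu e β x :=
  mul_nonneg (by positivity) (Finset.sum_nonneg fun _ _ => abs_nonneg _)

lemma diffFlux_ext (S : Setting M core nu c D N) (hw : M.BrokenC 1 w) :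
    ∀ T ∈ M.elements, Extends T (c.diffFlux w) := fun T hT =>
  S.reg.diffFlux_ext hT ((hw T hT).extends_gradient le_rfl)

/-- Interior and Dirichlet facets merge into a single sum in the diffusive terms. The advective
facet terms merge into one upwind expression over all facets, because `mean` keeps the factor `1/2`
on boundary facets too: there the expression is `(β · n + |β · n|) w z / 2`, which is zero on `Γ_D`,
where `β · n ≤ 0`, and `β · n w z` on `Γ_N`, where `β · n ≥ 0`. -/
lemma aDar_eq (S : Setting M core nu c D N) (hw : M.BrokenC 1 w) (hz : M.BrokenC 1 z) (ε γ : ℝ) :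
    c.aDar M D N ε γ w z = c.formA M w z - c.formP M nu D w z + ε * c.formP M nu D z w
      + c.formJ M nu D γ w z + c.formR M w z + c.formF M nu w z := by
  have G := S.geom
  have hwe : ∀ T ∈ M.elements, Extends T w := fun T hT => (hw T hT).extends
  have hze : ∀ T ∈ M.elements, Extends T z := fun T hT => (hz T hT).extends
  have hbe : ∀ T ∈ M.elements, Extends T c.β := fun T hT => S.reg.beta_ext hT
  have hP : ∀ v q : Vec d → ℝ, c.formP M nu D v q =
      (∑ e ∈ M.interiorFacets, ∫ x in e,
        inner ℝ (M.avg e (c.diffFlux v) x) (M.jump e q x) ∂(surf d)) +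
      ∑ e ∈ D, ∫ x in e, M.vecJump e (c.diffFlux v) x * M.avg e q x ∂(surf d) := by
    intro v q
    rw [Coeffs.formP, S.sum_active]
    congr 1
    · refine Finset.sum_congr rfl fun e he => integral_congr_ae ?_
      have hef := (Mesh.mem_interiorFacets.1 he).1
      filter_upwards [G.ae_core hef] with x hx
      rw [G.jump_eq hef q hx]
    · refine Finset.sum_congr rfl fun e he => integral_congr_ae ?_
      obtain ⟨T, n, h⟩ := G.exists_isBd ((S.DN e).2 (Or.inl he))
      filter_upwards [G.ae_core h.mem] with x hx
      rw [← G.jump_eq h.mem q hx, h.jump_eq G q hx, h.avg_eq, h.avg_eq, h.vecJump_eq G _ hx,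
        inner_smul_right]
      ring
  have hJ : c.formJ M nu D γ w z = (∑ e ∈ M.interiorFacets, γ / M.facetSize e *
        ∫ x in e, inner ℝ (M.jump e w x) (M.jump e z x) ∂(surf d)) +
      ∑ e ∈ D, γ / M.facetSize e * ∫ x in e, M.avg e w x * M.avg e z x ∂(surf d) := by
    rw [Coeffs.formJ, S.sum_active]
    congr 1
    · refine Finset.sum_congr rfl fun e he => ?_
      congr 1
      refine integral_congr_ae ?_
      have hef := (Mesh.mem_interiorFacets.1 he).1
      filter_upwards [G.ae_core hef] with x hx
      rw [G.jump_eq hef z hx, G.jump_eq hef w hx]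
    · refine Finset.sum_congr rfl fun e he => ?_
      congr 1
      refine integral_congr_ae ?_
      obtain ⟨T, n, h⟩ := G.exists_isBd ((S.DN e).2 (Or.inl he))
      filter_upwards [G.ae_core h.mem] with x hx
      rw [← G.jump_eq h.mem z hx, ← G.jump_eq h.mem w hx, h.jump_eq G z hx, h.jump_eq G w hx,
        h.avg_eq, h.avg_eq, inner_smul_right, inner_smul_left, real_inner_self_eq_norm_sq, h.norm]
      simp
      ring
  have hR : c.formR M w z = (∑ T ∈ M.elements, ∫ x in T, c.σ x * w x * z x) -
      ∑ T ∈ M.elements, ∫ x in T, inner ℝ (w x • c.β x) (∇ z x) := by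
    rw [Coeffs.formR, ← Finset.sum_sub_distrib]
    refine Finset.sum_congr rfl fun T hT => integral_sub ?_ ?_
    · exact (((S.reg.sigma_ext T hT).mul (hwe T hT)).mul (hze T hT)).integrableOn
        (G.elem_open T hT) (G.elem_bdd T hT)
    · exact (((hwe T hT).smul (hbe T hT)).dot ((hz T hT).extends_gradient le_rfl)).integrableOn
        (G.elem_open T hT) (G.elem_bdd T hT)
  have hF : c.formF M nu w z = (∑ e ∈ M.interiorFacets, ∫ x in e,
        inner ℝ (M.avg e (fun y => w y • c.β y) x) (M.jump e z x) ∂(surf d))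
      + 1 / 2 * (∑ e ∈ M.interiorFacets, ∫ x in e,
        M.absNormal e c.β x * inner ℝ (M.jump e w x) (M.jump e z x) ∂(surf d))
      + ∑ e ∈ N, ∫ x in e, M.vecJump e (fun y => w y • c.β y) x * M.avg e z x ∂(surf d) := by
    rw [Coeffs.formF, S.sum_facets]
    have hD0 : ∑ e ∈ D, ∫ x in e, (M.mean e w x * inner ℝ (M.avg e c.β x) (M.jmp nu e z x)
        + 1 / 2 * (M.abn nu e c.β x * inner ℝ (M.jmp nu e w x) (M.jmp nu e z x))) ∂(surf d) = 0 := by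
      refine Finset.sum_eq_zero fun e he => ?_
      rw [← integral_zero (Vec d) ℝ (μ := (surf d).restrict e)]
      refine integral_congr_ae ?_
      obtain ⟨T, n, h⟩ := G.exists_isBd ((S.DN e).2 (Or.inl he))
      have hm : T ∈ M.adj e := by rw [h.adj]; simp
      filter_upwards [S.abn_eq h.mem, S.beta_D e he] with x hx1 hx2
      rw [hx1 T hm, Mesh.mean, Mesh.jmp, Mesh.jmp, h.adj]
      simp only [Finset.sum_singleton, inner_smul_right, inner_smul_left, h.nu_eq,
        real_inner_self_eq_norm_sq, h.norm]
      have := hx2 T hm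
      rw [h.nu_eq] at this
      rw [abs_of_nonpos this]
      simp
      ring
    rw [hD0, add_zero]
    congr 1
    · rw [Finset.mul_sum, ← Finset.sum_add_distrib]
      refine Finset.sum_congr rfl fun e he => ?_
      have hef := (Mesh.mem_interiorFacets.1 he).1
      obtain ⟨T₁, T₂, n, h⟩ := G.exists_isInt he
      have m1 : T₁ ∈ M.adj e := by rw [h.adj]; simp
      have m2 : T₂ ∈ M.adj e := by rw [h.adj]; simp
      rw [integral_add, integral_const_mul]
      · congr 1
        · refine integral_congr_ae ?_
          filter_upwards [G.ae_core hef, S.beta_trace e hef,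
            ae_restrict_mem (G.facet_compact e hef).measurableSet] with x hx hb hxe
          rw [G.jump_eq hef z hx, h.avg_eq (fun y => w y • c.β y), Mesh.mean, h.adj,
            Finset.sum_pair h.ne,
            (hwe T₁ h.mem₁).extendFrom_comp₂ (hbe T₁ h.mem₁) (Φ := fun a b => a • b) (by fun_prop)
              (Mesh.Geometry.mem_closure_of_facet h.facet₁ hxe),
            (hwe T₂ h.mem₂).extendFrom_comp₂ (hbe T₂ h.mem₂) (Φ := fun a b => a • b) (by fun_prop)
              (Mesh.Geometry.mem_closure_of_facet h.facet₂ hxe), hb T₁ m1, hb T₂ m2, ← add_smul,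
            smul_smul, inner_smul_left]
          simp
        · congr 1
          refine integral_congr_ae ?_
          filter_upwards [G.ae_core hef] with x hx
          rw [G.jump_eq hef z hx, G.jump_eq hef w hx, G.absNormal_eq hef _ hx]
      · exact G.integrableOn_facet hef ((Mesh.continuousOn_mean hef hwe).mul
          ((Mesh.continuousOn_avg hef hbe).inner (Mesh.continuousOn_jmp hef hze)))
      · exact (G.integrableOn_facet hef ((Mesh.continuousOn_abn hef hbe).mul
          ((Mesh.continuousOn_jmp hef hwe).inner (Mesh.continuousOn_jmp hef hze)))).const_mul _
    · refine Finset.sum_congr rfl fun e he => integral_congr_ae ?_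
      obtain ⟨T, n, h⟩ := G.exists_isBd ((S.DN e).2 (Or.inr he))
      have hm : T ∈ M.adj e := by rw [h.adj]; simp
      filter_upwards [G.ae_core h.mem, S.abn_eq h.mem, S.beta_N e he, S.beta_trace e h.mem,
        ae_restrict_mem (G.facet_compact e h.mem).measurableSet] with x hx hx1 hx2 hb hxe
      rw [h.vecJump_eq G _ hx, (hwe T h.memT).extendFrom_comp₂ (hbe T h.memT)
        (Φ := fun a b => a • b) (by fun_prop) (Mesh.Geometry.mem_closure_of_facet h.facet hxe),
        hb T hm, hx1 T hm, h.avg_eq z, Mesh.mean, Mesh.jmp, Mesh.jmp, h.adj]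
      simp only [Finset.sum_singleton, inner_smul_right, inner_smul_left, h.nu_eq,
        real_inner_self_eq_norm_sq, h.norm]
      have := hx2 T hm
      rw [h.nu_eq] at this
      rw [abs_of_nonneg this]
      simp
      ring
  have hPc : ∑ e ∈ M.interiorFacets, ∫ x in e,
      inner ℝ (M.jump e w x) (M.avg e (c.diffFlux z) x) ∂(surf d) =
      ∑ e ∈ M.interiorFacets, ∫ x in e,
      inner ℝ (M.avg e (c.diffFlux z) x) (M.jump e w x) ∂(surf d) := by
    simp_rw [real_inner_comm]
  have hPd : ∑ e ∈ D, ∫ x in e, M.avg e w x * M.vecJump e (c.diffFlux z) x ∂(surf d) =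
      ∑ e ∈ D, ∫ x in e, M.vecJump e (c.diffFlux z) x * M.avg e w x ∂(surf d) := by
    simp_rw [mul_comm]
  rw [hP w z, hP z w, hJ, hR, hF, Coeffs.formA, Coeffs.aDar, hPc, hPd]
  ring

lemma normDar_eq (S : Setting M core nu c D N) (hw : M.BrokenC 1 w) (γ : ℝ) :
    c.normDar M D γ w = Real.sqrt (c.formA M w w + c.formJ M nu D γ w w
      + (∑ T ∈ M.elements, ∫ x in T, w x ^ 2) + c.formU M nu w) := by
  have G := S.geom
  have hJ : c.formJ M nu D γ w w = (∑ e ∈ M.interiorFacets, γ / M.facetSize e *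
        ∫ x in e, ‖M.jump e w x‖ ^ 2 ∂(surf d)) +
      ∑ e ∈ D, γ / M.facetSize e * ∫ x in e, M.avg e w x ^ 2 ∂(surf d) := by
    rw [Coeffs.formJ, S.sum_active]
    congr 1
    · refine Finset.sum_congr rfl fun e he => ?_
      congr 1
      refine integral_congr_ae ?_
      have hef := (Mesh.mem_interiorFacets.1 he).1
      filter_upwards [G.ae_core hef] with x hx
      rw [G.jump_eq hef w hx, real_inner_self_eq_norm_sq]
    · refine Finset.sum_congr rfl fun e he => ?_
      congr 1
      refine integral_congr_ae ?_
      obtain ⟨T, n, h⟩ := G.exists_isBd ((S.DN e).2 (Or.inl he))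
      filter_upwards [G.ae_core h.mem] with x hx
      rw [← G.jump_eq h.mem w hx, h.jump_eq G w hx,
        h.avg_eq, inner_smul_right, inner_smul_left, real_inner_self_eq_norm_sq, h.norm]
      simp
      ring
  have hU : c.formU M nu w = 1 / 2 * ∑ e ∈ M.facets, ∫ x in e,
      M.absNormal e c.β x * ‖M.jump e w x‖ ^ 2 ∂(surf d) := by
    rw [Coeffs.formU]
    congr 1
    refine Finset.sum_congr rfl fun e he => integral_congr_ae ?_
    filter_upwards [G.ae_core he] with x hx
    rw [G.jump_eq he w hx, G.absNormal_eq he _ hx]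
  have hL : ∫ x in Ω, w x ^ 2 = ∑ T ∈ M.elements, ∫ x in T, w x ^ 2 := by
    refine G.integral_eq_sum fun T hT => ?_
    exact ((hw T hT).extends.comp (Φ := fun a => a ^ 2) (by fun_prop)).integrableOn
      (G.elem_open T hT) (G.elem_bdd T hT)
  rw [Coeffs.normDar, hJ, hU, hL, Coeffs.formA]
  congr 1
  ring

end Setting

/-! ### Additivity of the form in its first argument, and integration by parts for a solution. -/

lemma MemC.sub_one {d : ℕ} {T : Set (Vec d)} (ho : IsOpen T) {f g : Vec d → ℝ} (hf : MemC 1 T f)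
    (hg : MemC 1 T g) : MemC 1 T fun x => f x - g x := by
  refine memC_one_of_extends (by exact_mod_cast hf.1.sub hg.1) (hf.extends.sub hg.extends) ?_
  refine ((hf.extends_fderiv le_rfl).comp₂ (hg.extends_fderiv le_rfl) (Φ := fun a b => a - b)
    (by fun_prop)).congr fun x hx => ?_
  exact (fderiv_fun_sub (hf.differentiableAt le_rfl ho hx) (hg.differentiableAt le_rfl ho hx)).symm

lemma MemC.gradient_sub {d : ℕ} {T : Set (Vec d)} (ho : IsOpen T) {f g : Vec d → ℝ}
    (hf : MemC 1 T f) (hg : MemC 1 T g) {x : Vec d} (hx : x ∈ T) :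
    ∇ (fun x => f x - g x) x = ∇ f x - ∇ g x := by
  rw [gradient, gradient, gradient, fderiv_fun_sub (hf.differentiableAt le_rfl ho hx)
    (hg.differentiableAt le_rfl ho hx), map_sub]

lemma memC_of_contDiff {d : ℕ} {T : Set (Vec d)} {f : Vec d → ℝ} (hf : ContDiff ℝ ∞ f) (m : ℕ) :
    MemC m T f :=
  ⟨(hf.of_le (by exact_mod_cast le_top)).contDiffOn, fun k _ =>
    ⟨iteratedFDeriv ℝ k f, (hf.continuous_iteratedFDeriv (by exact_mod_cast le_top)).continuousOn,
      fun _ _ => rfl⟩⟩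

lemma iteratedFDeriv_eq_of_eqOn {d : ℕ} {T : Set (Vec d)} (ho : IsOpen T) {f g : Vec d → ℝ}
    (h : Set.EqOn f g T) (k : ℕ) : Set.EqOn (iteratedFDeriv ℝ k f) (iteratedFDeriv ℝ k g) T :=
  fun _ hx => (Filter.EventuallyEq.iteratedFDeriv ℝ (h.eventuallyEq_of_mem (ho.mem_nhds hx))
    k).self_of_nhds

lemma MemC.congr {d m : ℕ} {T : Set (Vec d)} (ho : IsOpen T) {f g : Vec d → ℝ} (hf : MemC m T f)
    (h : Set.EqOn f g T) : MemC m T g := by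
  refine ⟨hf.1.congr fun x hx => (h hx).symm, fun k hk => ?_⟩
  obtain ⟨f', hf', hff⟩ := hf.2 k hk
  exact ⟨f', hf', fun x hx => (iteratedFDeriv_eq_of_eqOn ho h k hx).symm.trans (hff hx)⟩

lemma gradient_eq_of_eqOn {d : ℕ} {T : Set (Vec d)} (ho : IsOpen T) {f g : Vec d → ℝ}
    (h : Set.EqOn f g T) {x : Vec d} (hx : x ∈ T) : ∇ f x = ∇ g x := by
  rw [gradient, gradient, (h.eventuallyEq_of_mem (ho.mem_nhds hx)).fderiv_eq]

namespace Mesh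

variable {d : ℕ} {Ω : Set (Vec d)} {M : Mesh Ω} {core : Set (Vec d) → Set (Vec d)}
  {nu : Set (Vec d) → Set (Vec d) → Vec d} {e : Set (Vec d)}

/-- `v` is smooth up to the boundary in each element. -/
def PiecewiseSmooth (M : Mesh Ω) (v : Vec d → ℝ) : Prop :=
  ∀ T ∈ M.elements, ∃ ζ : Vec d → ℝ, ContDiff ℝ ∞ ζ ∧ Set.EqOn v ζ T

lemma PiecewiseSmooth.brokenC (G : M.Geometry core nu) {v : Vec d → ℝ}
    (h : M.PiecewiseSmooth v) (m : ℕ) : M.BrokenC m v := fun T hT => by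
  obtain ⟨ζ, hζ, hv⟩ := h T hT
  exact (memC_of_contDiff hζ m).congr (G.elem_open T hT) hv.symm

lemma Geometry.brokenC_sub (G : M.Geometry core nu) {f g : Vec d → ℝ} (hf : M.BrokenC 1 f)
    (hg : M.BrokenC 1 g) : M.BrokenC 1 fun x => f x - g x := fun T hT =>
  (hf T hT).sub_one (G.elem_open T hT) (hg T hT)

lemma extendFrom_sub {F : Type*} [NormedAddCommGroup F] {T : Set (Vec d)}
    {f g : Vec d → F} (hf : Extends T f) (hg : Extends T g) {x : Vec d} (hx : x ∈ closure T) :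
    extendFrom T (fun y => f y - g y) x = extendFrom T f x - extendFrom T g x :=
  hf.extendFrom_comp₂ hg (Φ := fun a b => a - b) (by fun_prop) hx

lemma jmp_sub (he : e ∈ M.facets) {f g : Vec d → ℝ} (hf : ∀ T ∈ M.elements, Extends T f)
    (hg : ∀ T ∈ M.elements, Extends T g) {x : Vec d} (hx : x ∈ e) :
    M.jmp nu e (fun y => f y - g y) x = M.jmp nu e f x - M.jmp nu e g x := by
  rw [jmp, jmp, jmp, ← Finset.sum_sub_distrib]
  refine Finset.sum_congr rfl fun T hT => ?_
  obtain ⟨hT', heT⟩ := Geometry.facetsOf_of_adj he hT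
  rw [extendFrom_sub (hf T hT') (hg T hT') (Geometry.mem_closure_of_facet heT hx), sub_smul]

lemma mean_sub (he : e ∈ M.facets) {f g : Vec d → ℝ} (hf : ∀ T ∈ M.elements, Extends T f)
    (hg : ∀ T ∈ M.elements, Extends T g) {x : Vec d} (hx : x ∈ e) :
    M.mean e (fun y => f y - g y) x = M.mean e f x - M.mean e g x := by
  rw [mean, mean, mean, ← mul_sub, ← Finset.sum_sub_distrib]
  congr 1
  refine Finset.sum_congr rfl fun T hT => ?_
  obtain ⟨hT', heT⟩ := Geometry.facetsOf_of_adj he hT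
  rw [extendFrom_sub (hf T hT') (hg T hT') (Geometry.mem_closure_of_facet heT hx)]

lemma avg_sub {F : Type*} [NormedAddCommGroup F] [NormedSpace ℝ F] (he : e ∈ M.facets)
    {f g : Vec d → F} (hf : ∀ T ∈ M.elements, Extends T f)
    (hg : ∀ T ∈ M.elements, Extends T g) {x : Vec d} (hx : x ∈ e) :
    M.avg e (fun y => f y - g y) x = M.avg e f x - M.avg e g x := by
  rw [avg, avg, avg, ← smul_sub, ← Finset.sum_sub_distrib]
  congr 1
  refine Finset.sum_congr rfl fun T hT => ?_
  obtain ⟨hT', heT⟩ := Geometry.facetsOf_of_adj he hT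
  rw [extendFrom_sub (hf T hT') (hg T hT') (Geometry.mem_closure_of_facet heT hx)]

lemma avg_congr {F : Type*} [NormedAddCommGroup F] [NormedSpace ℝ F]
    {f g : Vec d → F} (h : ∀ T ∈ M.elements, Set.EqOn f g T) (e : Set (Vec d)) (x : Vec d) :
    M.avg e f x = M.avg e g x := by
  rw [avg, avg]
  congr 1
  exact Finset.sum_congr rfl fun T hT => extendFrom_congr (h T (Mesh.mem_adj.1 hT).1) x

end Mesh

namespace Setting

variable {d : ℕ} {Ω : Set (Vec d)} {M : Mesh Ω} {core : Set (Vec d) → Set (Vec d)}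
  {nu : Set (Vec d) → Set (Vec d) → Vec d} {c : Coeffs d} {D N : Finset (Set (Vec d))}
  {f g u w z : Vec d → ℝ} {e : Set (Vec d)} {gD gN : Vec d → ℝ}

lemma diffFlux_sub (S : Setting M core nu c D N) (hf : M.BrokenC 1 f) (hg : M.BrokenC 1 g) :
    ∀ T ∈ M.elements, Set.EqOn (c.diffFlux fun x => f x - g x)
      (fun x => c.diffFlux f x - c.diffFlux g x) T := fun T hT x hx => by
  simp only [Coeffs.diffFlux]
  rw [(hf T hT).gradient_sub (S.geom.elem_open T hT) (hg T hT) hx, map_sub]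

/-- The bilinear form is additive in its first argument. -/
lemma aDar_sub (S : Setting M core nu c D N) (hf : M.BrokenC 1 f) (hg : M.BrokenC 1 g)
    (hz : M.BrokenC 1 z) (ε γ : ℝ) :
    c.aDar M D N ε γ (fun x => f x - g x) z =
      c.aDar M D N ε γ f z - c.aDar M D N ε γ g z := by
  have G := S.geom
  have hfe : ∀ T ∈ M.elements, Extends T f := fun T hT => (hf T hT).extends
  have hge : ∀ T ∈ M.elements, Extends T g := fun T hT => (hg T hT).extends
  have hze : ∀ T ∈ M.elements, Extends T z := fun T hT => (hz T hT).extends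
  have hzg : ∀ T ∈ M.elements, Extends T (∇ z) := fun T hT => (hz T hT).extends_gradient le_rfl
  have hbe : ∀ T ∈ M.elements, Extends T c.β := fun T hT => S.reg.beta_ext hT
  have hA : c.formA M (fun x => f x - g x) z = c.formA M f z - c.formA M g z := by
    rw [Coeffs.formA, Coeffs.formA, Coeffs.formA, ← Finset.sum_sub_distrib]
    refine Finset.sum_congr rfl fun T hT => ?_
    rw [← integral_sub]
    · refine setIntegral_congr_fun (G.elem_open T hT).measurableSet fun x hx => ?_
      simp only [S.diffFlux_sub hf hg T hT hx, inner_sub_left]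
    · exact ((S.diffFlux_ext hf T hT).dot (hzg T hT)).integrableOn (G.elem_open T hT)
        (G.elem_bdd T hT)
    · exact ((S.diffFlux_ext hg T hT).dot (hzg T hT)).integrableOn (G.elem_open T hT)
        (G.elem_bdd T hT)
  have hR : c.formR M (fun x => f x - g x) z = c.formR M f z - c.formR M g z := by
    have hi : ∀ v : Vec d → ℝ, (∀ T ∈ M.elements, Extends T v) → ∀ T ∈ M.elements,
        IntegrableOn (fun x => c.σ x * v x * z x - inner ℝ (v x • c.β x) (∇ z x)) T :=
      fun v hv T hT => ((((S.reg.sigma_ext T hT).mul (hv T hT)).mul (hze T hT)).sub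
        (((hv T hT).smul (hbe T hT)).dot (hzg T hT))).integrableOn (G.elem_open T hT)
        (G.elem_bdd T hT)
    rw [Coeffs.formR, Coeffs.formR, Coeffs.formR, ← Finset.sum_sub_distrib]
    refine Finset.sum_congr rfl fun T hT => ?_
    rw [← integral_sub (hi f hfe T hT) (hi g hge T hT)]
    congr 1
    ext x
    rw [sub_smul, inner_sub_left]
    ring
  have hP : c.formP M nu D (fun x => f x - g x) z = c.formP M nu D f z - c.formP M nu D g z := by
    rw [Coeffs.formP, Coeffs.formP, Coeffs.formP, ← Finset.sum_sub_distrib]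
    refine Finset.sum_congr rfl fun e he => ?_
    have hef := S.active_sub he
    rw [← integral_sub]
    · refine setIntegral_congr_fun (G.facet_compact e hef).measurableSet fun x hx => ?_
      simp only [Mesh.avg_congr (S.diffFlux_sub hf hg) e x,
        Mesh.avg_sub hef (S.diffFlux_ext hf) (S.diffFlux_ext hg) hx, inner_sub_left]
    · exact G.integrableOn_facet hef ((Mesh.continuousOn_avg hef (S.diffFlux_ext hf)).inner
        (Mesh.continuousOn_jmp hef hze))
    · exact G.integrableOn_facet hef ((Mesh.continuousOn_avg hef (S.diffFlux_ext hg)).inner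
        (Mesh.continuousOn_jmp hef hze))
  have hP' : c.formP M nu D z (fun x => f x - g x) = c.formP M nu D z f - c.formP M nu D z g := by
    rw [Coeffs.formP, Coeffs.formP, Coeffs.formP, ← Finset.sum_sub_distrib]
    refine Finset.sum_congr rfl fun e he => ?_
    have hef := S.active_sub he
    rw [← integral_sub]
    · refine setIntegral_congr_fun (G.facet_compact e hef).measurableSet fun x hx => ?_
      simp only [Mesh.jmp_sub hef hfe hge hx, inner_sub_right]
    · exact G.integrableOn_facet hef ((Mesh.continuousOn_avg hef (S.diffFlux_ext hz)).inner
        (Mesh.continuousOn_jmp hef hfe))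
    · exact G.integrableOn_facet hef ((Mesh.continuousOn_avg hef (S.diffFlux_ext hz)).inner
        (Mesh.continuousOn_jmp hef hge))
  have hJ : c.formJ M nu D γ (fun x => f x - g x) z =
      c.formJ M nu D γ f z - c.formJ M nu D γ g z := by
    rw [Coeffs.formJ, Coeffs.formJ, Coeffs.formJ, ← Finset.sum_sub_distrib]
    refine Finset.sum_congr rfl fun e he => ?_
    have hef := S.active_sub he
    rw [← mul_sub, ← integral_sub]
    · congr 1
      refine setIntegral_congr_fun (G.facet_compact e hef).measurableSet fun x hx => ?_
      simp only [Mesh.jmp_sub hef hfe hge hx, inner_sub_left]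
    · exact G.integrableOn_facet hef ((Mesh.continuousOn_jmp hef hfe).inner
        (Mesh.continuousOn_jmp hef hze))
    · exact G.integrableOn_facet hef ((Mesh.continuousOn_jmp hef hge).inner
        (Mesh.continuousOn_jmp hef hze))
  have hF : c.formF M nu (fun x => f x - g x) z = c.formF M nu f z - c.formF M nu g z := by
    have hi : ∀ v : Vec d → ℝ, (∀ T ∈ M.elements, Extends T v) → ∀ e ∈ M.facets,
        IntegrableOn (fun x => M.mean e v x * inner ℝ (M.avg e c.β x) (M.jmp nu e z x)
          + 1 / 2 * (M.abn nu e c.β x * inner ℝ (M.jmp nu e v x) (M.jmp nu e z x))) e (surf d) :=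
      fun v hv e he => G.integrableOn_facet he (((Mesh.continuousOn_mean he hv).mul
        ((Mesh.continuousOn_avg he hbe).inner (Mesh.continuousOn_jmp he hze))).add
        (continuousOn_const.mul ((Mesh.continuousOn_abn he hbe).mul
          ((Mesh.continuousOn_jmp he hv).inner (Mesh.continuousOn_jmp he hze)))))
    rw [Coeffs.formF, Coeffs.formF, Coeffs.formF, ← Finset.sum_sub_distrib]
    refine Finset.sum_congr rfl fun e he => ?_
    rw [← integral_sub (hi f hfe e he) (hi g hge e he)]
    refine setIntegral_congr_fun (G.facet_compact e he).measurableSet fun x hx => ?_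
    simp only [Mesh.jmp_sub he hfe hge hx, Mesh.mean_sub he hfe hge hx, inner_sub_left]
    ring
  rw [S.aDar_eq (G.brokenC_sub hf hg) hz, S.aDar_eq hf hz, S.aDar_eq hg hz, hA, hR, hP, hP', hJ, hF]
  ring

/-- Integration by parts of the volume terms for a weak solution. -/
lemma volume_terms (S : Setting M core nu c D N) (hu : M.BrokenC 1 u)
    (hsol : c.IsWeakSolution M D N (fun _ => 0) gD gN u) (hz : M.PiecewiseSmooth z) :
    c.formA M u z + c.formR M u z = ∑ e ∈ M.facets, ∫ x in e, (∑ T ∈ M.adj e,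
      (inner ℝ (extendFrom T (c.diffFlux u) x) (nu T e)
        - extendFrom T u x * inner ℝ (extendFrom T c.β x) (nu T e)) * extendFrom T z x)
      ∂(surf d) := by
  have G := S.geom
  have hbe : ∀ T ∈ M.elements, Extends T c.β := fun T hT => S.reg.beta_ext hT
  have hzC := hz.brokenC G 1
  have key : ∀ T ∈ M.elements, (∫ x in T, inner ℝ (c.diffFlux u x) (∇ z x)) +
      (∫ x in T, (c.σ x * u x * z x - inner ℝ (u x • c.β x) (∇ z x))) =
      ∑ e ∈ M.facetsOf T, ∫ x in e, (inner ℝ (extendFrom T (c.diffFlux u) x) (nu T e)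
        - extendFrom T u x * inner ℝ (extendFrom T c.β x) (nu T e)) * extendFrom T z x ∂(surf d) := by
    intro T hT
    obtain ⟨ζ, hζ, hzζ⟩ := hz T hT
    have ho := G.elem_open T hT
    have hb := G.elem_bdd T hT
    have huT := hu T hT
    have hue := huT.extends
    have hζe : Extends T ζ := Extends.of_continuous hζ.continuous
    have hζd : Extends T (fderiv ℝ ζ) := Extends.of_continuous (hζ.continuous_fderiv (by simp))
    have hq := S.diffFlux_ext hu T hT
    have hub := hue.smul (hbe T hT)
    have hfd := S.reg.fluxDiv_ext G hT huT
    have hbd : Extends T fun x => inner ℝ (c.β x) (∇ u x) + divg c.β x * u x :=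
      ((hbe T hT).dot (huT.extends_gradient le_rfl)).add ((S.reg.divg_ext G hT).mul hue)
    have p1 := G.integral_parts hT hq (hfd.integrableOn ho hb)
      (hasWeakDiv_flux S.DN G S.reg hu hsol hT) hζ
    have p2 := G.integral_parts hT hub (hbd.integrableOn ho hb)
      (S.reg.hasWeakDiv_smul_beta G hT huT) hζ
    rw [← integral_add]
    -- The weak divergences of `K ∇u` and of `u β` differ by `σ u`. Hence the volume terms of the
    -- method are the difference of two integration by parts identities.
    · have e1 : ∫ x in T, (inner ℝ (c.diffFlux u x) (∇ z x) +
          (c.σ x * u x * z x - inner ℝ (u x • c.β x) (∇ z x))) =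
          (∫ x in T, (c.fluxDiv u x * ζ x + fderiv ℝ ζ x (c.diffFlux u x))) -
          ∫ x in T, ((inner ℝ (c.β x) (∇ u x) + divg c.β x * u x) * ζ x +
            fderiv ℝ ζ x (u x • c.β x)) := by
        rw [← integral_sub]
        · refine setIntegral_congr_fun ho.measurableSet fun x hx => ?_
          simp only [gradient_eq_of_eqOn ho hzζ hx, hzζ hx, ← inner_gradient, Coeffs.fluxDiv,
            real_inner_comm (∇ ζ x)]
          ring
        · exact ((hfd.mul hζe).add (hζd.clm_apply hq)).integrableOn ho hb
        · exact ((hbd.mul hζe).add (hζd.clm_apply hub)).integrableOn ho hb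
      rw [e1, p1, p2, ← Finset.sum_sub_distrib]
      refine Finset.sum_congr rfl fun e he => ?_
      have hef := Mesh.Geometry.mem_facets he
      rw [← integral_sub]
      · refine setIntegral_congr_fun (G.facet_compact e hef).measurableSet fun x hx => ?_
        have hxc := Mesh.Geometry.mem_closure_of_facet he hx
        simp only [extendFrom_congr hzζ x, extendFrom_of_continuous hζ.continuous hxc,
          hue.extendFrom_comp₂ (hbe T hT) (Φ := fun a b => a • b) (by fun_prop) hxc,
          inner_smul_left]
        simp
        ring
      · exact G.integrableOn_facet hef (((Mesh.Geometry.continuousOn_trace he hq).inner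
          continuousOn_const).mul hζ.continuous.continuousOn)
      · exact G.integrableOn_facet hef (((Mesh.Geometry.continuousOn_trace he hub).inner
          continuousOn_const).mul hζ.continuous.continuousOn)
    · exact (hq.dot ((hzC T hT).extends_gradient le_rfl)).integrableOn ho hb
    · exact ((((S.reg.sigma_ext T hT).mul hue).mul (hzC T hT).extends).sub
        (hub.dot ((hzC T hT).extends_gradient le_rfl))).integrableOn ho hb
  rw [Coeffs.formA, Coeffs.formR, ← Finset.sum_add_distrib, Finset.sum_congr rfl key,
    Mesh.Geometry.sum_facets_comm]
  refine Finset.sum_congr rfl fun e he => ?_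
  rw [integral_finsetSum]
  intro T hT
  obtain ⟨hT', heT⟩ := Mesh.Geometry.facetsOf_of_adj he hT
  exact G.integrableOn_facet he ((((Mesh.Geometry.continuousOn_trace heT
    (S.diffFlux_ext hu T hT')).inner continuousOn_const).sub
    ((Mesh.Geometry.continuousOn_trace heT (hu T hT').extends).mul
    ((Mesh.Geometry.continuousOn_trace heT (hbe T hT')).inner continuousOn_const))).mul
    (Mesh.Geometry.continuousOn_trace heT (hzC T hT').extends))

end Setting

/-! ### Consistency, and the advective form on the diagonal. -/

namespace Setting

variable {d : ℕ} {Ω : Set (Vec d)} {M : Mesh Ω} {core : Set (Vec d) → Set (Vec d)}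
  {nu : Set (Vec d) → Set (Vec d) → Vec d} {c : Coeffs d} {D N : Finset (Set (Vec d))}
  {u z : Vec d → ℝ} {e : Set (Vec d)} {gD gN : Vec d → ℝ}

lemma trace_eq_of_sol (S : Setting M core nu c D N) (hu : M.BrokenC 1 u)
    (hsol : c.IsWeakSolution M D N (fun _ => 0) gD gN u) (he : e ∈ M.interiorFacets) :
    ∀ᵐ x ∂((surf d).restrict e), ∀ T ∈ M.adj e, ∀ T' ∈ M.adj e,
      extendFrom T u x = extendFrom T' u x := by
  obtain ⟨⟨Gr, -, hGr, hweak, -⟩, -⟩ := hsol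
  have : IsFiniteMeasure (volume.restrict Ω) := ⟨by simpa using S.geom.volume_lt_top⟩
  refine S.geom.trace_eq_interior hu (g := fun k x => Gr x k) (fun k => ?_) hweak he
  have h1 : MemLp (fun x => Gr x k) 2 (volume.restrict Ω) :=
    (EuclideanSpace.proj k : Vec d →L[ℝ] ℝ).comp_memLp' hGr
  exact h1.integrable (by norm_num)

/-- Consistency of the discrete problem. -/
lemma consistency (S : Setting M core nu c D N) (hu : M.BrokenC 1 u)
    (hgN : ∀ e ∈ N, MemLp gN 2 ((surf d).restrict e))
    (hsol : c.IsWeakSolution M D N (fun _ => 0) gD gN u) (hz : M.PiecewiseSmooth z) (ε γ : ℝ) :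
    c.aDar M D N ε γ u z = c.rhsDar M D N ε γ (fun _ => 0) gD gN z := by
  have G := S.geom
  have hzC := hz.brokenC G 1
  have hue : ∀ T ∈ M.elements, Extends T u := fun T hT => (hu T hT).extends
  have hze : ∀ T ∈ M.elements, Extends T z := fun T hT => (hzC T hT).extends
  have hbe : ∀ T ∈ M.elements, Extends T c.β := fun T hT => S.reg.beta_ext hT
  have hq := S.diffFlux_ext hu
  set V : Set (Vec d) → ℝ := fun e => ∫ x in e, (∑ T ∈ M.adj e,
      (inner ℝ (extendFrom T (c.diffFlux u) x) (nu T e)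
        - extendFrom T u x * inner ℝ (extendFrom T c.β x) (nu T e)) * extendFrom T z x)
      ∂(surf d) with hV
  set F : Set (Vec d) → ℝ := fun e => ∫ x in e,
    (M.mean e u x * inner ℝ (M.avg e c.β x) (M.jmp nu e z x)
    + 1 / 2 * (M.abn nu e c.β x * inner ℝ (M.jmp nu e u x) (M.jmp nu e z x))) ∂(surf d) with hF
  set P : Set (Vec d) → ℝ := fun e => ∫ x in e,
    inner ℝ (M.avg e (c.diffFlux u) x) (M.jmp nu e z x) ∂(surf d) with hP
  -- All terms that contain the jump of `u`, namely penalty, symmetrisation and upwinding, vanish on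
  -- interior facets.
  have hjmp0 : ∀ e ∈ M.interiorFacets, ∀ᵐ x ∂((surf d).restrict e), M.jmp nu e u x = 0 := by
    intro e he
    obtain ⟨T₁, T₂, n, h⟩ := G.exists_isInt he
    filter_upwards [S.trace_eq_of_sol hu hsol he] with x hx
    rw [Mesh.jmp, h.adj, Finset.sum_pair h.ne, h.nu₁, h.nu₂,
      hx T₁ (by rw [h.adj]; simp) T₂ (by rw [h.adj]; simp)]
    simp
  -- `V`, `P` and `F` are the contributions of integration by parts, of diffusive consistency and of
  -- advection. They cancel on an interior facet, because neither `u` nor the normal flux jumps and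
  -- `β` has a common trace.
  have hI : ∀ e ∈ M.interiorFacets, V e - P e + F e = 0 := by
    intro e he
    obtain ⟨T₁, T₂, n, h⟩ := G.exists_isInt he
    have m1 : T₁ ∈ M.adj e := by rw [h.adj]; simp
    have m2 : T₂ ∈ M.adj e := by rw [h.adj]; simp
    have heD : e ∉ D := fun heD =>
      Finset.disjoint_left.1 G.disjoint he ((S.DN e).2 (Or.inl heD))
    have heN : e ∉ N := fun heN =>
      Finset.disjoint_left.1 G.disjoint he ((S.DN e).2 (Or.inr heN))
    have hflux := ae_flux_jump S.DN G S.reg hu hgN hsol h.mem heD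
    simp only [heN, if_false, add_zero] at hflux
    have e1 : F e = ∫ x in e, M.mean e u x * inner ℝ (M.avg e c.β x) (M.jmp nu e z x) ∂(surf d) := by
      refine integral_congr_ae ?_
      filter_upwards [hjmp0 e he] with x hx
      rw [hx]
      simp
    have e2 : V e = P e - F e := by
      rw [e1, hP, ← integral_sub]
      · refine integral_congr_ae ?_
        filter_upwards [hflux, S.trace_eq_of_sol hu hsol he, S.beta_trace e h.mem] with x h1 h2 h3
        rw [h.avg_eq, Mesh.mean, Mesh.jmp, h.adj]
        rw [h.adj] at h1
        simp only [Finset.sum_pair h.ne, h.nu₁, h.nu₂, h3 T₁ m1, h3 T₂ m2, h2 T₂ m2 T₁ m1,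
          inner_neg_right, inner_add_right, inner_smul_right, inner_smul_left, inner_add_left,
          smul_neg] at h1 ⊢
        simp only [conj_trivial]
        have h4 : inner ℝ (extendFrom T₁ (c.diffFlux u) x) n =
          inner ℝ (extendFrom T₂ (c.diffFlux u) x) n := by linarith
        rw [h4]
        ring
      · exact G.integrableOn_facet h.mem ((Mesh.continuousOn_avg h.mem hq).inner
          (Mesh.continuousOn_jmp h.mem hze))
      · exact G.integrableOn_facet h.mem ((Mesh.continuousOn_mean h.mem hue).mul
          ((Mesh.continuousOn_avg h.mem hbe).inner (Mesh.continuousOn_jmp h.mem hze)))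
    linarith
  -- On `Γ_D` the flux terms cancel and the upwind term is zero; the advective trace with `u = gD`
  -- remains.
  have hD : ∀ e ∈ D, V e - P e + F e =
      - ∫ x in e, gD x * M.vecJump e c.β x * M.avg e z x ∂(surf d) := by
    intro e he
    obtain ⟨T, n, h⟩ := G.exists_isBd ((S.DN e).2 (Or.inl he))
    have hm : T ∈ M.adj e := by rw [h.adj]; simp
    have e1 : F e = 0 := by
      rw [hF, ← integral_zero (Vec d) ℝ (μ := (surf d).restrict e)]
      refine integral_congr_ae ?_
      filter_upwards [S.abn_eq h.mem, S.beta_D e he] with x hx1 hx2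
      rw [hx1 T hm, Mesh.mean, Mesh.jmp, Mesh.jmp, h.adj]
      simp only [Finset.sum_singleton, inner_smul_right, inner_smul_left, h.nu_eq,
        real_inner_self_eq_norm_sq, h.norm]
      have := hx2 T hm
      rw [h.nu_eq] at this
      rw [abs_of_nonpos this]
      simp
      ring
    have e2 : ∫ x in e, gD x * M.vecJump e c.β x * M.avg e z x ∂(surf d) =
        ∫ x in e, extendFrom T u x * inner ℝ (extendFrom T c.β x) n * extendFrom T z x ∂(surf d) := by
      refine integral_congr_ae ?_
      filter_upwards [G.ae_core h.mem, hsol.2 e he T hm] with x hx hx2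
      rw [h.vecJump_eq G _ hx, hx2, h.avg_eq]
    have e3 : P e = ∫ x in e, inner ℝ (extendFrom T (c.diffFlux u) x) n * extendFrom T z x
        ∂(surf d) := by
      refine integral_congr_ae (Filter.Eventually.of_forall fun x => ?_)
      simp only [h.avg_eq, Mesh.jmp, h.adj, Finset.sum_singleton, inner_smul_right, h.nu_eq]
      ring
    rw [e1, e2, e3, add_zero, sub_eq_iff_eq_add', ← sub_eq_add_neg, ← integral_sub]
    · refine integral_congr_ae (Filter.Eventually.of_forall fun x => ?_)
      simp only [h.adj, Finset.sum_singleton, h.nu_eq]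
      ring
    · exact G.integrableOn_facet h.mem (((Mesh.Geometry.continuousOn_trace h.facet
        (hq T h.memT)).inner continuousOn_const).mul
        (Mesh.Geometry.continuousOn_trace h.facet (hze T h.memT)))
    · exact G.integrableOn_facet h.mem (((Mesh.Geometry.continuousOn_trace h.facet
        (hue T h.memT)).mul ((Mesh.Geometry.continuousOn_trace h.facet
        (hbe T h.memT)).inner continuousOn_const)).mul
        (Mesh.Geometry.continuousOn_trace h.facet (hze T h.memT)))
  -- On `Γ_N` the outflow term cancels the advective trace, and the normal flux `-gN` remains.
  have hN : ∀ e ∈ N, V e + F e = - ∫ x in e, gN x * M.avg e z x ∂(surf d) := by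
    intro e he
    obtain ⟨T, n, h⟩ := G.exists_isBd ((S.DN e).2 (Or.inr he))
    have hm : T ∈ M.adj e := by rw [h.adj]; simp
    have hflux := ae_flux_jump S.DN G S.reg hu hgN hsol h.mem
      (fun heD => Finset.disjoint_left.1 S.disj heD he)
    simp only [he, if_true, h.adj, Finset.sum_singleton, h.nu_eq] at hflux
    rw [hV, hF, ← integral_neg, ← integral_add]
    · refine integral_congr_ae ?_
      filter_upwards [S.abn_eq h.mem, S.beta_N e he, hflux, S.beta_trace e h.mem]
        with x hx1 hx2 h3 h4
      rw [hx1 T hm, Mesh.mean, Mesh.jmp, Mesh.jmp, h.avg_eq z, h.adj]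
      simp only [Finset.sum_singleton, inner_smul_right, inner_smul_left, h.nu_eq,
        real_inner_self_eq_norm_sq, h.norm, h4 T hm, conj_trivial]
      have := hx2 T hm
      rw [h.nu_eq] at this
      rw [abs_of_nonneg this]
      have h5 : gN x = - inner ℝ (extendFrom T (c.diffFlux u) x) n := by linarith
      rw [h5]
      ring
    · simp only [h.adj, Finset.sum_singleton]
      exact G.integrableOn_facet h.mem ((((Mesh.Geometry.continuousOn_trace h.facet
        (hq T h.memT)).inner continuousOn_const).sub
        ((Mesh.Geometry.continuousOn_trace h.facet (hue T h.memT)).mul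
        ((Mesh.Geometry.continuousOn_trace h.facet (hbe T h.memT)).inner continuousOn_const))).mul
        (Mesh.Geometry.continuousOn_trace h.facet (hze T h.memT)))
    · exact G.integrableOn_facet h.mem (((Mesh.continuousOn_mean h.mem hue).mul
        ((Mesh.continuousOn_avg h.mem hbe).inner (Mesh.continuousOn_jmp h.mem hze))).add
        (continuousOn_const.mul ((Mesh.continuousOn_abn h.mem hbe).mul
          ((Mesh.continuousOn_jmp h.mem hue).inner (Mesh.continuousOn_jmp h.mem hze)))))
  have hP' : c.formP M nu D z u =
      ∑ e ∈ D, ∫ x in e, gD x * M.vecJump e (c.diffFlux z) x ∂(surf d) := by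
    rw [Coeffs.formP, S.sum_active, Finset.sum_eq_zero, zero_add]
    · refine Finset.sum_congr rfl fun e he => integral_congr_ae ?_
      obtain ⟨T, n, h⟩ := G.exists_isBd ((S.DN e).2 (Or.inl he))
      filter_upwards [G.ae_core h.mem, hsol.2 e he T (by rw [h.adj]; simp)] with x hx hx2
      rw [h.vecJump_eq G _ hx, h.avg_eq, Mesh.jmp, h.adj, Finset.sum_singleton, h.nu_eq, hx2,
        inner_smul_right]
    · intro e he
      rw [← integral_zero (Vec d) ℝ (μ := (surf d).restrict e)]
      refine integral_congr_ae ?_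
      filter_upwards [hjmp0 e he] with x hx
      rw [hx, inner_zero_right]
  have hJ : c.formJ M nu D γ u z =
      ∑ e ∈ D, γ / M.facetSize e * ∫ x in e, gD x * M.avg e z x ∂(surf d) := by
    rw [Coeffs.formJ, S.sum_active, Finset.sum_eq_zero, zero_add]
    · refine Finset.sum_congr rfl fun e he => ?_
      congr 1
      refine integral_congr_ae ?_
      obtain ⟨T, n, h⟩ := G.exists_isBd ((S.DN e).2 (Or.inl he))
      filter_upwards [hsol.2 e he T (by rw [h.adj]; simp)] with x hx2
      rw [h.avg_eq, Mesh.jmp, Mesh.jmp, h.adj, Finset.sum_singleton, Finset.sum_singleton, h.nu_eq,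
        hx2, inner_smul_right, inner_smul_left, real_inner_self_eq_norm_sq, h.norm]
      simp
      ring
    · intro e he
      have : ∫ x in e, inner ℝ (M.jmp nu e u x) (M.jmp nu e z x) ∂(surf d) = 0 := by
        rw [← integral_zero (Vec d) ℝ (μ := (surf d).restrict e)]
        refine integral_congr_ae ?_
        filter_upwards [hjmp0 e he] with x hx
        rw [hx, inner_zero_left]
      rw [this, mul_zero]
  have hvol := S.volume_terms hu hsol hz
  have hVs := S.sum_facets V
  have hFs : c.formF M nu u z = _ := S.sum_facets F
  have hPs : c.formP M nu D u z = _ := S.sum_active P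
  have sI : ∑ e ∈ M.interiorFacets, V e - ∑ e ∈ M.interiorFacets, P e +
      ∑ e ∈ M.interiorFacets, F e = 0 := by
    rw [← Finset.sum_sub_distrib, ← Finset.sum_add_distrib]
    exact Finset.sum_eq_zero hI
  have sD : ∑ e ∈ D, V e - ∑ e ∈ D, P e + ∑ e ∈ D, F e =
      - ∑ e ∈ D, ∫ x in e, gD x * M.vecJump e c.β x * M.avg e z x ∂(surf d) := by
    rw [← Finset.sum_sub_distrib, ← Finset.sum_add_distrib, ← Finset.sum_neg_distrib]
    exact Finset.sum_congr rfl hD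
  have sN : ∑ e ∈ N, V e + ∑ e ∈ N, F e = - ∑ e ∈ N, ∫ x in e, gN x * M.avg e z x ∂(surf d) := by
    rw [← Finset.sum_add_distrib, ← Finset.sum_neg_distrib]
    exact Finset.sum_congr rfl hN
  rw [S.aDar_eq hu hzC, Coeffs.rhsDar, hP', hJ]
  simp only [zero_mul, integral_zero]
  linarith

/-- The advection-reaction part of the form on the diagonal. -/
lemma formR_add_formF_self (S : Setting M core nu c D N) (hz : M.PiecewiseSmooth z) :
    c.formR M z z + c.formF M nu z z =
      (∑ T ∈ M.elements, ∫ x in T, (c.σ x + 1 / 2 * divg c.β x) * z x ^ 2) + c.formU M nu z := by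
  have G := S.geom
  have hzC := hz.brokenC G 1
  have hze : ∀ T ∈ M.elements, Extends T z := fun T hT => (hzC T hT).extends
  have hbe : ∀ T ∈ M.elements, Extends T c.β := fun T hT => S.reg.beta_ext hT
  -- Half of the divergence theorem for the field `z² β`.
  have key : ∀ T ∈ M.elements, ∫ x in T, (c.σ x * z x * z x - inner ℝ (z x • c.β x) (∇ z x)) =
      (∫ x in T, (c.σ x + 1 / 2 * divg c.β x) * z x ^ 2) - 1 / 2 * ∑ e ∈ M.facetsOf T,
        ∫ x in e, inner ℝ (extendFrom T c.β x) (nu T e) * extendFrom T z x ^ 2 ∂(surf d) := by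
    intro T hT
    obtain ⟨ζ, hζ, hzζ⟩ := hz T hT
    have ho := G.elem_open T hT
    have hb := G.elem_bdd T hT
    have hζ2 : ContDiff ℝ ∞ fun x => ζ x ^ 2 := hζ.pow 2
    have p1 := G.integral_parts hT (hbe T hT) ((S.reg.divg_ext G hT).integrableOn ho hb)
      (S.reg.hasWeakDiv_beta G hT) hζ2
    have e1 : ∑ e ∈ M.facetsOf T,
        ∫ x in e, inner ℝ (extendFrom T c.β x) (nu T e) * extendFrom T z x ^ 2 ∂(surf d) =
        ∑ e ∈ M.facetsOf T,
        ∫ x in e, inner ℝ (extendFrom T c.β x) (nu T e) * ζ x ^ 2 ∂(surf d) := by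
      refine Finset.sum_congr rfl fun e he => ?_
      refine setIntegral_congr_fun
        (G.facet_compact e (Mesh.Geometry.mem_facets he)).measurableSet fun x hx => ?_
      have hxc := Mesh.Geometry.mem_closure_of_facet he hx
      simp only [extendFrom_congr hzζ x, extendFrom_of_continuous hζ.continuous hxc]
    rw [e1, ← p1, ← integral_const_mul, ← integral_sub]
    · refine setIntegral_congr_fun ho.measurableSet fun x hx => ?_
      have hd : fderiv ℝ (fun x => ζ x ^ 2) x = (2 * ζ x) • fderiv ℝ ζ x := by
        rw [fderiv_fun_pow _ ((hζ.differentiable (by simp)) x)]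
        simp
      simp only [hd, gradient_eq_of_eqOn ho hzζ hx, hzζ hx, inner_smul_right,
        smul_apply, smul_eq_mul, ← inner_gradient,
        real_inner_comm (∇ ζ x)]
      ring
    · exact (((S.reg.sigma_ext T hT).add ((Extends.of_continuous continuous_const).mul
        (S.reg.divg_ext G hT))).mul ((hze T hT).comp (Φ := fun a => a ^ 2)
        (by fun_prop))).integrableOn ho hb
    · refine Integrable.const_mul ?_ _
      exact (((S.reg.divg_ext G hT).mul (Extends.of_continuous hζ2.continuous)).add
        ((Extends.of_continuous (hζ2.continuous_fderiv (by simp))).clm_apply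
          (hbe T hT))).integrableOn ho hb
  have hfac : ∀ e ∈ M.facets, ∫ x in e,
      (M.mean e z x * inner ℝ (M.avg e c.β x) (M.jmp nu e z x)
        + 1 / 2 * (M.abn nu e c.β x * inner ℝ (M.jmp nu e z x) (M.jmp nu e z x))) ∂(surf d) =
      1 / 2 * (∑ T ∈ M.adj e,
        ∫ x in e, inner ℝ (extendFrom T c.β x) (nu T e) * extendFrom T z x ^ 2 ∂(surf d)) +
      1 / 2 * ∫ x in e, M.abn nu e c.β x * ‖M.jmp nu e z x‖ ^ 2 ∂(surf d) := by
    intro e he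
    have hi : ∀ T ∈ M.adj e, IntegrableOn (fun x =>
        inner ℝ (extendFrom T c.β x) (nu T e) * extendFrom T z x ^ 2) e (surf d) := by
      intro T hT
      obtain ⟨hT', heT⟩ := Mesh.Geometry.facetsOf_of_adj he hT
      exact G.integrableOn_facet he (((Mesh.Geometry.continuousOn_trace heT
        (hbe T hT')).inner continuousOn_const).mul
        ((Mesh.Geometry.continuousOn_trace heT (hze T hT')).pow 2))
    rw [← integral_finsetSum _ hi, ← integral_const_mul, ← integral_const_mul, ← integral_add]
    · refine integral_congr_ae ?_
      filter_upwards [S.beta_trace e he] with x hx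
      rw [real_inner_self_eq_norm_sq]
      -- Half the sum of the traces times their difference is half the difference of their squares,
      -- which is what the elementwise boundary terms add up to on the facet.
      have hsum : M.mean e z x * inner ℝ (M.avg e c.β x) (M.jmp nu e z x) =
          1 / 2 * ∑ T ∈ M.adj e, inner ℝ (extendFrom T c.β x) (nu T e) * extendFrom T z x ^ 2 := by
        rcases M.interior_or_boundary e he with hi | hb
        · obtain ⟨T₁, T₂, n, h⟩ := G.exists_isInt (Mesh.mem_interiorFacets.2 ⟨he, hi⟩)
          have m1 : T₁ ∈ M.adj e := by rw [h.adj]; simp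
          have m2 : T₂ ∈ M.adj e := by rw [h.adj]; simp
          rw [Mesh.mean, Mesh.jmp, h.adj]
          simp only [Finset.sum_pair h.ne, h.nu₁, h.nu₂, hx T₁ m1, hx T₂ m2, inner_neg_right,
            inner_add_right, inner_smul_right, smul_neg]
          ring
        · obtain ⟨T, n, h⟩ := G.exists_isBd (Mesh.mem_boundaryFacets.2 ⟨he, hb⟩)
          have m1 : T ∈ M.adj e := by rw [h.adj]; simp
          rw [Mesh.mean, Mesh.jmp, h.adj]
          simp only [Finset.sum_singleton, h.nu_eq, hx T m1, inner_smul_right]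
          ring
      rw [hsum]
    · exact (integrable_finsetSum _ hi).const_mul _
    · exact (G.integrableOn_facet he ((Mesh.continuousOn_abn he hbe).mul
        ((Mesh.continuousOn_jmp he hze).norm.pow 2))).const_mul _
  rw [Coeffs.formR, Coeffs.formF, Coeffs.formU, Finset.sum_congr rfl key,
    Finset.sum_congr rfl hfac, Finset.sum_sub_distrib, Finset.sum_add_distrib, ← Finset.mul_sum,
    ← Finset.mul_sum, ← Finset.mul_sum, Mesh.Geometry.sum_facets_comm]
  ring

end Setting

/-! ### Cauchy-Schwarz inequalities and bounds by essential suprema. -/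

/-- Cauchy-Schwarz inequality for finite sums of integrals. -/
lemma abs_sum_integral_le {ι α : Type*} [MeasurableSpace α] (s : Finset ι) (μ : ι → Measure α)
    {h f g : ι → α → ℝ} (hle : ∀ i ∈ s, ∀ᵐ x ∂(μ i), |h i x| ≤ f i x * g i x)
    (hff : ∀ i ∈ s, Integrable (fun x => f i x ^ 2) (μ i))
    (hgg : ∀ i ∈ s, Integrable (fun x => g i x ^ 2) (μ i))
    (hfg : ∀ i ∈ s, Integrable (fun x => f i x * g i x) (μ i)) :
    |∑ i ∈ s, ∫ x, h i x ∂(μ i)| ≤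
      √(∑ i ∈ s, ∫ x, f i x ^ 2 ∂(μ i)) * √(∑ i ∈ s, ∫ x, g i x ^ 2 ∂(μ i)) := by
  set F := ∑ i ∈ s, ∫ x, f i x ^ 2 ∂(μ i)
  set H := ∑ i ∈ s, ∫ x, g i x ^ 2 ∂(μ i)
  set X := ∑ i ∈ s, ∫ x, f i x * g i x ∂(μ i)
  have hF : 0 ≤ F := Finset.sum_nonneg fun i _ => integral_nonneg fun x => sq_nonneg _
  have h1 : |∑ i ∈ s, ∫ x, h i x ∂(μ i)| ≤ X := by
    refine (Finset.abs_sum_le_sum_abs _ _).trans (Finset.sum_le_sum fun i hi => ?_)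
    refine abs_integral_le_integral_abs.trans ?_
    exact integral_mono_of_nonneg (Filter.Eventually.of_forall fun x => abs_nonneg _) (hfg i hi)
      (hle i hi)
  have h2 : discrim H (2 * X) F ≤ 0 := by
    refine discrim_le_zero fun t => ?_
    have : H * (t * t) + 2 * X * t + F = ∑ i ∈ s, ∫ x, (f i x + t * g i x) ^ 2 ∂(μ i) := by
      have e : ∀ i ∈ s, ∫ x, (f i x + t * g i x) ^ 2 ∂(μ i) = (∫ x, g i x ^ 2 ∂(μ i)) * (t * t)
          + 2 * (∫ x, f i x * g i x ∂(μ i)) * t + ∫ x, f i x ^ 2 ∂(μ i) := by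
        intro i hi
        have e1 : (fun x => (f i x + t * g i x) ^ 2) = fun x =>
            ((t * t) * g i x ^ 2 + (2 * t) * (f i x * g i x)) + f i x ^ 2 := by
          ext x; ring
        have i1 : Integrable (fun x => (t * t) * g i x ^ 2) (μ i) := (hgg i hi).const_mul _
        have i2 : Integrable (fun x => (2 * t) * (f i x * g i x)) (μ i) := (hfg i hi).const_mul _
        have i3 : Integrable (fun x => (t * t) * g i x ^ 2 + (2 * t) * (f i x * g i x)) (μ i) :=
          i1.add i2
        rw [e1, integral_add i3 (hff i hi), integral_add i1 i2, integral_const_mul,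
          integral_const_mul]
        ring
      rw [Finset.sum_congr rfl e, Finset.sum_add_distrib, Finset.sum_add_distrib, ← Finset.sum_mul,
        ← Finset.sum_mul, ← Finset.mul_sum]
    rw [this]
    exact Finset.sum_nonneg fun i _ => integral_nonneg fun x => sq_nonneg _
  rw [discrim] at h2
  refine h1.trans ?_
  rw [← Real.sqrt_mul hF]
  exact Real.le_sqrt_of_sq_le (by linarith)

lemma le_of_ae_le_of_continuousOn {d : ℕ} {T : Set (Vec d)} (ho : IsOpen T) {f : Vec d → ℝ}
    (hf : ContinuousOn f T) {C : ℝ} (h : ∀ᵐ x ∂(volume.restrict T), f x ≤ C) {x : Vec d}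
    (hx : x ∈ T) : f x ≤ C := by
  have h1 : Set.EqOn (fun x => max (f x) C) (fun _ => C) T :=
    Measure.eqOn_open_of_ae_eq (μ := volume) (by filter_upwards [h] with y hy using max_eq_right hy)
      ho (continuous_max.comp_continuousOn (hf.prodMk continuousOn_const)) continuousOn_const
  exact max_eq_right_iff.1 (h1 hx)

lemma linfNorm_ae_le {d : ℕ} {F : Type*} [NormedAddCommGroup F] {S : Set (Vec d)} {f : Vec d → F}
    {C : ℝ} (h : ∀ᵐ x ∂(volume.restrict S), ‖f x‖ ≤ C) :
    eLpNorm f ∞ (volume.restrict S) < ⊤ ∧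
      ∀ᵐ x ∂(volume.restrict S), ‖f x‖ ≤ linfNorm S f := by
  have h1 : eLpNorm f ∞ (volume.restrict S) < ⊤ := by
    rw [eLpNorm_exponent_top]
    exact (eLpNormEssSup_le_of_ae_bound h).trans_lt ENNReal.ofReal_lt_top
  refine ⟨h1, ?_⟩
  filter_upwards [enorm_ae_le_eLpNormEssSup f (volume.restrict S)] with x hx
  rw [linfNorm, eLpNorm_exponent_top, ← toReal_enorm]
  refine ENNReal.toReal_mono ?_ hx
  rw [← eLpNorm_exponent_top]
  exact h1.ne

lemma Extends.norm_le_linfNorm {d : ℕ} {F : Type*} [NormedAddCommGroup F] {T : Set (Vec d)}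
    (ho : IsOpen T) (hb : Bornology.IsBounded T) {f : Vec d → F} (hf : Extends T f) {x : Vec d}
    (hx : x ∈ T) : ‖f x‖ ≤ linfNorm T f := by
  obtain ⟨C, hC⟩ := hf.exists_bound hb
  refine le_of_ae_le_of_continuousOn ho hf.continuousOn.norm (linfNorm_ae_le (C := C) ?_).2 hx
  exact (ae_restrict_iff' ho.measurableSet).2 (Filter.Eventually.of_forall hC)

lemma Extends.norm_extendFrom_le {d : ℕ} {F : Type*} [NormedAddCommGroup F] {T : Set (Vec d)}
    {f : Vec d → F} (hf : Extends T f) {C : ℝ} (h : ∀ x ∈ T, ‖f x‖ ≤ C) {x : Vec d}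
    (hx : x ∈ closure T) : ‖extendFrom T f x‖ ≤ C := by
  have := mem_closure_iff_nhdsWithin_neBot.mp hx
  exact le_of_tendsto (hf.tendsto_extendFrom hx).norm
    (by filter_upwards [self_mem_nhdsWithin] with y hy using h y hy)

lemma linfNorm_nonneg {d : ℕ} {F : Type*} [NormedAddCommGroup F] (S : Set (Vec d)) (f : Vec d → F) :
    0 ≤ linfNorm S f := ENNReal.toReal_nonneg

namespace Mesh.Geometry

variable {d : ℕ} {Ω : Set (Vec d)} {M : Mesh Ω} {core : Set (Vec d) → Set (Vec d)}
  {nu : Set (Vec d) → Set (Vec d) → Vec d} {T e : Set (Vec d)}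

lemma linfNorm_le (G : M.Geometry core nu) {F : Type*} [NormedAddCommGroup F] {f : Vec d → F}
    (hf : ∀ T ∈ M.elements, Extends T f) (hT : T ∈ M.elements) :
    linfNorm T f ≤ linfNorm Ω f := by
  have h1 : ∀ T ∈ M.elements, ∃ C, ∀ x ∈ T, ‖f x‖ ≤ C := fun T hT =>
    (hf T hT).exists_bound (G.elem_bdd T hT)
  choose! C hC using h1
  have h2 : ∀ᵐ x ∂(volume.restrict Ω), ‖f x‖ ≤ ∑ T ∈ M.elements, |C T| :=
    G.ae_of_ae_elements fun T hT x hx => ((hC T hT x hx).trans (le_abs_self _)).trans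
      (Finset.single_le_sum (f := fun T => |C T|) (fun _ _ => abs_nonneg _) hT)
  exact ENNReal.toReal_mono (linfNorm_ae_le h2).1.ne
    (eLpNorm_mono_measure f (Measure.restrict_mono (G.elem_sub T hT) le_rfl))

/-- Integrals over the boundary of an element are sums of integrals over its facets. -/
lemma integral_frontier (G : M.Geometry core nu) (hT : T ∈ M.elements) {f : Vec d → ℝ}
    (hf : ∀ e ∈ M.facetsOf T, IntegrableOn f e (surf d)) :
    ∫ x in frontier T, f x ∂(surf d) = ∑ e ∈ M.facetsOf T, ∫ x in e, f x ∂(surf d) := by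
  have h1 : frontier T = ⋃ e : M.facetsOf T, (e : Set (Vec d)) := by
    rw [M.frontier_eq T hT]
    ext x
    simp only [Set.mem_iUnion, Subtype.exists, Mesh.mem_facetsOf, exists_prop, and_assoc]
  have hm : ∀ e : M.facetsOf T, MeasurableSet (e : Set (Vec d)) := fun e =>
    (G.facet_compact e (mem_facets e.2)).measurableSet
  rw [h1, integral_iUnion_ae (fun e => (hm e).nullMeasurableSet), tsum_fintype,
    Finset.sum_coe_sort (M.facetsOf T) fun e => ∫ x in e, f x ∂(surf d)]
  · intro e e' hne
    exact M.facet_overlap e (mem_facets e.2) e' (mem_facets e'.2) fun h => hne (Subtype.ext h)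
  · exact integrableOn_finite_iUnion.2 fun e => hf e e.2

lemma surf_frontier (G : M.Geometry core nu) (hT : T ∈ M.elements) :
    (surf d).real (frontier T) = ∑ e ∈ M.facetsOf T, (surf d).real e := by
  have := G.integral_frontier hT (f := fun _ => (1 : ℝ))
    (fun e he => integrableOn_const (G.facet_fin e (mem_facets he)).ne)
  simpa using this

lemma facetSize_le (hb : Bornology.IsBounded T) (he : e ∈ M.facets) (hT : T ∈ M.adj e) :
    M.facetSize e ≤ Metric.diam T := by
  obtain ⟨hT', heT⟩ := facetsOf_of_adj he hT
  rw [Mesh.facetSize]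
  split_ifs with h
  · refine csInf_le ⟨0, ?_⟩ ⟨T, hT, rfl⟩
    rintro _ ⟨T', -, rfl⟩
    exact Metric.diam_nonneg
  · rw [← Metric.diam_closure T]
    exact Metric.diam_mono (fun x hx => mem_closure_of_facet heT hx)
      (Metric.isBounded_closure_iff.2 hb)

lemma facetSize_pos (G : M.Geometry core nu) {Cg : ℝ} (hCg : 0 < Cg) (hgr : M.IsGraded Cg)
    (he : e ∈ M.facets) : 0 < M.facetSize e := by
  have : ∃ T, T ∈ M.adj e := by
    rcases M.interior_or_boundary e he with ⟨T, hT, T', hT', -, h⟩ | ⟨T, hT, h⟩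
    · exact ⟨T, Mesh.mem_adj.2 ⟨hT, h.trans Set.inter_subset_left⟩⟩
    · exact ⟨T, Mesh.mem_adj.2 ⟨hT, h.trans Set.inter_subset_left⟩⟩
  obtain ⟨T, hT⟩ := this
  obtain ⟨hT', heT⟩ := facetsOf_of_adj he hT
  have := (G.diam_pos T hT').trans_le (hgr T hT' e heT)
  exact pos_of_mul_pos_right this hCg.le

end Mesh.Geometry

/-- Cauchy-Schwarz inequality for a symmetric positive semidefinite matrix. -/
lemma abs_inner_le_of_isSymm {d : ℕ} {K : Matrix (Fin d) (Fin d) ℝ} (hK : K.IsSymm)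
    (hpos : ∀ ξ : Vec d, 0 ≤ inner ℝ ξ ((Matrix.toEuclideanCLM (𝕜 := ℝ) K : Vec d →L[ℝ] Vec d) ξ))
    (ξ ζ : Vec d) :
    |inner ℝ ((Matrix.toEuclideanCLM (𝕜 := ℝ) K : Vec d →L[ℝ] Vec d) ξ) ζ| ≤
      √(inner ℝ ((Matrix.toEuclideanCLM (𝕜 := ℝ) K : Vec d →L[ℝ] Vec d) ξ) ξ) *
      √(inner ℝ ((Matrix.toEuclideanCLM (𝕜 := ℝ) K : Vec d →L[ℝ] Vec d) ζ) ζ) := by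
  set L := (Matrix.toEuclideanCLM (𝕜 := ℝ) K : Vec d →L[ℝ] Vec d) with hL
  have hsymm : ∀ a b, inner ℝ (L a) b = inner ℝ (L b) a := by
    intro a b
    have h1 : star L = L := by
      rw [hL, ← map_star, Matrix.star_eq_conjTranspose, Matrix.conjTranspose_eq_transpose_of_trivial,
        hK.eq]
    rw [ContinuousLinearMap.star_eq_adjoint] at h1
    rw [← ContinuousLinearMap.adjoint_inner_right, h1, real_inner_comm]
  have hpos' : ∀ a, 0 ≤ inner ℝ (L a) a := fun a => by rw [real_inner_comm]; exact hpos a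
  have h2 : discrim (inner ℝ (L ζ) ζ) (2 * inner ℝ (L ξ) ζ) (inner ℝ (L ξ) ξ) ≤ 0 := by
    refine discrim_le_zero fun t => ?_
    have := hpos' (ξ + t • ζ)
    simp only [map_add, map_smul, inner_add_left, inner_add_right, inner_smul_left,
      inner_smul_right, conj_trivial, hsymm ζ ξ] at this
    linarith
  rw [discrim] at h2
  rw [← Real.sqrt_mul (hpos' ξ), ← Real.sqrt_sq_eq_abs]
  exact Real.sqrt_le_sqrt (by linarith)

section Construction

variable {d : ℕ} {Ω : Set (Vec d)} {M : Mesh Ω} {core : Set (Vec d) → Set (Vec d)}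
  {nu : Set (Vec d) → Set (Vec d) → Vec d} {c : Coeffs d} {D N : Finset (Set (Vec d))}

lemma Extends.extendFrom_coord {T : Set (Vec d)} {f : Vec d → Vec d} (hf : Extends T f) (k : Fin d)
    {x : Vec d} (hx : x ∈ closure T) : extendFrom T (fun y => f y k) x = extendFrom T f x k :=
  hf.extendFrom_comp (Φ := fun v : Vec d => v k)
    (EuclideanSpace.proj k : Vec d →L[ℝ] ℝ).continuous hx

/-- Membership of `β` in `W^{1,∞}(Ω)` enters only here: its weak derivatives on all of `Ω` force the
traces from both sides of an interior facet to agree. -/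
lemma Mesh.Geometry.setting (G : M.Geometry core nu) (hreg : c.Regular M)
    (hDN : ∀ e, e ∈ M.boundaryFacets ↔ e ∈ D ∨ e ∈ N) (hdisj : Disjoint D N)
    (hS : ∀ j, MemSobolev ⊤ Ω 1 fun x => c.β x j)
    (hD : ∀ e ∈ D, ∀ T ∈ M.adj e, ∀ᵐ x ∂((surf d).restrict e),
      inner ℝ (extendFrom T c.β x) (outerNormal T x) ≤ 0)
    (hN : ∀ e ∈ N, ∀ T ∈ M.adj e, ∀ᵐ x ∂((surf d).restrict e),
      0 ≤ inner ℝ (extendFrom T c.β x) (outerNormal T x)) : Setting M core nu c D N := by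
  have : IsFiniteMeasure (volume.restrict Ω) := ⟨by simpa using G.volume_lt_top⟩
  have hbe : ∀ T ∈ M.elements, Extends T c.β := fun T hT => hreg.beta_ext hT
  refine ⟨G, hreg, hDN, hdisj, ?_, ?_, ?_⟩
  · intro e he
    rcases M.interior_or_boundary e he with hi | hb
    · have hei := Mesh.mem_interiorFacets.2 ⟨he, hi⟩
      obtain ⟨T₁, T₂, n, h⟩ := G.exists_isInt hei
      have h1 : ∀ j, ∀ᵐ x ∂((surf d).restrict e), ∀ T ∈ M.adj e, ∀ T' ∈ M.adj e,
          extendFrom T (fun x => c.β x j) x = extendFrom T' (fun x => c.β x j) x := by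
        intro j
        obtain ⟨-, hw⟩ := hS j
        choose g hg hgm using hw
        refine G.trace_eq_interior (fun T hT => hreg.beta_C T hT j) (g := g) (fun k => ?_) hg hei
        exact MemLp.integrable le_top (hgm k)
      filter_upwards [ae_all_iff.2 h1, ae_restrict_mem (G.facet_compact e he).measurableSet]
        with x hx hxe T hT
      have key : ∀ T ∈ M.adj e, ∀ T' ∈ M.adj e, extendFrom T c.β x = extendFrom T' c.β x := by
        intro T hT T' hT'
        ext j
        have := hx j T hT T' hT'
        obtain ⟨a, a'⟩ := Mesh.Geometry.facetsOf_of_adj he hT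
        obtain ⟨b, b'⟩ := Mesh.Geometry.facetsOf_of_adj he hT'
        rwa [(hbe T a).extendFrom_coord j (Mesh.Geometry.mem_closure_of_facet a' hxe),
          (hbe T' b).extendFrom_coord j (Mesh.Geometry.mem_closure_of_facet b' hxe)] at this
      rw [h.avg_eq, key T₁ (by rw [h.adj]; simp) T hT, key T₂ (by rw [h.adj]; simp) T hT]
      module
    · obtain ⟨T, n, h⟩ := G.exists_isBd (Mesh.mem_boundaryFacets.2 ⟨he, hb⟩)
      refine Filter.Eventually.of_forall fun x T' hT' => ?_
      rw [h.adj, Finset.mem_singleton] at hT'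
      rw [h.avg_eq, hT']
  · intro e he
    obtain ⟨T, n, h⟩ := G.exists_isBd ((hDN e).2 (Or.inl he))
    filter_upwards [hD e he T (by rw [h.adj]; simp), G.ae_core h.mem] with x hx hxc T' hT'
    rw [h.adj, Finset.mem_singleton] at hT'
    rw [hT', h.avg_eq]
    rwa [G.outerNormal_eq T h.memT e h.facet x hxc] at hx
  · intro e he
    obtain ⟨T, n, h⟩ := G.exists_isBd ((hDN e).2 (Or.inr he))
    filter_upwards [hN e he T (by rw [h.adj]; simp), G.ae_core h.mem] with x hx hxc T' hT'
    rw [h.adj, Finset.mem_singleton] at hT'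
    rw [hT', h.avg_eq]
    rwa [G.outerNormal_eq T h.memT e h.facet x hxc] at hx

end Construction

lemma sqrt_mul_norm_sq {a : ℝ} (ha : 0 ≤ a) (b : ℝ) : (√a * b) ^ 2 = a * b ^ 2 := by
  rw [mul_pow, Real.sq_sqrt ha]

/-! ### Continuity estimates for the individual forms. -/

namespace Coeffs

variable {d : ℕ} {Ω : Set (Vec d)} (M : Mesh Ω)

/-- Sum of the boundary norms `‖w‖²_{L²(∂T)}`. -/
noncomputable def formB (w : Vec d → ℝ) : ℝ :=
  ∑ T ∈ M.elements, ∑ e ∈ M.facetsOf T, ∫ x in e, extendFrom T w x ^ 2 ∂(surf d)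

/-- Weighted sum of the boundary norms of the diffusive flux. -/
noncomputable def formQ (c : Coeffs d) (w : Vec d → ℝ) : ℝ :=
  ∑ T ∈ M.elements, ∑ e ∈ M.facetsOf T,
    M.facetSize e * ∫ x in e, ‖extendFrom T (c.diffFlux w) x‖ ^ 2 ∂(surf d)

end Coeffs

namespace Mesh

variable {d : ℕ} {Ω : Set (Vec d)} {M : Mesh Ω} {core : Set (Vec d) → Set (Vec d)}
  {nu : Set (Vec d) → Set (Vec d) → Vec d} {T e : Set (Vec d)}

lemma Geometry.card_adj_le (G : M.Geometry core nu) (he : e ∈ M.facets) : (M.adj e).card ≤ 2 := by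
  rcases M.interior_or_boundary e he with hi | hb
  · obtain ⟨T₁, T₂, n, h⟩ := G.exists_isInt (Mesh.mem_interiorFacets.2 ⟨he, hi⟩)
    rw [h.adj, Finset.card_pair h.ne]
  · obtain ⟨T, n, h⟩ := G.exists_isBd (Mesh.mem_boundaryFacets.2 ⟨he, hb⟩)
    rw [h.adj, Finset.card_singleton]
    norm_num

lemma norm_avg_sq_le {F : Type*} [NormedAddCommGroup F] [NormedSpace ℝ F] (f : Vec d → F)
    (x : Vec d) : ‖M.avg e f x‖ ^ 2 ≤ ∑ T ∈ M.adj e, ‖extendFrom T f x‖ ^ 2 := by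
  rw [avg, norm_smul, mul_pow]
  rcases Nat.eq_zero_or_pos (M.adj e).card with h | h
  · rw [Finset.card_eq_zero.1 h]
    simp
  have h1 : ‖∑ T ∈ M.adj e, extendFrom T f x‖ ^ 2 ≤
      (M.adj e).card * ∑ T ∈ M.adj e, ‖extendFrom T f x‖ ^ 2 :=
    (pow_le_pow_left₀ (norm_nonneg _) (norm_sum_le _ _) 2).trans sq_sum_le_card_mul_sum_sq
  have hc : (1 : ℝ) ≤ (M.adj e).card := by exact_mod_cast h
  have hs : 0 ≤ ∑ T ∈ M.adj e, ‖extendFrom T f x‖ ^ 2 :=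
    Finset.sum_nonneg fun _ _ => sq_nonneg _
  rw [Real.norm_eq_abs, abs_of_nonneg (by positivity), inv_pow]
  rw [inv_mul_le_iff₀ (by positivity)]
  refine h1.trans ?_
  gcongr
  nlinarith

/-- A facet has at most two neighbours, so the square of a sum of traces costs a factor `2`; the
factor `1/2` in `mean` more than pays for it. -/
lemma Geometry.mean_sq_le (G : M.Geometry core nu) (he : e ∈ M.facets) (w : Vec d → ℝ)
    (x : Vec d) : 2 * M.mean e w x ^ 2 ≤ ∑ T ∈ M.adj e, extendFrom T w x ^ 2 := by
  have h1 : (∑ T ∈ M.adj e, extendFrom T w x) ^ 2 ≤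
      (M.adj e).card * ∑ T ∈ M.adj e, extendFrom T w x ^ 2 := sq_sum_le_card_mul_sum_sq
  have hc : ((M.adj e).card : ℝ) ≤ 2 := by exact_mod_cast G.card_adj_le he
  have hs : 0 ≤ ∑ T ∈ M.adj e, extendFrom T w x ^ 2 := Finset.sum_nonneg fun _ _ => sq_nonneg _
  rw [mean]
  nlinarith

lemma Geometry.norm_jmp_sq_le (G : M.Geometry core nu) (he : e ∈ M.facets) (w : Vec d → ℝ)
    (x : Vec d) : ‖M.jmp nu e w x‖ ^ 2 ≤ 2 * ∑ T ∈ M.adj e, extendFrom T w x ^ 2 := by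
  have h0 : ‖M.jmp nu e w x‖ ≤ ∑ T ∈ M.adj e, |extendFrom T w x| := by
    refine (norm_sum_le _ _).trans (Finset.sum_le_sum fun T hT => ?_)
    obtain ⟨hT', heT⟩ := Geometry.facetsOf_of_adj he hT
    rw [norm_smul, G.nu_norm T hT' e heT, mul_one, Real.norm_eq_abs]
  have h1 : (∑ T ∈ M.adj e, |extendFrom T w x|) ^ 2 ≤
      (M.adj e).card * ∑ T ∈ M.adj e, |extendFrom T w x| ^ 2 := sq_sum_le_card_mul_sum_sq
  simp only [sq_abs] at h1
  have hc : ((M.adj e).card : ℝ) ≤ 2 := by exact_mod_cast G.card_adj_le he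
  have hs : 0 ≤ ∑ T ∈ M.adj e, extendFrom T w x ^ 2 := Finset.sum_nonneg fun _ _ => sq_nonneg _
  have h2 := pow_le_pow_left₀ (norm_nonneg _) h0 2
  nlinarith

lemma Geometry.exists_jmp_eq (G : M.Geometry core nu) (he : e ∈ M.facets) (w : Vec d → ℝ)
    (x : Vec d) : ∃ T ∈ M.adj e, ‖nu T e‖ = 1 ∧ ∃ t : ℝ, M.jmp nu e w x = t • nu T e := by
  rcases M.interior_or_boundary e he with hi | hb
  · obtain ⟨T₁, T₂, n, h⟩ := G.exists_isInt (Mesh.mem_interiorFacets.2 ⟨he, hi⟩)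
    refine ⟨T₁, by rw [h.adj]; simp, by rw [h.nu₁, h.norm],
      extendFrom T₁ w x - extendFrom T₂ w x, ?_⟩
    rw [jmp, h.adj, Finset.sum_pair h.ne, h.nu₁, h.nu₂]
    module
  · obtain ⟨T, n, h⟩ := G.exists_isBd (Mesh.mem_boundaryFacets.2 ⟨he, hb⟩)
    refine ⟨T, by rw [h.adj]; simp, by rw [h.nu_eq, h.norm], extendFrom T w x, ?_⟩
    rw [jmp, h.adj, Finset.sum_singleton]

end Mesh

namespace Setting

variable {d : ℕ} {Ω : Set (Vec d)} {M : Mesh Ω} {core : Set (Vec d) → Set (Vec d)}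
  {nu : Set (Vec d) → Set (Vec d) → Vec d} {c : Coeffs d} {D N : Finset (Set (Vec d))}
  {w z : Vec d → ℝ} {T e : Set (Vec d)}

lemma abs_inner_jmp_le (S : Setting M core nu c D N) (he : e ∈ M.facets) (z : Vec d → ℝ) :
    ∀ᵐ x ∂((surf d).restrict e),
      |inner ℝ (M.avg e c.β x) (M.jmp nu e z x)| ≤ M.abn nu e c.β x * ‖M.jmp nu e z x‖ := by
  filter_upwards [S.abn_eq he] with x hx
  obtain ⟨T, hT, hn, t, ht⟩ := S.geom.exists_jmp_eq he z x
  rw [ht, hx T hT, inner_smul_right, abs_mul, norm_smul, hn, mul_one, Real.norm_eq_abs, mul_comm]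

/-- The trace of `β` on the facet is the same from each side, so the local norm of either neighbour
may be used. This keeps later estimates local to elements. -/
lemma abn_le (S : Setting M core nu c D N) (he : e ∈ M.facets) :
    ∀ᵐ x ∂((surf d).restrict e), ∀ T ∈ M.adj e, M.abn nu e c.β x ≤ linfNorm T c.β := by
  filter_upwards [S.abn_eq he, S.beta_trace e he,
    ae_restrict_mem (S.geom.facet_compact e he).measurableSet] with x hx hb hxe T hT
  obtain ⟨hT', heT⟩ := Mesh.Geometry.facetsOf_of_adj he hT
  rw [hx T hT, ← hb T hT]
  refine (abs_real_inner_le_norm _ _).trans ?_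
  rw [S.geom.nu_norm T hT' e heT, mul_one]
  refine (S.reg.beta_ext hT').norm_extendFrom_le (fun y hy => ?_)
    (Mesh.Geometry.mem_closure_of_facet heT hxe)
  exact (S.reg.beta_ext hT').norm_le_linfNorm (S.geom.elem_open T hT') (S.geom.elem_bdd T hT') hy

section Elliptic

variable {kmin : ℝ}

lemma abs_formA_le (S : Setting M core nu c D N)
    (hsym : ∀ᵐ x ∂(volume.restrict Ω), (c.K x).IsSymm) (hk : 0 < kmin)
    (hell : ∀ᵐ x ∂(volume.restrict Ω), ∀ ξ : Vec d, kmin * ‖ξ‖ ^ 2 ≤ inner ℝ ξ (c.Kop x ξ))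
    (hw : M.BrokenC 1 w) (hz : M.BrokenC 1 z) :
    |c.formA M w z| ≤ √(c.formA M w w) * √(c.formA M z z) := by
  have G := S.geom
  have hpos : ∀ T ∈ M.elements, ∀ᵐ x ∂(volume.restrict T), ∀ ξ : Vec d,
      0 ≤ inner ℝ ξ (c.Kop x ξ) := by
    intro T hT
    filter_upwards [G.ae_element hT hell] with x hx ξ
    exact le_trans (by positivity) (hx ξ)
  have hsq : ∀ v : Vec d → ℝ, c.formA M v v = ∑ T ∈ M.elements, ∫ x in T,
      √(inner ℝ (c.diffFlux v x) (∇ v x)) ^ 2 := by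
    intro v
    refine Finset.sum_congr rfl fun T hT => integral_congr_ae ?_
    filter_upwards [hpos T hT] with x hx
    rw [Real.sq_sqrt]
    rw [real_inner_comm]
    exact hx _
  have hext : ∀ v : Vec d → ℝ, M.BrokenC 1 v → ∀ T ∈ M.elements, Extends T fun x =>
      √(inner ℝ (c.diffFlux v x) (∇ v x)) := fun v hv T hT =>
    ((S.diffFlux_ext hv T hT).dot ((hv T hT).extends_gradient le_rfl)).comp (Φ := Real.sqrt)
      Real.continuous_sqrt
  rw [hsq w, hsq z]
  refine abs_sum_integral_le M.elements (fun T => volume.restrict T)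
    (f := fun _ x => √(inner ℝ (c.diffFlux w x) (∇ w x)))
    (g := fun _ x => √(inner ℝ (c.diffFlux z x) (∇ z x))) (fun T hT => ?_) (fun T hT => ?_)
    (fun T hT => ?_) (fun T hT => ?_)
  · filter_upwards [hpos T hT, G.ae_element hT hsym] with x hx hs
    exact abs_inner_le_of_isSymm hs hx _ _
  · exact ((hext w hw T hT).comp (Φ := fun a => a ^ 2) (by fun_prop)).integrableOn
      (G.elem_open T hT) (G.elem_bdd T hT)
  · exact ((hext z hz T hT).comp (Φ := fun a => a ^ 2) (by fun_prop)).integrableOn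
      (G.elem_open T hT) (G.elem_bdd T hT)
  · exact ((hext w hw T hT).mul (hext z hz T hT)).integrableOn
      (G.elem_open T hT) (G.elem_bdd T hT)

lemma sum_gradient_le (S : Setting M core nu c D N)
    (hell : ∀ᵐ x ∂(volume.restrict Ω), ∀ ξ : Vec d, kmin * ‖ξ‖ ^ 2 ≤ inner ℝ ξ (c.Kop x ξ))
    (hz : M.BrokenC 1 z) :
    kmin * ∑ T ∈ M.elements, ∫ x in T, ‖∇ z x‖ ^ 2 ≤ c.formA M z z := by
  have G := S.geom
  rw [Finset.mul_sum]
  refine Finset.sum_le_sum fun T hT => ?_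
  have hg := (hz T hT).extends_gradient le_rfl
  rw [← integral_const_mul]
  refine integral_mono_ae ?_ ?_ ?_
  · exact ((hg.comp (Φ := fun v => ‖v‖ ^ 2) (by fun_prop)).integrableOn
      (G.elem_open T hT) (G.elem_bdd T hT)).const_mul _
  · exact ((S.diffFlux_ext hz T hT).dot hg).integrableOn (G.elem_open T hT) (G.elem_bdd T hT)
  · filter_upwards [G.ae_element hT hell] with x hx
    rw [real_inner_comm]
    exact hx _

/-- The advective part is bounded through `‖∇z‖`, and ellipticity exchanges `‖∇z‖` for the diffusive
energy at the price of `1 / √kmin`. -/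
lemma abs_formR_le (S : Setting M core nu c D N) (hk : 0 < kmin)
    (hell : ∀ᵐ x ∂(volume.restrict Ω), ∀ ξ : Vec d, kmin * ‖ξ‖ ^ 2 ≤ inner ℝ ξ (c.Kop x ξ))
    (hw : M.BrokenC 1 w) (hz : M.BrokenC 1 z) :
    |c.formR M w z| ≤ linfNorm Ω c.σ * (√(∑ T ∈ M.elements, ∫ x in T, w x ^ 2) *
        √(∑ T ∈ M.elements, ∫ x in T, z x ^ 2)) +
      linfNorm Ω c.β / √kmin * (√(∑ T ∈ M.elements, ∫ x in T, w x ^ 2) * √(c.formA M z z)) := by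
  have G := S.geom
  set s := linfNorm Ω c.σ
  set b := linfNorm Ω c.β
  have hs0 : 0 ≤ s := linfNorm_nonneg _ _
  have hb0 : 0 ≤ b := linfNorm_nonneg _ _
  have hwe : ∀ T ∈ M.elements, Extends T w := fun T hT => (hw T hT).extends
  have hze : ∀ T ∈ M.elements, Extends T z := fun T hT => (hz T hT).extends
  have hzg : ∀ T ∈ M.elements, Extends T (∇ z) := fun T hT => (hz T hT).extends_gradient le_rfl
  have hbe : ∀ T ∈ M.elements, Extends T c.β := fun T hT => S.reg.beta_ext hT
  have hsplit : c.formR M w z = (∑ T ∈ M.elements, ∫ x in T, c.σ x * w x * z x) -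
      ∑ T ∈ M.elements, ∫ x in T, inner ℝ (w x • c.β x) (∇ z x) := by
    rw [Coeffs.formR, ← Finset.sum_sub_distrib]
    refine Finset.sum_congr rfl fun T hT => integral_sub ?_ ?_
    · exact (((S.reg.sigma_ext T hT).mul (hwe T hT)).mul (hze T hT)).integrableOn
        (G.elem_open T hT) (G.elem_bdd T hT)
    · exact (((hwe T hT).smul (hbe T hT)).dot (hzg T hT)).integrableOn
        (G.elem_open T hT) (G.elem_bdd T hT)
  have h1 : |∑ T ∈ M.elements, ∫ x in T, c.σ x * w x * z x| ≤
      s * (√(∑ T ∈ M.elements, ∫ x in T, w x ^ 2) * √(∑ T ∈ M.elements, ∫ x in T, z x ^ 2)) := by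
    have := abs_sum_integral_le M.elements (fun T => volume.restrict T)
      (h := fun _ x => c.σ x * w x * z x) (f := fun _ x => s * |w x|) (g := fun _ x => |z x|)
      ?_ ?_ ?_ ?_
    · simp only [mul_pow, sq_abs, integral_const_mul, ← Finset.mul_sum] at this
      rw [Real.sqrt_mul (sq_nonneg s), Real.sqrt_sq hs0] at this
      rwa [← mul_assoc]
    · intro T hT
      refine (ae_restrict_iff' (G.elem_open T hT).measurableSet).2
        (Filter.Eventually.of_forall fun x hx => ?_)
      rw [abs_mul, abs_mul]
      gcongr
      exact ((S.reg.sigma_ext T hT).norm_le_linfNorm (G.elem_open T hT) (G.elem_bdd T hT)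
        hx).trans (G.linfNorm_le S.reg.sigma_ext hT)
    · exact fun T hT => ((hwe T hT).comp (Φ := fun a => (s * |a|) ^ 2) (by fun_prop)).integrableOn
        (G.elem_open T hT) (G.elem_bdd T hT)
    · exact fun T hT => ((hze T hT).comp (Φ := fun a => |a| ^ 2) (by fun_prop)).integrableOn
        (G.elem_open T hT) (G.elem_bdd T hT)
    · exact fun T hT => ((hwe T hT).comp₂ (hze T hT) (Φ := fun a b => (s * |a|) * |b|)
        (by fun_prop)).integrableOn (G.elem_open T hT) (G.elem_bdd T hT)
  have h2 : |∑ T ∈ M.elements, ∫ x in T, inner ℝ (w x • c.β x) (∇ z x)| ≤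
      b * (√(∑ T ∈ M.elements, ∫ x in T, w x ^ 2) *
        √(∑ T ∈ M.elements, ∫ x in T, ‖∇ z x‖ ^ 2)) := by
    have := abs_sum_integral_le M.elements (fun T => volume.restrict T)
      (h := fun _ x => inner ℝ (w x • c.β x) (∇ z x)) (f := fun _ x => b * |w x|)
      (g := fun _ x => ‖∇ z x‖) ?_ ?_ ?_ ?_
    · simp only [mul_pow, sq_abs, integral_const_mul, ← Finset.mul_sum] at this
      rw [Real.sqrt_mul (sq_nonneg b), Real.sqrt_sq hb0] at this
      rwa [← mul_assoc]
    · intro T hT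
      refine (ae_restrict_iff' (G.elem_open T hT).measurableSet).2
        (Filter.Eventually.of_forall fun x hx => ?_)
      refine (abs_real_inner_le_norm _ _).trans ?_
      rw [norm_smul, Real.norm_eq_abs, mul_comm |w x|]
      gcongr
      exact ((hbe T hT).norm_le_linfNorm (G.elem_open T hT) (G.elem_bdd T hT)
        hx).trans (G.linfNorm_le hbe hT)
    · exact fun T hT => ((hwe T hT).comp (Φ := fun a => (b * |a|) ^ 2) (by fun_prop)).integrableOn
        (G.elem_open T hT) (G.elem_bdd T hT)
    · exact fun T hT => ((hzg T hT).comp (Φ := fun a => ‖a‖ ^ 2) (by fun_prop)).integrableOn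
        (G.elem_open T hT) (G.elem_bdd T hT)
    · exact fun T hT => ((hwe T hT).comp₂ (hzg T hT) (Φ := fun a v => (b * |a|) * ‖v‖)
        (by fun_prop)).integrableOn (G.elem_open T hT) (G.elem_bdd T hT)
  have h3 : √(∑ T ∈ M.elements, ∫ x in T, ‖∇ z x‖ ^ 2) ≤ √(c.formA M z z) / √kmin := by
    rw [← Real.sqrt_div' _ hk.le]
    apply Real.sqrt_le_sqrt
    rw [le_div_iff₀' hk]
    exact S.sum_gradient_le hell hz
  rw [hsplit]
  refine (abs_sub _ _).trans (add_le_add h1 (h2.trans ?_))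
  have : b * (√(∑ T ∈ M.elements, ∫ x in T, w x ^ 2) *
        √(∑ T ∈ M.elements, ∫ x in T, ‖∇ z x‖ ^ 2)) ≤
      b * (√(∑ T ∈ M.elements, ∫ x in T, w x ^ 2) * (√(c.formA M z z) / √kmin)) := by gcongr
  refine this.trans (le_of_eq ?_)
  ring

end Elliptic

/-- Cauchy-Schwarz with the weight `h_e / γ` on the flux and `γ / h_e` on the jump, so that the
second factor is exactly the penalty term. -/
lemma abs_formP_le (S : Setting M core nu c D N) {γ : ℝ} (hγ : 0 < γ)
    (hsize : ∀ e ∈ M.facets, 0 < M.facetSize e) (hw : M.BrokenC 1 w) (hz : M.BrokenC 1 z) :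
    |c.formP M nu D w z| ≤ √(c.formQ M w / γ) * √(c.formJ M nu D γ z z) := by
  have G := S.geom
  have hze : ∀ T ∈ M.elements, Extends T z := fun T hT => (hz T hT).extends
  have hq := S.diffFlux_ext hw
  have hpos : ∀ e ∈ M.active D, 0 < γ / M.facetSize e := fun e he =>
    div_pos hγ (hsize e (S.active_sub he))
  have hpos' : ∀ e ∈ M.active D, 0 < M.facetSize e / γ := fun e he =>
    div_pos (hsize e (S.active_sub he)) hγ
  have hca : ∀ e ∈ M.active D, ContinuousOn (M.avg e (c.diffFlux w)) e := fun e he =>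
    Mesh.continuousOn_avg (S.active_sub he) hq
  have hcj : ∀ e ∈ M.active D, ContinuousOn (M.jmp nu e z) e := fun e he =>
    Mesh.continuousOn_jmp (S.active_sub he) hze
  have := abs_sum_integral_le (M.active D) (fun e => (surf d).restrict e)
    (h := fun e x => inner ℝ (M.avg e (c.diffFlux w) x) (M.jmp nu e z x))
    (f := fun e x => √(M.facetSize e / γ) * ‖M.avg e (c.diffFlux w) x‖)
    (g := fun e x => √(γ / M.facetSize e) * ‖M.jmp nu e z x‖) ?_ ?_ ?_ ?_
  · refine this.trans (mul_le_mul (Real.sqrt_le_sqrt ?_) (Real.sqrt_le_sqrt (le_of_eq ?_))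
      (Real.sqrt_nonneg _) (Real.sqrt_nonneg _))
    · have hfint : ∀ e ∈ M.facets, ∀ T ∈ M.adj e,
          IntegrableOn (fun x => ‖extendFrom T (c.diffFlux w) x‖ ^ 2) e (surf d) := by
        intro e he T hT
        obtain ⟨hT', heT⟩ := Mesh.Geometry.facetsOf_of_adj he hT
        exact G.integrableOn_facet he ((Mesh.Geometry.continuousOn_trace heT (hq T hT')).norm.pow 2)
      have h1 : ∀ e ∈ M.active D,
          ∫ x in e, (√(M.facetSize e / γ) * ‖M.avg e (c.diffFlux w) x‖) ^ 2 ∂(surf d) ≤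
          ∑ T ∈ M.adj e, M.facetSize e / γ *
            ∫ x in e, ‖extendFrom T (c.diffFlux w) x‖ ^ 2 ∂(surf d) := by
        intro e he
        have hef := S.active_sub he
        simp only [sqrt_mul_norm_sq (hpos' e he).le]
        rw [integral_const_mul, ← Finset.mul_sum, ← integral_finsetSum _ (hfint e hef)]
        refine mul_le_mul_of_nonneg_left ?_ (hpos' e he).le
        exact integral_mono (G.integrableOn_facet hef ((hca e he).norm.pow 2))
          (integrable_finsetSum _ (hfint e hef)) fun x => Mesh.norm_avg_sq_le _ x
      refine (Finset.sum_le_sum h1).trans ?_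
      have h2 : c.formQ M w / γ = ∑ e ∈ M.facets, ∑ T ∈ M.adj e, M.facetSize e / γ *
            ∫ x in e, ‖extendFrom T (c.diffFlux w) x‖ ^ 2 ∂(surf d) := by
        rw [Coeffs.formQ, Mesh.Geometry.sum_facets_comm (M := M) (fun T e =>
          M.facetSize e * ∫ x in e, ‖extendFrom T (c.diffFlux w) x‖ ^ 2 ∂(surf d)), Finset.sum_div]
        refine Finset.sum_congr rfl fun e _ => ?_
        rw [Finset.sum_div]
        refine Finset.sum_congr rfl fun T _ => by ring
      rw [h2]
      refine Finset.sum_le_sum_of_subset_of_nonneg (fun e he => S.active_sub he) fun e he _ =>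
        Finset.sum_nonneg fun T _ => mul_nonneg (div_pos (hsize e he) hγ).le
          (integral_nonneg fun x => sq_nonneg _)
    · refine Finset.sum_congr rfl fun e he => ?_
      simp only [sqrt_mul_norm_sq (hpos e he).le, integral_const_mul, real_inner_self_eq_norm_sq]
  · intro e he
    refine Filter.Eventually.of_forall fun x => (abs_real_inner_le_norm _ _).trans (le_of_eq ?_)
    have : √(M.facetSize e / γ) * √(γ / M.facetSize e) = 1 := by
      rw [← Real.sqrt_mul (hpos' e he).le, div_mul_div_comm, mul_comm γ, div_self, Real.sqrt_one]
      exact (mul_pos (hsize e (S.active_sub he)) hγ).ne'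
    linear_combination (- ‖M.avg e (c.diffFlux w) x‖ * ‖M.jmp nu e z x‖) * this
  · exact fun e he => G.integrableOn_facet (S.active_sub he)
      ((continuousOn_const.mul (hca e he).norm).pow 2)
  · exact fun e he => G.integrableOn_facet (S.active_sub he)
      ((continuousOn_const.mul (hcj e he).norm).pow 2)
  · exact fun e he => G.integrableOn_facet (S.active_sub he)
      ((continuousOn_const.mul (hca e he).norm).mul (continuousOn_const.mul (hcj e he).norm))

lemma abs_formJ_le (S : Setting M core nu c D N) {γ : ℝ} (hγ : 0 < γ)
    (hsize : ∀ e ∈ M.facets, 0 < M.facetSize e) (hw : M.BrokenC 1 w) (hz : M.BrokenC 1 z) :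
    |c.formJ M nu D γ w z| ≤ √(c.formJ M nu D γ w w) * √(c.formJ M nu D γ z z) := by
  have G := S.geom
  have hpos : ∀ e ∈ M.active D, 0 < γ / M.facetSize e := fun e he =>
    div_pos hγ (hsize e (S.active_sub he))
  have hcj : ∀ v : Vec d → ℝ, M.BrokenC 1 v → ∀ e ∈ M.active D, ContinuousOn (M.jmp nu e v) e :=
    fun v hv e he => Mesh.continuousOn_jmp (S.active_sub he) fun T hT => (hv T hT).extends
  have hsq : ∀ v : Vec d → ℝ, c.formJ M nu D γ v v = ∑ e ∈ M.active D,
      ∫ x in e, (√(γ / M.facetSize e) * ‖M.jmp nu e v x‖) ^ 2 ∂(surf d) := by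
    intro v
    refine Finset.sum_congr rfl fun e he => ?_
    simp only [sqrt_mul_norm_sq (hpos e he).le, integral_const_mul, real_inner_self_eq_norm_sq]
  have h0 : c.formJ M nu D γ w z = ∑ e ∈ M.active D, ∫ x in e,
      γ / M.facetSize e * inner ℝ (M.jmp nu e w x) (M.jmp nu e z x) ∂(surf d) :=
    Finset.sum_congr rfl fun e he => (integral_const_mul _ _).symm
  rw [hsq w, hsq z, h0]
  refine abs_sum_integral_le (M.active D) (fun e => (surf d).restrict e)
    (f := fun e x => √(γ / M.facetSize e) * ‖M.jmp nu e w x‖)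
    (g := fun e x => √(γ / M.facetSize e) * ‖M.jmp nu e z x‖) ?_ ?_ ?_ ?_
  · intro e he
    refine Filter.Eventually.of_forall fun x => ?_
    have h1 : √(γ / M.facetSize e) * ‖M.jmp nu e w x‖ * (√(γ / M.facetSize e) * ‖M.jmp nu e z x‖) =
        γ / M.facetSize e * (‖M.jmp nu e w x‖ * ‖M.jmp nu e z x‖) := by
      linear_combination (‖M.jmp nu e w x‖ * ‖M.jmp nu e z x‖) * Real.mul_self_sqrt (hpos e he).le
    rw [h1, abs_mul, abs_of_pos (hpos e he)]
    exact mul_le_mul_of_nonneg_left (abs_real_inner_le_norm _ _) (hpos e he).le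
  · exact fun e he => G.integrableOn_facet (S.active_sub he)
      ((continuousOn_const.mul (hcj w hw e he).norm).pow 2)
  · exact fun e he => G.integrableOn_facet (S.active_sub he)
      ((continuousOn_const.mul (hcj z hz e he).norm).pow 2)
  · exact fun e he => G.integrableOn_facet (S.active_sub he)
      ((continuousOn_const.mul (hcj w hw e he).norm).mul
        (continuousOn_const.mul (hcj z hz e he).norm))

/-- The weight `|β · n|` is distributed over both factors, and `|⟪β, [z]⟫|` equals `|β · n| |[z]|`
because the jump is normal. Only the mean of `w` is not part of the norm of the method; it is
bounded by the boundary norms collected in `formB`. -/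
lemma abs_formF_le (S : Setting M core nu c D N) (hw : M.BrokenC 1 w) (hz : M.BrokenC 1 z) :
    |c.formF M nu w z| ≤ √(linfNorm Ω c.β) * (√(Coeffs.formB M w) * √(c.formU M nu z)) +
      √(c.formU M nu w) * √(c.formU M nu z) := by
  have G := S.geom
  set b := linfNorm Ω c.β
  have hb0 : 0 ≤ b := linfNorm_nonneg _ _
  have hbe : ∀ T ∈ M.elements, Extends T c.β := fun T hT => S.reg.beta_ext hT
  have hwe : ∀ T ∈ M.elements, Extends T w := fun T hT => (hw T hT).extends
  have ha0 : ∀ e x, 0 ≤ M.abn nu e c.β x := fun e x => abn_nonneg e c.β x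
  have hcj : ∀ v : Vec d → ℝ, M.BrokenC 1 v → ∀ e ∈ M.facets, ContinuousOn (M.jmp nu e v) e :=
    fun v hv e he => Mesh.continuousOn_jmp he fun T hT => (hv T hT).extends
  have hcn : ∀ e ∈ M.facets, ContinuousOn (fun x => √(1 / 2 * M.abn nu e c.β x)) e := fun e he =>
    Real.continuous_sqrt.comp_continuousOn
      (continuousOn_const.mul (Mesh.continuousOn_abn he hbe))
  have hcm : ∀ e ∈ M.facets, ContinuousOn (M.mean e w) e := fun e he =>
    Mesh.continuousOn_mean he hwe
  have hU : ∀ v, c.formU M nu v = ∑ e ∈ M.facets,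
      ∫ x in e, (√(1 / 2 * M.abn nu e c.β x) * ‖M.jmp nu e v x‖) ^ 2 ∂(surf d) := by
    intro v
    rw [Coeffs.formU, Finset.mul_sum]
    refine Finset.sum_congr rfl fun e he => ?_
    rw [← integral_const_mul]
    congr 1
    ext x
    rw [sqrt_mul_norm_sq (by have := ha0 e x; positivity)]
    ring
  have hsq : ∀ e x, √(1 / 2 * M.abn nu e c.β x) * √(1 / 2 * M.abn nu e c.β x) =
      1 / 2 * M.abn nu e c.β x := fun e x =>
    Real.mul_self_sqrt (by have := ha0 e x; positivity)
  have h1 : |∑ e ∈ M.facets, ∫ x in e,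
      M.mean e w x * inner ℝ (M.avg e c.β x) (M.jmp nu e z x) ∂(surf d)| ≤
      √(b * Coeffs.formB M w) * √(c.formU M nu z) := by
    rw [hU z]
    have := abs_sum_integral_le M.facets (fun e => (surf d).restrict e)
      (h := fun e x => M.mean e w x * inner ℝ (M.avg e c.β x) (M.jmp nu e z x))
      (f := fun e x => 2 * √(1 / 2 * M.abn nu e c.β x) * |M.mean e w x|)
      (g := fun e x => √(1 / 2 * M.abn nu e c.β x) * ‖M.jmp nu e z x‖) ?_ ?_ ?_ ?_
    · refine this.trans (mul_le_mul_of_nonneg_right (Real.sqrt_le_sqrt ?_) (Real.sqrt_nonneg _))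
      rw [Coeffs.formB, Mesh.Geometry.sum_facets_comm (M := M)
        (fun T e => ∫ x in e, extendFrom T w x ^ 2 ∂(surf d)), Finset.mul_sum]
      refine Finset.sum_le_sum fun e he => ?_
      have hfint : ∀ T ∈ M.adj e, IntegrableOn (fun x => extendFrom T w x ^ 2) e (surf d) := by
        intro T hT
        obtain ⟨hT', heT⟩ := Mesh.Geometry.facetsOf_of_adj he hT
        exact G.integrableOn_facet he ((Mesh.Geometry.continuousOn_trace heT (hwe T hT')).pow 2)
      rw [← integral_finsetSum _ hfint, ← integral_const_mul]
      refine integral_mono_ae ?_ ((integrable_finsetSum _ hfint).const_mul _) ?_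
      · exact G.integrableOn_facet he
          (((continuousOn_const.mul (hcn e he)).mul (hcm e he).abs).pow 2)
      · filter_upwards [S.abn_le he] with x hx
        obtain ⟨T, hT, -⟩ := G.exists_jmp_eq he w x
        obtain ⟨hT', heT⟩ := Mesh.Geometry.facetsOf_of_adj he hT
        have h1 : M.abn nu e c.β x ≤ b := (hx T hT).trans (G.linfNorm_le hbe hT')
        have h2 : (2 * √(1 / 2 * M.abn nu e c.β x) * |M.mean e w x|) ^ 2 =
            M.abn nu e c.β x * (2 * M.mean e w x ^ 2) := by
          rw [mul_pow, sq_abs, mul_pow, sq (√_), hsq]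
          ring
        simp only [h2]
        exact mul_le_mul h1 (G.mean_sq_le he w x) (by positivity) hb0
    · intro e he
      filter_upwards [S.abs_inner_jmp_le he z] with x hx
      rw [abs_mul]
      have h2 : 2 * √(1 / 2 * M.abn nu e c.β x) * |M.mean e w x| *
          (√(1 / 2 * M.abn nu e c.β x) * ‖M.jmp nu e z x‖) =
          |M.mean e w x| * (M.abn nu e c.β x * ‖M.jmp nu e z x‖) := by
        linear_combination (2 * |M.mean e w x| * ‖M.jmp nu e z x‖) * hsq e x
      rw [h2]
      exact mul_le_mul_of_nonneg_left hx (abs_nonneg _)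
    · exact fun e he => G.integrableOn_facet he
        (((continuousOn_const.mul (hcn e he)).mul (hcm e he).abs).pow 2)
    · exact fun e he => G.integrableOn_facet he (((hcn e he).mul (hcj z hz e he).norm).pow 2)
    · exact fun e he => G.integrableOn_facet he
        (((continuousOn_const.mul (hcn e he)).mul (hcm e he).abs).mul
          ((hcn e he).mul (hcj z hz e he).norm))
  have h2 : |∑ e ∈ M.facets, ∫ x in e,
      1 / 2 * (M.abn nu e c.β x * inner ℝ (M.jmp nu e w x) (M.jmp nu e z x)) ∂(surf d)| ≤
      √(c.formU M nu w) * √(c.formU M nu z) := by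
    rw [hU z, hU w]
    refine abs_sum_integral_le M.facets (fun e => (surf d).restrict e)
      (f := fun e x => √(1 / 2 * M.abn nu e c.β x) * ‖M.jmp nu e w x‖)
      (g := fun e x => √(1 / 2 * M.abn nu e c.β x) * ‖M.jmp nu e z x‖) ?_ ?_ ?_ ?_
    · intro e he
      refine Filter.Eventually.of_forall fun x => ?_
      have h2 : √(1 / 2 * M.abn nu e c.β x) * ‖M.jmp nu e w x‖ *
          (√(1 / 2 * M.abn nu e c.β x) * ‖M.jmp nu e z x‖) =
          1 / 2 * (M.abn nu e c.β x * (‖M.jmp nu e w x‖ * ‖M.jmp nu e z x‖)) := by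
        linear_combination (‖M.jmp nu e w x‖ * ‖M.jmp nu e z x‖) * hsq e x
      rw [h2, abs_mul, abs_mul, abs_of_nonneg (ha0 e x), abs_of_nonneg (by norm_num : (0:ℝ) ≤ 1 / 2)]
      have := ha0 e x
      gcongr
      exact abs_real_inner_le_norm _ _
    · exact fun e he => G.integrableOn_facet he (((hcn e he).mul (hcj w hw e he).norm).pow 2)
    · exact fun e he => G.integrableOn_facet he (((hcn e he).mul (hcj z hz e he).norm).pow 2)
    · exact fun e he => G.integrableOn_facet he (((hcn e he).mul (hcj w hw e he).norm).mul
        ((hcn e he).mul (hcj z hz e he).norm))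
  have hsplit : c.formF M nu w z = (∑ e ∈ M.facets, ∫ x in e,
      M.mean e w x * inner ℝ (M.avg e c.β x) (M.jmp nu e z x) ∂(surf d)) +
      ∑ e ∈ M.facets, ∫ x in e,
      1 / 2 * (M.abn nu e c.β x * inner ℝ (M.jmp nu e w x) (M.jmp nu e z x)) ∂(surf d) := by
    rw [Coeffs.formF, ← Finset.sum_add_distrib]
    refine Finset.sum_congr rfl fun e he => integral_add ?_ ?_
    · exact G.integrableOn_facet he ((hcm e he).mul
        ((Mesh.continuousOn_avg he hbe).inner (hcj z hz e he)))
    · exact G.integrableOn_facet he (continuousOn_const.mul ((Mesh.continuousOn_abn he hbe).mul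
        ((hcj w hw e he).inner (hcj z hz e he))))
  rw [hsplit, ← mul_assoc, ← Real.sqrt_mul hb0]
  exact (abs_add_le _ _).trans (add_le_add h1 h2)

end Setting

/-! ### Polynomial functions and their derivatives. -/

/-- The polynomial function on `ℝ^d` given by `q`. -/
noncomputable def polyFun {d : ℕ} (q : MvPolynomial (Fin d) ℝ) (x : Vec d) : ℝ :=
  MvPolynomial.eval (fun k => x k) q

section Poly

variable {d : ℕ}

lemma hasFDerivAt_coord (k : Fin d) (x : Vec d) :
    HasFDerivAt (fun y : Vec d => y k) (EuclideanSpace.proj k : Vec d →L[ℝ] ℝ) x :=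
  (EuclideanSpace.proj k : Vec d →L[ℝ] ℝ).hasFDerivAt

lemma polyFun_C (a : ℝ) : polyFun (MvPolynomial.C a : MvPolynomial (Fin d) ℝ) = fun _ => a := by
  ext x; simp [polyFun]

lemma polyFun_add (p q : MvPolynomial (Fin d) ℝ) :
    polyFun (p + q) = fun x => polyFun p x + polyFun q x := by
  ext x; simp [polyFun]

lemma polyFun_mul_X (p : MvPolynomial (Fin d) ℝ) (k : Fin d) :
    polyFun (p * MvPolynomial.X k) = fun x => polyFun p x * x k := by
  ext x; simp [polyFun]

lemma contDiff_polyFun (q : MvPolynomial (Fin d) ℝ) : ContDiff ℝ ∞ (polyFun q) := by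
  induction q using MvPolynomial.induction_on with
  | C a => rw [polyFun_C]; exact contDiff_const
  | add p q hp hq => rw [polyFun_add]; exact hp.add hq
  | mul_X p k hp =>
    rw [polyFun_mul_X]
    exact hp.mul (EuclideanSpace.proj k : Vec d →L[ℝ] ℝ).contDiff

lemma differentiable_polyFun (q : MvPolynomial (Fin d) ℝ) : Differentiable ℝ (polyFun q) :=
  (contDiff_polyFun q).differentiable (by simp)

lemma fderiv_polyFun (q : MvPolynomial (Fin d) ℝ) (x : Vec d) (k : Fin d) :
    fderiv ℝ (polyFun q) x (unitVec k) = polyFun (MvPolynomial.pderiv k q) x := by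
  induction q using MvPolynomial.induction_on with
  | C a => simp [polyFun_C, polyFun]
  | add p q hp hq =>
    rw [polyFun_add, fderiv_fun_add (differentiable_polyFun p x) (differentiable_polyFun q x),
      add_apply, hp, hq, map_add, polyFun_add]
  | mul_X p j hp =>
    have hj : (EuclideanSpace.proj j : Vec d →L[ℝ] ℝ) (unitVec k) = if j = k then 1 else 0 := by
      simp [unitVec]
    rw [polyFun_mul_X, fderiv_fun_mul (differentiable_polyFun p x)
      (hasFDerivAt_coord j x).differentiableAt, (hasFDerivAt_coord j x).fderiv,
      MvPolynomial.pderiv_mul, MvPolynomial.pderiv_X, polyFun_add, polyFun_mul_X, add_apply,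
      smul_apply, smul_apply, hp, hj, add_comm]
    by_cases h : j = k
    · subst h; simp [polyFun, mul_comm]
    · simp [h, polyFun, mul_comm]

lemma totalDegree_pderiv_le (q : MvPolynomial (Fin d) ℝ) (k : Fin d) :
    (MvPolynomial.pderiv k q).totalDegree ≤ q.totalDegree - 1 := by
  classical
  nth_rewrite 1 [q.as_sum]
  rw [map_sum]
  refine (MvPolynomial.totalDegree_finsetSum _ _).trans (Finset.sup_le fun s hs => ?_)
  rw [MvPolynomial.pderiv_monomial]
  by_cases h : s k = 0
  · simp [h]
  refine (MvPolynomial.totalDegree_monomial_le _ _).trans ?_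
  have h1 := MvPolynomial.le_totalDegree hs
  have h2 : (s - Finsupp.single k 1) + Finsupp.single k 1 = s := by
    ext j
    by_cases hj : j = k
    · subst hj; simp; omega
    · simp [hj]
  have h3 : s.degree = (s - Finsupp.single k 1).degree + 1 := by
    nth_rewrite 1 [← h2]
    rw [map_add, Finsupp.degree_single]
  have h4 : (s - Finsupp.single k 1).degree =
    (s - Finsupp.single k 1).sum fun _ e => e := rfl
  have h5 : s.degree = s.sum fun _ e => e := rfl
  have h6 : (s - Finsupp.single k 1).degree ≤ q.totalDegree - 1 := by omega
  exact h6

lemma norm_gradient_polyFun_sq (q : MvPolynomial (Fin d) ℝ) (x : Vec d) :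
    ‖∇ (polyFun q) x‖ ^ 2 = ∑ k, polyFun (MvPolynomial.pderiv k q) x ^ 2 := by
  rw [EuclideanSpace.norm_sq_eq]
  refine Finset.sum_congr rfl fun k _ => ?_
  rw [gradient_apply_coord, fderiv_polyFun, Real.norm_eq_abs, sq_abs]

end Poly

/-- `v` is a polynomial of degree at most `p` in each element. -/
def Mesh.PiecewisePoly {d : ℕ} {Ω : Set (Vec d)} (M : Mesh Ω) (p : ℕ) (v : Vec d → ℝ) : Prop :=
  ∀ T ∈ M.elements, ∃ q : MvPolynomial (Fin d) ℝ, q.totalDegree ≤ p ∧ Set.EqOn v (polyFun q) T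

lemma Mesh.PiecewisePoly.smooth {d : ℕ} {Ω : Set (Vec d)} {M : Mesh Ω} {p : ℕ} {v : Vec d → ℝ}
    (h : M.PiecewisePoly p v) : M.PiecewiseSmooth v := fun T hT => by
  obtain ⟨q, -, hq⟩ := h T hT
  exact ⟨polyFun q, contDiff_polyFun q, hq⟩

/-- Minimising the right-hand side over `t` gives `(√W + √Z)²`, attained at `t = √Z / √W`. It
deduces the triangle inequality for a norm made of many quadratic terms from Young's inequality in
each of them. -/
lemma sqrt_le_add_sqrt {N W Z : ℝ} (hW : 0 ≤ W) (hZ : 0 ≤ Z)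
    (h : ∀ t : ℝ, 0 < t → N ≤ (1 + t) * W + (1 + t⁻¹) * Z) : √N ≤ √W + √Z := by
  apply Real.sqrt_le_iff.2
  refine ⟨by positivity, le_of_forall_pos_le_add fun δ hδ => ?_⟩
  have hw := Real.sqrt_nonneg W
  have hz := Real.sqrt_nonneg Z
  set a := √W
  set b := √Z
  have ha : W = a ^ 2 := (Real.sq_sqrt hW).symm
  have hb : Z = b ^ 2 := (Real.sq_sqrt hZ).symm
  set μ := δ / (2 * (a + b) + 1) with hμ
  have hμ0 : 0 < μ := by positivity
  have hμ1 : μ * (2 * (a + b) + 1) = δ := by rw [hμ]; field_simp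
  -- The optimal value `b / a` is perturbed by `μ`, since `a` or `b` may be zero; the resulting
  -- excess is at most `μ (a + b) ≤ δ`.
  have h1 := h ((b + μ) / (a + μ)) (by positivity)
  rw [inv_div] at h1
  have e1 : (b + μ) / (a + μ) * a ≤ b + μ := by
    rw [div_mul_eq_mul_div, div_le_iff₀ (by positivity)]
    nlinarith
  have e2 : (a + μ) / (b + μ) * b ≤ a + μ := by
    rw [div_mul_eq_mul_div, div_le_iff₀ (by positivity)]
    nlinarith
  have e3 := mul_le_mul_of_nonneg_right e1 hw
  have e4 := mul_le_mul_of_nonneg_right e2 hz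
  rw [ha, hb] at h1
  nlinarith

/-! ### The norm of the method and the trace estimate for discrete fluxes. -/

namespace Setting

variable {d : ℕ} {Ω : Set (Vec d)} {M : Mesh Ω} {core : Set (Vec d) → Set (Vec d)}
  {nu : Set (Vec d) → Set (Vec d) → Vec d} {c : Coeffs d} {D N : Finset (Set (Vec d))}
  {w z : Vec d → ℝ} {T e : Set (Vec d)} {kmin Ctr γ ε σ₀ : ℝ} {p : ℕ}

/-- The norm of the bilinear form is a sum of squares. -/
noncomputable def energy (M : Mesh Ω) (nu : Set (Vec d) → Set (Vec d) → Vec d) (c : Coeffs d)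
    (D : Finset (Set (Vec d))) (γ : ℝ) (w : Vec d → ℝ) : ℝ :=
  c.formA M w w + c.formJ M nu D γ w w + (∑ T ∈ M.elements, ∫ x in T, w x ^ 2) + c.formU M nu w

lemma formJ_nonneg (S : Setting M core nu c D N) (hγ : 0 < γ)
    (hsize : ∀ e ∈ M.facets, 0 < M.facetSize e) (w : Vec d → ℝ) : 0 ≤ c.formJ M nu D γ w w :=
  Finset.sum_nonneg fun e he => mul_nonneg (div_pos hγ (hsize e (S.active_sub he))).le
    (integral_nonneg fun _ => real_inner_self_nonneg)

lemma formU_nonneg (w : Vec d → ℝ) : 0 ≤ c.formU M nu w :=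
  mul_nonneg (by norm_num) (Finset.sum_nonneg fun e _ => integral_nonneg fun x =>
    mul_nonneg (abn_nonneg e c.β x) (sq_nonneg _))

lemma formL_nonneg (w : Vec d → ℝ) : 0 ≤ ∑ T ∈ M.elements, ∫ x in T, w x ^ 2 :=
  Finset.sum_nonneg fun _ _ => integral_nonneg fun _ => sq_nonneg _

lemma formA_nonneg (S : Setting M core nu c D N) (hk : 0 < kmin)
    (hell : ∀ᵐ x ∂(volume.restrict Ω), ∀ ξ : Vec d, kmin * ‖ξ‖ ^ 2 ≤ inner ℝ ξ (c.Kop x ξ))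
    (hw : M.BrokenC 1 w) : 0 ≤ c.formA M w w :=
  le_trans (mul_nonneg hk.le (Finset.sum_nonneg fun _ _ => integral_nonneg fun _ => sq_nonneg _))
    (S.sum_gradient_le hell hw)

/-- Triangle inequality for the norm of the method. -/
lemma normDar_sub_le (S : Setting M core nu c D N) (hk : 0 < kmin)
    (hell : ∀ᵐ x ∂(volume.restrict Ω), ∀ ξ : Vec d, kmin * ‖ξ‖ ^ 2 ≤ inner ℝ ξ (c.Kop x ξ))
    (hγ : 0 < γ) (hsize : ∀ e ∈ M.facets, 0 < M.facetSize e)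
    (hw : M.BrokenC 1 w) (hz : M.BrokenC 1 z) :
    c.normDar M D γ (fun x => w x - z x) ≤ √(energy M nu c D γ w) + √(energy M nu c D γ z) := by
  have G := S.geom
  have hwe : ∀ T ∈ M.elements, Extends T w := fun T hT => (hw T hT).extends
  have hze : ∀ T ∈ M.elements, Extends T z := fun T hT => (hz T hT).extends
  have hbe : ∀ T ∈ M.elements, Extends T c.β := fun T hT => S.reg.beta_ext hT
  have hnn : ∀ v : Vec d → ℝ, M.BrokenC 1 v → 0 ≤ energy M nu c D γ v := fun v hv => by
    have := S.formA_nonneg hk hell hv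
    have := S.formJ_nonneg hγ hsize v
    have := formU_nonneg (M := M) (nu := nu) (c := c) v
    have := formL_nonneg (M := M) v
    rw [energy]
    positivity
  rw [S.normDar_eq (G.brokenC_sub hw hz)]
  refine sqrt_le_add_sqrt (hnn w hw) (hnn z hz) fun t ht => ?_
  have ht' : t * t⁻¹ = 1 := mul_inv_cancel₀ ht.ne'
  have htp : 0 < t⁻¹ := inv_pos.2 ht
  have young : ∀ a b : ℝ, (a - b) ^ 2 ≤ (1 + t) * a ^ 2 + (1 + t⁻¹) * b ^ 2 := fun a b => by
    nlinarith [mul_nonneg htp.le (sq_nonneg (t * a + b))]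
  have youngI : ∀ a b : Vec d, ‖a - b‖ ^ 2 ≤ (1 + t) * ‖a‖ ^ 2 + (1 + t⁻¹) * ‖b‖ ^ 2 := fun a b => by
    have h1 : ‖a - b‖ ^ 2 ≤ (‖a‖ - -‖b‖) ^ 2 := by
      rw [sub_neg_eq_add]
      exact pow_le_pow_left₀ (norm_nonneg _) (norm_sub_le _ _) 2
    simpa using h1.trans (young _ _)
  have hA : c.formA M (fun x => w x - z x) (fun x => w x - z x) ≤
      (1 + t) * c.formA M w w + (1 + t⁻¹) * c.formA M z z := by
    simp only [Coeffs.formA, Finset.mul_sum, ← Finset.sum_add_distrib, ← integral_const_mul]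
    refine Finset.sum_le_sum fun T hT => ?_
    have hi : ∀ v : Vec d → ℝ, M.BrokenC 1 v →
        IntegrableOn (fun x => inner ℝ (c.diffFlux v x) (∇ v x)) T := fun v hv =>
      ((S.diffFlux_ext hv T hT).dot ((hv T hT).extends_gradient le_rfl)).integrableOn
        (G.elem_open T hT) (G.elem_bdd T hT)
    rw [← integral_add ((hi w hw).const_mul _) ((hi z hz).const_mul _)]
    refine integral_mono_ae (hi _ (G.brokenC_sub hw hz))
      (((hi w hw).const_mul _).add ((hi z hz).const_mul _)) ?_
    filter_upwards [G.ae_element hT hell, ae_restrict_mem (G.elem_open T hT).measurableSet]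
      with x hx hxT
    -- Young's inequality for the quadratic form of `K`: its value at `t ∇w + ∇z`, divided by `t`,
    -- is the difference between the right and the left side.
    have h1 := hx (t • ∇ w x + ∇ z x)
    have h2 : 0 ≤ inner ℝ (t • ∇ w x + ∇ z x) (c.Kop x (t • ∇ w x + ∇ z x)) :=
      le_trans (by positivity) h1
    simp only [Coeffs.diffFlux]
    rw [(hw T hT).gradient_sub (G.elem_open T hT) (hz T hT) hxT]
    simp only [map_add, map_sub, map_smul, inner_add_left, inner_add_right, inner_smul_left,
      inner_smul_right, conj_trivial, inner_sub_left, inner_sub_right] at h2 ⊢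
    rw [real_inner_comm (c.Kop x (∇ w x)) (∇ w x), real_inner_comm (c.Kop x (∇ w x)) (∇ z x),
      real_inner_comm (c.Kop x (∇ z x)) (∇ w x), real_inner_comm (c.Kop x (∇ z x)) (∇ z x)] at h2
    have h3 := mul_nonneg htp.le h2
    rw [mul_add, ← mul_assoc t⁻¹ t, mul_add t⁻¹, ← mul_assoc t⁻¹ t, inv_mul_cancel₀ ht.ne'] at h3
    linarith
  have hJ : c.formJ M nu D γ (fun x => w x - z x) (fun x => w x - z x) ≤
      (1 + t) * c.formJ M nu D γ w w + (1 + t⁻¹) * c.formJ M nu D γ z z := by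
    simp only [Coeffs.formJ, Finset.mul_sum, ← Finset.sum_add_distrib, real_inner_self_eq_norm_sq]
    refine Finset.sum_le_sum fun e he => ?_
    have hef := S.active_sub he
    have hi : ∀ v : Vec d → ℝ, M.BrokenC 1 v →
        IntegrableOn (fun x => ‖M.jmp nu e v x‖ ^ 2) e (surf d) := fun v hv =>
      G.integrableOn_facet hef
        ((Mesh.continuousOn_jmp hef fun T hT => (hv T hT).extends).norm.pow 2)
    have h1 : ∫ x in e, ‖M.jmp nu e (fun x => w x - z x) x‖ ^ 2 ∂(surf d) ≤
        (1 + t) * (∫ x in e, ‖M.jmp nu e w x‖ ^ 2 ∂(surf d)) +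
        (1 + t⁻¹) * ∫ x in e, ‖M.jmp nu e z x‖ ^ 2 ∂(surf d) := by
      rw [← integral_const_mul, ← integral_const_mul,
        ← integral_add ((hi w hw).const_mul _) ((hi z hz).const_mul _)]
      refine setIntegral_mono_on (hi _ (G.brokenC_sub hw hz))
        (((hi w hw).const_mul _).add ((hi z hz).const_mul _))
        (G.facet_compact e hef).measurableSet fun x hx => ?_
      rw [Mesh.jmp_sub hef hwe hze hx]
      exact youngI _ _
    have := mul_le_mul_of_nonneg_left h1 (div_pos hγ (hsize e hef)).le
    linarith
  have hL : ∑ T ∈ M.elements, ∫ x in T, (w x - z x) ^ 2 ≤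
      (1 + t) * (∑ T ∈ M.elements, ∫ x in T, w x ^ 2) +
      (1 + t⁻¹) * ∑ T ∈ M.elements, ∫ x in T, z x ^ 2 := by
    simp only [Finset.mul_sum, ← Finset.sum_add_distrib, ← integral_const_mul]
    refine Finset.sum_le_sum fun T hT => ?_
    have hi : ∀ v : Vec d → ℝ, M.BrokenC 1 v → IntegrableOn (fun x => v x ^ 2) T := fun v hv =>
      ((hv T hT).extends.comp (Φ := fun a => a ^ 2) (by fun_prop)).integrableOn
        (G.elem_open T hT) (G.elem_bdd T hT)
    rw [← integral_add ((hi w hw).const_mul _) ((hi z hz).const_mul _)]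
    exact integral_mono (hi _ (G.brokenC_sub hw hz))
      (((hi w hw).const_mul _).add ((hi z hz).const_mul _)) fun x => young _ _
  have hU : c.formU M nu (fun x => w x - z x) ≤
      (1 + t) * c.formU M nu w + (1 + t⁻¹) * c.formU M nu z := by
    have h0 : ∑ e ∈ M.facets, ∫ x in e,
          M.abn nu e c.β x * ‖M.jmp nu e (fun x => w x - z x) x‖ ^ 2 ∂(surf d) ≤
        (1 + t) * (∑ e ∈ M.facets, ∫ x in e, M.abn nu e c.β x * ‖M.jmp nu e w x‖ ^ 2 ∂(surf d)) +
        (1 + t⁻¹) *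
          ∑ e ∈ M.facets, ∫ x in e, M.abn nu e c.β x * ‖M.jmp nu e z x‖ ^ 2 ∂(surf d) := by
      simp only [Finset.mul_sum, ← Finset.sum_add_distrib, ← integral_const_mul]
      refine Finset.sum_le_sum fun e he => ?_
      have hi : ∀ v : Vec d → ℝ, M.BrokenC 1 v →
          IntegrableOn (fun x => M.abn nu e c.β x * ‖M.jmp nu e v x‖ ^ 2) e (surf d) := fun v hv =>
        G.integrableOn_facet he ((Mesh.continuousOn_abn he hbe).mul
          ((Mesh.continuousOn_jmp he fun T hT => (hv T hT).extends).norm.pow 2))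
      rw [← integral_add ((hi w hw).const_mul _) ((hi z hz).const_mul _)]
      refine setIntegral_mono_on (hi _ (G.brokenC_sub hw hz))
        (((hi w hw).const_mul _).add ((hi z hz).const_mul _))
        (G.facet_compact e he).measurableSet fun x hx => ?_
      rw [Mesh.jmp_sub he hwe hze hx]
      have := mul_le_mul_of_nonneg_left (youngI (M.jmp nu e w x) (M.jmp nu e z x))
        (abn_nonneg (M := M) (nu := nu) e c.β x)
      linarith
    simp only [Coeffs.formU]
    linarith
  simp only [energy]
  linarith

/-- The discrete trace inequality for the diffusive flux. -/
lemma formQ_le (S : Setting M core nu c D N) (hk : 0 < kmin)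
    (hell : ∀ᵐ x ∂(volume.restrict Ω), ∀ ξ : Vec d, kmin * ‖ξ‖ ^ 2 ≤ inner ℝ ξ (c.Kop x ξ))
    (hC : 0 < Ctr) (htr : M.IsTraceConst p Ctr) (hz : M.PiecewisePoly p z) :
    c.formQ M z ≤ linfNorm Ω c.Kop ^ 2 * (Ctr / kmin) * c.formA M z z := by
  have G := S.geom
  have hzC := hz.smooth.brokenC G 1
  set κ := linfNorm Ω c.Kop
  have key : ∀ T ∈ M.elements, ∑ e ∈ M.facetsOf T,
      M.facetSize e * ∫ x in e, ‖extendFrom T (c.diffFlux z) x‖ ^ 2 ∂(surf d) ≤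
      κ ^ 2 * Ctr * ∫ x in T, ‖∇ z x‖ ^ 2 := by
    intro T hT
    obtain ⟨q, hq, hzq⟩ := hz T hT
    have ho := G.elem_open T hT
    have hgc : Continuous (∇ (polyFun q)) :=
      (InnerProductSpace.toDual ℝ (Vec d)).symm.continuous.comp
        ((contDiff_polyFun q).continuous_fderiv (by simp))
    have hge : Set.EqOn (∇ z) (∇ (polyFun q)) T := fun x hx => gradient_eq_of_eqOn ho hzq hx
    have hKn : ∀ x ∈ T, ‖c.Kop x‖ ≤ κ := fun x hx =>
      ((S.reg.K_ext T hT).norm_le_linfNorm ho (G.elem_bdd T hT) hx).trans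
        (G.linfNorm_le S.reg.K_ext hT)
    have h1 : ∀ e ∈ M.facetsOf T,
        M.facetSize e * ∫ x in e, ‖extendFrom T (c.diffFlux z) x‖ ^ 2 ∂(surf d) ≤
        Metric.diam T * κ ^ 2 * ∫ x in e, ‖∇ (polyFun q) x‖ ^ 2 ∂(surf d) := by
      intro e he
      have hef := Mesh.Geometry.mem_facets he
      have hm := (G.facet_compact e hef).measurableSet
      have hTe : T ∈ M.adj e := Mesh.mem_adj.2 ⟨hT, (Mesh.mem_facetsOf.1 he).2⟩
      have h2 : ∫ x in e, ‖extendFrom T (c.diffFlux z) x‖ ^ 2 ∂(surf d) ≤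
          κ ^ 2 * ∫ x in e, ‖∇ (polyFun q) x‖ ^ 2 ∂(surf d) := by
        rw [← integral_const_mul]
        refine setIntegral_mono_on (G.integrableOn_facet hef
          ((Mesh.Geometry.continuousOn_trace he (S.diffFlux_ext hzC T hT)).norm.pow 2))
          ((G.integrableOn_facet hef (hgc.continuousOn.norm.pow 2)).const_mul _) hm fun x hx => ?_
        have hxc := Mesh.Geometry.mem_closure_of_facet he hx
        have e1 : extendFrom T (c.diffFlux z) x =
            extendFrom T c.Kop x (∇ (polyFun q) x) := by
          have := (S.reg.K_ext T hT).extendFrom_comp₂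
            ((hzC T hT).extends_gradient le_rfl) (Φ := fun L v => L v)
            (continuous_fst.clm_apply continuous_snd) hxc
          rw [extendFrom_congr hge, extendFrom_of_continuous hgc hxc] at this
          exact this
        rw [e1, ← mul_pow]
        refine pow_le_pow_left₀ (norm_nonneg _) ?_ 2
        exact (ContinuousLinearMap.le_opNorm _ _).trans (mul_le_mul_of_nonneg_right
          ((S.reg.K_ext T hT).norm_extendFrom_le hKn hxc) (norm_nonneg _))
      have h3 := Mesh.Geometry.facetSize_le (G.elem_bdd T hT) hef hTe
      calc _ ≤ Metric.diam T * ∫ x in e, ‖extendFrom T (c.diffFlux z) x‖ ^ 2 ∂(surf d) :=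
            mul_le_mul_of_nonneg_right h3 (integral_nonneg fun x => sq_nonneg _)
        _ ≤ Metric.diam T * (κ ^ 2 * ∫ x in e, ‖∇ (polyFun q) x‖ ^ 2 ∂(surf d)) :=
            mul_le_mul_of_nonneg_left h2 Metric.diam_nonneg
        _ = _ := by ring
    refine (Finset.sum_le_sum h1).trans ?_
    have hpc : ∀ k, Continuous fun x => polyFun (MvPolynomial.pderiv k q) x ^ 2 := fun k =>
      (contDiff_polyFun _).continuous.pow 2
    rw [← Finset.mul_sum, ← G.integral_frontier hT (f := fun x => ‖∇ (polyFun q) x‖ ^ 2) fun e he => G.integrableOn_facet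
      (Mesh.Geometry.mem_facets he) (hgc.continuousOn.norm.pow 2)]
    simp only [norm_gradient_polyFun_sq]
    have hfi : ∀ k, IntegrableOn (fun x => polyFun (MvPolynomial.pderiv k q) x ^ 2) (frontier T)
        (surf d) := by
      intro k
      rw [M.frontier_eq T hT]
      refine (integrableOn_finset_iUnion (μ := surf d)).2 fun e he => ?_
      by_cases h : e ⊆ frontier T
      · simpa [h] using G.integrableOn_facet he (hpc k).continuousOn
      · simp [h]
    have e2 : ∫ x in T, ‖∇ z x‖ ^ 2 =
        ∑ k, ∫ x in T, polyFun (MvPolynomial.pderiv k q) x ^ 2 := by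
      rw [← integral_finsetSum _ fun k _ =>
        (Extends.of_continuous (hpc k)).integrableOn ho (G.elem_bdd T hT)]
      refine setIntegral_congr_fun ho.measurableSet fun x hx => ?_
      simp only [hge hx, norm_gradient_polyFun_sq]
    rw [e2, integral_finsetSum _ fun k _ => hfi k]
    -- The trace inequality is applied to each partial derivative, again a polynomial of degree at
    -- most `p`. The weight `h_e ≤ h_T` compensates the factor `h_T⁻¹`.
    have h4 : ∀ k, ∫ x in frontier T, polyFun (MvPolynomial.pderiv k q) x ^ 2 ∂(surf d) ≤
        Ctr * (Metric.diam T)⁻¹ * ∫ x in T, polyFun (MvPolynomial.pderiv k q) x ^ 2 := fun k =>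
      htr T hT _ (((totalDegree_pderiv_le q k).trans (Nat.sub_le _ _)).trans hq)
    have h5 := Finset.sum_le_sum fun k (_ : k ∈ Finset.univ) => h4 k
    rw [← Finset.mul_sum] at h5
    have hd := G.diam_pos T hT
    calc _ ≤ Metric.diam T * κ ^ 2 * (Ctr * (Metric.diam T)⁻¹ *
          ∑ k, ∫ x in T, polyFun (MvPolynomial.pderiv k q) x ^ 2) := by gcongr
      _ = _ := by field_simp
  have h1 := S.sum_gradient_le hell hzC
  calc c.formQ M z ≤ ∑ T ∈ M.elements, κ ^ 2 * Ctr * ∫ x in T, ‖∇ z x‖ ^ 2 :=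
        Finset.sum_le_sum key
    _ = κ ^ 2 * (Ctr / kmin) * (kmin * ∑ T ∈ M.elements, ∫ x in T, ‖∇ z x‖ ^ 2) := by
        rw [← Finset.mul_sum]; field_simp
    _ ≤ _ := by gcongr

end Setting

/-- With `t = κ √(Np Ctr / (γ kmin))`, the diffusive coercivity constant is `1 - t` for `ε = -1` and
`1 - t / 2` for `ε = 0`. The threshold for `γ` says `t < 1` and `t < 2` respectively. -/
lemma alphaDar_pos {ε γ κ Np Ctr kmin σ₀ : ℝ} (hε : ε = -1 ∨ ε = 0 ∨ ε = 1) (hκ : 0 ≤ κ)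
    (hN : 0 ≤ Np) (hC : 0 < Ctr) (hk : 0 < kmin) (hσ : 0 < σ₀)
    (h : gammaEps ε κ Np Ctr kmin < γ) : 0 < γ ∧ 0 < alphaDar ε γ κ Np Ctr kmin σ₀ := by
  have hx : ∀ γ, κ * √(Np * Ctr / (γ * kmin)) = √(κ ^ 2 * (Np * Ctr / (γ * kmin))) := fun γ => by
    rw [Real.sqrt_mul (sq_nonneg κ), Real.sqrt_sq hκ]
  have hγ : 0 < γ := by
    refine lt_of_le_of_lt ?_ h
    rw [gammaEps]
    split_ifs <;> positivity
  refine ⟨hγ, lt_min one_pos (lt_min hσ ?_)⟩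
  rw [gammaEps] at h
  rw [alphaD]
  rcases hε with rfl | rfl | rfl
  · norm_num at h ⊢
    rw [hx, Real.sqrt_lt' one_pos]
    have : κ ^ 2 * (Np * Ctr / (γ * kmin)) = κ ^ 2 * (Np * Ctr / kmin) / γ := by field_simp
    rw [this, div_lt_iff₀ hγ]
    linarith
  · norm_num at h ⊢
    have h1 : κ * √(Np * Ctr / (γ * kmin)) < 2 := by
      rw [hx, Real.sqrt_lt' two_pos]
      have : κ ^ 2 * (Np * Ctr / (γ * kmin)) = 4 * (κ ^ 2 * (Np * Ctr / (4 * kmin))) / γ := by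
        field_simp
      rw [this, div_lt_iff₀ hγ]
      linarith
    linarith
  · norm_num

/-! ### Isoperimetric bounds, and lower bounds for the mesh constants. -/

namespace Mesh.Geometry

variable {d : ℕ} {Ω : Set (Vec d)} {M : Mesh Ω} {core : Set (Vec d) → Set (Vec d)}
  {nu : Set (Vec d) → Set (Vec d) → Vec d} {T : Set (Vec d)}

lemma volume_pos (G : M.Geometry core nu) (hT : T ∈ M.elements) : 0 < volume.real T :=
  ENNReal.toReal_pos ((G.elem_open T hT).measure_pos volume (G.elem_nonempty T hT)).ne'
    (G.elem_bdd T hT).measure_lt_top.ne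

/-- An isoperimetric inequality for elements. -/
lemma volume_le_surf (G : M.Geometry core nu) (hT : T ∈ M.elements) :
    d * volume.real T ≤ Metric.diam T * (surf d).real (frontier T) := by
  have ho := G.elem_open T hT
  have hb := G.elem_bdd T hT
  obtain ⟨a, ha⟩ := G.elem_nonempty T hT
  have hsm : ContDiff ℝ ∞ fun x : Vec d => x - a := contDiff_id.sub contDiff_const
  have hF : Extends T fun x : Vec d => x - a := Extends.of_continuous hsm.continuous
  -- The field `x - a` with `a ∈ T` has divergence `d`, and its length on the boundary is at most
  -- the diameter.
  have hdiv : HasWeakDiv T (fun x : Vec d => x - a) fun _ => (d : ℝ) := by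
    refine (hasWeakDiv_of_memC ho hb (F := fun x => x - a) fun k => ?_).congr ho.measurableSet
      (fun _ _ => rfl) fun x _ => ?_
    · exact memC_of_contDiff ((EuclideanSpace.proj k : Vec d →L[ℝ] ℝ).contDiff.comp hsm) 1
    · have : ∀ k : Fin d, fderiv ℝ (fun y : Vec d => (y - a) k) x (unitVec k) = 1 := by
        intro k
        have h1 : (fun y : Vec d => (y - a) k) = fun y : Vec d => y k - a k := by ext y; simp
        rw [h1, fderiv_sub_const, (hasFDerivAt_coord k x).fderiv]
        simp [unitVec]
      simp only [this]
      simp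
  have h1 := G.div T hT _ _ hF (integrableOn_const hb.measure_lt_top.ne) hdiv
  rw [G.surf_frontier hT, Finset.mul_sum]
  have e1 : ∫ _ in T, (d : ℝ) = d * volume.real T := by simp [mul_comm]
  rw [← e1, h1]
  refine Finset.sum_le_sum fun e he => ?_
  have hef := mem_facets he
  have e2 : Metric.diam T * (surf d).real e = ∫ _ in e, Metric.diam T ∂(surf d) := by
    simp [mul_comm]
  rw [e2]
  refine setIntegral_mono_on (G.integrableOn_facet hef ((continuousOn_trace he hF).inner
    continuousOn_const)) (integrableOn_const (G.facet_fin e hef).ne)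
    (G.facet_compact e hef).measurableSet fun x hx => ?_
  have hxc := mem_closure_of_facet he hx
  rw [extendFrom_of_continuous hsm.continuous hxc]
  refine (real_inner_le_norm _ _).trans ?_
  rw [G.nu_norm T hT e he, mul_one, ← dist_eq_norm, ← Metric.diam_closure T]
  exact Metric.dist_le_diam_of_mem (Metric.isBounded_closure_iff.2 hb) hxc (subset_closure ha)

lemma facetsOf_nonempty (G : M.Geometry core nu) (hd : 1 ≤ d) (hT : T ∈ M.elements) :
    (M.facetsOf T).Nonempty := by
  by_contra h
  rw [Finset.not_nonempty_iff_eq_empty] at h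
  have h1 := G.volume_le_surf hT
  rw [G.surf_frontier hT, h, Finset.sum_empty, mul_zero] at h1
  have h2 := G.volume_pos hT
  have h3 : (1 : ℝ) ≤ d := by exact_mod_cast hd
  nlinarith

lemma elements_nonempty (G : M.Geometry core nu) : M.elements.Nonempty := by
  obtain ⟨x, hx⟩ := G.omega_nonempty
  have := subset_closure hx
  rw [M.cover] at this
  obtain ⟨T, hT, -⟩ := Set.mem_iUnion₂.1 this
  exact ⟨T, hT⟩

lemma one_le_maxFacets (G : M.Geometry core nu) (hd : 1 ≤ d) : (1 : ℝ) ≤ M.maxFacets := by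
  obtain ⟨T, hT⟩ := G.elements_nonempty
  have h1 := (G.facetsOf_nonempty hd hT).card_pos
  have h2 : (M.facetsOf T).card ≤ M.maxFacets :=
    Finset.le_sup (f := fun T => (M.facetsOf T).card) hT
  exact_mod_cast h1.trans_le h2

/-- Absorbs into `1 + η` the factor `d` that the gradient estimate loses for `p = 0`. -/
lemma le_of_isChunky (G : M.Geometry core nu) {η : ℝ} (h : M.IsChunky η) : (d : ℝ) ≤ η := by
  obtain ⟨T, hT⟩ := G.elements_nonempty
  exact le_of_mul_le_mul_right ((G.volume_le_surf hT).trans (h T hT)) (G.volume_pos hT)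

/-- The trace inequality for the constant polynomial `1`, combined with the isoperimetric
inequality. It serves the flux term in the case `p = 0`. -/
lemma le_of_isTraceConst (G : M.Geometry core nu) {p : ℕ} {Ctr : ℝ} (h : M.IsTraceConst p Ctr) :
    (d : ℝ) ≤ Ctr := by
  obtain ⟨T, hT⟩ := G.elements_nonempty
  have h1 := h T hT 1 (by simp)
  simp only [map_one, one_pow, integral_const, measureReal_restrict_apply_univ, smul_eq_mul,
    mul_one] at h1
  refine le_of_mul_le_mul_right ((G.volume_le_surf hT).trans ?_) (G.volume_pos hT)
  have hd := G.diam_pos T hT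
  calc _ ≤ Metric.diam T * (Ctr * (Metric.diam T)⁻¹ * volume.real T) := by gcongr
    _ = _ := by field_simp

end Mesh.Geometry

/-! ### Coercivity and quasi-optimality. -/

namespace Setting

variable {d : ℕ} {Ω : Set (Vec d)} {M : Mesh Ω} {core : Set (Vec d) → Set (Vec d)}
  {nu : Set (Vec d) → Set (Vec d) → Vec d} {c : Coeffs d} {D N : Finset (Set (Vec d))}
  {w z : Vec d → ℝ} {kmin Ctr γ ε σ₀ : ℝ} {p : ℕ}

lemma kmin_le (S : Setting M core nu c D N) (hd : 1 ≤ d)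
    (hell : ∀ᵐ x ∂(volume.restrict Ω), ∀ ξ : Vec d, kmin * ‖ξ‖ ^ 2 ≤ inner ℝ ξ (c.Kop x ξ)) :
    kmin ≤ linfNorm Ω c.Kop := by
  have G := S.geom
  obtain ⟨T, hT⟩ := G.elements_nonempty
  have : (ae (volume.restrict T)).NeBot := by
    rw [ae_neBot, Ne, Measure.restrict_eq_zero]
    exact ((G.elem_open T hT).measure_pos volume (G.elem_nonempty T hT)).ne'
  obtain ⟨x, hx, hxT⟩ := ((G.ae_element hT hell).and
    (ae_restrict_mem (G.elem_open T hT).measurableSet)).exists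
  have h1 := hx (unitVec ⟨0, hd⟩)
  rw [norm_unitVec, one_pow, mul_one] at h1
  refine h1.trans ((real_inner_le_norm _ _).trans ?_)
  rw [norm_unitVec, one_mul]
  refine (ContinuousLinearMap.le_opNorm _ _).trans ?_
  rw [norm_unitVec, mul_one]
  exact ((S.reg.K_ext T hT).norm_le_linfNorm (G.elem_open T hT) (G.elem_bdd T hT) hxT).trans
    (G.linfNorm_le S.reg.K_ext hT)

/-- `formQ_le` already sums over all facets of an element, so `maxFacets ≥ 1` is merely inserted, to
reach the constant of the statement. -/
lemma sqrt_formQ_le (S : Setting M core nu c D N) (hd : 1 ≤ d) (hk : 0 < kmin)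
    (hell : ∀ᵐ x ∂(volume.restrict Ω), ∀ ξ : Vec d, kmin * ‖ξ‖ ^ 2 ≤ inner ℝ ξ (c.Kop x ξ))
    (hγ : 0 < γ) (hC : 0 < Ctr) (htr : M.IsTraceConst p Ctr) (hz : M.PiecewisePoly p z) :
    √(c.formQ M z / γ) ≤
      linfNorm Ω c.Kop * √(M.maxFacets * Ctr / (γ * kmin)) * √(c.formA M z z) := by
  have hA := S.formA_nonneg hk hell (hz.smooth.brokenC S.geom 1)
  have hN := S.geom.one_le_maxFacets hd
  set κ := linfNorm Ω c.Kop
  have hκ : 0 ≤ κ := linfNorm_nonneg _ _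
  have e1 : κ * √(M.maxFacets * Ctr / (γ * kmin)) * √(c.formA M z z) =
      √(κ ^ 2 * (M.maxFacets * Ctr / (γ * kmin)) * c.formA M z z) := by
    rw [Real.sqrt_mul (by positivity), Real.sqrt_mul (sq_nonneg κ), Real.sqrt_sq hκ]
  rw [e1]
  apply Real.sqrt_le_sqrt
  rw [div_le_iff₀ hγ]
  refine (S.formQ_le hk hell hC htr hz).trans ?_
  calc _ ≤ κ ^ 2 * (M.maxFacets * Ctr / kmin) * c.formA M z z := by
        gcongr
        nlinarith
    _ = _ := by field_simp

/-- Coercivity of the bilinear form on piecewise polynomials. -/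
lemma coercive (S : Setting M core nu c D N) (hd : 1 ≤ d) (hk : 0 < kmin)
    (hell : ∀ᵐ x ∂(volume.restrict Ω), ∀ ξ : Vec d, kmin * ‖ξ‖ ^ 2 ≤ inner ℝ ξ (c.Kop x ξ))
    (hγ : 0 < γ) (hsize : ∀ e ∈ M.facets, 0 < M.facetSize e) (hC : 0 < Ctr)
    (htr : M.IsTraceConst p Ctr) (hz : M.PiecewisePoly p z)
    (hσ : ∀ᵐ x ∂(volume.restrict Ω), σ₀ ≤ c.σ x + 1 / 2 * divg c.β x)
    (hε : ε = -1 ∨ ε = 0 ∨ ε = 1) :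
    alphaDar ε γ (linfNorm Ω c.Kop) M.maxFacets Ctr kmin σ₀ * energy M nu c D γ z ≤
      c.aDar M D N ε γ z z := by
  have G := S.geom
  have hzC := hz.smooth.brokenC G 1
  have hze : ∀ T ∈ M.elements, Extends T z := fun T hT => (hzC T hT).extends
  have hA := S.formA_nonneg hk hell hzC
  have hJ := S.formJ_nonneg hγ hsize z
  have hU := formU_nonneg (M := M) (nu := nu) (c := c) z
  have hL := formL_nonneg (M := M) z
  have hQ := S.sqrt_formQ_le hd hk hell hγ hC htr hz
  have hP := S.abs_formP_le hγ hsize hzC hzC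
  have hκ : 0 ≤ linfNorm Ω c.Kop := linfNorm_nonneg _ _
  have hre : σ₀ * ∑ T ∈ M.elements, ∫ x in T, z x ^ 2 ≤
      ∑ T ∈ M.elements, ∫ x in T, (c.σ x + 1 / 2 * divg c.β x) * z x ^ 2 := by
    rw [Finset.mul_sum]
    refine Finset.sum_le_sum fun T hT => ?_
    have hz2 : Extends T fun x => z x ^ 2 := (hze T hT).comp (Φ := fun a => a ^ 2) (by fun_prop)
    rw [← integral_const_mul]
    refine integral_mono_ae ((hz2.integrableOn (G.elem_open T hT) (G.elem_bdd T hT)).const_mul _)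
      ((((S.reg.sigma_ext T hT).add ((Extends.of_continuous continuous_const).mul
        (S.reg.divg_ext G hT))).mul hz2).integrableOn (G.elem_open T hT) (G.elem_bdd T hT)) ?_
    filter_upwards [G.ae_element hT hσ] with x hx
    exact mul_le_mul_of_nonneg_right hx (sq_nonneg _)
  have hAR := S.formR_add_formF_self hz.smooth
  rw [S.aDar_eq hzC hzC, energy]
  set κ := linfNorm Ω c.Kop
  set A := c.formA M z z
  set J := c.formJ M nu D γ z z
  set P := c.formP M nu D z z
  set U := c.formU M nu z
  set L := ∑ T ∈ M.elements, ∫ x in T, z x ^ 2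
  set t := κ * √(M.maxFacets * Ctr / (γ * kmin))
  have ht : 0 ≤ t := by positivity
  -- The consistency term is at most `t √A √J`, by the weighted Cauchy-Schwarz inequality and the
  -- discrete trace inequality.
  have hP2 : |P| ≤ t * ((A + J) / 2) := by
    have h1 : √A * √J ≤ (A + J) / 2 := by
      nlinarith [sq_nonneg (√A - √J), Real.sq_sqrt hA, Real.sq_sqrt hJ]
    calc |P| ≤ t * √A * √J := hP.trans (mul_le_mul_of_nonneg_right hQ (Real.sqrt_nonneg _))
      _ = t * (√A * √J) := by ring
      _ ≤ _ := mul_le_mul_of_nonneg_left h1 ht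
  have hαd : alphaD ε γ κ M.maxFacets Ctr kmin = 1 + 1 / 2 * (ε - 1) * t := by
    rw [alphaD]
    split_ifs with h
    · rw [h]; ring
    · ring
  -- The diagonal contains `-(1 - ε) P`, where `1 - ε` is `0`, `1` or `2`.
  have hdiff : alphaD ε γ κ M.maxFacets Ctr kmin * (A + J) ≤ A - P + ε * P + J := by
    rw [hαd]
    have h1 : 0 ≤ 1 - ε := by rcases hε with rfl | rfl | rfl <;> norm_num
    have h2 := mul_le_mul_of_nonneg_left ((le_abs_self P).trans hP2) h1
    linarith
  have h1 : alphaDar ε γ κ M.maxFacets Ctr kmin σ₀ ≤ 1 := min_le_left _ _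
  have h2 : alphaDar ε γ κ M.maxFacets Ctr kmin σ₀ ≤ σ₀ :=
    (min_le_right _ _).trans (min_le_left _ _)
  have h3 : alphaDar ε γ κ M.maxFacets Ctr kmin σ₀ ≤ alphaD ε γ κ M.maxFacets Ctr kmin :=
    (min_le_right _ _).trans (min_le_right _ _)
  have i1 := mul_le_mul_of_nonneg_right h1 hU
  have i2 := mul_le_mul_of_nonneg_right h2 hL
  have i3 := mul_le_mul_of_nonneg_right h3 (add_nonneg hA hJ)
  linarith

set_option maxHeartbeats 800000 in
/-- Quasi-optimality: the error is bounded by the best approximation error `E`. -/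
lemma error_le (S : Setting M core nu c D N) (hd : 1 ≤ d)
    (hsym : ∀ᵐ x ∂(volume.restrict Ω), (c.K x).IsSymm) (hk : 0 < kmin)
    (hell : ∀ᵐ x ∂(volume.restrict Ω), ∀ ξ : Vec d, kmin * ‖ξ‖ ^ 2 ≤ inner ℝ ξ (c.Kop x ξ))
    (hsize : ∀ e ∈ M.facets, 0 < M.facetSize e) (hC : 0 < Ctr)
    (htr : M.IsTraceConst p Ctr) (hw : M.BrokenC 1 w) (hz : M.PiecewisePoly p z) (hσ₀ : 0 < σ₀)
    (hσ : ∀ᵐ x ∂(volume.restrict Ω), σ₀ ≤ c.σ x + 1 / 2 * divg c.β x)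
    (hε : ε = -1 ∨ ε = 0 ∨ ε = 1)
    (hγε : gammaEps ε (linfNorm Ω c.Kop) M.maxFacets Ctr kmin < γ)
    (hgal : c.aDar M D N ε γ z z = c.aDar M D N ε γ w z) {E : ℝ} (hE : 0 ≤ E)
    (hwE : energy M nu c D γ w ≤ E ^ 2) (hBE : Coeffs.formB M w ≤ E ^ 2)
    (hQE : c.formQ M w ≤ linfNorm Ω c.Kop * E ^ 2 ∨
      p = 0 ∧ c.formQ M w ≤ d * (linfNorm Ω c.Kop * E ^ 2)) :
    c.normDar M D γ (fun x => w x - z x) ≤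
      (1 + boundDar γ (linfNorm Ω c.Kop) (linfNorm Ω c.β) (linfNorm Ω c.σ) M.maxFacets Ctr kmin /
        alphaDar ε γ (linfNorm Ω c.Kop) M.maxFacets Ctr kmin σ₀) * E := by
  have G := S.geom
  have hκ : 0 ≤ linfNorm Ω c.Kop := linfNorm_nonneg _ _
  have hb : 0 ≤ linfNorm Ω c.β := linfNorm_nonneg _ _
  have hs : 0 ≤ linfNorm Ω c.σ := linfNorm_nonneg _ _
  obtain ⟨hγ, hα⟩ := alphaDar_pos hε hκ (Nat.cast_nonneg M.maxFacets) hC hk hσ₀ hγε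
  have hzC := hz.smooth.brokenC G 1
  have hkκ := S.kmin_le hd hell
  have hcoer := S.coercive hd hk hell hγ hsize hC htr hz hσ hε
  have fA := S.abs_formA_le hsym hk hell hw hzC
  have fJ := S.abs_formJ_le hγ hsize hw hzC
  have fR := S.abs_formR_le hk hell hw hzC
  have fF := S.abs_formF_le hw hzC
  have fP := S.abs_formP_le hγ hsize hw hzC
  have fP' := S.abs_formP_le hγ hsize hzC hw
  have hQz := S.sqrt_formQ_le hd hk hell hγ hC htr hz
  have hAw := S.formA_nonneg hk hell hw
  have hJw := S.formJ_nonneg hγ hsize w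
  have hUw := formU_nonneg (M := M) (nu := nu) (c := c) w
  have hLw := formL_nonneg (M := M) w
  have hAz := S.formA_nonneg hk hell hzC
  have hJz := S.formJ_nonneg hγ hsize z
  have hUz := formU_nonneg (M := M) (nu := nu) (c := c) z
  have hLz := formL_nonneg (M := M) z
  refine (S.normDar_sub_le hk hell hγ hsize hw hzC).trans ?_
  have hw1 : √(energy M nu c D γ w) ≤ E := Real.sqrt_le_iff.2 ⟨hE, hwE⟩
  -- Coercivity now reads `α |||z|||² ≤ a_h(w, z)`; each form on the right is bounded by a part of
  -- `M` times `E |||z|||`.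
  rw [hgal, S.aDar_eq hw hzC] at hcoer
  set n := √(energy M nu c D γ z) with hn
  have hn0 : 0 ≤ n := Real.sqrt_nonneg _
  have hez : energy M nu c D γ z = n ^ 2 := (Real.sq_sqrt (by rw [energy]; positivity)).symm
  rw [hez] at hcoer
  rw [energy] at hwE hez
  set κ := linfNorm Ω c.Kop
  set b := linfNorm Ω c.β
  set s := linfNorm Ω c.σ
  set α := alphaDar ε γ κ M.maxFacets Ctr kmin σ₀
  set ρ := κ * √(M.maxFacets * Ctr / (γ * kmin)) with hρ
  have hρ0 : 0 ≤ ρ := by positivity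
  have zA : √(c.formA M z z) ≤ n := Real.sqrt_le_iff.2 ⟨hn0, by linarith⟩
  have zJ : √(c.formJ M nu D γ z z) ≤ n := Real.sqrt_le_iff.2 ⟨hn0, by linarith⟩
  have zU : √(c.formU M nu z) ≤ n := Real.sqrt_le_iff.2 ⟨hn0, by linarith⟩
  have zL : √(∑ T ∈ M.elements, ∫ x in T, z x ^ 2) ≤ n := Real.sqrt_le_iff.2 ⟨hn0, by linarith⟩
  have wA : √(c.formA M w w) ≤ E := Real.sqrt_le_iff.2 ⟨hE, by linarith⟩
  have wJ : √(c.formJ M nu D γ w w) ≤ E := Real.sqrt_le_iff.2 ⟨hE, by linarith⟩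
  have wU : √(c.formU M nu w) ≤ E := Real.sqrt_le_iff.2 ⟨hE, by linarith⟩
  have wL : √(∑ T ∈ M.elements, ∫ x in T, w x ^ 2) ≤ E := Real.sqrt_le_iff.2 ⟨hE, by linarith⟩
  have wB : √(Coeffs.formB M w) ≤ E := Real.sqrt_le_iff.2 ⟨hE, hBE⟩
  -- The two consistency terms are estimated together. Normally the one with the flux of `w` costs
  -- `√κ / √γ` and the one with the discrete flux costs `ρ`.
  have hPP : |c.formP M nu D w z| + |c.formP M nu D z w| ≤ (√κ / √γ + ρ) * (E * n) := by
    rcases hQE with hQ | ⟨hp, hQ⟩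
    · have h1 : √(c.formQ M w / γ) ≤ √κ / √γ * E := by
        rw [← Real.sqrt_div hκ]
        apply Real.sqrt_le_iff.2 ⟨by positivity, ?_⟩
        rw [mul_pow, Real.sq_sqrt (by positivity), div_mul_eq_mul_div]
        gcongr
      have h2 : |c.formP M nu D w z| ≤ √κ / √γ * E * n :=
        fP.trans (mul_le_mul h1 zJ (Real.sqrt_nonneg _) (by positivity))
      have h3 : |c.formP M nu D z w| ≤ ρ * n * E :=
        fP'.trans (mul_le_mul (hQz.trans (mul_le_mul_of_nonneg_left zA hρ0)) wJ
          (Real.sqrt_nonneg _) (by positivity))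
      linarith
    -- For `p = 0` the function `z` is piecewise constant and has no flux. The term with the flux of
    -- `z` vanishes, and its share `ρ` is spent on the other one, whose bound is larger by the
    -- factor `d`.
    · have h0 : c.formA M z z = 0 := by
        refine Finset.sum_eq_zero fun T hT => ?_
        refine setIntegral_eq_zero_of_forall_eq_zero fun x hx => ?_
        obtain ⟨q, hq, hzq⟩ := hz T hT
        have h1 : q = MvPolynomial.C (MvPolynomial.coeff 0 q) :=
          (MvPolynomial.totalDegree_eq_zero_iff_eq_C).1 (by omega)
        have h2 : ∇ z x = 0 := by
          rw [gradient_eq_of_eqOn (G.elem_open T hT) hzq hx, h1, polyFun_C, gradient_fun_const]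
        rw [h2, inner_zero_right]
      have h3 : |c.formP M nu D z w| ≤ 0 := by
        refine fP'.trans ?_
        rw [h0, Real.sqrt_zero, mul_zero] at hQz
        exact mul_nonpos_of_nonpos_of_nonneg hQz (Real.sqrt_nonneg _)
      have hdC := G.le_of_isTraceConst htr
      have hN := G.one_le_maxFacets hd
      have h1 : √(c.formQ M w / γ) ≤ ρ * E := by
        apply Real.sqrt_le_iff.2 ⟨by positivity, ?_⟩
        rw [hρ, mul_pow, mul_pow, Real.sq_sqrt (by positivity), div_le_iff₀ hγ]
        refine hQ.trans ?_
        -- This is `d κ / γ ≤ ρ²` after clearing denominators; it follows from `d ≤ Ctr`, `kmin ≤ κ`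
        -- and `maxFacets ≥ 1`.
        have h4 : (d : ℝ) * kmin ≤ κ * (M.maxFacets * Ctr) := by
          calc (d : ℝ) * kmin ≤ Ctr * κ := by gcongr
            _ ≤ κ * (M.maxFacets * Ctr) := by
              nlinarith [mul_nonneg hκ hC.le]
        have h5 : κ ^ 2 * (M.maxFacets * Ctr / (γ * kmin)) * E ^ 2 * γ =
            κ * (M.maxFacets * Ctr) / kmin * (κ * E ^ 2) := by field_simp
        rw [h5]
        refine mul_le_mul_of_nonneg_right ?_ (by positivity)
        rw [le_div_iff₀ hk]
        exact h4
      have h2 : |c.formP M nu D w z| ≤ ρ * E * n :=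
        fP.trans (mul_le_mul h1 zJ (Real.sqrt_nonneg _) (by positivity))
      have h6 : 0 ≤ √κ / √γ * (E * n) := by positivity
      linarith
  have hεP : |ε * c.formP M nu D z w| ≤ |c.formP M nu D z w| := by
    rw [abs_mul]
    refine mul_le_of_le_one_left (abs_nonneg _) ?_
    rcases hε with rfl | rfl | rfl <;> norm_num
  have tA : |c.formA M w z| ≤ E * n := fA.trans (mul_le_mul wA zA (Real.sqrt_nonneg _) hE)
  have tJ : |c.formJ M nu D γ w z| ≤ E * n := fJ.trans (mul_le_mul wJ zJ (Real.sqrt_nonneg _) hE)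
  have tR : |c.formR M w z| ≤ s * (E * n) + b / √kmin * (E * n) := by
    refine fR.trans (add_le_add ?_ ?_)
    · exact mul_le_mul_of_nonneg_left (mul_le_mul wL zL (Real.sqrt_nonneg _) hE) hs
    · exact mul_le_mul_of_nonneg_left (mul_le_mul wL zA (Real.sqrt_nonneg _) hE) (by positivity)
  have tF : |c.formF M nu w z| ≤ √b * (E * n) + E * n := by
    refine fF.trans (add_le_add ?_ (mul_le_mul wU zU (Real.sqrt_nonneg _) hE))
    exact mul_le_mul_of_nonneg_left (mul_le_mul wB zU (Real.sqrt_nonneg _) hE) (Real.sqrt_nonneg _)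
  have hEn : 0 ≤ E * n := mul_nonneg hE hn0
  have hbound : α * n ^ 2 ≤ boundDar γ κ b s M.maxFacets Ctr kmin * (E * n) := by
    rw [boundDar, ← hρ]
    have a1 := le_abs_self (c.formA M w z)
    have a2 := neg_abs_le (c.formP M nu D w z)
    have a3 := le_abs_self (ε * c.formP M nu D z w)
    have a4 := le_abs_self (c.formJ M nu D γ w z)
    have a5 := le_abs_self (c.formR M w z)
    have a6 := le_abs_self (c.formF M nu w z)
    linarith
  have hfin : n ≤ boundDar γ κ b s M.maxFacets Ctr kmin / α * E := by
    rcases hn0.eq_or_lt with h0 | h0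
    · rw [← h0]
      have : 0 ≤ boundDar γ κ b s M.maxFacets Ctr kmin := by rw [boundDar]; positivity
      positivity
    · rw [div_mul_eq_mul_div, le_div_iff₀ hα]
      refine le_of_mul_le_mul_right ?_ h0
      linarith
  linarith

end Setting

/-! ### The energy of a function in terms of pointwise bounds. -/

namespace Setting

variable {d : ℕ} {Ω : Set (Vec d)} {M : Mesh Ω} {core : Set (Vec d) → Set (Vec d)}
  {nu : Set (Vec d) → Set (Vec d) → Vec d} {c : Coeffs d} {D N : Finset (Set (Vec d))}
  {w : Vec d → ℝ} {γ Cg η m lam : ℝ} {W X : Set (Vec d) → ℝ}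

lemma integral_trace_sq_le (S : Setting M core nu c D N) {T e : Set (Vec d)} (hT : T ∈ M.elements)
    (he : e ∈ M.facetsOf T) {F : Type*} [NormedAddCommGroup F] {f : Vec d → F}
    (hf : Extends T f) {C : ℝ} (hC : ∀ x ∈ T, ‖f x‖ ^ 2 ≤ C) :
    ∫ x in e, ‖extendFrom T f x‖ ^ 2 ∂(surf d) ≤ C * (surf d).real e := by
  have G := S.geom
  have hef := Mesh.Geometry.mem_facets he
  have e1 : C * (surf d).real e = ∫ _ in e, C ∂(surf d) := by simp [mul_comm]
  rw [e1]
  refine setIntegral_mono_on (G.integrableOn_facet hef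
    ((Mesh.Geometry.continuousOn_trace he hf).norm.pow 2))
    (integrableOn_const (G.facet_fin e hef).ne) (G.facet_compact e hef).measurableSet fun x hx => ?_
  have hxc := Mesh.Geometry.mem_closure_of_facet he hx
  obtain ⟨y, hy⟩ := G.elem_nonempty T hT
  have hC0 : 0 ≤ C := (sq_nonneg _).trans (hC y hy)
  have h1 := hf.norm_extendFrom_le (C := √C) (fun y hy => Real.le_sqrt_of_sq_le (hC y hy)) hxc
  calc _ ≤ √C ^ 2 := pow_le_pow_left₀ (norm_nonneg _) h1 2
    _ = C := Real.sq_sqrt hC0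

lemma formB_le (S : Setting M core nu c D N) (hw : M.BrokenC 1 w)
    (hW : ∀ T ∈ M.elements, ∀ x ∈ T, w x ^ 2 ≤ W T) :
    Coeffs.formB M w ≤ ∑ T ∈ M.elements, W T * (surf d).real (frontier T) := by
  refine Finset.sum_le_sum fun T hT => ?_
  rw [S.geom.surf_frontier hT, Finset.mul_sum]
  refine Finset.sum_le_sum fun e he => ?_
  have := S.integral_trace_sq_le hT he (hw T hT).extends (C := W T)
    (fun x hx => by rw [Real.norm_eq_abs, sq_abs]; exact hW T hT x hx)
  simpa only [Real.norm_eq_abs, sq_abs] using this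

/-- Bounds the facet terms by sums of trace norms. -/
lemma sum_facets_jmp_le (S : Setting M core nu c D N) (hw : M.BrokenC 1 w)
    {a : Set (Vec d) → Vec d → ℝ} {b : Set (Vec d) → Set (Vec d) → ℝ}
    (ha : ∀ e ∈ M.facets, ContinuousOn (a e) e) (ha0 : ∀ e x, 0 ≤ a e x)
    (hb0 : ∀ T ∈ M.elements, ∀ e ∈ M.facetsOf T, 0 ≤ b T e)
    (hab : ∀ e ∈ M.facets, ∀ᵐ x ∂((surf d).restrict e), ∀ T ∈ M.adj e, a e x ≤ b T e)
    (hW : ∀ T ∈ M.elements, ∀ x ∈ T, w x ^ 2 ≤ W T) :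
    ∑ e ∈ M.facets, ∫ x in e, a e x * ‖M.jmp nu e w x‖ ^ 2 ∂(surf d) ≤
      ∑ T ∈ M.elements, ∑ e ∈ M.facetsOf T, 2 * b T e * (W T * (surf d).real e) := by
  have G := S.geom
  have hwe : ∀ T ∈ M.elements, Extends T w := fun T hT => (hw T hT).extends
  rw [Mesh.Geometry.sum_facets_comm (M := M) fun T e => 2 * b T e * (W T * (surf d).real e)]
  refine Finset.sum_le_sum fun e he => ?_
  have hfint : ∀ T ∈ M.adj e,
      IntegrableOn (fun x => 2 * b T e * ‖extendFrom T w x‖ ^ 2) e (surf d) := by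
    intro T hT
    obtain ⟨hT', heT⟩ := Mesh.Geometry.facetsOf_of_adj he hT
    exact (G.integrableOn_facet he
      ((Mesh.Geometry.continuousOn_trace heT (hwe T hT')).norm.pow 2)).const_mul _
  have h1 : ∫ x in e, a e x * ‖M.jmp nu e w x‖ ^ 2 ∂(surf d) ≤
      ∫ x in e, ∑ T ∈ M.adj e, 2 * b T e * ‖extendFrom T w x‖ ^ 2 ∂(surf d) := by
    refine integral_mono_ae (G.integrableOn_facet he ((ha e he).mul
      ((Mesh.continuousOn_jmp he hwe).norm.pow 2))) (integrable_finsetSum _ hfint) ?_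
    filter_upwards [hab e he] with x hx
    calc a e x * ‖M.jmp nu e w x‖ ^ 2
        ≤ a e x * (2 * ∑ T ∈ M.adj e, extendFrom T w x ^ 2) :=
          mul_le_mul_of_nonneg_left (G.norm_jmp_sq_le he w x) (ha0 e x)
      _ = ∑ T ∈ M.adj e, 2 * a e x * ‖extendFrom T w x‖ ^ 2 := by
          rw [← mul_assoc, Finset.mul_sum]
          refine Finset.sum_congr rfl fun T _ => ?_
          rw [Real.norm_eq_abs, sq_abs]
          ring
      _ ≤ _ := Finset.sum_le_sum fun T hT => by
          have := hx T hT
          gcongr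
  refine h1.trans ?_
  rw [integral_finsetSum _ hfint]
  refine Finset.sum_le_sum fun T hT => ?_
  obtain ⟨hT', heT⟩ := Mesh.Geometry.facetsOf_of_adj he hT
  rw [integral_const_mul]
  refine mul_le_mul_of_nonneg_left ?_ (mul_nonneg two_pos.le (hb0 T hT' e heT))
  exact S.integral_trace_sq_le hT' heT (hwe T hT')
    (fun x hx => by rw [Real.norm_eq_abs, sq_abs]; exact hW T hT' x hx)

/-- Grading gives `γ / h_e ≤ Cg γ / h_T` for each neighbour, so the penalty is bounded element by
element; the factor `2` comes from the square of a jump of two traces. -/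
lemma formJ_le (S : Setting M core nu c D N) (hγ : 0 < γ) (hCg : 0 < Cg) (hgr : M.IsGraded Cg)
    (hw : M.BrokenC 1 w) (hW : ∀ T ∈ M.elements, ∀ x ∈ T, w x ^ 2 ≤ W T) :
    c.formJ M nu D γ w w ≤ ∑ T ∈ M.elements,
      2 * (Cg * γ / Metric.diam T) * (W T * (surf d).real (frontier T)) := by
  have G := S.geom
  have hsize : ∀ e ∈ M.facets, 0 < M.facetSize e := fun e he => G.facetSize_pos hCg hgr he
  have h1 : c.formJ M nu D γ w w ≤ ∑ e ∈ M.facets, ∫ x in e,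
      |γ / M.facetSize e| * ‖M.jmp nu e w x‖ ^ 2 ∂(surf d) := by
    have : c.formJ M nu D γ w w = ∑ e ∈ M.active D, ∫ x in e,
        |γ / M.facetSize e| * ‖M.jmp nu e w x‖ ^ 2 ∂(surf d) := by
      refine Finset.sum_congr rfl fun e he => ?_
      simp only [integral_const_mul, real_inner_self_eq_norm_sq,
        abs_of_pos (div_pos hγ (hsize e (S.active_sub he)))]
    rw [this]
    exact Finset.sum_le_sum_of_subset_of_nonneg (fun e he => S.active_sub he) fun e _ _ =>
      integral_nonneg fun x => mul_nonneg (abs_nonneg _) (sq_nonneg _)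
  refine h1.trans ((S.sum_facets_jmp_le hw (a := fun e _ => |γ / M.facetSize e|)
    (b := fun T _ => Cg * γ / Metric.diam T) (fun _ _ => continuousOn_const)
    (fun _ _ => abs_nonneg _) (fun T hT _ _ => ?_) (fun e he => ?_) hW).trans (le_of_eq ?_))
  · have := G.diam_pos T hT
    positivity
  · refine Filter.Eventually.of_forall fun x T hT => ?_
    obtain ⟨hT', heT⟩ := Mesh.Geometry.facetsOf_of_adj he hT
    have := G.diam_pos T hT'
    rw [abs_of_pos (div_pos hγ (hsize e he)), div_le_div_iff₀ (hsize e he) this]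
    nlinarith [hgr T hT' e heT]
  · refine Finset.sum_congr rfl fun T hT => ?_
    rw [G.surf_frontier hT, Finset.mul_sum, Finset.mul_sum]

/-- The factor `2` from the square of the jump cancels the `1/2` in front of the upwind term. -/
lemma formU_le (S : Setting M core nu c D N) (hw : M.BrokenC 1 w)
    (hW : ∀ T ∈ M.elements, ∀ x ∈ T, w x ^ 2 ≤ W T) :
    c.formU M nu w ≤ ∑ T ∈ M.elements,
      linfNorm T c.β * (W T * (surf d).real (frontier T)) := by
  have G := S.geom
  have h1 := S.sum_facets_jmp_le hw (a := fun e x => M.abn nu e c.β x)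
    (b := fun T _ => linfNorm T c.β)
    (fun e he => Mesh.continuousOn_abn he fun T hT => S.reg.beta_ext hT)
    (fun e x => abn_nonneg e c.β x) (fun T _ _ _ => linfNorm_nonneg _ _)
    (fun e he => S.abn_le he) hW
  rw [Coeffs.formU]
  refine (mul_le_mul_of_nonneg_left h1 (by norm_num)).trans (le_of_eq ?_)
  rw [Finset.mul_sum]
  refine Finset.sum_congr rfl fun T hT => ?_
  rw [G.surf_frontier hT, Finset.mul_sum, Finset.mul_sum, Finset.mul_sum]
  refine Finset.sum_congr rfl fun e _ => by ring

lemma integral_le_mul_volume (S : Setting M core nu c D N) {T : Set (Vec d)}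
    (hT : T ∈ M.elements) {f : Vec d → ℝ} (hf : Extends T f) {C : ℝ} (hC : ∀ x ∈ T, f x ≤ C) :
    ∫ x in T, f x ≤ C * volume.real T := by
  have G := S.geom
  have e1 : C * volume.real T = ∫ _ in T, C := by simp [mul_comm]
  rw [e1]
  exact setIntegral_mono_on (hf.integrableOn (G.elem_open T hT) (G.elem_bdd T hT))
    (integrableOn_const (G.elem_bdd T hT).measure_lt_top.ne) (G.elem_open T hT).measurableSet hC

lemma formA_le (S : Setting M core nu c D N) (hw : M.BrokenC 1 w)
    (hX : ∀ T ∈ M.elements, ∀ x ∈ T, ‖∇ w x‖ ^ 2 ≤ X T) :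
    c.formA M w w ≤ ∑ T ∈ M.elements, linfNorm T c.Kop * X T * volume.real T := by
  have G := S.geom
  refine Finset.sum_le_sum fun T hT => S.integral_le_mul_volume hT
    ((S.diffFlux_ext hw T hT).dot ((hw T hT).extends_gradient le_rfl)) fun x hx => ?_
  have h1 := (S.reg.K_ext T hT).norm_le_linfNorm (G.elem_open T hT) (G.elem_bdd T hT) hx
  calc inner ℝ (c.diffFlux w x) (∇ w x) ≤ ‖c.diffFlux w x‖ * ‖∇ w x‖ := real_inner_le_norm _ _
    _ ≤ (linfNorm T c.Kop * ‖∇ w x‖) * ‖∇ w x‖ := by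
        gcongr
        exact (ContinuousLinearMap.le_opNorm _ _).trans (by gcongr)
    _ = linfNorm T c.Kop * ‖∇ w x‖ ^ 2 := by ring
    _ ≤ _ := mul_le_mul_of_nonneg_left (hX T hT x hx) (linfNorm_nonneg _ _)

/-- Of the two factors `‖K‖` in the squared flux, one is taken globally and the other on `T`. The
sum is then comparable with `‖K‖` times the local `budget`. -/
lemma formQ_le_sum (S : Setting M core nu c D N) (hw : M.BrokenC 1 w)
    (hX : ∀ T ∈ M.elements, ∀ x ∈ T, ‖∇ w x‖ ^ 2 ≤ X T) :
    c.formQ M w ≤ ∑ T ∈ M.elements, linfNorm Ω c.Kop * (linfNorm T c.Kop * X T *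
      (Metric.diam T * (surf d).real (frontier T))) := by
  have G := S.geom
  refine Finset.sum_le_sum fun T hT => ?_
  obtain ⟨y, hy⟩ := G.elem_nonempty T hT
  have hX0 : 0 ≤ X T := (sq_nonneg _).trans (hX T hT y hy)
  have hkT : linfNorm T c.Kop ≤ linfNorm Ω c.Kop := G.linfNorm_le S.reg.K_ext hT
  have hk0 : 0 ≤ linfNorm T c.Kop := linfNorm_nonneg _ _
  have hκ0 : 0 ≤ linfNorm Ω c.Kop := linfNorm_nonneg _ _
  rw [G.surf_frontier hT, Finset.mul_sum, Finset.mul_sum, Finset.mul_sum]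
  refine Finset.sum_le_sum fun e he => ?_
  have hef := Mesh.Geometry.mem_facets he
  have hTe : T ∈ M.adj e := Mesh.mem_adj.2 ⟨hT, (Mesh.mem_facetsOf.1 he).2⟩
  have h1 := S.integral_trace_sq_le hT he (S.diffFlux_ext hw T hT)
    (C := linfNorm Ω c.Kop * linfNorm T c.Kop * X T) fun x hx => by
      have h1 := (S.reg.K_ext T hT).norm_le_linfNorm (G.elem_open T hT) (G.elem_bdd T hT) hx
      have h2 : ‖c.diffFlux w x‖ ≤ linfNorm T c.Kop * ‖∇ w x‖ :=
        (ContinuousLinearMap.le_opNorm _ _).trans (by gcongr)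
      calc ‖c.diffFlux w x‖ ^ 2 ≤ (linfNorm T c.Kop * ‖∇ w x‖) ^ 2 := by gcongr
        _ = linfNorm T c.Kop * linfNorm T c.Kop * ‖∇ w x‖ ^ 2 := by ring
        _ ≤ linfNorm Ω c.Kop * linfNorm T c.Kop * X T := by
          have := hX T hT x hx
          gcongr
  calc _ ≤ Metric.diam T * ∫ x in e, ‖extendFrom T (c.diffFlux w) x‖ ^ 2 ∂(surf d) :=
        mul_le_mul_of_nonneg_right (Mesh.Geometry.facetSize_le (G.elem_bdd T hT) hef hTe)
          (integral_nonneg fun x => sq_nonneg _)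
    _ ≤ Metric.diam T * (linfNorm Ω c.Kop * linfNorm T c.Kop * X T * (surf d).real e) :=
        mul_le_mul_of_nonneg_left h1 Metric.diam_nonneg
    _ = _ := by ring

/-- The squared approximation error bound. -/
noncomputable def budget (M : Mesh Ω) (c : Coeffs d) (Cg γ η m : ℝ) (X : Set (Vec d) → ℝ) : ℝ :=
  ∑ T ∈ M.elements, volume.real T * ((1 + η) * linfNorm T c.Kop +
    m * (2 * Cg * γ * η + linfNorm T c.β * η * Metric.diam T + Metric.diam T ^ 2
      + η * Metric.diam T)) * X T

/-- Approximation bounds in terms of pointwise bounds of a function and its gradient. -/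
lemma approximation_le (S : Setting M core nu c D N) (hγ : 0 < γ) (hCg : 0 < Cg) (hη : 0 < η)
    (hgr : M.IsGraded Cg) (hch : M.IsChunky η) (hw : M.BrokenC 1 w) (hm : 0 ≤ m)
    (hlam : 1 ≤ lam) (hlam' : lam ≤ 1 + η) (hX0 : ∀ T ∈ M.elements, 0 ≤ X T)
    (hW : ∀ T ∈ M.elements, ∀ x ∈ T, w x ^ 2 ≤ m * Metric.diam T ^ 2 * X T)
    (hX : ∀ T ∈ M.elements, ∀ x ∈ T, ‖∇ w x‖ ^ 2 ≤ lam * X T) :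
    energy M nu c D γ w ≤ budget M c Cg γ η m X ∧ Coeffs.formB M w ≤ budget M c Cg γ η m X ∧
      c.formQ M w ≤ lam * (linfNorm Ω c.Kop * budget M c Cg γ η m X) := by
  have G := S.geom
  have hA := S.formA_le hw hX
  have hJ := S.formJ_le hγ hCg hgr hw hW
  have hU := S.formU_le hw hW
  have hB := S.formB_le hw hW
  have hQ := S.formQ_le_sum hw hX
  have hL : ∑ T ∈ M.elements, ∫ x in T, w x ^ 2 ≤
      ∑ T ∈ M.elements, m * Metric.diam T ^ 2 * X T * volume.real T :=
    Finset.sum_le_sum fun T hT => S.integral_le_mul_volume hT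
      ((hw T hT).extends.comp (Φ := fun a => a ^ 2) (by fun_prop)) (hW T hT)
  have hκ : 0 ≤ linfNorm Ω c.Kop := linfNorm_nonneg _ _
  have hb0 : ∀ T : Set (Vec d), 0 ≤ linfNorm T c.β := fun T => linfNorm_nonneg _ _
  have hk0 : ∀ T : Set (Vec d), 0 ≤ linfNorm T c.Kop := fun T => linfNorm_nonneg _ _
  -- Chunkiness trades one power of the diameter times the boundary measure for `η` times the
  -- volume.
  have hsurf : ∀ T ∈ M.elements, ∀ a, 0 ≤ a → a * Metric.diam T ^ 2 * (surf d).real (frontier T) ≤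
      a * Metric.diam T * (η * volume.real T) := fun T hT a ha => by
    have := mul_le_mul_of_nonneg_left (hch T hT) (mul_nonneg ha (G.diam_pos T hT).le)
    linarith
  refine ⟨?_, ?_, ?_⟩
  · rw [energy]
    refine (add_le_add (add_le_add (add_le_add hA hJ) hL) hU).trans ?_
    rw [← Finset.sum_add_distrib, ← Finset.sum_add_distrib, ← Finset.sum_add_distrib]
    refine Finset.sum_le_sum fun T hT => ?_
    have hd := G.diam_pos T hT
    have hx := hX0 T hT
    have hv := G.volume_pos hT
    have hk := hk0 T
    have hb := hb0 T
    have e1 : linfNorm T c.Kop * (lam * X T) * volume.real T ≤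
        linfNorm T c.Kop * ((1 + η) * X T) * volume.real T := by gcongr
    have e2 : 2 * (Cg * γ / Metric.diam T) *
        (m * Metric.diam T ^ 2 * X T * (surf d).real (frontier T)) ≤
        2 * Cg * γ * m * X T * (η * volume.real T) := by
      have := mul_le_mul_of_nonneg_left (hch T hT)
        (by positivity : 0 ≤ 2 * Cg * γ * m * X T)
      refine le_trans (le_of_eq ?_) this
      field_simp
    have e3 := hsurf T hT (linfNorm T c.β * (m * X T)) (by positivity)
    -- This part of the budget is not needed for the energy. It is reserved for the boundary norms
    -- `formB`, just as a share of `(1 + η) ‖K‖` is used for the flux norms `formQ`.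
    have e4 : 0 ≤ volume.real T * (m * (η * Metric.diam T)) * X T := by positivity
    linarith
  · refine hB.trans (Finset.sum_le_sum fun T hT => ?_)
    have hd := G.diam_pos T hT
    have hx := hX0 T hT
    have hv := G.volume_pos hT
    have hk := hk0 T
    have hb := hb0 T
    have e3 := hsurf T hT (m * X T) (by positivity)
    have e4 : 0 ≤ volume.real T * ((1 + η) * linfNorm T c.Kop +
      m * (2 * Cg * γ * η + linfNorm T c.β * η * Metric.diam T + Metric.diam T ^ 2)) * X T := by
      positivity
    linarith
  · refine hQ.trans ?_
    rw [budget, Finset.mul_sum, Finset.mul_sum]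
    refine Finset.sum_le_sum fun T hT => ?_
    have hd := G.diam_pos T hT
    have hx := hX0 T hT
    have hv := G.volume_pos hT
    have hk := hk0 T
    have hb := hb0 T
    have hl : 0 ≤ lam := by linarith
    have e3 := mul_le_mul_of_nonneg_left (hch T hT)
      (by positivity : 0 ≤ linfNorm Ω c.Kop * (linfNorm T c.Kop * (lam * X T)))
    have e4 : 0 ≤ lam * (linfNorm Ω c.Kop * (volume.real T * (linfNorm T c.Kop +
      m * (2 * Cg * γ * η + linfNorm T c.β * η * Metric.diam T + Metric.diam T ^ 2
        + η * Metric.diam T)) * X T)) := by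
      positivity
    linarith

end Setting

/-! ### Iterated partial derivatives and the Taylor remainder. -/

/-- Iterated partial derivatives along a list of directions; the head is taken last. -/
noncomputable def pd {d : ℕ} (l : List (Fin d)) (f : Vec d → ℝ) : Vec d → ℝ := l.foldr partialD f

section IteratedPartials

variable {d : ℕ} {T : Set (Vec d)} {f g : Vec d → ℝ}

lemma pd_cons (k : Fin d) (l : List (Fin d)) (f : Vec d → ℝ) :
    pd (k :: l) f = partialD k (pd l f) := rfl

lemma pd_append (l l' : List (Fin d)) (f : Vec d → ℝ) : pd (l ++ l') f = pd l (pd l' f) := by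
  simp [pd]

lemma pd_concat (l : List (Fin d)) (k : Fin d) (f : Vec d → ℝ) :
    pd (l ++ [k]) f = pd l (partialD k f) := pd_append l [k] f

lemma partialD_eqOn (ho : IsOpen T) (h : Set.EqOn f g T) (k : Fin d) :
    Set.EqOn (partialD k f) (partialD k g) T := fun x hx => by
  rw [partialD, partialD, (h.eventuallyEq_of_mem (ho.mem_nhds hx)).fderiv_eq]

lemma pd_eqOn (ho : IsOpen T) (h : Set.EqOn f g T) (l : List (Fin d)) :
    Set.EqOn (pd l f) (pd l g) T := by
  induction l with
  | nil => exact h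
  | cons k l ih => exact partialD_eqOn ho ih k

lemma contDiffOn_partialD (ho : IsOpen T) {m : ℕ} (hf : ContDiffOn ℝ (m + 1 : ℕ) f T) (k : Fin d) :
    ContDiffOn ℝ m (partialD k f) T :=
  (hf.fderiv_of_isOpen ho (by norm_cast)).clm_apply contDiffOn_const

lemma contDiffOn_pd (ho : IsOpen T) (l : List (Fin d)) {m : ℕ}
    (hf : ContDiffOn ℝ (m + l.length : ℕ) f T) : ContDiffOn ℝ m (pd l f) T := by
  induction l generalizing m with
  | nil => exact hf
  | cons k l ih =>
    refine contDiffOn_partialD ho (ih ?_) k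
    rwa [add_assoc, add_comm 1]

lemma differentiableAt_of_contDiffOn (ho : IsOpen T) {m : ℕ} (hf : ContDiffOn ℝ m f T)
    (hm : 1 ≤ m) {x : Vec d} (hx : x ∈ T) : DifferentiableAt ℝ f x :=
  (hf.contDiffAt (ho.mem_nhds hx)).differentiableAt (by exact_mod_cast (by omega : m ≠ 0))

lemma pd_sub (ho : IsOpen T) (l : List (Fin d)) (hf : ContDiffOn ℝ l.length f T)
    (hg : ContDiffOn ℝ l.length g T) :
    Set.EqOn (pd l fun x => f x - g x) (fun x => pd l f x - pd l g x) T := by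
  induction l with
  | nil => exact fun x _ => rfl
  | cons k l ih =>
    have hf' : ContDiffOn ℝ (1 + l.length : ℕ) f T := by rw [add_comm]; exact hf
    have hg' : ContDiffOn ℝ (1 + l.length : ℕ) g T := by rw [add_comm]; exact hg
    intro x hx
    have h1 := partialD_eqOn ho (ih (hf'.of_le (by exact_mod_cast (by omega)))
      (hg'.of_le (by exact_mod_cast (by omega)))) k hx
    rw [pd_cons, h1, pd_cons, pd_cons]
    rw [partialD, fderiv_fun_sub
      (differentiableAt_of_contDiffOn ho (contDiffOn_pd ho l hf') le_rfl hx)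
      (differentiableAt_of_contDiffOn ho (contDiffOn_pd ho l hg') le_rfl hx)]
    rfl

lemma pd_sum (ho : IsOpen T) (l : List (Fin d)) {ι : Type*} (s : Finset ι) {F : ι → Vec d → ℝ}
    (hF : ∀ i ∈ s, ContDiffOn ℝ l.length (F i) T) :
    Set.EqOn (pd l fun x => ∑ i ∈ s, F i x) (fun x => ∑ i ∈ s, pd l (F i) x) T := by
  induction l with
  | nil => exact fun x _ => rfl
  | cons k l ih =>
    have hF' : ∀ i ∈ s, ContDiffOn ℝ (1 + l.length : ℕ) (F i) T := fun i hi => by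
      rw [add_comm]; exact hF i hi
    intro x hx
    have h1 := partialD_eqOn ho (ih fun i hi => (hF' i hi).of_le (by exact_mod_cast (by omega))) k hx
    rw [pd_cons, h1, partialD, fderiv_fun_sum fun i hi =>
      differentiableAt_of_contDiffOn ho (contDiffOn_pd ho l (hF' i hi)) le_rfl hx]
    simp [pd_cons, partialD]

lemma partialD_comm (ho : IsOpen T) (hf : ContDiffOn ℝ 2 f T) (j k : Fin d) :
    Set.EqOn (partialD j (partialD k f)) (partialD k (partialD j f)) T := fun x hx => by
  have hx' := hf.contDiffAt (ho.mem_nhds hx)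
  have hs : IsSymmSndFDerivAt ℝ f x := hx'.isSymmSndFDerivAt (by simp)
  have hd : DifferentiableAt ℝ (fderiv ℝ f) x :=
    (hx'.fderiv_right (m := 1) (by norm_num)).differentiableAt (by simp)
  have e : ∀ a b : Fin d, partialD a (partialD b f) x =
      fderiv ℝ (fderiv ℝ f) x (unitVec a) (unitVec b) := fun a b => by
    unfold partialD
    rw [fderiv_clm_apply hd (differentiableAt_const _)]
    simp
  rw [e, e]
  exact hs _ _

/-- Permutations are generated by adjacent swaps. A swap at the head of a list is the symmetry of
second derivatives for the derivative along the tail, which is still `C²`. -/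
lemma pd_perm (ho : IsOpen T) {l l' : List (Fin d)} (h : l.Perm l')
    (hf : ContDiffOn ℝ l.length f T) : Set.EqOn (pd l f) (pd l' f) T := by
  induction h with
  | nil => exact fun _ _ => rfl
  | cons k _ ih =>
    exact partialD_eqOn ho (ih (hf.of_le (by simp))) k
  | swap j k l =>
    refine partialD_comm ho (contDiffOn_pd ho l (m := 2) ?_) _ _
    rw [add_comm]; exact hf
  | trans h1 _ ih1 ih2 => exact (ih1 hf).trans (ih2 (h1.length_eq ▸ hf))

lemma norm_iteratedFDeriv_partialD_le (ho : IsOpen T) {n : ℕ}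
    (hf : ContDiffOn ℝ (n + 1 : ℕ) f T) (k : Fin d) {x : Vec d} (hx : x ∈ T) :
    ‖iteratedFDeriv ℝ n (partialD k f) x‖ ≤ ‖iteratedFDeriv ℝ (n + 1) f x‖ := by
  have hc : ContDiffAt ℝ n (fderiv ℝ f) x :=
    (hf.contDiffAt (ho.mem_nhds hx)).fderiv_right (by norm_cast)
  have h := (ContinuousLinearMap.apply ℝ ℝ (unitVec k)).norm_iteratedFDeriv_comp_left hc le_rfl
  refine h.trans ?_
  rw [norm_iteratedFDeriv_fderiv]
  refine mul_le_of_le_one_left (norm_nonneg _) ?_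
  refine ContinuousLinearMap.opNorm_le_bound _ zero_le_one fun A => ?_
  have := A.le_opNorm (unitVec k)
  rw [norm_unitVec, mul_one] at this
  simpa using this

lemma norm_iteratedFDeriv_pd_le (ho : IsOpen T) (l : List (Fin d)) {n : ℕ}
    (hf : ContDiffOn ℝ (n + l.length : ℕ) f T) {x : Vec d} (hx : x ∈ T) :
    ‖iteratedFDeriv ℝ n (pd l f) x‖ ≤ ‖iteratedFDeriv ℝ (n + l.length) f x‖ := by
  induction l generalizing n with
  | nil => exact le_rfl
  | cons k l ih =>
    have e : n + (k :: l).length = n + 1 + l.length := by simp; omega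
    rw [e] at hf ⊢
    exact (norm_iteratedFDeriv_partialD_le ho (contDiffOn_pd ho l hf) k hx).trans (ih hf)

lemma MemC.exists_bound_pd (ho : IsOpen T) (hb : Bornology.IsBounded T) {n : ℕ}
    (hf : MemC n T f) : ∃ C, ∀ l : List (Fin d), l.length = n → ∀ x ∈ T, |pd l f x| ≤ C := by
  obtain ⟨C, hC⟩ := Extends.exists_bound hb (hf.2 n le_rfl)
  refine ⟨C, fun l hl x hx => ?_⟩
  have h := norm_iteratedFDeriv_pd_le (n := 0) ho l (by rw [zero_add, hl]; exact hf.1) hx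
  rw [norm_iteratedFDeriv_zero, zero_add, hl] at h
  exact h.trans (hC x hx)

/-- The list of directions of a multi-index. -/
def dirs {d : ℕ} (i : Fin d → ℕ) : List (Fin d) :=
  (List.finRange d).flatMap fun k => List.replicate (i k) k

lemma multiD_eq_pd (i : Fin d → ℕ) (f : Vec d → ℝ) : multiD i f = pd (dirs i) f := by
  unfold multiD dirs
  induction List.finRange d with
  | nil => rfl
  | cons k l ih =>
    rw [List.foldr_cons, ih, List.flatMap_cons, pd_append]
    induction i k with
    | zero => rfl
    | succ n ihn => rw [Function.iterate_succ', Function.comp_apply, ihn]; rfl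

lemma count_dirs (i : Fin d → ℕ) (k : Fin d) : (dirs i).count k = i k := by
  rw [dirs, List.count_flatMap]
  have : (fun j => List.count k (List.replicate (i j) j)) = fun j => if j = k then i k else 0 := by
    ext j
    rw [List.count_replicate]
    by_cases h : j = k <;> simp [h]
  change ((List.finRange d).map (fun j => List.count k (List.replicate (i j) j))).sum = _
  rw [this, ← List.ofFn_eq_map, List.sum_ofFn]
  simp

lemma length_dirs (i : Fin d → ℕ) : (dirs i).length = multiLen i := by
  rw [dirs, List.length_flatMap]
  simp only [List.length_replicate]
  rw [← List.ofFn_eq_map, List.sum_ofFn]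
  rfl

lemma dirs_count_perm (l : List (Fin d)) : l.Perm (dirs fun k => l.count k) :=
  List.perm_iff_count.2 fun k => (count_dirs (fun k => l.count k) k).symm

/-- The seminorm is an `sSup`, which dominates the derivatives only when their set is bounded; the
continuous extension of the derivatives to the closure provides this. -/
lemma bddAbove_seminormC (ho : IsOpen T) (hb : Bornology.IsBounded T) {n : ℕ} (hf : MemC n T f) :
    BddAbove {y | ∃ i : Fin d → ℕ, multiLen i = n ∧ ∃ x ∈ T, y = |multiD i f x|} := by
  obtain ⟨C, hC⟩ := hf.exists_bound_pd ho hb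
  refine ⟨C, ?_⟩
  rintro y ⟨i, hi, x, hx, rfl⟩
  rw [multiD_eq_pd]
  exact hC _ (by rw [length_dirs, hi]) x hx

/-- Every list of directions is a permutation of the canonical list of its multi-index of counts. -/
lemma MemC.abs_pd_le (ho : IsOpen T) (hb : Bornology.IsBounded T) {l : List (Fin d)}
    (hf : MemC l.length T f) {x : Vec d} (hx : x ∈ T) : |pd l f x| ≤ seminormC l.length T f := by
  refine le_csSup (bddAbove_seminormC ho hb hf) ⟨fun k => l.count k, ?_, x, hx, ?_⟩
  · rw [← length_dirs, ← (dirs_count_perm l).length_eq]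
  · rw [multiD_eq_pd, pd_perm ho (dirs_count_perm l) hf.1 hx]

lemma seminormC_nonneg (n : ℕ) (T : Set (Vec d)) (f : Vec d → ℝ) : 0 ≤ seminormC n T f := by
  refine Real.sSup_nonneg ?_
  rintro y ⟨i, -, x, -, rfl⟩
  exact abs_nonneg _

/-- A function all of whose derivatives of order less than `m` vanish at the centre of a star-shaped
set is bounded by the derivatives of order `m`. -/
lemma abs_le_of_pd_eq_zero (ho : IsOpen T) {a : Vec d} (hs : StarConvex ℝ a T)
    {B : ℝ} (m : ℕ) (hf : ContDiffOn ℝ m f T)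
    (h0 : ∀ l : List (Fin d), l.length < m → pd l f a = 0)
    (h1 : ∀ l : List (Fin d), l.length = m → ∀ x ∈ T, |pd l f x| ≤ B) {x : Vec d} (hx : x ∈ T) :
    |f x| ≤ B * (∑ k, |(x - a) k|) ^ m / m.factorial := by
  induction m generalizing f x with
  | zero => simpa [pd] using h1 [] rfl x hx
  | succ m ih =>
    -- Each first derivative is flat to one order less, so the induction hypothesis bounds it at
    -- every point of the segment.
    have hk : ∀ k, ∀ z ∈ T, |partialD k f z| ≤
        B * (∑ k, |(z - a) k|) ^ m / m.factorial := fun k z hz => by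
      refine ih (contDiffOn_partialD ho hf k) (fun l hl => ?_) (fun l hl y hy => ?_) hz
      · rw [← pd_concat]; exact h0 _ (by simp; omega)
      · rw [← pd_concat]; exact h1 _ (by simp [hl]) y hy
    set y := x - a with hy
    set s := ∑ k, |y k| with hsdef
    have hs0 : 0 ≤ s := Finset.sum_nonneg fun k _ => abs_nonneg _
    have hmem : ∀ t ∈ Set.Icc (0 : ℝ) 1, a + t • y ∈ T := fun t ht =>
      hs.add_smul_sub_mem hx ht.1 ht.2
    have hder : ∀ t ∈ Set.Icc (0 : ℝ) 1, HasDerivAt (fun t : ℝ => f (a + t • y))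
        (fderiv ℝ f (a + t • y) y) t := fun t ht => by
      have hfd := (differentiableAt_of_contDiffOn ho hf (by omega) (hmem t ht)).hasFDerivAt
      have hl : HasDerivAt (fun t : ℝ => a + t • y) y t := by
        simpa using ((hasDerivAt_id t).smul_const y).const_add a
      exact hfd.comp_hasDerivAt t hl
    have hbd : ∀ t ∈ Set.Ico (0 : ℝ) 1, ‖fderiv ℝ f (a + t • y) y‖ ≤
        B * s ^ (m + 1) / m.factorial * t ^ m := fun t ht => by
      have ht' : t ∈ Set.Icc (0 : ℝ) 1 := ⟨ht.1, ht.2.le⟩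
      rw [clm_apply_eq_sum, Real.norm_eq_abs]
      have hz : ∑ k, |((a + t • y) - a) k| = t * s := by
        rw [hsdef, Finset.mul_sum]
        refine Finset.sum_congr rfl fun k _ => ?_
        rw [add_sub_cancel_left, PiLp.smul_apply, smul_eq_mul, abs_mul, abs_of_nonneg ht.1]
      calc |∑ k, y k * fderiv ℝ f (a + t • y) (unitVec k)|
          ≤ ∑ k, |y k| * (B * (t * s) ^ m / m.factorial) := by
            refine (Finset.abs_sum_le_sum_abs _ _).trans (Finset.sum_le_sum fun k _ => ?_)
            rw [abs_mul, ← hz]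
            exact mul_le_mul_of_nonneg_left (hk k _ (hmem t ht')) (abs_nonneg _)
        _ = _ := by rw [← Finset.sum_mul, ← hsdef]; ring
    have h00 : f a = 0 := h0 [] (by simp)
    -- Along the segment the derivative is at most `B s^(m+1) t^m / m!`, where the sum `s` of the
    -- `|y k|` enters once more through the directional derivative. Comparison with a primitive in
    -- `t` replaces `m!` by `(m+1)!`.
    have key := image_norm_le_of_norm_deriv_right_le_deriv_boundary (a := (0 : ℝ)) (b := 1)
      (f := fun t : ℝ => f (a + t • y)) (f' := fun t => fderiv ℝ f (a + t • y) y)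
      (B := fun t => B * s ^ (m + 1) / (m + 1).factorial * t ^ (m + 1))
      (B' := fun t => B * s ^ (m + 1) / m.factorial * t ^ m)
      (fun t ht => (hder t ht).continuousAt.continuousWithinAt)
      (fun t ht => (hder t ⟨ht.1, ht.2.le⟩).hasDerivWithinAt)
      (by simp [h00])
      (fun t => by
        have := (hasDerivAt_pow (m + 1) t).const_mul (B * s ^ (m + 1) / (m + 1).factorial)
        refine this.congr_deriv ?_
        rw [Nat.factorial_succ, Nat.add_sub_cancel]; push_cast; field_simp)
      hbd (Set.right_mem_Icc.2 zero_le_one)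
    simpa [hy] using key

end IteratedPartials

/-! ### Taylor polynomials. -/

section TaylorPolynomial

variable {d : ℕ}

/-- The polynomial `∏ (x_k - a_k)^{s_k} / s_k!`. -/
noncomputable def taylorMonomial (a : Vec d) (s : Fin d → ℕ) : MvPolynomial (Fin d) ℝ :=
  ∏ k, MvPolynomial.C ((s k).factorial : ℝ)⁻¹ * (MvPolynomial.X k - MvPolynomial.C (a k)) ^ s k

lemma pderiv_prod_eq_zero {ι : Type*} (k : Fin d) (t : Finset ι) (f : ι → MvPolynomial (Fin d) ℝ)
    (h : ∀ j ∈ t, MvPolynomial.pderiv k (f j) = 0) : MvPolynomial.pderiv k (∏ j ∈ t, f j) = 0 := by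
  classical
  induction t using Finset.induction_on with
  | empty => simp
  | insert j t hj ih =>
    rw [Finset.prod_insert hj, MvPolynomial.pderiv_mul, h j (Finset.mem_insert_self j t),
      ih fun i hi => h i (Finset.mem_insert_of_mem hi), zero_mul, mul_zero, add_zero]

/-- The factorials turn the monomials into divided powers, on which differentiation just lowers an
exponent. -/
lemma pderiv_taylorMonomial (a : Vec d) (s : Fin d → ℕ) (k : Fin d) :
    MvPolynomial.pderiv k (taylorMonomial a s) =
      if s k = 0 then 0 else taylorMonomial a (Function.update s k (s k - 1)) := by
  classical
  have e : ∀ r : Fin d → ℕ, taylorMonomial a r =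
      (MvPolynomial.C ((r k).factorial : ℝ)⁻¹ *
        (MvPolynomial.X k - MvPolynomial.C (a k)) ^ r k) *
      ∏ j ∈ Finset.univ.erase k, MvPolynomial.C ((r j).factorial : ℝ)⁻¹ *
        (MvPolynomial.X j - MvPolynomial.C (a j)) ^ r j := fun r =>
    (Finset.mul_prod_erase _ _ (Finset.mem_univ k)).symm
  rw [e s, MvPolynomial.pderiv_mul, pderiv_prod_eq_zero, mul_zero, add_zero]
  · rw [MvPolynomial.pderiv_C_mul, MvPolynomial.pderiv_pow, map_sub, MvPolynomial.pderiv_X_self,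
      MvPolynomial.pderiv_C, sub_zero, mul_one]
    by_cases h : s k = 0
    · simp [h]
    rw [if_neg h, e (Function.update s k (s k - 1)), Function.update_self]
    have h2 : ∏ j ∈ Finset.univ.erase k,
        MvPolynomial.C ((Function.update s k (s k - 1) j).factorial : ℝ)⁻¹ *
          (MvPolynomial.X j - MvPolynomial.C (a j)) ^ (Function.update s k (s k - 1) j) =
        ∏ j ∈ Finset.univ.erase k, MvPolynomial.C ((s j).factorial : ℝ)⁻¹ *
          (MvPolynomial.X j - MvPolynomial.C (a j)) ^ s j :=
      Finset.prod_congr rfl fun j hj => by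
        rw [Function.update_of_ne (Finset.ne_of_mem_erase hj)]
    rw [h2]
    congr 1
    obtain ⟨n, hn⟩ := Nat.exists_eq_succ_of_ne_zero h
    have h3 : ((s k : ℕ) : MvPolynomial (Fin d) ℝ) = MvPolynomial.C ((s k : ℕ) : ℝ) := by simp
    rw [h3, ← mul_assoc, ← MvPolynomial.C_mul]
    congr 2
    rw [hn, Nat.factorial_succ]
    push_cast
    field_simp
  · intro j hj
    have hjk := Finset.ne_of_mem_erase hj
    rw [MvPolynomial.pderiv_C_mul, MvPolynomial.pderiv_pow, map_sub, MvPolynomial.pderiv_X_of_ne hjk,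
      MvPolynomial.pderiv_C]
    simp

lemma polyFun_taylorMonomial_self (a : Vec d) (s : Fin d → ℕ) :
    polyFun (taylorMonomial a s) a = if s = 0 then 1 else 0 := by
  simp only [polyFun, taylorMonomial, map_prod, map_mul, map_pow, map_sub, MvPolynomial.eval_X,
    MvPolynomial.eval_C, sub_self]
  split_ifs with h
  · simp [h]
  · obtain ⟨k, hk⟩ := Function.ne_iff.1 h
    exact Finset.prod_eq_zero (Finset.mem_univ k) (by simp [zero_pow hk])

lemma totalDegree_taylorMonomial_le (a : Vec d) (s : Fin d → ℕ) :
    (taylorMonomial a s).totalDegree ≤ ∑ k, s k := by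
  refine (MvPolynomial.totalDegree_finsetProd _ _).trans (Finset.sum_le_sum fun k _ => ?_)
  refine (MvPolynomial.totalDegree_mul _ _).trans ?_
  rw [MvPolynomial.totalDegree_C, zero_add]
  refine (MvPolynomial.totalDegree_pow _ _).trans ?_
  have : (MvPolynomial.X k - MvPolynomial.C (a k) : MvPolynomial (Fin d) ℝ).totalDegree ≤ 1 :=
    (MvPolynomial.totalDegree_sub_C_le _ _).trans (MvPolynomial.totalDegree_X k).le
  nlinarith

lemma contDiffOn_polyFun (q : MvPolynomial (Fin d) ℝ) (n : ℕ) (T : Set (Vec d)) :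
    ContDiffOn ℝ n (polyFun q) T :=
  ((contDiff_polyFun q).of_le (by exact_mod_cast le_top)).contDiffOn

lemma pd_polyFun (l : List (Fin d)) (q : MvPolynomial (Fin d) ℝ) :
    pd l (polyFun q) = polyFun (l.foldr (fun k r => MvPolynomial.pderiv k r) q) := by
  induction l with
  | nil => rfl
  | cons k l ih => rw [pd_cons, ih]; ext x; exact fderiv_polyFun _ x k

/-- The divided powers are dual to the derivatives at `a`. The induction removes the last entry of
the list, which is the derivative taken first. -/
lemma pd_taylorMonomial_self (a : Vec d) (l : List (Fin d)) (s : Fin d → ℕ) :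
    pd l (polyFun (taylorMonomial a s)) a = if s = fun k => l.count k then 1 else 0 := by
  induction l using List.reverseRecOn generalizing s with
  | nil =>
    rw [pd, List.foldr_nil, polyFun_taylorMonomial_self]
    rfl
  | append_singleton l k ih =>
    have e : partialD k (polyFun (taylorMonomial a s)) =
        polyFun (MvPolynomial.pderiv k (taylorMonomial a s)) := by
      ext x; exact fderiv_polyFun _ x k
    rw [pd_concat, e, pderiv_taylorMonomial]
    by_cases h : s k = 0
    · rw [if_pos h, pd_polyFun, if_neg]
      · have : l.foldr (fun k r => MvPolynomial.pderiv k r) (0 : MvPolynomial (Fin d) ℝ) = 0 := by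
          clear ih
          induction l with
          | nil => rfl
          | cons j l ih => rw [List.foldr_cons, ih, map_zero]
        rw [this]; simp [polyFun]
      · intro hs
        rw [hs] at h
        simp at h
    · rw [if_neg h, ih]
      refine if_congr ?_ rfl rfl
      constructor
      · intro hs
        ext j
        have hj := congrFun hs j
        by_cases hjk : j = k
        · subst hjk; simp at hj ⊢; omega
        · rw [Function.update_of_ne hjk] at hj
          simp [hj, Ne.symm hjk]
      · intro hs
        ext j
        have hj := congrFun hs j
        by_cases hjk : j = k
        · subst hjk; simp at hj ⊢; omega
        · rw [Function.update_of_ne hjk, hj]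
          simp [Ne.symm hjk]

lemma totalDegree_foldr_pderiv_le (l : List (Fin d)) (q : MvPolynomial (Fin d) ℝ) :
    (l.foldr (fun k r => MvPolynomial.pderiv k r) q).totalDegree ≤ q.totalDegree - l.length := by
  induction l with
  | nil => simp
  | cons k l ih =>
    have := totalDegree_pderiv_le (l.foldr (fun k r => MvPolynomial.pderiv k r) q) k
    simp only [List.foldr_cons, List.length_cons]
    omega

lemma pd_polyFun_eq_zero {q : MvPolynomial (Fin d) ℝ} {l : List (Fin d)}
    (h : q.totalDegree < l.length) : pd l (polyFun q) = 0 := by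
  cases l with
  | nil => simp at h
  | cons k l =>
    have h1 := totalDegree_foldr_pderiv_le l q
    have h2 : (l.foldr (fun k r => MvPolynomial.pderiv k r) q).totalDegree = 0 := by
      simp only [List.length_cons] at h; omega
    rw [pd_cons, pd_polyFun, MvPolynomial.totalDegree_eq_zero_iff_eq_C.1 h2, polyFun_C]
    ext x
    simp [partialD]

/-- The multi-indices of length at most `p`. -/
def multiIndices (d p : ℕ) : Finset (Fin d → ℕ) :=
  {s ∈ Fintype.piFinset fun _ => Finset.range (p + 1) | ∑ k, s k ≤ p}

lemma count_mem_multiIndices {p : ℕ} {l : List (Fin d)} (hl : l.length ≤ p) :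
    (fun k => l.count k) ∈ multiIndices d p := by
  have h1 : ∑ k, l.count k = l.length := by
    rw [(dirs_count_perm l).length_eq, length_dirs]; rfl
  rw [multiIndices, Finset.mem_filter, Fintype.mem_piFinset]
  refine ⟨fun k => Finset.mem_range.2 ?_, h1.le.trans hl⟩
  have := (List.count_le_length (a := k) (l := l))
  omega

/-- The polynomial of degree `p` with derivatives `A s` at `a`. -/
noncomputable def taylorPoly (a : Vec d) (p : ℕ) (A : (Fin d → ℕ) → ℝ) : MvPolynomial (Fin d) ℝ :=
  ∑ s ∈ multiIndices d p, MvPolynomial.C (A s) * taylorMonomial a s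

lemma totalDegree_taylorPoly_le (a : Vec d) (p : ℕ) (A : (Fin d → ℕ) → ℝ) :
    (taylorPoly a p A).totalDegree ≤ p := by
  refine (MvPolynomial.totalDegree_finsetSum _ _).trans (Finset.sup_le fun s hs => ?_)
  refine (MvPolynomial.totalDegree_mul _ _).trans ?_
  rw [MvPolynomial.totalDegree_C, zero_add]
  exact (totalDegree_taylorMonomial_le a s).trans (Finset.mem_filter.1 hs).2

lemma pd_taylorPoly_self (a : Vec d) {p : ℕ} (A : (Fin d → ℕ) → ℝ) {l : List (Fin d)}
    (hl : l.length ≤ p) : pd l (polyFun (taylorPoly a p A)) a = A fun k => l.count k := by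
  have hlin : pd l (polyFun (taylorPoly a p A)) a =
      ∑ s ∈ multiIndices d p, A s * pd l (polyFun (taylorMonomial a s)) a := by
    have : ∀ S : Finset (Fin d → ℕ), l.foldr (fun k r => MvPolynomial.pderiv k r)
        (∑ s ∈ S, MvPolynomial.C (A s) * taylorMonomial a s) =
        ∑ s ∈ S, MvPolynomial.C (A s) *
          l.foldr (fun k r => MvPolynomial.pderiv k r) (taylorMonomial a s) := fun S => by
      clear hl
      induction l with
      | nil => rfl
      | cons k l ih => simp [ih, map_sum]
    rw [pd_polyFun, taylorPoly, this]
    simp [polyFun, pd_polyFun]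
  rw [hlin]
  simp_rw [pd_taylorMonomial_self]
  rw [Finset.sum_eq_single_of_mem _ (count_mem_multiIndices hl)
    (fun s _ hs => by rw [if_neg hs, mul_zero]), if_pos rfl, mul_one]

lemma exists_taylorPolynomial {T : Set (Vec d)} (ho : IsOpen T) {a : Vec d} (ha : a ∈ T) {p : ℕ}
    {f : Vec d → ℝ} (hf : ContDiffOn ℝ p f T) :
    ∃ q : MvPolynomial (Fin d) ℝ, q.totalDegree ≤ p ∧
      ∀ l : List (Fin d), l.length ≤ p → pd l (polyFun q) a = pd l f a := by
  refine ⟨taylorPoly a p fun s => pd (dirs s) f a, totalDegree_taylorPoly_le _ _ _, fun l hl => ?_⟩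
  rw [pd_taylorPoly_self a _ hl]
  exact (pd_perm ho (dirs_count_perm l) (hf.of_le (by exact_mod_cast hl)) ha).symm

/-- Taylor polynomials with their remainder bounds on star-shaped sets. -/
lemma exists_taylorPolynomial_bounds {T : Set (Vec d)} (ho : IsOpen T) (hb : Bornology.IsBounded T)
    {a : Vec d} (ha : a ∈ T) (hs : StarConvex ℝ a T) {p : ℕ} {f : Vec d → ℝ}
    (hf : MemC (p + 1) T f) :
    ∃ q : MvPolynomial (Fin d) ℝ, q.totalDegree ≤ p ∧
      (∀ l : List (Fin d), l.length ≤ p → pd l (fun y => f y - polyFun q y) a = 0) ∧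
      ∀ x ∈ T, (f x - polyFun q x) ^ 2 ≤
          (seminormC (p + 1) T f / (p + 1).factorial) ^ 2 * (d * Metric.diam T ^ 2) ^ (p + 1) ∧
        ‖∇ (fun y => f y - polyFun q y) x‖ ^ 2 ≤
          d * ((seminormC (p + 1) T f / p.factorial) ^ 2 * (d * Metric.diam T ^ 2) ^ p) := by
  obtain ⟨q, hq, hqf⟩ := exists_taylorPolynomial ho ha (hf.1.of_le (by exact_mod_cast p.le_succ))
  have hqC : ∀ n : ℕ, ContDiffOn ℝ n (polyFun q) T := fun n => contDiffOn_polyFun q n T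
  have hpd : ∀ l : List (Fin d), l.length ≤ p + 1 →
      Set.EqOn (pd l fun y => f y - polyFun q y) (fun x => pd l f x - pd l (polyFun q) x) T :=
    fun l hl => pd_sub ho l (hf.1.of_le (by exact_mod_cast hl)) (hqC _)
  have hw : ContDiffOn ℝ (p + 1 : ℕ) (fun y => f y - polyFun q y) T := hf.1.sub (hqC _)
  have h0 : ∀ l : List (Fin d), l.length ≤ p → pd l (fun y => f y - polyFun q y) a = 0 :=
    fun l hl => by rw [hpd l (by omega) ha]; simp only [hqf l hl, sub_self]
  have hB := seminormC_nonneg (p + 1) T f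
  set B := seminormC (p + 1) T f with hBdef
  have h1 : ∀ l : List (Fin d), l.length = p + 1 → ∀ x ∈ T,
      |pd l (fun y => f y - polyFun q y) x| ≤ B := fun l hl x hx => by
    rw [hpd l hl.le hx, pd_polyFun_eq_zero (by omega)]
    simp only [Pi.zero_apply, sub_zero]
    rw [hBdef, ← hl]
    exact MemC.abs_pd_le ho hb (hl ▸ hf) hx
  -- The remainder bound involves the `ℓ¹` norm of `x - a`; Cauchy-Schwarz costs a factor `d` in its
  -- square.
  have hS : ∀ x ∈ T, (∑ k, |(x - a) k|) ^ 2 ≤ d * Metric.diam T ^ 2 := fun x hx => by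
    have e1 := sq_sum_le_card_mul_sum_sq (s := Finset.univ) (f := fun k => |(x - a) k|)
    have e2 : ∑ k, |(x - a) k| ^ 2 = ‖x - a‖ ^ 2 := by
      rw [EuclideanSpace.norm_sq_eq]; rfl
    rw [Finset.card_univ, Fintype.card_fin, e2] at e1
    refine e1.trans ?_
    have : ‖x - a‖ ≤ Metric.diam T := by
      rw [← dist_eq_norm]; exact Metric.dist_le_diam_of_mem hb hx ha
    gcongr
  have hfin : ∀ (m : ℕ) (g : ℝ) (x : Vec d), x ∈ T →
      |g| ≤ B * (∑ k, |(x - a) k|) ^ m / m.factorial →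
      g ^ 2 ≤ (B / m.factorial) ^ 2 * (d * Metric.diam T ^ 2) ^ m := fun m g x hx hg => by
    rw [← sq_abs]
    calc |g| ^ 2 ≤ (B * (∑ k, |(x - a) k|) ^ m / m.factorial) ^ 2 := by gcongr
      _ = (B / m.factorial) ^ 2 * ((∑ k, |(x - a) k|) ^ 2) ^ m := by ring
      _ ≤ _ := by gcongr; exact hS x hx
  refine ⟨q, hq, h0, fun x hx => ⟨?_, ?_⟩⟩
  · exact hfin (p + 1) _ x hx (abs_le_of_pd_eq_zero ho hs (p + 1) hw
      (fun l hl => h0 l (by omega)) h1 hx)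
  -- Each partial derivative of the remainder obeys the bound with one order less, and the `d`
  -- components give the leading factor `d`.
  · rw [EuclideanSpace.norm_sq_eq]
    calc ∑ k, ‖∇ (fun y => f y - polyFun q y) x k‖ ^ 2
        ≤ ∑ _k : Fin d, (B / p.factorial) ^ 2 * (d * Metric.diam T ^ 2) ^ p := by
          refine Finset.sum_le_sum fun k _ => ?_
          rw [gradient_apply_coord, Real.norm_eq_abs, sq_abs]
          refine hfin p _ x hx (abs_le_of_pd_eq_zero ho hs p
            (contDiffOn_partialD ho hw k) (fun l hl => ?_) (fun l hl y hy => ?_) hx)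
          · rw [← pd_concat]; exact h0 _ (by simp; omega)
          · rw [← pd_concat]; exact h1 _ (by simp [hl]) y hy
      _ = _ := by simp

end TaylorPolynomial

/-! ### Flat functions and the differential operator. -/

/-- `f` is of class `C^n` on `T` and its derivatives of order at most `n` vanish at `a`. -/
def FlatAt {d : ℕ} (T : Set (Vec d)) (a : Vec d) (n : ℕ) (f : Vec d → ℝ) : Prop :=
  ContDiffOn ℝ n f T ∧ ∀ l : List (Fin d), l.length ≤ n → pd l f a = 0

section Flat

variable {d : ℕ} {T : Set (Vec d)} {a : Vec d} {f g : Vec d → ℝ} {n : ℕ}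

lemma FlatAt.mono (h : FlatAt T a n f) {m : ℕ} (hm : m ≤ n) : FlatAt T a m f :=
  ⟨h.1.of_le (by exact_mod_cast hm), fun l hl => h.2 l (hl.trans hm)⟩

lemma FlatAt.congr (ho : IsOpen T) (ha : a ∈ T) (h : FlatAt T a n f) (hfg : Set.EqOn g f T) :
    FlatAt T a n g :=
  ⟨h.1.congr hfg, fun l hl => (pd_eqOn ho hfg l ha).trans (h.2 l hl)⟩

lemma FlatAt.partialD (ho : IsOpen T) (h : FlatAt T a (n + 1) f) (k : Fin d) :
    FlatAt T a n (partialD k f) :=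
  ⟨contDiffOn_partialD ho h.1 k, fun l hl => by
    rw [← pd_concat]; exact h.2 _ (by simp; omega)⟩

lemma FlatAt.sum (ho : IsOpen T) (ha : a ∈ T) {ι : Type*} (s : Finset ι) {F : ι → Vec d → ℝ}
    (h : ∀ i ∈ s, FlatAt T a n (F i)) : FlatAt T a n fun x => ∑ i ∈ s, F i x := by
  refine ⟨ContDiffOn.sum fun i hi => (h i hi).1, fun l hl => ?_⟩
  rw [pd_sum ho l s (fun i hi => (h i hi).1.of_le (by exact_mod_cast hl)) ha]
  exact Finset.sum_eq_zero fun i hi => (h i hi).2 l hl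

lemma FlatAt.sub (ho : IsOpen T) (ha : a ∈ T) (hf : FlatAt T a n f) (hg : FlatAt T a n g) :
    FlatAt T a n fun x => f x - g x := by
  refine ⟨hf.1.sub hg.1, fun l hl => ?_⟩
  rw [pd_sub ho l (hf.1.of_le (by exact_mod_cast hl)) (hg.1.of_le (by exact_mod_cast hl)) ha]
  simp only [hf.2 l hl, hg.2 l hl, sub_self]

/-- The product rule is written as a difference so that `pd_sub` applies to it. -/
lemma partialD_mul (ho : IsOpen T) (hf : ContDiffOn ℝ 1 f T) (hg : ContDiffOn ℝ 1 g T) (k : Fin d) :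
    Set.EqOn (partialD k fun x => f x * g x)
      (fun x => partialD k f x * g x - partialD k g x * (-f x)) T := fun x hx => by
  have h1 := differentiableAt_of_contDiffOn ho (m := 1) (by exact_mod_cast hf) le_rfl hx
  have h2 := differentiableAt_of_contDiffOn ho (m := 1) (by exact_mod_cast hg) le_rfl hx
  simp only [QTDG.partialD]
  rw [fderiv_fun_mul h1 h2]
  simp
  ring

/-- Functions flat at `a` form an ideal. The innermost derivative is expanded by the product rule:
it falls on `g`, leaving `f`, or on `f`, which then is still flat to the lower order needed. -/
lemma FlatAt.mul (ho : IsOpen T) (ha : a ∈ T) (hf : FlatAt T a n f) (hg : ContDiffOn ℝ n g T) :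
    FlatAt T a n fun x => g x * f x := by
  refine ⟨hg.mul hf.1, fun l hl => ?_⟩
  induction n generalizing f g l with
  | zero =>
    obtain rfl : l = [] := List.length_eq_zero_iff.1 (Nat.le_zero.1 hl)
    have := hf.2 [] le_rfl
    change f a = 0 at this
    change g a * f a = 0
    rw [this, mul_zero]
  | succ n ih =>
    have hg1 : ContDiffOn ℝ n g T := hg.of_le (by exact_mod_cast n.le_succ)
    have hf1 := hf.mono n.le_succ
    rcases List.eq_nil_or_concat l with rfl | ⟨l, k, rfl⟩
    · exact ih hf1 hg1 [] (Nat.zero_le n)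
    have hl' : l.length ≤ n := by simp at hl; omega
    have hln : ((l.length : ℕ) : WithTop ℕ∞) ≤ n := by exact_mod_cast hl'
    rw [List.concat_eq_append, pd_concat,
      pd_eqOn ho (partialD_mul ho (hg.of_le (by exact_mod_cast Nat.le_add_left 1 n))
        (hf.1.of_le (by exact_mod_cast Nat.le_add_left 1 n)) k) l ha]
    have hgk := contDiffOn_partialD ho hg k
    have hfk := hf.partialD ho k
    rw [pd_sub ho l ((hgk.mul hf1.1).of_le hln) ((hfk.1.mul hg1.neg).of_le hln) ha]
    have e : (fun x => QTDG.partialD k f x * -g x) = fun x => (-g x) * QTDG.partialD k f x := by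
      ext x; ring
    simp only [e]
    rw [ih hf1 hgk l hl', ih hfk hg1.neg l hl', sub_zero]

end Flat

namespace Coeffs

variable {d : ℕ} {T : Set (Vec d)} {a : Vec d} {f g : Vec d → ℝ} {n : ℕ} {c : Coeffs d}

/-- The `k`-th component of the flux `K ∇f - f β`. -/
noncomputable def fluxComp (c : Coeffs d) (f : Vec d → ℝ) (k : Fin d) (y : Vec d) : ℝ :=
  ∑ m, c.K y k m * partialD m f y - c.β y k * f y

lemma neg_diffFlux_add_apply (c : Coeffs d) (f : Vec d → ℝ) (y : Vec d) (k : Fin d) :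
    (- c.diffFlux f y + f y • c.β y) k = - c.fluxComp f k y := by
  have : c.diffFlux f y k = ∑ m, c.K y k m * partialD m f y := by
    simp only [diffFlux, Kop, partialD, ← gradient_apply_coord]
    rfl
  rw [fluxComp, PiLp.add_apply, PiLp.neg_apply, this, PiLp.smul_apply, smul_eq_mul]
  ring

lemma contDiffOn_fluxComp (ho : IsOpen T) (hK : ∀ j m, ContDiffOn ℝ n (fun x => c.K x j m) T)
    (hβ : ∀ j, ContDiffOn ℝ n (fun x => c.β x j) T) (hf : ContDiffOn ℝ (n + 1 : ℕ) f T)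
    (k : Fin d) : ContDiffOn ℝ n (c.fluxComp f k) T :=
  (ContDiffOn.sum fun m _ => (hK k m).mul (contDiffOn_partialD ho hf m)).sub
    ((hβ k).mul (hf.of_le (by exact_mod_cast n.le_succ)))

lemma L_eqOn (ho : IsOpen T) (hK : ∀ j m, ContDiffOn ℝ 1 (fun x => c.K x j m) T)
    (hβ : ∀ j, ContDiffOn ℝ 1 (fun x => c.β x j) T) (hf : ContDiffOn ℝ 2 f T) :
    Set.EqOn (c.L f) (fun x => c.σ x * f x - ∑ k, partialD k (c.fluxComp f k) x) T := fun x hx => by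
  have hd : ∀ k, DifferentiableAt ℝ (c.fluxComp f k) x := fun k =>
    differentiableAt_of_contDiffOn ho (m := 1) (contDiffOn_fluxComp ho (by exact_mod_cast hK)
      (by exact_mod_cast hβ) (by exact_mod_cast hf) k) le_rfl hx
  have e : ∀ k, (fun y => (- c.diffFlux f y + f y • c.β y) k) = fun y => - c.fluxComp f k y :=
    fun k => funext fun y => neg_diffFlux_add_apply c f y k
  rw [L, divg_eq_sum fun k => by rw [e]; exact (hd k).neg]
  simp only [e, fderiv_fun_neg, partialD, neg_apply, Finset.sum_neg_distrib]
  ring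

/-- `𝓛 f` is flat to order `n` if `f` is flat to order `n + 2`. -/
lemma flatAt_L (ho : IsOpen T) (ha : a ∈ T)
    (hK : ∀ j m, ContDiffOn ℝ (n + 1 : ℕ) (fun x => c.K x j m) T)
    (hβ : ∀ j, ContDiffOn ℝ (n + 1 : ℕ) (fun x => c.β x j) T) (hσ : ContDiffOn ℝ n c.σ T)
    (hf : FlatAt T a (n + 2) f) : FlatAt T a n (c.L f) := by
  refine FlatAt.congr ho ha ?_ (L_eqOn ho
    (fun j m => (hK j m).of_le (by exact_mod_cast Nat.le_add_left 1 n))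
    (fun j => (hβ j).of_le (by exact_mod_cast Nat.le_add_left 1 n))
    (hf.1.of_le (by exact_mod_cast Nat.le_add_left 2 n)))
  -- In `σ f - div (K ∇f - f β)` at most two derivatives fall on `f`, and multiplication by the
  -- coefficients preserves flatness; so exactly two orders are lost.
  refine ((hf.mono (by omega)).mul ho ha hσ).sub ho ha (FlatAt.sum ho ha _ fun k _ => ?_)
  refine FlatAt.partialD ho ?_ k
  exact (FlatAt.sum ho ha _ fun m _ => (hf.partialD ho m).mul ho ha (hK k m)).sub ho ha
    ((hf.mono (by omega)).mul ho ha (hβ k))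

lemma L_sub_eqOn (ho : IsOpen T) (hK : ∀ j m, ContDiffOn ℝ 1 (fun x => c.K x j m) T)
    (hβ : ∀ j, ContDiffOn ℝ 1 (fun x => c.β x j) T) (hf : ContDiffOn ℝ 2 f T)
    (hg : ContDiffOn ℝ 2 g T) :
    Set.EqOn (c.L fun x => f x - g x) (fun x => c.L f x - c.L g x) T := fun x hx => by
  have hd : ∀ (v : Vec d → ℝ), ContDiffOn ℝ 2 v T → ∀ k, ContDiffOn ℝ 1 (c.fluxComp v k) T :=
    fun v hv k => by
      exact_mod_cast contDiffOn_fluxComp (n := 1) ho (by exact_mod_cast hK)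
        (by exact_mod_cast hβ) (by exact_mod_cast hv) k
  have e : ∀ k, Set.EqOn (c.fluxComp (fun x => f x - g x) k)
      (fun y => c.fluxComp f k y - c.fluxComp g k y) T := fun k y hy => by
    have h1 : ∀ m, partialD m (fun x => f x - g x) y = partialD m f y - partialD m g y :=
      fun m => pd_sub ho [m] (hf.of_le (by norm_num)) (hg.of_le (by norm_num)) hy
    simp only [fluxComp, h1, mul_sub, Finset.sum_sub_distrib]
    ring
  have e2 : ∀ k, partialD k (c.fluxComp (fun x => f x - g x) k) x =
      partialD k (c.fluxComp f k) x - partialD k (c.fluxComp g k) x := fun k => by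
    rw [partialD_eqOn ho (e k) k hx]
    exact pd_sub ho [k] (by exact_mod_cast hd f hf k) (by exact_mod_cast hd g hg k) hx
  rw [L_eqOn ho hK hβ (hf.sub hg) hx]
  simp only [L_eqOn ho hK hβ hf hx, L_eqOn ho hK hβ hg hx, e2, Finset.sum_sub_distrib]
  ring

lemma contDiffOn_L (ho : IsOpen T)
    (hK : ∀ j m, ContDiffOn ℝ (n + 1 : ℕ) (fun x => c.K x j m) T)
    (hβ : ∀ j, ContDiffOn ℝ (n + 1 : ℕ) (fun x => c.β x j) T) (hσ : ContDiffOn ℝ n c.σ T)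
    (hf : ContDiffOn ℝ (n + 2 : ℕ) f T) : ContDiffOn ℝ n (c.L f) T := by
  refine ContDiffOn.congr ?_ (L_eqOn ho
    (fun j m => (hK j m).of_le (by exact_mod_cast Nat.le_add_left 1 n))
    (fun j => (hβ j).of_le (by exact_mod_cast Nat.le_add_left 1 n))
    (hf.of_le (by exact_mod_cast Nat.le_add_left 2 n)))
  exact (hσ.mul (hf.of_le (by exact_mod_cast Nat.le_add_right n 2))).sub
    (ContDiffOn.sum fun k _ => contDiffOn_partialD ho (contDiffOn_fluxComp ho hK hβ hf k) k)

lemma pd_L_sub (ho : IsOpen T) (ha : a ∈ T)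
    (hK : ∀ j m, ContDiffOn ℝ (n + 1 : ℕ) (fun x => c.K x j m) T)
    (hβ : ∀ j, ContDiffOn ℝ (n + 1 : ℕ) (fun x => c.β x j) T) (hσ : ContDiffOn ℝ n c.σ T)
    (hf : ContDiffOn ℝ (n + 2 : ℕ) f T) (hg : ContDiffOn ℝ (n + 2 : ℕ) g T) {l : List (Fin d)}
    (hl : l.length ≤ n) :
    pd l (c.L fun x => f x - g x) a = pd l (c.L f) a - pd l (c.L g) a := by
  have hln : ((l.length : ℕ) : WithTop ℕ∞) ≤ n := by exact_mod_cast hl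
  rw [pd_eqOn ho (L_sub_eqOn ho
    (fun j m => (hK j m).of_le (by exact_mod_cast Nat.le_add_left 1 n))
    (fun j => (hβ j).of_le (by exact_mod_cast Nat.le_add_left 1 n))
    (hf.of_le (by exact_mod_cast Nat.le_add_left 2 n))
    (hg.of_le (by exact_mod_cast Nat.le_add_left 2 n))) l ha]
  exact pd_sub ho l ((contDiffOn_L ho hK hβ hσ hf).of_le hln)
    ((contDiffOn_L ho hK hβ hσ hg).of_le hln) ha

end Coeffs

lemma MemC.partialD {d : ℕ} {T : Set (Vec d)} {f : Vec d → ℝ} (ho : IsOpen T) (hf : MemC 2 T f)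
    (k : Fin d) : MemC 1 T (partialD k f) := by
  refine memC_one_of_extends (contDiffOn_partialD ho hf.1 k)
    ((hf.extends_fderiv one_le_two).fderiv_apply (unitVec k)) ?_
  let e := continuousMultilinearCurryLeftEquiv ℝ (fun _ : Fin 2 => Vec d) ℝ
  let A := ContinuousMultilinearMap.apply ℝ (fun _ : Fin 1 => Vec d) ℝ (fun _ => unitVec k)
  have h2 : Extends T (iteratedFDeriv ℝ 2 f) := hf.2 2 le_rfl
  refine (h2.comp (Φ := fun B => A.comp (e B : Vec d →L[ℝ] _)) ?_).congr fun x hx => ?_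
  · exact ((ContinuousLinearMap.compL ℝ (Vec d) _ ℝ) A).continuous.comp e.continuous
  · have hd : DifferentiableAt ℝ (fderiv ℝ f) x :=
      ((hf.contDiffAt ho hx).fderiv_right (m := 1) (by norm_num)).differentiableAt (by simp)
    ext v
    have : fderiv ℝ (QTDG.partialD k f) x v = fderiv ℝ (fderiv ℝ f) x v (unitVec k) := by
      unfold QTDG.partialD
      rw [fderiv_clm_apply hd (differentiableAt_const _)]
      simp
    rw [this]
    simp [A, e, iteratedFDeriv_two_apply]

/-- Test functions determine the weak divergence almost everywhere, and continuity upgrades this to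
all points of `T`. -/
lemma HasWeakDiv.eqOn {d : ℕ} {T : Set (Vec d)} (ho : IsOpen T) (hb : Bornology.IsBounded T)
    {F : Vec d → Vec d} {g g' : Vec d → ℝ} (hg : Extends T g) (hg' : Extends T g')
    (h : HasWeakDiv T F g) (h' : HasWeakDiv T F g') : Set.EqOn g g' T := by
  have hd := (hg.sub hg').integrableOn ho hb
  have h0 : ∀ᵐ x, x ∈ T → g x - g' x = 0 := by
    refine ho.ae_eq_zero_of_integral_contDiff_smul_eq_zero hd.locallyIntegrableOn fun φ h1 h2 h3 => ?_
    have hφ : IsTestFun T φ := ⟨h1, h2, h3⟩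
    have e1 := h φ hφ
    rw [h' φ hφ] at e1
    have i1 := (hg.mul hφ.extends).integrableOn ho hb
    have i2 := (hg'.mul hφ.extends).integrableOn ho hb
    have e2 : ∫ x in T, φ x • (g x - g' x) = ∫ x in T, (g x * φ x - g' x * φ x) := by
      congr 1; ext x; simp; ring
    rw [← setIntegral_eq_integral_of_forall_compl_eq_zero (s := T) (fun x hx => by
      rw [image_eq_zero_of_notMem_tsupport fun hh => hx (h3 hh), zero_smul]), e2,
      integral_sub i1 i2]
    linarith
  refine Measure.eqOn_open_of_ae_eq (μ := volume) ?_ ho hg.continuousOn hg'.continuousOn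
  refine (ae_restrict_iff' ho.measurableSet).2 ?_
  filter_upwards [h0] with x hx hxT using sub_eq_zero.1 (hx hxT)

/-- A weak solution of class `C^2` solves the equation classically in each element. -/
lemma Coeffs.L_eq_zero {d : ℕ} {Ω : Set (Vec d)} {M : Mesh Ω} {c : Coeffs d}
    {core : Set (Vec d) → Set (Vec d)} {nu : Set (Vec d) → Set (Vec d) → Vec d}
    {D N : Finset (Set (Vec d))} {gD gN u : Vec d → ℝ}
    (hDN : ∀ e, e ∈ M.boundaryFacets ↔ e ∈ D ∨ e ∈ N) (G : M.Geometry core nu) (h : c.Regular M)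
    (hK : ∀ j m, M.BrokenC 1 fun x => c.K x j m) (hu : M.BrokenC 2 u)
    (hsol : c.IsWeakSolution M D N (fun _ => 0) gD gN u) {T : Set (Vec d)}
    (hT : T ∈ M.elements) : Set.EqOn (c.L u) 0 T := by
  have ho := G.elem_open T hT
  have hb := G.elem_bdd T hT
  have huT := hu T hT
  have hu1 : ∀ T ∈ M.elements, MemC 1 T u := fun T hT => (hu T hT).mono one_le_two
  have hcomp : ∀ k, MemC 1 T (c.fluxComp u k) := fun k => by
    refine MemC.sub_one ho ?_ ((h.beta_C T hT k).mul_one ho (hu1 T hT))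
    have : ∀ s : Finset (Fin d), MemC 1 T fun y => ∑ m ∈ s, c.K y k m * partialD m u y := fun s => by
      classical
      induction s using Finset.induction_on with
      | empty => simpa using memC_of_contDiff (T := T) (contDiff_const (c := (0 : ℝ))) 1
      | insert m s hm ih =>
        have h1 := ((hK k m T hT).mul_one ho (huT.partialD ho m))
        have h2 : MemC 1 T fun _ : Vec d => (0 : ℝ) := memC_of_contDiff contDiff_const 1
        refine (MemC.sub_one ho h1 (MemC.sub_one ho h2 ih)).congr ho fun x _ => ?_
        simp [Finset.sum_insert hm]
    exact this _
  -- The weak formulation gives the divergence `σ u` for the total flux, and differentiation gives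
  -- the classical divergence. Both are continuous, so they coincide, which is `𝓛 u = 0`.
  have hw : HasWeakDiv T (fun y => c.diffFlux u y - u y • c.β y) fun x => c.σ x * u x := by
    intro φ hφ
    have i1 := (hφ.extends_fderiv.clm_apply
      (h.diffFlux_ext hT ((hu1 T hT).extends_gradient le_rfl))).integrableOn ho hb
    have i2 := (hφ.extends_fderiv.clm_apply
      ((hu1 T hT).extends.smul (h.beta_ext hT))).integrableOn ho hb
    have j1 := ((h.fluxDiv_ext G hT (hu1 T hT)).mul hφ.extends).integrableOn ho hb
    have j2 := ((((h.beta_ext hT).dot ((hu1 T hT).extends_gradient le_rfl)).add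
      ((h.divg_ext G hT).mul (hu1 T hT).extends)).mul hφ.extends).integrableOn ho hb
    simp only [map_sub]
    rw [integral_sub i1 i2, hasWeakDiv_flux hDN G h hu1 hsol hT φ hφ,
      h.hasWeakDiv_smul_beta G hT (hu1 T hT) φ hφ, sub_neg_eq_add, neg_add_eq_sub, ← neg_sub,
      ← integral_sub j1 j2]
    congr 2
    ext x
    simp only [Coeffs.fluxDiv]
    ring
  have e : ∀ k, (fun y => (c.diffFlux u y - u y • c.β y) k) = c.fluxComp u k := fun k => by
    ext y
    have := c.neg_diffFlux_add_apply u y k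
    simp only [PiLp.add_apply, PiLp.neg_apply, PiLp.sub_apply] at this ⊢
    linarith
  have hw' : HasWeakDiv T (fun y => c.diffFlux u y - u y • c.β y) fun x =>
      ∑ k, partialD k (c.fluxComp u k) x := by
    have := hasWeakDiv_of_memC ho hb (F := fun y => c.diffFlux u y - u y • c.β y)
      (fun k => by rw [e k]; exact hcomp k)
    simp only [e] at this
    exact this
  have heq := HasWeakDiv.eqOn ho hb ((h.sigma_ext T hT).mul (hu1 T hT).extends)
    (Extends.finset_sum (T := T) Finset.univ fun k _ =>
      ((hcomp k).extends_fderiv le_rfl).fderiv_apply (unitVec k)) hw hw'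
  intro x hx
  rw [L_eqOn ho (fun j m => by exact_mod_cast (hK j m T hT).1)
    (fun j => by exact_mod_cast (h.beta_C T hT j).1) (by exact_mod_cast huT.1) hx]
  exact sub_eq_zero.2 (heq hx)

/-! ### Quasi-Trefftz functions and the Taylor approximation of a solution. -/

namespace Coeffs

variable {d : ℕ} {Ω : Set (Vec d)} {M : Mesh Ω} {c : Coeffs d} {core : Set (Vec d) → Set (Vec d)}
  {nu : Set (Vec d) → Set (Vec d) → Vec d} {D N : Finset (Set (Vec d))} {gD gN u : Vec d → ℝ}
  {xc : Set (Vec d) → Vec d} {p : ℕ}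

lemma MemQT.piecewisePoly {v : Vec d → ℝ} (h : c.MemQT M xc p v) : M.PiecewisePoly p v :=
  fun T hT => (h T hT).1

lemma regular_of_brokenC (hK : ∀ j m, M.BrokenC (max (p - 1) 1) fun x => c.K x j m)
    (hβ : ∀ j, M.BrokenC (max (p - 1) 1) fun x => c.β x j)
    (hσ : M.BrokenC (max (p - 2) 0) c.σ) : c.Regular M where
  K_ext T hT := Extends.toEuclideanCLM fun j m => (hK j m T hT).extends
  beta_C T hT j := (hβ j T hT).mono (le_max_right _ _)
  sigma_ext T hT := (hσ T hT).extends

lemma MemQT.sub (G : M.Geometry core nu)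
    (hK : ∀ j m, M.BrokenC (max (p - 1) 1) fun x => c.K x j m)
    (hβ : ∀ j, M.BrokenC (max (p - 1) 1) fun x => c.β x j)
    (hσ : M.BrokenC (max (p - 2) 0) c.σ) (hxc : ∀ T ∈ M.elements, xc T ∈ T)
    {f g : Vec d → ℝ} (hf : c.MemQT M xc p f) (hg : c.MemQT M xc p g) :
    c.MemQT M xc p fun x => f x - g x := by
  intro T hT
  have ho := G.elem_open T hT
  obtain ⟨q, hq, hfq⟩ := (hf T hT).1
  obtain ⟨r, hr, hgr⟩ := (hg T hT).1
  refine ⟨⟨q - r, (MvPolynomial.totalDegree_sub _ _).trans (max_le hq hr), fun x hx => ?_⟩,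
    fun i hi => ?_⟩
  · simp only [map_sub, hfq x hx, hgr x hx]
  -- A multi-index with `|i| + 2 ≤ p` forces `p ≥ 2`; for smaller `p` there are no conditions. The
  -- regularity of the coefficients then reads `n + 1` and `n`, which is what differentiating `𝓛` up
  -- to order `n` requires.
  obtain ⟨n, rfl⟩ : ∃ n, p = n + 2 := ⟨p - 2, by omega⟩
  have hn : max (n + 2 - 1) 1 = n + 1 := by omega
  have hn' : max (n + 2 - 2) 0 = n := by omega
  rw [hn] at hK hβ
  rw [hn'] at hσ
  have hC : ∀ {v : Vec d → ℝ} {q : MvPolynomial (Fin d) ℝ},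
      (∀ x ∈ T, v x = MvPolynomial.eval (fun k => x k) q) → ContDiffOn ℝ (n + 2 : ℕ) v T :=
    fun h => (contDiffOn_polyFun _ _ T).congr h
  have hl : (dirs i).length ≤ n := by rw [length_dirs]; omega
  have h1 := (hf T hT).2 i hi
  have h2 := (hg T hT).2 i hi
  rw [multiD_eq_pd] at h1 h2 ⊢
  rw [pd_L_sub ho (hxc T hT) (fun j m => (hK j m T hT).1) (fun j => (hβ j T hT).1) (hσ T hT).1
    (hC hfq) (hC hgr) hl, h1, h2, sub_zero]

/-- The elementwise Taylor polynomial of a solution is a quasi-Trefftz function. -/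
lemma exists_memQT_approx (G : M.Geometry core nu)
    (hDN : ∀ e, e ∈ M.boundaryFacets ↔ e ∈ D ∨ e ∈ N)
    (hK : ∀ j m, M.BrokenC (max (p - 1) 1) fun x => c.K x j m)
    (hβ : ∀ j, M.BrokenC (max (p - 1) 1) fun x => c.β x j)
    (hσ : M.BrokenC (max (p - 2) 0) c.σ)
    (hxc : ∀ T ∈ M.elements, xc T ∈ T ∧ StarConvex ℝ (xc T) T)
    (hu : M.BrokenC (p + 1) u) (hsol : c.IsWeakSolution M D N (fun _ => 0) gD gN u) :
    ∃ v, c.MemQT M xc p v ∧ ∀ T ∈ M.elements, ∀ x ∈ T,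
      (u x - v x) ^ 2 ≤
          (seminormC (p + 1) T u / (p + 1).factorial) ^ 2 * (d * Metric.diam T ^ 2) ^ (p + 1) ∧
      ‖∇ (fun y => u y - v y) x‖ ^ 2 ≤
          d * ((seminormC (p + 1) T u / p.factorial) ^ 2 * (d * Metric.diam T ^ 2) ^ p) := by
  classical
  have hq : ∀ T : Set (Vec d), ∃ q : MvPolynomial (Fin d) ℝ, T ∈ M.elements →
      q.totalDegree ≤ p ∧
      (∀ l : List (Fin d), l.length ≤ p → pd l (fun y => u y - polyFun q y) (xc T) = 0) ∧
      ∀ x ∈ T, (u x - polyFun q x) ^ 2 ≤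
          (seminormC (p + 1) T u / (p + 1).factorial) ^ 2 * (d * Metric.diam T ^ 2) ^ (p + 1) ∧
        ‖∇ (fun y => u y - polyFun q y) x‖ ^ 2 ≤
          d * ((seminormC (p + 1) T u / p.factorial) ^ 2 * (d * Metric.diam T ^ 2) ^ p) :=
    fun T => by
      by_cases hT : T ∈ M.elements
      · obtain ⟨q, h⟩ := exists_taylorPolynomial_bounds (G.elem_open T hT) (G.elem_bdd T hT)
          (hxc T hT).1 (hxc T hT).2 (hu T hT)
        exact ⟨q, fun _ => h⟩
      · exact ⟨0, fun h => absurd h hT⟩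
  choose q hq using hq
  -- The elements are disjoint, so at a point of an element only its own polynomial contributes.
  set v : Vec d → ℝ := fun x => ∑ T ∈ M.elements, T.indicator (polyFun (q T)) x with hv
  have hvT : ∀ T ∈ M.elements, Set.EqOn v (polyFun (q T)) T := fun T hT x hx => by
    rw [hv]
    simp only
    rw [Finset.sum_eq_single_of_mem T hT fun T' hT' hne => Set.indicator_of_notMem
      (fun hx' => Set.disjoint_left.1 (M.disjoint T' hT' T hT hne) hx' hx) _,
      Set.indicator_of_mem hx]
  refine ⟨v, fun T hT => ⟨⟨q T, (hq T hT).1, hvT T hT⟩, fun i hi => ?_⟩, fun T hT x hx => ?_⟩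
  · have ho := G.elem_open T hT
    have ha := (hxc T hT).1
    have hreg := regular_of_brokenC hK hβ hσ
    have hK1 : ∀ j m, M.BrokenC 1 fun x => c.K x j m := fun j m T hT =>
      (hK j m T hT).mono (le_max_right _ _)
    obtain ⟨n, rfl⟩ : ∃ n, p = n + 2 := ⟨p - 2, by omega⟩
    have hn : max (n + 2 - 1) 1 = n + 1 := by omega
    have hn' : max (n + 2 - 2) 0 = n := by omega
    rw [hn] at hK hβ
    rw [hn'] at hσ
    have hl : (dirs i).length ≤ n := by rw [length_dirs]; omega
    have hvC : ContDiffOn ℝ (n + 2 : ℕ) v T :=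
      (contDiffOn_polyFun (q T) _ T).congr (hvT T hT)
    have huC : ContDiffOn ℝ (n + 2 : ℕ) u T := (hu T hT).1.of_le (by exact_mod_cast Nat.le_succ _)
    have hw : FlatAt T (xc T) (n + 2) fun y => u y - v y := by
      refine FlatAt.congr ho ha (f := fun y => u y - polyFun (q T) y) ⟨?_, (hq T hT).2.1⟩
        fun y hy => by rw [hvT T hT hy]
      exact huC.sub (contDiffOn_polyFun (q T) _ T)
    have hKT : ∀ j m, ContDiffOn ℝ (n + 1 : ℕ) (fun x => c.K x j m) T := fun j m => (hK j m T hT).1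
    have hβT : ∀ j, ContDiffOn ℝ (n + 1 : ℕ) (fun x => c.β x j) T := fun j => (hβ j T hT).1
    -- `u - v` is flat to order `p` at the centre, hence `𝓛 u` and `𝓛 v` have the same derivatives
    -- there up to order `p - 2`, and those of `𝓛 u` are zero.
    have h1 := (flatAt_L ho ha hKT hβT (hσ T hT).1 hw).2 _ hl
    rw [pd_L_sub ho ha hKT hβT (hσ T hT).1 huC hvC hl] at h1
    have h2 : pd (dirs i) (c.L u) (xc T) = 0 := by
      rw [pd_eqOn ho (L_eq_zero hDN G hreg hK1
        (fun T hT => (hu T hT).mono (by omega)) hsol hT) _ ha]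
      have : (0 : Vec d → ℝ) = polyFun (0 : MvPolynomial (Fin d) ℝ) := by ext; simp [polyFun]
      rw [this]
      cases hli : dirs i with
      | nil => simp [pd, polyFun]
      | cons k l => rw [pd_polyFun_eq_zero (by simp)]; rfl
    rw [h2, zero_sub, neg_eq_zero] at h1
    rw [multiD_eq_pd]
    exact h1
  · obtain ⟨h1, h2⟩ := (hq T hT).2.2 x hx
    refine ⟨by rw [hvT T hT hx]; exact h1, ?_⟩
    rw [gradient_eq_of_eqOn (G.elem_open T hT) (g := fun y => u y - polyFun (q T) y)
      (fun y hy => by simp only [hvT T hT hy]) hx]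
    exact h2

end Coeffs

/-! ### The error bound. -/

namespace Setting

variable {d : ℕ} {Ω : Set (Vec d)} {M : Mesh Ω} {c : Coeffs d} {core : Set (Vec d) → Set (Vec d)}
  {nu : Set (Vec d) → Set (Vec d) → Vec d} {D N : Finset (Set (Vec d))} {gD gN u uh : Vec d → ℝ}
  {xc : Set (Vec d) → Vec d} {p : ℕ} {kmin Ctr γ ε σ₀ Cg η : ℝ}

/-- The error bound of the quasi-Trefftz discontinuous Galerkin method. -/
theorem quasiTrefftz_error_le (S : Setting M core nu c D N) (hd : 1 ≤ d) (hCg : 0 < Cg) (hη : 0 < η)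
    (hgr : M.IsGraded Cg) (hch : M.IsChunky η) (hC : 0 < Ctr) (htr : M.IsTraceConst p Ctr)
    (hxc : ∀ T ∈ M.elements, xc T ∈ T ∧ StarConvex ℝ (xc T) T)
    (hK : ∀ j m, M.BrokenC (max (p - 1) 1) fun x => c.K x j m)
    (hβ : ∀ j, M.BrokenC (max (p - 1) 1) fun x => c.β x j)
    (hσC : M.BrokenC (max (p - 2) 0) c.σ)
    (hsym : ∀ᵐ x ∂(volume.restrict Ω), (c.K x).IsSymm) (hk : 0 < kmin)
    (hell : ∀ᵐ x ∂(volume.restrict Ω), ∀ ξ : Vec d, kmin * ‖ξ‖ ^ 2 ≤ inner ℝ ξ (c.Kop x ξ))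
    (hσ₀ : 0 < σ₀) (hσ : ∀ᵐ x ∂(volume.restrict Ω), σ₀ ≤ c.σ x + 1 / 2 * divg c.β x)
    (hgN : ∀ e ∈ N, MemLp gN 2 ((surf d).restrict e)) (hu : M.BrokenC (p + 1) u)
    (hsol : c.IsWeakSolution M D N (fun _ => 0) gD gN u) (hε : ε = -1 ∨ ε = 0 ∨ ε = 1)
    (hγε : gammaEps ε (linfNorm Ω c.Kop) M.maxFacets Ctr kmin < γ)
    (huh : c.IsQTDGSolution M xc p D N ε γ (fun _ => 0) gD gN uh) :
    c.normDar M D γ (fun x => u x - uh x) ≤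
      (1 + boundDar γ (linfNorm Ω c.Kop) (linfNorm Ω c.β) (linfNorm Ω c.σ) M.maxFacets Ctr kmin
          / alphaDar ε γ (linfNorm Ω c.Kop) M.maxFacets Ctr kmin σ₀)
        * ((d : ℝ) ^ p / (p.factorial : ℝ))
        * Real.sqrt (∑ T ∈ M.elements, volume.real T *
            ((1 + η) * linfNorm T c.Kop
              + (d : ℝ) ^ 2 / ((p : ℝ) + 1) ^ 2 *
                (2 * Cg * γ * η + linfNorm T c.β * η * Metric.diam T
                  + Metric.diam T ^ 2 + η * Metric.diam T))
            * Metric.diam T ^ (2 * p) * seminormC (p + 1) T u ^ 2) := by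
  have G := S.geom
  have hγ := (alphaDar_pos hε (linfNorm_nonneg _ _) (Nat.cast_nonneg _) hC hk hσ₀ hγε).1
  obtain ⟨v, hv, hbd⟩ := Coeffs.exists_memQT_approx G S.DN hK hβ hσC hxc hu hsol
  have hz := Coeffs.MemQT.sub G hK hβ hσC (fun T hT => (hxc T hT).1) huh.1 hv
  have hu1 : M.BrokenC 1 u := fun T hT => (hu T hT).mono (by omega)
  have hv1 := hv.piecewisePoly.smooth.brokenC G 1
  have huh1 := huh.1.piecewisePoly.smooth.brokenC G 1
  have hz1 := hz.piecewisePoly.smooth.brokenC G 1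
  have hw1 : M.BrokenC 1 fun x => u x - v x := G.brokenC_sub hu1 hv1
  -- Galerkin orthogonality: by consistency `u` and `u_h` have the same form against the discrete
  -- function `u_h - v`.
  have hgal : c.aDar M D N ε γ (fun x => uh x - v x) (fun x => uh x - v x) =
      c.aDar M D N ε γ (fun x => u x - v x) (fun x => uh x - v x) := by
    rw [S.aDar_sub huh1 hv1 hz1, S.aDar_sub hu1 hv1 hz1, huh.2 _ hz,
      S.consistency hu1 hgN hsol hz.piecewisePoly.smooth]
  set m : ℝ := (d : ℝ) ^ 2 / ((p : ℝ) + 1) ^ 2 with hm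
  set X : Set (Vec d) → ℝ := fun T =>
    ((d : ℝ) ^ p / p.factorial) ^ 2 * (Metric.diam T ^ (2 * p) * seminormC (p + 1) T u ^ 2) with hX
  -- The squared gradient of the remainder carries `d^(p+1)`, whereas `X` carries `d^(2p)`. The
  -- latter is at least as large for `p ≥ 1` but falls short by a factor `d` for `p = 0`.
  set lam : ℝ := if p = 0 then (d : ℝ) else 1 with hlam
  have hd1 : (1 : ℝ) ≤ d := by exact_mod_cast hd
  have hdη := G.le_of_isChunky hch
  have hlam1 : 1 ≤ lam := by rw [hlam]; split_ifs <;> simp [hd1]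
  have hlam2 : lam ≤ 1 + η := by rw [hlam]; split_ifs <;> linarith
  have hX0 : ∀ T ∈ M.elements, 0 ≤ X T := fun T _ => by
    simp only [hX]; have := Metric.diam_nonneg (s := T); positivity
  have hW : ∀ T ∈ M.elements, ∀ x ∈ T, (u x - v x) ^ 2 ≤ m * Metric.diam T ^ 2 * X T := by
    intro T hT x hx
    refine (hbd T hT x hx).1.trans ?_
    have h0 := Metric.diam_nonneg (s := T)
    have e : m * Metric.diam T ^ 2 * X T = (seminormC (p + 1) T u / (p + 1).factorial) ^ 2 *
        ((d : ℝ) ^ (p + 1) * (d * Metric.diam T ^ 2) ^ (p + 1)) := by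
      simp only [hX, hm, Nat.factorial_succ]
      push_cast
      field_simp
      ring
    rw [e]
    refine mul_le_mul_of_nonneg_left ?_ (sq_nonneg _)
    -- Cauchy-Schwarz gave only `d^(p+1)` where the stated bound has `d^(2p+2)`; the surplus is
    -- discarded.
    exact le_mul_of_one_le_left (by positivity) (one_le_pow₀ hd1)
  have hgrad : ∀ T ∈ M.elements, ∀ x ∈ T, ‖∇ (fun y => u y - v y) x‖ ^ 2 ≤ lam * X T := by
    intro T hT x hx
    refine (hbd T hT x hx).2.trans ?_
    have h0 := Metric.diam_nonneg (s := T)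
    rw [hlam]
    split_ifs with hp
    · subst hp; simp [hX]
    · have e : 1 * X T = (d : ℝ) ^ p * ((seminormC (p + 1) T u / p.factorial) ^ 2 *
          (d * Metric.diam T ^ 2) ^ p) := by
        simp only [hX]
        field_simp
        ring
      rw [e]
      exact mul_le_mul_of_nonneg_right (le_self_pow₀ hd1 hp) (by positivity)
  obtain ⟨hE, hB, hQ⟩ := S.approximation_le hγ hCg hη hgr hch hw1
    (by rw [hm]; positivity : 0 ≤ m) hlam1 hlam2 hX0 hW hgrad
  set W : ℝ := ∑ T ∈ M.elements, volume.real T *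
            ((1 + η) * linfNorm T c.Kop
              + m * (2 * Cg * γ * η + linfNorm T c.β * η * Metric.diam T
                  + Metric.diam T ^ 2 + η * Metric.diam T))
            * Metric.diam T ^ (2 * p) * seminormC (p + 1) T u ^ 2 with hWdef
  have hW0 : 0 ≤ W := Finset.sum_nonneg fun T _ => by
    have h0 := Metric.diam_nonneg (s := T)
    have h1 := linfNorm_nonneg T c.Kop
    have h2 := linfNorm_nonneg T c.β
    positivity
  have hbud : budget M c Cg γ η m X = ((d : ℝ) ^ p / p.factorial * √W) ^ 2 := by
    rw [mul_pow, Real.sq_sqrt hW0, hWdef, Finset.mul_sum, budget]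
    refine Finset.sum_congr rfl fun T _ => ?_
    simp only [hX]
    ring
  rw [hbud] at hE hB hQ
  have e : (fun x => u x - uh x) = fun x => (u x - v x) - (uh x - v x) := by ext x; ring
  rw [e, mul_assoc]
  refine S.error_le hd hsym hk hell (fun e he => G.facetSize_pos hCg hgr he) hC htr hw1
    hz.piecewisePoly hσ₀ hσ hε hγε hgal (by positivity) hE hB ?_
  by_cases hp : p = 0
  · right; rw [hlam, if_pos hp] at hQ; exact ⟨hp, hQ⟩
  · left; rw [hlam, if_neg hp, one_mul] at hQ; exact hQ

end Setting

lemma Mesh.diam_le_meshSize {d : ℕ} {Ω : Set (Vec d)} (M : Mesh Ω) {T : Set (Vec d)}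
    (hT : T ∈ M.elements) : Metric.diam T ≤ M.meshSize :=
  le_csSup (M.elements.finite_toSet.image _).bddAbove ⟨T, hT, rfl⟩

lemma Mesh.seminormC_le_broken {d : ℕ} {Ω : Set (Vec d)} (M : Mesh Ω) (m : ℕ) (v : Vec d → ℝ)
    {T : Set (Vec d)} (hT : T ∈ M.elements) : seminormC m T v ≤ M.brokenSeminormC m v :=
  le_csSup (M.elements.finite_toSet.image _).bddAbove ⟨T, hT, rfl⟩

/-- Elementwise bounds sum up to a global bound in terms of the mesh size. -/
lemma Mesh.Geometry.sqrt_sum_le {d : ℕ} {Ω : Set (Vec d)} {M : Mesh Ω} {c : Coeffs d}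
    {core : Set (Vec d) → Set (Vec d)} {nu : Set (Vec d) → Set (Vec d) → Vec d}
    (G : M.Geometry core nu) (hreg : c.Regular M) {m Cg γ η : ℝ} (hm : 0 ≤ m) (hCg : 0 ≤ Cg)
    (hγ : 0 ≤ γ) (hη : 0 ≤ η) (p : ℕ) (u : Vec d → ℝ) :
    Real.sqrt (∑ T ∈ M.elements, volume.real T *
        ((1 + η) * linfNorm T c.Kop
          + m * (2 * Cg * γ * η + linfNorm T c.β * η * Metric.diam T
              + Metric.diam T ^ 2 + η * Metric.diam T))
        * Metric.diam T ^ (2 * p) * seminormC (p + 1) T u ^ 2) ≤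
      Real.sqrt (volume.real Ω *
        ((1 + η) * linfNorm Ω c.Kop
          + m * (2 * Cg * γ * η + linfNorm Ω c.β * η * M.meshSize
              + M.meshSize ^ 2 + η * M.meshSize)))
        * M.meshSize ^ p * M.brokenSeminormC (p + 1) u := by
  obtain ⟨T₀, hT₀⟩ := G.elements_nonempty
  have hh : 0 ≤ M.meshSize := Metric.diam_nonneg.trans (M.diam_le_meshSize hT₀)
  have hs : 0 ≤ M.brokenSeminormC (p + 1) u :=
    (seminormC_nonneg _ _ _).trans (M.seminormC_le_broken _ u hT₀)
  have hκ := linfNorm_nonneg Ω c.Kop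
  have hb := linfNorm_nonneg Ω c.β
  rw [mul_assoc (Real.sqrt _), ← Real.sqrt_sq (by positivity : 0 ≤ M.meshSize ^ p * M.brokenSeminormC (p + 1) u),
    ← Real.sqrt_mul (by positivity)]
  refine Real.sqrt_le_sqrt ?_
  rw [G.volume_eq_sum, Finset.sum_mul, Finset.sum_mul]
  refine Finset.sum_le_sum fun T hT => ?_
  have h0 := Metric.diam_nonneg (s := T)
  have h1 := M.diam_le_meshSize hT
  have h2 := G.linfNorm_le hreg.K_ext hT
  have h3 := G.linfNorm_le (fun T hT => hreg.beta_ext hT) hT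
  have h4 := M.seminormC_le_broken (p + 1) u hT
  have h5 := linfNorm_nonneg T c.Kop
  have h6 := linfNorm_nonneg T c.β
  have h7 := seminormC_nonneg (p + 1) T u
  have e : (M.meshSize ^ p * M.brokenSeminormC (p + 1) u) ^ 2 =
      M.meshSize ^ (2 * p) * M.brokenSeminormC (p + 1) u ^ 2 := by ring
  rw [e, mul_assoc (volume.real T * _)]
  gcongr

/-! ### The uniform discrete trace inequality. -/

section TraceConstant

variable {d : ℕ}

lemma continuous_polyFun (q : MvPolynomial (Fin d) ℝ) : Continuous (polyFun q) :=
  (contDiff_polyFun q).continuous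

/-- The Taylor remainder bound with `B = 0`, since derivatives of order `p + 1` of the polynomial
vanish identically. -/
lemma polyFun_eq_zero_of_pd {q : MvPolynomial (Fin d) ℝ} {p : ℕ} (hq : q.totalDegree ≤ p)
    {a : Vec d} (h : ∀ l : List (Fin d), l.length ≤ p → pd l (polyFun q) a = 0) (x : Vec d) :
    polyFun q x = 0 := by
  have := abs_le_of_pd_eq_zero isOpen_univ (starConvex_univ a) (B := 0) (p + 1)
    (contDiffOn_polyFun q _ _) (fun l hl => h l (by omega)) (fun l hl y _ => by
      rw [pd_polyFun_eq_zero (by omega)]; simp) (Set.mem_univ x)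
  simpa using this

lemma polyFun_eq_taylorPoly {q : MvPolynomial (Fin d) ℝ} {p : ℕ} (hq : q.totalDegree ≤ p)
    (a x : Vec d) :
    polyFun q x = polyFun (taylorPoly a p fun s => pd (dirs s) (polyFun q) a) x := by
  set r := taylorPoly a p fun s => pd (dirs s) (polyFun q) a with hr
  have e : polyFun (q - r) = fun x => polyFun q x - polyFun r x := by ext y; simp [polyFun]
  have h := polyFun_eq_zero_of_pd (q := q - r) (a := a)
    ((MvPolynomial.totalDegree_sub _ _).trans (max_le hq (totalDegree_taylorPoly_le a p _)))
    (fun l hl => by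
      rw [e, pd_sub isOpen_univ l (contDiffOn_polyFun q _ _) (contDiffOn_polyFun r _ _)
        (Set.mem_univ a), hr]
      simp only [pd_taylorPoly_self a _ hl]
      rw [pd_perm isOpen_univ (dirs_count_perm l) (contDiffOn_polyFun q _ _) (Set.mem_univ a),
        sub_self]) x
  rw [e] at h
  exact sub_eq_zero.1 h

lemma polyFun_taylorMonomial (a x : Vec d) (s : Fin d → ℕ) :
    polyFun (taylorMonomial a s) x = ∏ k, ((s k).factorial : ℝ)⁻¹ * (x k - a k) ^ s k := by
  simp [polyFun, taylorMonomial]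

lemma polyFun_taylorPoly (a x : Vec d) (p : ℕ) (A : (Fin d → ℕ) → ℝ) :
    polyFun (taylorPoly a p A) x =
      ∑ s ∈ multiIndices d p, A s * polyFun (taylorMonomial a s) x := by
  simp [polyFun, taylorPoly]

/-- Rescaling about `a` multiplies each coefficient by a power of `h`. So polynomials on all
elements are compared within one finite-dimensional family on the unit ball. -/
lemma polyFun_taylorPoly_scale (a y : Vec d) (p : ℕ) (A : (Fin d → ℕ) → ℝ) (h : ℝ) :
    polyFun (taylorPoly a p A) (a + h • y) =
      polyFun (taylorPoly 0 p fun s => A s * h ^ ∑ k, s k) y := by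
  rw [polyFun_taylorPoly, polyFun_taylorPoly]
  refine Finset.sum_congr rfl fun s _ => ?_
  rw [polyFun_taylorMonomial, polyFun_taylorMonomial, mul_assoc, ← Finset.prod_pow_eq_pow_sum,
    ← Finset.prod_mul_distrib]
  congr 1
  refine Finset.prod_congr rfl fun k _ => ?_
  simp only [PiLp.add_apply, PiLp.smul_apply, smul_eq_mul, add_sub_cancel_left, PiLp.zero_apply,
    sub_zero]
  ring

lemma abs_taylorMonomial_le_one {y : Vec d} (hy : ‖y‖ ≤ 1) (s : Fin d → ℕ) :
    |polyFun (taylorMonomial 0 s) y| ≤ 1 := by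
  rw [polyFun_taylorMonomial, Finset.abs_prod]
  refine Finset.prod_le_one (fun k _ => abs_nonneg _) fun k _ => ?_
  rw [abs_mul, abs_pow, PiLp.zero_apply, sub_zero, abs_inv, Nat.abs_cast]
  have h1 : |y k| ≤ 1 := (PiLp.norm_apply_le y k).trans hy
  have h2 : ((s k).factorial : ℝ)⁻¹ ≤ 1 := inv_le_one_of_one_le₀ (by
    exact_mod_cast Nat.factorial_pos _)
  exact mul_le_one₀ h2 (by positivity) (pow_le_one₀ (abs_nonneg _) h1)

/-- Polynomials of degree at most `p` are bounded on the unit ball by their `L²` norm on a smaller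
ball. -/
lemma exists_sq_le_integral_ball (d p : ℕ) {ρ : ℝ} (hρ : 0 < ρ) :
    ∃ C : ℝ, 0 < C ∧ ∀ (A : (Fin d → ℕ) → ℝ) (y : Vec d), ‖y‖ ≤ 1 →
      polyFun (taylorPoly 0 p A) y ^ 2 ≤
        C * ∫ z in Metric.closedBall (0 : Vec d) ρ, polyFun (taylorPoly 0 p A) z ^ 2 := by
  classical
  set S := multiIndices d p with hS
  have hne : Nonempty S := ⟨⟨fun k => ([] : List (Fin d)).count k, count_mem_multiIndices (by simp)⟩⟩
  set F : (S → ℝ) → Vec d → ℝ := fun b y => ∑ s : S, b s * polyFun (taylorMonomial 0 s.1) y with hF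
  have hFA : ∀ A : (Fin d → ℕ) → ℝ, ∀ y,
      polyFun (taylorPoly 0 p A) y = F (fun s => A s.1) y := fun A y => by
    rw [polyFun_taylorPoly, hF, ← Finset.sum_coe_sort]
  have hcont : Continuous (Function.uncurry fun b y => F b y ^ 2) := by
    have : ∀ s : S, Continuous (polyFun (taylorMonomial (0 : Vec d) s.1)) := fun s =>
      continuous_polyFun _
    refine Continuous.pow ?_ 2
    refine continuous_finsetSum _ fun s _ => ?_
    exact ((continuous_apply s).comp continuous_fst).mul ((this s).comp continuous_snd)
  -- The squared `L²` norm as a continuous quadratic form of the coefficients.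
  set Q : (S → ℝ) → ℝ := fun b => ∫ z in Metric.closedBall (0 : Vec d) ρ, F b z ^ 2 with hQ
  have hQc : Continuous Q :=
    continuous_parametric_integral_of_continuous hcont (isCompact_closedBall 0 ρ)
  have hFc : ∀ b, Continuous fun z => F b z ^ 2 := fun b =>
    hcont.comp (Continuous.prodMk_right b)
  -- A polynomial with zero norm vanishes on the open ball, and its coefficients are its derivatives
  -- at the origin.
  have hQpos : ∀ b, b ≠ 0 → 0 < Q b := fun b hb => by
    refine lt_of_le_of_ne (integral_nonneg fun z => sq_nonneg _) fun h0 => hb ?_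
    have hi : IntegrableOn (fun z => F b z ^ 2) (Metric.closedBall (0 : Vec d) ρ) :=
      (hFc b).continuousOn.integrableOn_compact (isCompact_closedBall 0 ρ)
    have hae := (setIntegral_eq_zero_iff_of_nonneg_ae
      (Filter.Eventually.of_forall fun z => sq_nonneg (F b z)) hi).1 h0.symm
    have hae' := ae_mono (Measure.restrict_mono Metric.ball_subset_closedBall le_rfl) hae
    have hz := Measure.eqOn_open_of_ae_eq hae' Metric.isOpen_ball (hFc b).continuousOn
      continuousOn_const
    set A : (Fin d → ℕ) → ℝ := fun s => if hs : s ∈ S then b ⟨s, hs⟩ else 0 with hA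
    have hAb : (fun s : S => A s.1) = b := by ext s; simp [hA]
    have hz' : Set.EqOn (polyFun (taylorPoly 0 p A)) (polyFun 0) (Metric.ball (0 : Vec d) ρ) :=
      fun y hy => by
        rw [hFA, hAb]
        have := pow_eq_zero_iff (two_ne_zero) |>.1 (hz hy)
        rw [this]; simp [polyFun]
    ext s
    have hs : (dirs s.1).length ≤ p := by
      rw [length_dirs]; exact (Finset.mem_filter.1 s.2).2
    have h1 := pd_taylorPoly_self (0 : Vec d) A hs
    have h2 : (fun k => (dirs s.1).count k) = s.1 := funext fun k => count_dirs _ k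
    rw [pd_eqOn Metric.isOpen_ball hz' _ (Metric.mem_ball_self hρ), h2] at h1
    have h3 : pd (dirs s.1) (polyFun (0 : MvPolynomial (Fin d) ℝ)) 0 = 0 := by
      cases dirs s.1 with
      | nil => simp [pd, polyFun]
      | cons k l => rw [pd_polyFun_eq_zero (by simp)]; rfl
    rw [h3] at h1
    have h4 := congrFun hAb s
    simp only [← h1] at h4
    exact h4.symm
  have hsph : (Metric.sphere (0 : S → ℝ) 1).Nonempty := ⟨fun _ => 1, by simp⟩
  obtain ⟨b₀, hb₀, hmin⟩ := (isCompact_sphere (0 : S → ℝ) 1).exists_isMinOn hsph hQc.continuousOn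
  have hb₀' : b₀ ≠ 0 := by
    rintro rfl
    simp at hb₀
  have hc := hQpos b₀ hb₀'
  -- Homogeneity extends the minimum of `Q` on the compact unit sphere to all coefficient vectors.
  have hhom : ∀ b, Q b₀ * ‖b‖ ^ 2 ≤ Q b := fun b => by
    by_cases hb : b = 0
    · subst hb
      have : 0 ≤ Q 0 := integral_nonneg fun z => sq_nonneg _
      simpa using this
    have hnb : 0 < ‖b‖ := norm_pos_iff.2 hb
    have h1 : Q b₀ ≤ Q (‖b‖⁻¹ • b) := hmin (by simp [norm_smul, hnb.ne'])
    have h2 : Q (‖b‖⁻¹ • b) = (‖b‖⁻¹) ^ 2 * Q b := by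
      simp only [hQ]
      rw [← integral_const_mul]
      congr 1
      ext z
      rw [← mul_pow]
      simp only [hF, Pi.smul_apply, smul_eq_mul, mul_assoc, ← Finset.mul_sum]
    rw [h2] at h1
    calc Q b₀ * ‖b‖ ^ 2 ≤ (‖b‖⁻¹ ^ 2 * Q b) * ‖b‖ ^ 2 := by gcongr
      _ = Q b := by field_simp
  -- On the unit ball every monomial is at most `1`, so the polynomial is bounded by the number of
  -- coefficients times their maximum norm.
  refine ⟨(Fintype.card S : ℝ) ^ 2 / Q b₀, by
    have : 0 < Fintype.card S := Fintype.card_pos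
    positivity, fun A y hy => ?_⟩
  have hb := hhom fun s => A s.1
  set b : S → ℝ := fun s => A s.1 with hbdef
  have h1 : |F b y| ≤ Fintype.card S * ‖b‖ := by
    refine (Finset.abs_sum_le_sum_abs _ _).trans ?_
    refine (Finset.sum_le_card_nsmul _ _ ‖b‖ fun s _ => ?_).trans (by simp)
    rw [abs_mul]
    exact (mul_le_of_le_one_right (abs_nonneg _) (abs_taylorMonomial_le_one hy _)).trans
      (norm_le_pi_norm b s)
  simp only [hFA]
  change F b y ^ 2 ≤ _ * Q b
  calc F b y ^ 2 = |F b y| ^ 2 := (sq_abs _).symm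
    _ ≤ (Fintype.card S * ‖b‖) ^ 2 := by gcongr
    _ = (Fintype.card S : ℝ) ^ 2 / Q b₀ * (Q b₀ * ‖b‖ ^ 2) := by field_simp
    _ ≤ _ := by gcongr

lemma integral_closedBall_scale (f : Vec d → ℝ) (a : Vec d) {h ρ : ℝ} (hh : 0 < h) :
    ∫ y in Metric.closedBall (0 : Vec d) ρ, f (a + h • y) =
      (h ^ d)⁻¹ * ∫ x in Metric.closedBall a (h * ρ), f x := by
  have h1 := Measure.setIntegral_comp_smul_of_pos (volume : Measure (Vec d)) (fun x => f (a + x))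
    (Metric.closedBall 0 ρ) hh
  rw [h1, finrank_euclideanSpace_fin, smul_eq_mul]
  congr 1
  have h2 := (measurePreserving_add_left (volume : Measure (Vec d)) a).setIntegral_preimage_emb
    (measurableEmbedding_addLeft a) f (Metric.closedBall a (h * ρ))
  rw [← h2]
  congr 2
  ext x
  rw [Set.mem_smul_set_iff_inv_smul_mem₀ hh.ne']
  simp [norm_smul, abs_of_pos hh, inv_mul_le_iff₀ hh]

/-- The discrete trace inequality, with a constant that depends only on the dimension, the degree,
the star-shapedness and the chunkiness parameters. -/
theorem exists_isTraceConst (d : ℕ) (p : ℕ) {r η : ℝ} (hr : 0 < r) (hη : 0 < η) :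
    ∃ C : ℝ, 0 < C ∧ ∀ {Ω : Set (Vec d)} {M : Mesh Ω} {core : Set (Vec d) → Set (Vec d)}
      {nu : Set (Vec d) → Set (Vec d) → Vec d}, M.Geometry core nu → M.IsStarShapedBall r →
      M.IsChunky η → M.IsTraceConst p C := by
  obtain ⟨C₀, hC₀, hsup⟩ := exists_sq_le_integral_ball d p (half_pos hr)
  set bvol := volume.real (Metric.closedBall (0 : Vec d) 1) with hbd
  have hb0 : 0 < bvol := ENNReal.toReal_pos (Metric.measure_closedBall_pos _ _ one_pos).ne'
    (isCompact_closedBall _ _).measure_lt_top.ne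
  -- `C₀` bounds the squared supremum by the `L²` norm on the inner ball, and `η * bvol` bounds the
  -- rescaled boundary measure: `|∂T| ≤ η |T| / h`, and `T` lies in a ball of radius `h`.
  refine ⟨C₀ * η * bvol, by positivity, fun {Ω M core nu} G hst hch T hT q hq => ?_⟩
  obtain ⟨a, ha, hstar⟩ := hst T hT
  have hh := G.diam_pos T hT
  have hb := G.elem_bdd T hT
  set h := Metric.diam T with hdef
  -- A nonempty set that is star-shaped with respect to a point contains it, so the ball of star
  -- centres lies in `T`; halving the radius allows a closed ball.
  have hin : Metric.closedBall a (h * (r / 2)) ⊆ T := fun y hy => by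
    have hy' : y ∈ Metric.ball a (r * h) := by
      rw [Metric.mem_closedBall] at hy
      rw [Metric.mem_ball]
      nlinarith [mul_pos hr hh]
    exact (hstar y hy').mem ⟨a, ha⟩
  have hout : closure T ⊆ Metric.closedBall a h :=
    closure_minimal (fun x hx => Metric.dist_le_diam_of_mem hb hx ha) Metric.isClosed_closedBall
  set A : (Fin d → ℕ) → ℝ := fun s => pd (dirs s) (polyFun q) a * h ^ ∑ k, s k with hA
  have hqy : ∀ y, polyFun q (a + h • y) = polyFun (taylorPoly 0 p A) y := fun y => by
    rw [polyFun_eq_taylorPoly hq a, polyFun_taylorPoly_scale]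
  set I := ∫ x in T, polyFun q x ^ 2 with hI
  have hfint : IntegrableOn (fun x => polyFun q x ^ 2) T :=
    (((continuous_polyFun q).pow 2).continuousOn.integrableOn_compact hb.isCompact_closure).mono_set
      subset_closure
  have hball : ∫ y in Metric.closedBall (0 : Vec d) (r / 2), polyFun (taylorPoly 0 p A) y ^ 2 ≤
      (h ^ d)⁻¹ * I := by
    simp_rw [← hqy]
    rw [integral_closedBall_scale (fun x => polyFun q x ^ 2) a hh]
    refine mul_le_mul_of_nonneg_left ?_ (by positivity)
    exact setIntegral_mono_set hfint (Filter.Eventually.of_forall fun x => sq_nonneg _)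
      hin.eventuallyLE
  have hpt : ∀ x ∈ frontier T, ‖polyFun q x ^ 2‖ ≤ C₀ * ((h ^ d)⁻¹ * I) := fun x hx => by
    have hx' := hout (frontier_subset_closure hx)
    rw [Metric.mem_closedBall, dist_eq_norm] at hx'
    -- Boundary points have rescaled norm at most `1`, so the supremum bound on the unit ball
    -- applies to them.
    have e : x = a + h • (h⁻¹ • (x - a)) := by rw [smul_inv_smul₀ hh.ne']; abel
    rw [Real.norm_eq_abs, abs_of_nonneg (sq_nonneg _), e, hqy]
    refine (hsup A _ ?_).trans (by gcongr)
    rw [norm_smul, norm_inv, Real.norm_eq_abs, abs_of_pos hh]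
    exact inv_mul_le_one_of_le₀ hx' hh.le
  have hfin : surf d (frontier T) < ⊤ := by
    have hsub : frontier T ⊆ ⋃ e ∈ M.facets, e := by
      rw [M.frontier_eq T hT]
      exact Set.iUnion₂_mono fun e _ => Set.iUnion_subset fun _ => subset_rfl
    exact (measure_mono hsub).trans_lt (measure_biUnion_lt_top M.facets.finite_toSet
      fun e he => G.facet_fin e he)
  have hI0 : 0 ≤ I := integral_nonneg fun x => sq_nonneg _
  have hvol : volume.real T ≤ h ^ d * bvol := by
    have h1 : volume.real T ≤ volume.real (Metric.closedBall a h) :=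
      measureReal_mono (subset_closure.trans hout) (isCompact_closedBall _ _).measure_lt_top.ne
    rwa [Measure.addHaar_real_closedBall' _ _ hh.le, finrank_euclideanSpace_fin] at h1
  have h1 := norm_setIntegral_le_of_norm_le_const hfin hpt
  have h2 := hch T hT
  have h3 : (surf d).real (frontier T) ≤ η * (h ^ d * bvol) / h := by
    rw [le_div_iff₀ hh, mul_comm]
    exact h2.trans (by gcongr)
  calc ∫ x in frontier T, polyFun q x ^ 2 ∂(surf d)
      ≤ C₀ * ((h ^ d)⁻¹ * I) * (surf d).real (frontier T) := (Real.le_norm_self _).trans h1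
    _ ≤ C₀ * ((h ^ d)⁻¹ * I) * (η * (h ^ d * bvol) / h) := by gcongr
    _ = C₀ * η * bvol * h⁻¹ * I := by field_simp

end TraceConstant

end QTDG

/-! ### Assembly of the trace constant, the elementwise bound and its global form. -/

theorem theorem5p2 (d : ℕ) (hd : 1 ≤ d) (Ω : Set (Vec d)) (hΩ : IsPolytope d Ω)
    -- a family of polytopic meshes: star-shaped with respect to balls, graded, chunkiness bound
    {ι : Type*} (mesh : ι → Mesh Ω) (r Cg η : ℝ) (hr : 0 < r) (hr' : r ≤ 1 / 2)
    (hCg : 0 < Cg) (hη : 0 < η)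
    (hstar : ∀ i, (mesh i).IsStarShapedBall r) (hgraded : ∀ i, (mesh i).IsGraded Cg)
    (hchunky : ∀ i, (mesh i).IsChunky η) (p : ℕ) :
    -- the discrete trace inequality holds with a constant that is uniform in the family
    (∃ Ctr : ℝ, 0 < Ctr ∧ ∀ i, (mesh i).IsTraceConst p Ctr) ∧
    ∀ Ctr : ℝ, 0 < Ctr → (∀ i, (mesh i).IsTraceConst p Ctr) → ∀ i : ι,
    -- Taylor centres
    ∀ xc : Set (Vec d) → Vec d,
      (∀ T ∈ (mesh i).elements, xc T ∈ T ∧ StarConvex ℝ (xc T) T) →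
    -- Dirichlet and Neumann facets
    ∀ D N : Finset (Set (Vec d)), Disjoint D N →
      (∀ e, e ∈ (mesh i).boundaryFacets ↔ e ∈ D ∨ e ∈ N) →
    -- coefficients
    ∀ c : Coeffs d,
      (∀ j m, (mesh i).BrokenC (max (p - 1) 1) fun x => c.K x j m) →
      (∀ j, (mesh i).BrokenC (max (p - 1) 1) fun x => c.β x j) →
      (mesh i).BrokenC (max (p - 2) 0) c.σ →
      (∀ j, MemSobolev ⊤ Ω 1 fun x => c.β x j) →
      (∀ᵐ x ∂(volume.restrict Ω), (c.K x).IsSymm) →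
    ∀ kmin : ℝ, 0 < kmin →
      (∀ᵐ x ∂(volume.restrict Ω), ∀ ξ : Vec d, kmin * ‖ξ‖ ^ 2 ≤ inner ℝ ξ (c.Kop x ξ)) →
    ∀ σ₀ : ℝ, 0 < σ₀ →
      (∀ᵐ x ∂(volume.restrict Ω), σ₀ ≤ c.σ x + 1 / 2 * divg c.β x) →
      (∀ e ∈ D, ∀ T ∈ (mesh i).adj e, ∀ᵐ x ∂((surf d).restrict e),
        inner ℝ (extendFrom T c.β x) (outerNormal T x) ≤ 0) →
      (∀ e ∈ N, ∀ T ∈ (mesh i).adj e, ∀ᵐ x ∂((surf d).restrict e),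
        0 ≤ inner ℝ (extendFrom T c.β x) (outerNormal T x)) →
    -- boundary data and exact solution
    ∀ gD gN : Vec d → ℝ, (∀ e ∈ N, MemLp gN 2 ((surf d).restrict e)) →
    ∀ u : Vec d → ℝ, (mesh i).BrokenH 2 u → (mesh i).BrokenC (p + 1) u →
      c.IsWeakSolution (mesh i) D N (fun _ => 0) gD gN u →
    -- the discrete solution
    ∀ ε : ℝ, (ε = -1 ∨ ε = 0 ∨ ε = 1) →
    ∀ γ : ℝ, gammaEps ε (linfNorm Ω c.Kop) (mesh i).maxFacets Ctr kmin < γ →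
    ∀ uh : Vec d → ℝ,
      c.IsQTDGSolution (mesh i) xc p D N ε γ (fun _ => 0) gD gN uh →
    c.normDar (mesh i) D γ (fun x => u x - uh x) ≤
        (1 + boundDar γ (linfNorm Ω c.Kop) (linfNorm Ω c.β) (linfNorm Ω c.σ)
              (mesh i).maxFacets Ctr kmin
            / alphaDar ε γ (linfNorm Ω c.Kop) (mesh i).maxFacets Ctr kmin σ₀)
          * ((d : ℝ) ^ p / (p.factorial : ℝ))
          * Real.sqrt (∑ T ∈ (mesh i).elements, volume.real T *
              ((1 + η) * linfNorm T c.Kop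
                + (d : ℝ) ^ 2 / ((p : ℝ) + 1) ^ 2 *
                  (2 * Cg * γ * η + linfNorm T c.β * η * Metric.diam T
                    + Metric.diam T ^ 2 + η * Metric.diam T))
              * Metric.diam T ^ (2 * p) * seminormC (p + 1) T u ^ 2) ∧
    c.normDar (mesh i) D γ (fun x => u x - uh x) ≤
        (1 + boundDar γ (linfNorm Ω c.Kop) (linfNorm Ω c.β) (linfNorm Ω c.σ)
              (mesh i).maxFacets Ctr kmin
            / alphaDar ε γ (linfNorm Ω c.Kop) (mesh i).maxFacets Ctr kmin σ₀)
          * ((d : ℝ) ^ p / (p.factorial : ℝ))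
          * Real.sqrt (volume.real Ω *
              ((1 + η) * linfNorm Ω c.Kop
                + (d : ℝ) ^ 2 / ((p : ℝ) + 1) ^ 2 *
                  (2 * Cg * γ * η + linfNorm Ω c.β * η * (mesh i).meshSize
                    + (mesh i).meshSize ^ 2 + η * (mesh i).meshSize)))
          * (mesh i).meshSize ^ p * (mesh i).brokenSeminormC (p + 1) u := by
  have hgeo := fun i => (mesh i).exists_geometry hd hΩ hr (hstar i)
  refine ⟨?_, ?_⟩
  · obtain ⟨C, hC, h⟩ := exists_isTraceConst d p hr hη
    refine ⟨C, hC, fun i => ?_⟩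
    obtain ⟨core, nu, G⟩ := hgeo i
    exact h G (hstar i) (hchunky i)
  intro Ctr hC htr i xc hxc D N hdisj hDN c hK hβ hσC hS hsym kmin hk hell σ₀ hσ₀ hσ hD hN gD gN
    hgN u _ hu hsol ε hε γ hγε uh huh
  obtain ⟨core, nu, G⟩ := hgeo i
  have hreg := Coeffs.regular_of_brokenC hK hβ hσC
  have S := G.setting hreg hDN hdisj hS hD hN
  obtain ⟨hγ, hα⟩ := alphaDar_pos hε (linfNorm_nonneg Ω c.Kop) (Nat.cast_nonneg _) hC hk hσ₀ hγε
  have h1 := S.quasiTrefftz_error_le hd hCg hη (hgraded i) (hchunky i) hC (htr i) hxc hK hβ hσC hsym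
    hk hell hσ₀ hσ hgN hu hsol hε hγε huh
  refine ⟨h1, h1.trans ?_⟩
  -- The prefactor has to be nonnegative for the elementwise bound to pass to the mesh size.
  have hM : 0 ≤ boundDar γ (linfNorm Ω c.Kop) (linfNorm Ω c.β) (linfNorm Ω c.σ)
      (mesh i).maxFacets Ctr kmin := by
    have := linfNorm_nonneg Ω c.Kop
    have := linfNorm_nonneg Ω c.β
    have := linfNorm_nonneg Ω c.σ
    rw [boundDar]
    positivity
  have h2 := G.sqrt_sum_le hreg (m := (d : ℝ) ^ 2 / ((p : ℝ) + 1) ^ 2) (by positivity) hCg.le hγ.le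
    hη.le p u
  rw [mul_assoc _ (Real.sqrt _), mul_assoc _ (Real.sqrt _ * _)]
  exact mul_le_mul_of_nonneg_left h2 (by positivity)
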